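/- **Setting.** Let $\mathbb T$ be one of $\{0,\dots,T\}$ with $T\in\mathbb N_0$, $\mathbb N_0$, or $\mathbb N_0\cup\{\infty\}$ (in the last two cases $T=\infty$), and $\mathbb T_t=\{s\in\mathbb T: s\ge t\}$. Let $(\Omega,\mathcal F,(\mathcal F_s)_{s\in\mathbb T},P)$ be a filtered probability space with $\mathcal F_0=\{\emptyset,\Omega\}$ and $\mathcal F=\sigma(\bigcup_{s\in\mathbb T\cap\mathbb N_0}\mathcal F_s)$. If $T=\infty$, assume that each $\mathcal F_s$, $s\in\mathbb N_0$, is $\sigma$-isomorphic to the Borel $\sigma$-field of a complete separable metric space, and that $\bigcap_nA_n\ne\emptyset$ for every decreasing sequence in which $A_n$ is an atom of $\mathcal F_n$. Relations between random variables hold $P$-a.s. unless another measure is named. $L^\infty_t=L^\infty(\Omega,\mathcal F_t,P)$; $\mathcal R^\infty$ is the space of essentially bounded adapted processes $(X_s)_{s\in\mathbb T}$; $\mathcal R^\infty_t=\{X\in\mathcal R^\infty: X_s=0\ \forall s<t\}$, and $\pi_t(X)=(X_s1_{\{s\ge t\}})_{s\in\mathbb T}$. For $\mathbb T=\mathbb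 N_0\cup\{\infty\}$, $\mathcal X^\infty_t=\{X\in\mathcal R_t^\infty: X_\infty=\lim_{n\to\infty}X_n\}$. Put $\Delta X_s=X_s-X_{s-1}$ with $X_{-1}=0$. Fix $t\in\mathbb T\cap\mathbb N_0$. A *conditional convex risk measure for processes* is a map $\rho_t:\mathcal R_t^\infty\to L_t^\infty$ with, for $X,Y\in\mathcal R^\infty_t$: $\rho_t(X+m1_{\mathbb T_t})=\rho_t(X)-m$ for $m\in L_t^\infty$; $\rho_t(X)\ge\rho_t(Y)$ if $X\le Y$; $\rho_t(\lambda X+(1-\lambda)Y)\le\lambda\rho_t(X)+(1-\lambda)\rho_t(Y)$ for $\lambda\in L^\infty_t$, $0\le\lambda\le1$; and $\rho_t(0)=0$. It is *continuous from above* if $\rho_t(\pi_t(X^n))\nearrow\rho_t(\pi_t(X))$ whenever $X^n,X\in\mathcal R^\infty$ and $X^n_s\searrow X_s$ for all $s\in\mathbb T_t$. Let $\mathcal A_t=\{X\in\mathcal R_t^\infty:\rho_t(X)\le0\}$. $\mathcal M_{loc}(P)$ (resp. $\mathcal M^e_{loc}(P)$) is the set of probability measures $Q$ on $(\Omega,\mathcal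 F)$ with $Q\ll P$ (resp. $Q\approx P$) on $\mathcal F_s$ for every $s\in\mathbb T\cap\mathbb N_0$. For $Q\in\mathcal M_{loc}(P)$ let $M_s=\frac{dQ}{dP}|_{\mathcal F_s}$ and, if $T=\infty$, $M_\infty=\lim_nM_n$. * $\Gamma(Q)$: adapted processes $\gamma=(\gamma_s)_{s\in\mathbb T}$, nonnegative with $\sum_{s\in\mathbb T}\gamma_s=1$ $Q$-a.s., and $\gamma_\infty=0$ $Q$-a.s. on $\{M_\infty=\infty\}$ if $\infty\in\mathbb T$. * $\mathcal D(Q)$: predictable processes $D=(D_s)_{s\in\mathbb T}$ which $Q$-a.s. are nonnegative and nonincreasing with $D_0=1$; moreover $Q$-a.s. $\lim_nD_n=0$ if $\mathbb T=\mathbb N_0$, and $D_\infty=\lim_nD_n$, with $D_\infty=0$ on $\{M_\infty=\infty\}$, if $\mathbb T=\mathbb N_0\cup\{\infty\}$. Put $D_{T+1}=0$ if $T<\infty$. * $\gamma$ and $D$ correspond to each other through $D_s=1-\sum_{r<s}\gamma_r$, $\gamma_s=D_s-D_{s+1}$ ($s\in\mathbb T\cap\mathbb N_0$), and $D_\infty=\gamma_\infty$.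 * $\mathcal Q^{loc}_t=\{Q\in\mathcal M_{loc}(P):Q=P\text{ on }\mathcal F_t\}$, $\Gamma_t(Q)=\{\gamma\in\Gamma(Q):\gamma_s=0\ \forall s<t\}$, $\mathcal D_t(Q)=\{D\in\mathcal D(Q):D_s=1\ \forall s\le t\}$, $\Gamma^e(Q)=\{\gamma\in\Gamma(Q):\gamma_s>0\ P\text{-a.s.}\ \forall s\in\mathbb T\}$. For $Q\in\mathcal M_{loc}(P)$, $\gamma\in\Gamma(Q)$ with corresponding $D$, let $Q\otimes\gamma=Q\otimes D$ be the measure $\bar Q(B)=E_Q[\sum_s\gamma_s1_B(\cdot,s)]$ on the optional $\sigma$-field $\bar{\mathcal F}$ of $\Omega\times\mathbb T$ (generated by the sets $A\times\{s\}$, $A\in\mathcal F_s$), and let $$\alpha_t(Q\otimes\gamma)=\alpha_t(Q\otimes D)=Q\text{-}\operatorname*{ess\,sup}_{X\in\mathcal A_t}E_Q\Big[-\sum_{s\in\mathbb T_t}\tfrac{\gamma_s}{D_t}X_s\,\Big|\,\mathcal F_t\Big]\quad\text{on }\{D_t>0\}.$$ Let $\mu=(\mu_s)_{s\in\mathbb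 T}$ be an adapted process with $\mu_s>0$ and $\sum_{s}\mu_s=1$, $\bar P=P\otimes\mu$, and $\mathcal M(\bar P)$ the set of probability measures on $\bar{\mathcal F}$ that are absolutely continuous with respect to $\bar P$. Let $\bar{\mathcal F}_t$ be generated by the sets $A\times\{j\}$ ($j<t$, $A\in\mathcal F_j$) and $A\times\mathbb T_t$ ($A\in\mathcal F_t$), and $\bar{\mathcal Q}_t(\bar Q)=\{\bar R\in\mathcal M(\bar P):\bar R=\bar Q\text{ on }\bar{\mathcal F}_t\}$. **Theorem.** Let $\rho_t$ be a conditional convex risk measure for processes. (A) $\rho_t$ is continuous from above if and only if, for all $X\in\mathcal R_t^\infty$, $$\rho_t(X)=\operatorname*{ess\,sup}_{Q\in\mathcal Q_t^{loc}}\ \operatorname*{ess\,sup}_{\gamma\in\Gamma_t(Q)}\Big(E_Q\Big[-\sum_{s\in\mathbb T_t}\gamma_sX_s\Big|\mathcal F_t\Big]-\alpha_t(Q\otimes\gamma)\Big).\tag{1}$$ (B) Let $X\in\mathcal R_t^\infty$, and $X\in\mathcal X_t^\infty$ if $\infty\in\mathbb T$. For $Q\in\mathcal Q_t^{loc}$ and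 $D\in\mathcal D_t(Q)$ the sum $\sum_{s=t}^TD_s\Delta X_s$ (over finite $s$; the limit of its partial sums if $T=\infty$) converges $Q$-a.s., and the right-hand side of (1) equals $$\operatorname*{ess\,sup}_{Q\in\mathcal Q_t^{loc}}\ \operatorname*{ess\,sup}_{D\in\mathcal D_t(Q)}\Big(E_Q\Big[-\sum_{s=t}^TD_s\Delta X_s\Big|\mathcal F_t\Big]-\alpha_t(Q\otimes D)\Big).\tag{2}$$ Hence, if $\rho_t$ is continuous from above, $\rho_t(X)$ equals (2) for all such $X$; and if $\infty\notin\mathbb T$, $\rho_t$ is continuous from above if and only if $\rho_t(X)$ equals (2) for all $X\in\mathcal R_t^\infty$. (C) $\rho_t$ is continuous from above if and only if, for all $X\in\mathcal R_t^\infty$, $\rho_t(X)$ is the essential supremum of the terms in (1) over all pairs $Q\in\mathcal Q_t^{loc}$, $\gamma\in\Gamma_t(Q)$ with $E_Q\big[\big(\sum_{s\in\mathbb T_t}\mu_s\big)\alpha_t(Q\otimes\gamma)\big]<\infty$, where the weight $\sum_{s\in\mathbb T_t}\mu_s$ is taken in its $\mathcal F_t$-measurable version $1-\sum_{s<t}\mu_s$.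 (D) $\rho_t$ is continuous from above if and only if for all $\bar Q=Q\otimes\gamma=Q\otimes D\in\mathcal M(\bar P)$ and all $X\in\mathcal R_t^\infty$ $$\rho_t(X)=Q\text{-}\operatorname*{ess\,sup}_{R\otimes\xi\in\bar{\mathcal Q}_t(\bar Q)}\Big(\frac1{D_t}E_R\Big[-\sum_{s\in\mathbb T_t}\xi_sX_s\Big|\mathcal F_t\Big]-\alpha_t(R\otimes\xi)\Big)\quad Q\text{-a.s. on }\{D_t>0\}.$$ (E) If there is a probability measure $\bar P^*=Q^*\otimes\gamma^*\approx\bar P$ on $\bar{\mathcal F}$ with $\alpha_t(\bar P^*)<\infty$, then $\rho_t$ is continuous from above if and only if, for all $X\in\mathcal R_t^\infty$, $$\rho_t(X)=\operatorname*{ess\,sup}_{Q\in\mathcal M^e_{loc}(P),\ \gamma\in\Gamma^e(Q)}\Big(E_Q\Big[-\sum_{s\in\mathbb T_t}\frac{\gamma_s}{D_t}X_s\Big|\mathcal F_t\Big]-\alpha_t(Q\otimes\gamma)\Big).$$ -/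

import Mathlib

open MeasureTheory Filter Topology
open scoped ENNReal

noncomputable section

namespace RiskProc

/-! ### Time sets -/

/-- The three kinds of time sets: `{0, …, T}` with `T < ∞`, `ℕ`, and `ℕ ∪ {∞}`. -/
inductive Horizon : Type
  | finite (T : ℕ) : Horizon
  | nat : Horizon
  | natInfty : Horizon

/-- The set of time points, as a subset of `ℕ ∪ {∞}`. -/
def Horizon.times : Horizon → Set ℕ∞
  | .finite T => {s | s ≤ (T : ℕ∞)}
  | .nat => {s | s ≠ ⊤}
  | .natInfty => Set.univ

/-- The time set `𝕋` as a type. -/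
abbrev Horizon.Time (H : Horizon) : Type := {s : ℕ∞ // s ∈ H.times}

/-- The case `T = ∞`. -/
def Horizon.IsInfinite (H : Horizon) : Prop := ∀ T : ℕ, H ≠ .finite T

theorem Horizon.mem_times_of_le {H : Horizon} {r s : ℕ∞} (hs : s ∈ H.times) (hr : r ≤ s) :
    r ∈ H.times := by
  cases H with
  | finite T => exact le_trans hr hs
  | nat => exact ne_top_of_le_ne_top hs hr
  | natInfty => trivial

theorem Horizon.zero_mem_times (H : Horizon) : (0 : ℕ∞) ∈ H.times := by
  cases H with
  | finite T => exact zero_le (a := (T : ℕ∞))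
  | nat => exact ENat.zero_ne_top
  | natInfty => trivial

/-- The time point `0`. -/
def Horizon.zero (H : Horizon) : H.Time := ⟨0, H.zero_mem_times⟩

/-- The time point preceding `s`; the convention is `0 - 1 = 0` and `∞ - 1 = ∞`. -/
def Horizon.pred {H : Horizon} (s : H.Time) : H.Time :=
  ⟨s.1 - 1, Horizon.mem_times_of_le s.2 tsub_le_self⟩

/-- The natural number `n` as a time point, truncated at `T` if the horizon `T` is finite. -/
def Horizon.ofNat (H : Horizon) (n : ℕ) : H.Time :=
  match H with
  | .finite T => ⟨((min n T : ℕ) : ℕ∞), (Nat.cast_le (α := ℕ∞)).2 (min_le_right n T)⟩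
  | .nat => ⟨(n : ℕ∞), ENat.natCast_ne_top n⟩
  | .natInfty => ⟨(n : ℕ∞), trivial⟩

variable {Ω : Type*} {mΩ : MeasurableSpace Ω} {H : Horizon}

/-! ### Standing assumptions on the filtered probability space -/

/-- `A` is an atom of the `σ`-field `m`. -/
def IsAtomOf {Ω : Type*} (m : MeasurableSpace Ω) (A : Set Ω) : Prop :=
  MeasurableSet[m] A ∧ A.Nonempty ∧
    ∀ B : Set Ω, MeasurableSet[m] B → B ⊆ A → B = ∅ ∨ B = A

/-- Two `σ`-fields are `σ`-isomorphic: there is a bijection between them which preserves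
complements and countable unions. -/
def SigmaIsomorphic {α β : Type*} (m₁ : MeasurableSpace α) (m₂ : MeasurableSpace β) : Prop :=
  ∃ Φ : {A : Set α // MeasurableSet[m₁] A} ≃ {B : Set β // MeasurableSet[m₂] B},
    (∀ A, (Φ ⟨(A.1)ᶜ, MeasurableSet.compl A.2⟩).1 = ((Φ A).1)ᶜ) ∧
    ∀ A : ℕ → {A : Set α // MeasurableSet[m₁] A},
      (Φ ⟨⋃ n, (A n).1, MeasurableSet.iUnion fun n => (A n).2⟩).1 = ⋃ n, (Φ (A n)).1

/-- The standing assumptions on the filtration: `ℱ₀` is trivial, the ambient `σ`-field is generated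
by the `ℱ_t`, `t ∈ 𝕋 ∩ ℕ` (so it is `ℱ_T` if `T < ∞`, and it is `ℱ_∞ = σ(⋃ₜ ℱ_t)` if `T = ∞`;
in particular the filtration satisfies `ℱ ∞ = σ(⋃ₜ ℱ_t)` if `∞ ∈ 𝕋`), and, if `T = ∞`, each `ℱ_t`
with `t ∈ ℕ` is `σ`-isomorphic to the Borel `σ`-field of a complete separable metric space, and
decreasing sequences of atoms `Aₙ` of `ℱₙ` have a non-empty intersection. -/
structure IsStandardFiltration (ℱ : Filtration H.Time mΩ) : Prop where
  trivial_zero : ℱ H.zero = ⊥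
  generates : mΩ = ⨆ (s : H.Time) (_ : s.1 ≠ ⊤), ℱ s
  standard : H.IsInfinite → ∀ s : H.Time, s.1 ≠ ⊤ →
    ∃ (Y : Type) (_ : TopologicalSpace Y) (_ : PolishSpace Y), SigmaIsomorphic (ℱ s) (borel Y)
  atoms : H.IsInfinite → ∀ A : ℕ → Set Ω, Antitone A →
    (∀ n, IsAtomOf (ℱ (H.ofNat n)) (A n)) → (⋂ n, A n).Nonempty

/-! ### Essential suprema of families of random variables -/

/-- `g` is the essential supremum with respect to `μ` of the family `S`, among `m`-measurable
extended real random variables: the `μ`-almost surely smallest `m`-measurable function that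
dominates every member of `S` `μ`-almost surely. -/
structure IsFamilyEssSup (μ : Measure Ω) (m : MeasurableSpace Ω) (S : Set (Ω → EReal))
    (g : Ω → EReal) : Prop where
  measurable : Measurable[m] g
  upper : ∀ f ∈ S, f ≤ᵐ[μ] g
  least : ∀ h : Ω → EReal, Measurable[m] h → (∀ f ∈ S, f ≤ᵐ[μ] h) → g ≤ᵐ[μ] h

/-- The essential supremum of a family of random variables; see `familyEssSup_spec`. -/
def familyEssSup (μ : Measure Ω) (m : MeasurableSpace Ω) (S : Set (Ω → EReal)) : Ω → EReal :=
  open Classical in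
  if h : ∃ g, IsFamilyEssSup μ m S g then h.choose else ⊤

theorem exists_isFamilyEssSup (μ : Measure Ω) [IsFiniteMeasure μ]
    {m : MeasurableSpace Ω} (hm : m ≤ mΩ) (S : Set (Ω → EReal)) : ∃ g, IsFamilyEssSup μ m S g := by
  -- maximize `∫ φ(h)` over the majorants `h`, where `φ` is bounded and strictly decreasing
  let φ : EReal → ℝ≥0∞ := fun x => (EReal.exp x + 1)⁻¹
  have hφm : Measurable φ := (EReal.measurable_exp.add_const 1).inv
  have hφ : Antitone φ := fun x y hxy =>
    ENNReal.inv_le_inv.2 (add_le_add_left (EReal.exp_monotone hxy) 1)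
  have hφs : ∀ x y, x < y → φ y < φ x := fun x y hxy =>
    ENNReal.inv_lt_inv.2 ((ENNReal.add_lt_add_iff_right ENNReal.one_ne_top).2
      (EReal.exp_strictMono hxy))
  have hφ1 : ∀ x, φ x ≤ 1 := fun x => by
    simp only [φ]
    exact ENNReal.inv_le_one.2 le_add_self
  have hlt : ∀ h : Ω → EReal, ∫⁻ ω, φ (h ω) ∂μ ≠ ∞ := fun h => by
    refine ne_top_of_le_ne_top (measure_ne_top μ Set.univ) ?_
    calc ∫⁻ ω, φ (h ω) ∂μ ≤ ∫⁻ _, 1 ∂μ := lintegral_mono fun ω => hφ1 _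
      _ = μ Set.univ := by simp
  let M : Set (Ω → EReal) := {h | Measurable[m] h ∧ ∀ f ∈ S, f ≤ᵐ[μ] h}
  have hM : (⊤ : Ω → EReal) ∈ M :=
    ⟨@measurable_const _ _ _ m ⊤, fun f _ => Eventually.of_forall fun ω => le_top⟩
  let V : Set ℝ≥0∞ := (fun h : Ω → EReal => ∫⁻ ω, φ (h ω) ∂μ) '' M
  have hVne : V.Nonempty := ⟨_, _, hM, rfl⟩
  obtain ⟨u, -, hu, huV⟩ := exists_seq_tendsto_sSup hVne (OrderTop.bddAbove V)
  choose h hhM hhu using huV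
  let g : Ω → EReal := fun ω => ⨅ n, h n ω
  have hgm : Measurable[m] g := Measurable.iInf fun n => (hhM n).1
  have hgM : g ∈ M := by
    refine ⟨hgm, fun f hf => ?_⟩
    have := ae_all_iff.2 fun n => (hhM n).2 f hf
    filter_upwards [this] with ω hω
    exact le_iInf hω
  have hgmax : ∀ k ∈ M, ∫⁻ ω, φ (k ω) ∂μ ≤ ∫⁻ ω, φ (g ω) ∂μ := by
    intro k hk
    refine le_trans (le_sSup ⟨k, hk, rfl⟩ : _ ≤ sSup V) (le_of_tendsto' hu fun n => ?_)
    rw [← hhu n]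
    exact lintegral_mono fun ω => hφ (iInf_le _ n)
  refine ⟨g, hgm, hgM.2, fun k hk hkS => ?_⟩
  have hmin : (fun ω => g ω ⊓ k ω) ∈ M := by
    refine ⟨Measurable.min hgm hk, fun f hf => ?_⟩
    filter_upwards [hgM.2 f hf, hkS f hf] with ω h1 h2
    exact le_inf h1 h2
  have hle : (fun ω => φ (g ω)) ≤ᵐ[μ] fun ω => φ (g ω ⊓ k ω) :=
    Eventually.of_forall fun ω => hφ inf_le_left
  have heq := ae_eq_of_ae_le_of_lintegral_le hle (hlt g)
    (hφm.comp (hmin.1.mono hm le_rfl)).aemeasurable (hgmax _ hmin)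
  filter_upwards [heq] with ω hω
  by_contra hc
  have h1 : k ω < g ω := not_le.1 hc
  have h2 : φ (g ω) = φ (k ω) := by
    have h3 : g ω ⊓ k ω = k ω := inf_eq_right.2 h1.le
    rw [← h3]; exact hω
  exact absurd h2 (hφs _ _ h1).ne

theorem familyEssSup_spec (μ : Measure Ω) [IsFiniteMeasure μ]
    {m : MeasurableSpace Ω} (hm : m ≤ mΩ) (S : Set (Ω → EReal)) :
    IsFamilyEssSup μ m S (familyEssSup μ m S) := by
  have h := exists_isFamilyEssSup μ hm S
  unfold familyEssSup
  rw [dif_pos h]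
  exact h.choose_spec

/-! ### Bounded adapted processes and conditional convex risk measures -/

/-- `Z` represents an element of `L^∞(Ω, m, P)`. -/
structure MemLinf (P : Measure Ω) (m : MeasurableSpace Ω) (Z : Ω → ℝ) : Prop where
  measurable : Measurable[m] Z
  bounded : ∃ C : ℝ, ∀ᵐ ω ∂P, |Z ω| ≤ C

/-- `X` represents an element of `ℛ^∞`. -/
structure MemR (P : Measure Ω) (ℱ : Filtration H.Time mΩ) (X : H.Time → Ω → ℝ) : Prop where
  adapted : ∀ s, Measurable[ℱ s] (X s)
  bounded : ∃ C : ℝ, ∀ᵐ ω ∂P, ∀ s, |X s ω| ≤ C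

/-- The projection `π_{t,T}`. -/
def proj (t : H.Time) (X : H.Time → Ω → ℝ) : H.Time → Ω → ℝ :=
  fun s ω => if t ≤ s then X s ω else 0

/-- `X` represents an element of `ℛ_t^∞ = π_{t,T}(ℛ^∞)`. -/
structure MemRt (P : Measure Ω) (ℱ : Filtration H.Time mΩ) (t : H.Time)
    (X : H.Time → Ω → ℝ) : Prop where
  memR : MemR P ℱ X
  eq_zero : ∀ s < t, X s = 0

/-- The condition on `X ∈ ℛ_t^∞` under which sums against `ΔX` are considered: none if `∞ ∉ 𝕋`,
and `X ∈ 𝒳_t^∞`, i.e. `X_∞ = lim X_n` almost surely, if `∞ ∈ 𝕋`. -/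
structure MemXt (P : Measure Ω) (ℱ : Filtration H.Time mΩ) (t : H.Time)
    (X : H.Time → Ω → ℝ) : Prop where
  memRt : MemRt P ℱ t X
  tendsto : ∀ i : H.Time, i.1 = ⊤ →
    ∀ᵐ ω ∂P, Tendsto (fun n : ℕ => X (H.ofNat n) ω) atTop (𝓝 (X i ω))

/-- The process `m 1_{𝕋_t}`. -/
def cashFrom (t : H.Time) (m : Ω → ℝ) : H.Time → Ω → ℝ :=
  fun s ω => if t ≤ s then m ω else 0

/-- `ρ` is (given by representatives) a conditional convex risk measure for processes
`ℛ_t^∞ → L^∞_t`. By monotonicity it respects almost sure equality; its values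
outside `ℛ_t^∞` play no role. -/
structure IsCondConvexRisk (P : Measure Ω) (ℱ : Filtration H.Time mΩ) (t : H.Time)
    (ρ : (H.Time → Ω → ℝ) → Ω → ℝ) : Prop where
  memLinf : ∀ X, MemRt P ℱ t X → MemLinf P (ℱ t) (ρ X)
  cash : ∀ X m, MemRt P ℱ t X → MemLinf P (ℱ t) m →
    ρ (X + cashFrom t m) =ᵐ[P] ρ X - m
  mono : ∀ X Y, MemRt P ℱ t X → MemRt P ℱ t Y → (∀ s, X s ≤ᵐ[P] Y s) → ρ Y ≤ᵐ[P] ρ X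
  convex : ∀ X Y (l : Ω → ℝ), MemRt P ℱ t X → MemRt P ℱ t Y → MemLinf P (ℱ t) l →
    (∀ᵐ ω ∂P, 0 ≤ l ω ∧ l ω ≤ 1) →
    ρ (fun s ω => l ω * X s ω + (1 - l ω) * Y s ω)
      ≤ᵐ[P] fun ω => l ω * ρ X ω + (1 - l ω) * ρ Y ω
  normalized : ρ 0 =ᵐ[P] 0

/-- Continuity from above; `ρ_t` is evaluated on `ℛ^∞` as `ρ_t ∘ π_{t,T}`. -/
def ContFromAbove (P : Measure Ω) (ℱ : Filtration H.Time mΩ) (t : H.Time)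
    (ρ : (H.Time → Ω → ℝ) → Ω → ℝ) : Prop :=
  ∀ (Xn : ℕ → H.Time → Ω → ℝ) (X : H.Time → Ω → ℝ), (∀ n, MemR P ℱ (Xn n)) → MemR P ℱ X →
    (∀ s, t ≤ s → ∀ᵐ ω ∂P, Antitone (fun n => Xn n s ω) ∧
      Tendsto (fun n => Xn n s ω) atTop (𝓝 (X s ω))) →
    ∀ᵐ ω ∂P, Monotone (fun n => ρ (proj t (Xn n)) ω) ∧
      Tendsto (fun n => ρ (proj t (Xn n)) ω) atTop (𝓝 (ρ (proj t X) ω))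

/-! ### Locally absolutely continuous measures, random measures on time, discounting -/

/-- `Q ∈ ℳ_loc(P)`. -/
structure MemMloc (P : Measure Ω) (ℱ : Filtration H.Time mΩ) (Q : Measure Ω) : Prop where
  prob : IsProbabilityMeasure Q
  locally_ac : ∀ s : H.Time, s.1 ≠ ⊤ → ∀ A, MeasurableSet[ℱ s] A → P A = 0 → Q A = 0

/-- `Q ∈ ℳ^e_loc(P)`. -/
structure MemMlocE (P : Measure Ω) (ℱ : Filtration H.Time mΩ) (Q : Measure Ω) : Prop where
  prob : IsProbabilityMeasure Q
  locally_equiv : ∀ s : H.Time, s.1 ≠ ⊤ → ∀ A, MeasurableSet[ℱ s] A → (P A = 0 ↔ Q A = 0)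

/-- `Q ∈ 𝒬_t^loc`. -/
structure MemQloc (P : Measure Ω) (ℱ : Filtration H.Time mΩ) (t : H.Time)
    (Q : Measure Ω) : Prop where
  memMloc : MemMloc P ℱ Q
  eq_on : ∀ A, MeasurableSet[ℱ t] A → Q A = P A

/-- The density process `M_s` of `Q` with respect to `P` along the filtration. -/
def densityProc (P : Measure Ω) (ℱ : Filtration H.Time mΩ) (Q : Measure Ω) (s : H.Time) :
    Ω → ℝ≥0∞ :=
  (Q.trim (ℱ.le s)).rnDeriv (P.trim (ℱ.le s))

/-- The event `{M_∞ = ∞}`, where `M_∞ = lim M_n` (used only if `∞ ∈ 𝕋`). -/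
def singularEvent (P : Measure Ω) (ℱ : Filtration H.Time mΩ) (Q : Measure Ω) : Set Ω :=
  {ω | Tendsto (fun n : ℕ => densityProc P ℱ Q (H.ofNat n) ω) atTop (𝓝 ∞)}

/-- `γ ∈ Γ(Q)`: optional random measures on `𝕋` which are normalized with respect to `Q`. -/
structure MemGamma (P : Measure Ω) (ℱ : Filtration H.Time mΩ) (Q : Measure Ω)
    (γ : H.Time → Ω → ℝ) : Prop where
  adapted : ∀ s, Measurable[ℱ s] (γ s)
  nonneg : ∀ᵐ ω ∂Q, ∀ s, 0 ≤ γ s ω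
  hasSum : ∀ᵐ ω ∂Q, HasSum (fun s => γ s ω) 1
  singular : ∀ i : H.Time, i.1 = ⊤ → ∀ᵐ ω ∂Q, ω ∈ singularEvent P ℱ Q → γ i ω = 0

/-- `γ ∈ Γ_t(Q)`. -/
structure MemGammaT (P : Measure Ω) (ℱ : Filtration H.Time mΩ) (t : H.Time) (Q : Measure Ω)
    (γ : H.Time → Ω → ℝ) : Prop where
  memGamma : MemGamma P ℱ Q γ
  eq_zero : ∀ s < t, γ s =ᵐ[Q] 0

/-- `γ ∈ Γ^e(Q)`. -/
structure MemGammaE (P : Measure Ω) (ℱ : Filtration H.Time mΩ) (Q : Measure Ω)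
    (γ : H.Time → Ω → ℝ) : Prop where
  memGamma : MemGamma P ℱ Q γ
  pos : ∀ s, ∀ᵐ ω ∂P, 0 < γ s ω

/-- `D ∈ 𝒟(Q)`: predictable discounting processes. Non-negativity is part of the requirement that
`D` be non-increasing up to `D_{T+1} = 0` (if `T < ∞`), resp. with limit `D_∞ ≥ 0`
(if `T = ∞`). -/
structure MemDisc (P : Measure Ω) (ℱ : Filtration H.Time mΩ) (Q : Measure Ω)
    (D : H.Time → Ω → ℝ) : Prop where
  predictable : ∀ s, Measurable[ℱ (Horizon.pred s)] (D s)
  zero : D H.zero =ᵐ[Q] 1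
  antitone : ∀ᵐ ω ∂Q, Antitone fun s => D s ω
  nonneg : ∀ᵐ ω ∂Q, ∀ s, 0 ≤ D s ω
  tendsto_zero : H = .nat → ∀ᵐ ω ∂Q, Tendsto (fun n : ℕ => D (H.ofNat n) ω) atTop (𝓝 0)
  tendsto_top : ∀ i : H.Time, i.1 = ⊤ →
    ∀ᵐ ω ∂Q, Tendsto (fun n : ℕ => D (H.ofNat n) ω) atTop (𝓝 (D i ω))
  singular : ∀ i : H.Time, i.1 = ⊤ → ∀ᵐ ω ∂Q, ω ∈ singularEvent P ℱ Q → D i ω = 0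

/-- `D ∈ 𝒟_t(Q)`. -/
structure MemDiscT (P : Measure Ω) (ℱ : Filtration H.Time mΩ) (t : H.Time) (Q : Measure Ω)
    (D : H.Time → Ω → ℝ) : Prop where
  memDisc : MemDisc P ℱ Q D
  eq_one : ∀ s ≤ t, D s =ᵐ[Q] 1

/-- The discounting process of `γ`: `D_s = 1 - ∑_{r < s} γ_r` for `s ∈ 𝕋 ∩ ℕ` (a finite sum), and
`D_∞ = γ_∞`. -/
def discOf (γ : H.Time → Ω → ℝ) (s : H.Time) (ω : Ω) : ℝ :=
  open Classical in
  if s.1 = ⊤ then γ s ω else 1 - ∑' r : H.Time, if r < s then γ r ω else 0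

/-- The random measure of `D`: `γ_s = D_s - D_{s+1}` for `s ∈ 𝕋 ∩ ℕ`, where `D_{T+1} = 0` if
`T < ∞`, and `γ_∞ = D_∞`. -/
def gammaOf (D : H.Time → Ω → ℝ) (s : H.Time) (ω : Ω) : ℝ :=
  open Classical in
  if s.1 = ⊤ then D s ω
  else D s ω - (if h : s.1 + 1 ∈ H.times then D ⟨s.1 + 1, h⟩ ω else 0)

/-! ### The optional `σ`-field and measures on it -/

/-- The product space `Ω × 𝕋`, which carries the optional `σ`-field of `ℱ`. -/
structure OptSpace (ℱ : Filtration H.Time mΩ) : Type _ where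
  outcome : Ω
  time : H.Time

/-- The set `A × S` in `Ω × 𝕋`. -/
def rect (ℱ : Filtration H.Time mΩ) (A : Set Ω) (S : Set H.Time) : Set (OptSpace ℱ) :=
  {p | p.outcome ∈ A ∧ p.time ∈ S}

/-- The optional `σ`-field, generated by the sets `A × {s}` with `A ∈ ℱ_s`. -/
instance instMeasurableSpaceOptSpace (ℱ : Filtration H.Time mΩ) : MeasurableSpace (OptSpace ℱ) :=
  MeasurableSpace.generateFrom
    {B | ∃ (s : H.Time) (A : Set Ω), MeasurableSet[ℱ s] A ∧ B = rect ℱ A {s}}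

/-- The optional filtration: at time `t`, the `σ`-field generated by the sets `A × {j}` with `j < t`,
`A ∈ ℱ_j`, and the sets `A × 𝕋_t` with `A ∈ ℱ_t`. -/
abbrev optFiltration (ℱ : Filtration H.Time mΩ) (t : H.Time) : MeasurableSpace (OptSpace ℱ) :=
  MeasurableSpace.generateFrom
    ({B | ∃ (j : H.Time) (A : Set Ω), j < t ∧ MeasurableSet[ℱ j] A ∧ B = rect ℱ A {j}} ∪
     {B | ∃ A : Set Ω, MeasurableSet[ℱ t] A ∧ B = rect ℱ A (Set.Ici t)})

/-- The section map `ω ↦ (ω, s)`. -/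
def atTime (ℱ : Filtration H.Time mΩ) (s : H.Time) (ω : Ω) : OptSpace ℱ := ⟨ω, s⟩

theorem measurable_atTime (ℱ : Filtration H.Time mΩ) (s : H.Time) : Measurable (atTime ℱ s) := by
  apply measurable_generateFrom
  rintro B ⟨r, A, hA, rfl⟩
  by_cases h : s = r
  · have e : atTime ℱ s ⁻¹' rect ℱ A {r} = A := by
      ext ω; simp [atTime, rect, h]
    rw [e]; exact ℱ.le r A hA
  · have e : atTime ℱ s ⁻¹' rect ℱ A {r} = ∅ := by
      ext ω; simp [atTime, rect, h]
    rw [e]; exact MeasurableSet.empty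

/-- The measure `Q ⊗ γ` on the optional `σ`-field, `(Q ⊗ γ)(B) = E_Q[∑ₛ γ_s 1_B(·, s)]`. -/
def optProd (ℱ : Filtration H.Time mΩ) (Q : Measure Ω) (γ : H.Time → Ω → ℝ) :
    Measure (OptSpace ℱ) :=
  Measure.sum fun s => (Q.withDensity fun ω => ENNReal.ofReal (γ s ω)).map (atTime ℱ s)

/-- `μ` is an adapted reference process: `μ_s > 0` and `∑ₛ μ_s = 1` almost surely. -/
structure IsReference (P : Measure Ω) (ℱ : Filtration H.Time mΩ) (μ : H.Time → Ω → ℝ) :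
    Prop where
  adapted : ∀ s, Measurable[ℱ s] (μ s)
  pos : ∀ᵐ ω ∂P, ∀ s, 0 < μ s ω
  hasSum : ∀ᵐ ω ∂P, HasSum (fun s => μ s ω) 1

/-- `Q̄ ∈ ℳ(P̄)` with `P̄ = P ⊗ μ`. -/
structure MemMbar (P : Measure Ω) (ℱ : Filtration H.Time mΩ) (μ : H.Time → Ω → ℝ)
    (Qbar : Measure (OptSpace ℱ)) : Prop where
  prob : IsProbabilityMeasure Qbar
  ac : Qbar ≪ optProd ℱ P μ

/-- `Q̄ = Q ⊗ γ` with `Q ∈ ℳ_loc(P)` and `γ ∈ Γ(Q)`. -/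
structure IsDecomp (P : Measure Ω) (ℱ : Filtration H.Time mΩ) (Qbar : Measure (OptSpace ℱ))
    (Q : Measure Ω) (γ : H.Time → Ω → ℝ) : Prop where
  memMloc : MemMloc P ℱ Q
  memGamma : MemGamma P ℱ Q γ
  eq : Qbar = optProd ℱ Q γ

/-- `R̄ ∈ 𝒬̄_t(Q̄)`: `R̄ ∈ ℳ(P̄)` and `R̄ = Q̄` on the optional `σ`-field at time `t`. -/
structure MemQbar (P : Measure Ω) (ℱ : Filtration H.Time mΩ) (μ : H.Time → Ω → ℝ) (t : H.Time)
    (Qbar Rbar : Measure (OptSpace ℱ)) : Prop where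
  memMbar : MemMbar P ℱ μ Rbar
  eq_on : ∀ B, MeasurableSet[optFiltration ℱ t] B → Rbar B = Qbar B

/-! ### Penalty and the representations -/

/-- `∑_{s ∈ 𝕋_t} γ_s X_s`. -/
def sumFrom (t : H.Time) (γ X : H.Time → Ω → ℝ) (ω : Ω) : ℝ :=
  ∑' s : H.Time, if t ≤ s then γ s ω * X s ω else 0

/-- `E_Q[-∑_{s ∈ 𝕋_t} γ_s X_s | ℱ_t]`. -/
def condLoss (ℱ : Filtration H.Time mΩ) (t : H.Time) (Q : Measure Ω) (γ X : H.Time → Ω → ℝ) :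
    Ω → ℝ :=
  Q[fun ω => -sumFrom t γ X ω | ℱ t]

/-- The normalized weights `γ_s / D_t` with `D_t = 1 - ∑_{s < t} γ_s`. -/
def normalize (t : H.Time) (γ : H.Time → Ω → ℝ) : H.Time → Ω → ℝ :=
  fun s ω => γ s ω / discOf γ t ω

/-- `X ∈ 𝒜_t`, the acceptance set. -/
structure MemAccept (P : Measure Ω) (ℱ : Filtration H.Time mΩ) (t : H.Time)
    (ρ : (H.Time → Ω → ℝ) → Ω → ℝ) (X : H.Time → Ω → ℝ) : Prop where
  memRt : MemRt P ℱ t X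
  nonpos : ρ X ≤ᵐ[P] 0

/-- The minimal penalty
`α_t(Q ⊗ γ) = Q-ess sup_{X ∈ 𝒜_t} E_Q[-∑_{s ∈ 𝕋_t} (γ_s / D_t) X_s | ℱ_t]`; its values are
meaningful on `{D_t > 0}`. -/
def penalty (P : Measure Ω) (ℱ : Filtration H.Time mΩ) (t : H.Time)
    (ρ : (H.Time → Ω → ℝ) → Ω → ℝ) (Q : Measure Ω) (γ : H.Time → Ω → ℝ) : Ω → EReal :=
  familyEssSup Q (ℱ t)
    {f | ∃ X, MemAccept P ℱ t ρ X ∧ f = fun ω => (condLoss ℱ t Q (normalize t γ) X ω : EReal)}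

/-- `E_Q[-∑_{s ∈ 𝕋_t} γ_s X_s | ℱ_t] - α_t(Q ⊗ γ)`. -/
def gammaTerm (P : Measure Ω) (ℱ : Filtration H.Time mΩ) (t : H.Time)
    (ρ : (H.Time → Ω → ℝ) → Ω → ℝ) (X : H.Time → Ω → ℝ) (Q : Measure Ω)
    (γ : H.Time → Ω → ℝ) : Ω → EReal :=
  fun ω => (condLoss ℱ t Q γ X ω : EReal) - penalty P ℱ t ρ Q γ ω

/-- `ess sup_{Q ∈ 𝒬_t^loc} ess sup_{γ ∈ Γ_t(Q)} (E_Q[-∑_{s ∈ 𝕋_t} γ_s X_s | ℱ_t] - α_t(Q ⊗ γ))`. -/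
def gammaRep (P : Measure Ω) (ℱ : Filtration H.Time mΩ) (t : H.Time)
    (ρ : (H.Time → Ω → ℝ) → Ω → ℝ) (X : H.Time → Ω → ℝ) : Ω → EReal :=
  familyEssSup P (ℱ t) {g | ∃ Q, MemQloc P ℱ t Q ∧
    g = familyEssSup P (ℱ t) {f | ∃ γ, MemGammaT P ℱ t Q γ ∧ f = gammaTerm P ℱ t ρ X Q γ}}

/-- The increment `ΔX_s = X_s - X_{s-1}` with `X_{-1} = 0`. -/
def delta (X : H.Time → Ω → ℝ) (s : H.Time) (ω : Ω) : ℝ :=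
  open Classical in
  X s ω - (if s = H.zero then 0 else X (Horizon.pred s) ω)

/-- The partial sums `∑_{s ∈ 𝕋, t ≤ s ≤ n} D_s ΔX_s`. -/
def discSum (t : H.Time) (D X : H.Time → Ω → ℝ) (n : ℕ) (ω : Ω) : ℝ :=
  open Classical in
  ∑ k ∈ Finset.range (n + 1),
    if (k : ℕ∞) ∈ H.times ∧ t.1 ≤ (k : ℕ∞) then
      D (H.ofNat k) ω * delta X (H.ofNat k) ω else 0

/-- `∑_{s=t}^T D_s ΔX_s`, the limit of the partial sums (which are eventually constant if `T < ∞`;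
for `T = ∞` the series need not converge absolutely). -/
def discSumLim (t : H.Time) (D X : H.Time → Ω → ℝ) (ω : Ω) : ℝ :=
  limUnder atTop fun n : ℕ => discSum t D X n ω

/-- `E_Q[-∑_{s=t}^T D_s ΔX_s | ℱ_t] - α_t(Q ⊗ D)`. -/
def discTerm (P : Measure Ω) (ℱ : Filtration H.Time mΩ) (t : H.Time)
    (ρ : (H.Time → Ω → ℝ) → Ω → ℝ) (X : H.Time → Ω → ℝ) (Q : Measure Ω)
    (D : H.Time → Ω → ℝ) : Ω → EReal :=
  fun ω => ((Q[fun ω' => -discSumLim t D X ω' | ℱ t]) ω : EReal) -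
    penalty P ℱ t ρ Q (gammaOf D) ω

/-- `ess sup_{Q ∈ 𝒬_t^loc} ess sup_{D ∈ 𝒟_t(Q)} (E_Q[-∑_{s=t}^T D_s ΔX_s | ℱ_t] - α_t(Q ⊗ D))`. -/
def discRep (P : Measure Ω) (ℱ : Filtration H.Time mΩ) (t : H.Time)
    (ρ : (H.Time → Ω → ℝ) → Ω → ℝ) (X : H.Time → Ω → ℝ) : Ω → EReal :=
  familyEssSup P (ℱ t) {g | ∃ Q, MemQloc P ℱ t Q ∧
    g = familyEssSup P (ℱ t) {f | ∃ D, MemDiscT P ℱ t Q D ∧ f = discTerm P ℱ t ρ X Q D}}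

/-- `E_Q[(∑_{s ∈ 𝕋_t} μ_s) α_t(Q ⊗ γ)]`, for `Q ∈ 𝒬_t^loc`. The weight is written in its
`ℱ_t`-measurable version `1 - ∑_{s < t} μ_s`, which agrees `P`-almost surely with
`∑_{s ∈ 𝕋_t} μ_s`; the penalty is almost surely non-negative. -/
def expectedPenalty (P : Measure Ω) (ℱ : Filtration H.Time mΩ) (μ : H.Time → Ω → ℝ)
    (t : H.Time) (ρ : (H.Time → Ω → ℝ) → Ω → ℝ) (Q : Measure Ω) (γ : H.Time → Ω → ℝ) : ℝ≥0∞ :=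
  ∫⁻ ω, ENNReal.ofReal (discOf μ t ω) * (penalty P ℱ t ρ Q γ ω).toENNReal ∂Q

/-- The essential supremum of the terms `E_Q[-∑_{s ∈ 𝕋_t} γ_s X_s | ℱ_t] - α_t(Q ⊗ γ)` over all
`Q ∈ 𝒬_t^loc`, `γ ∈ Γ_t(Q)` with finite expected penalty. -/
def finitePenaltyRep (P : Measure Ω) (ℱ : Filtration H.Time mΩ) (μ : H.Time → Ω → ℝ)
    (t : H.Time) (ρ : (H.Time → Ω → ℝ) → Ω → ℝ) (X : H.Time → Ω → ℝ) : Ω → EReal :=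
  familyEssSup P (ℱ t) {f | ∃ Q γ, MemQloc P ℱ t Q ∧ MemGammaT P ℱ t Q γ ∧
    expectedPenalty P ℱ μ t ρ Q γ < ∞ ∧ f = gammaTerm P ℱ t ρ X Q γ}

/-- For `Q̄ = Q ⊗ γ = Q ⊗ D`, the `Q`-essential supremum over all `R ⊗ ξ ∈ 𝒬̄_t(Q̄)` of
`(1 / D_t) E_R[-∑_{s ∈ 𝕋_t} ξ_s X_s | ℱ_t] - α_t(R ⊗ ξ)`. -/
def localRep (P : Measure Ω) (ℱ : Filtration H.Time mΩ) (μ : H.Time → Ω → ℝ) (t : H.Time)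
    (ρ : (H.Time → Ω → ℝ) → Ω → ℝ) (X : H.Time → Ω → ℝ) (Qbar : Measure (OptSpace ℱ))
    (Q : Measure Ω) (γ : H.Time → Ω → ℝ) : Ω → EReal :=
  familyEssSup Q (ℱ t) {f | ∃ Rbar R ξ, MemQbar P ℱ μ t Qbar Rbar ∧ IsDecomp P ℱ Rbar R ξ ∧
    f = fun ω => ((1 / discOf γ t ω * condLoss ℱ t R ξ X ω : ℝ) : EReal) -
      penalty P ℱ t ρ R ξ ω}

/-- The essential supremum over all `Q ∈ ℳ^e_loc(P)`, `γ ∈ Γ^e(Q)` of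
`E_Q[-∑_{s ∈ 𝕋_t} (γ_s / D_t) X_s | ℱ_t] - α_t(Q ⊗ γ)`. -/
def equivRep (P : Measure Ω) (ℱ : Filtration H.Time mΩ) (t : H.Time)
    (ρ : (H.Time → Ω → ℝ) → Ω → ℝ) (X : H.Time → Ω → ℝ) : Ω → EReal :=
  familyEssSup P (ℱ t) {f | ∃ Q γ, MemMlocE P ℱ Q ∧ MemGammaE P ℱ Q γ ∧
    f = fun ω => (condLoss ℱ t Q (normalize t γ) X ω : EReal) - penalty P ℱ t ρ Q γ ω}

end RiskProc

end

/-! A process is a function on `Ω × 𝕋`, so `ρ` acts as a conditional risk measure on the optional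
σ-field with reference measure `P ⊗ μ`. Every `Q ⊗ γ` with `Q ∈ ℳ_loc(P)`, `γ ∈ Γ(Q)` is absolutely
continuous with respect to `P ⊗ μ`, hence equals `P ⊗ N` for an adapted density process `N`.
Conditional losses per unit of remaining mass, and therefore penalties, depend only on this measure
(`IsWeight.condLoss_congr`, `penalty_eq_densityPenalty`). So (A), (C), (D) and (E) all compare `ρ`
with essential suprema of the same expression `densityTerm`, taken over different families of `N`.

From a representation to continuity: `X + ρ(X)` is acceptable, so no penalized loss exceeds the risk
(`densityTerm_le`). Each penalized loss passes to decreasing limits by dominated convergence, and a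
supremum of such terms cannot jump above the limit of the risks (`contFromAbove_of_representation`).

From continuity to a representation: the set of `Y` with `E[ρ(Y)] ≤ 0` is convex, and continuity
from above, applied to tail suprema, makes its bounded parts closed in `L²(P ⊗ μ)`. A Krein–Šmulian
argument (`exists_separating_series`) then separates it from a process of positive expected risk by
an integrable `Z`, rather than by a general functional on bounded processes. Monotonicity makes `Z`
nonnegative from time `t` on, and invariance under `ℱ_t`-measurable cash makes its conditional mass
constant; so `Z` normalizes to a density process (`exists_weight_separating`). The losses of
acceptable processes are directed upwards, which allows expectation and essential supremum to be
exchanged; the penalized loss falls short of `ρ(X)` by at most `ε` in mean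
(`le_of_forall_densityTerm_le`).

A density process `N` has to be factored back into `Q ⊗ γ`. The conditional tail mass `E[∑_{s ≥ n}
N_s | ℱ_n]` is a supermartingale and splits into a martingale `M_n` times `D_n = 1 - ∑_{r < n} γ_r`
(`exists_multiplicative_decomposition`). The martingale gives consistent measures on the `ℱ_n`,
which Parthasarathy's extension theorem (`exists_extension`) joins to one measure `Q`. The limit of
`D_n` is the mass at `∞`; it vanishes on `{M_∞ = ∞}` since it corresponds to a `P`-absolutely
continuous measure (`exists_decomposition`).

Part (B) is summation by parts, where the boundary term causes no trouble because `D_∞ = 0` wherever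
`X_n → X_∞` may fail under `Q`. For (D), a separating density is pasted after time `t` onto the
density of the given measure, which changes nothing on the optional σ-field at time `t`. For (E),
each separating density is mixed with a small multiple of a positive one with finite penalty. -/

namespace RiskProc

/-! ### A Krein–Šmulian separation theorem in Hilbert space -/

section KreinSmulian

open scoped InnerProductSpace

variable {E : Type*} [NormedAddCommGroup E] [InnerProductSpace ℝ E]

/-- Bounded closed convex sets in a Hilbert space are weakly compact: the finite intersection
property for polars. -/
theorem exists_mem_forall_abs_inner_le_one [CompleteSpace E] {K : Set E} (hconv : Convex ℝ K) (hcl : IsClosed K)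
    (hb : Bornology.IsBounded K) (S : Set E)
    (h : ∀ F : Finset E, (F : Set E) ⊆ S → ∃ f ∈ K, ∀ x ∈ F, |⟪x, f⟫_ℝ| ≤ 1) :
    ∃ f ∈ K, ∀ x ∈ S, |⟪x, f⟫_ℝ| ≤ 1 := by
  let J : WeakDual ℝ E → E := fun φ => (InnerProductSpace.toDual ℝ E).symm (WeakDual.toStrongDual φ)
  have hJ : ∀ (φ : WeakDual ℝ E) (x : E), ⟪x, J φ⟫_ℝ = φ x := fun φ x => by
    rw [real_inner_comm]; exact InnerProductSpace.toDual_symm_apply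
  let J' : E → WeakDual ℝ E := fun f => StrongDual.toWeakDual (InnerProductSpace.toDual ℝ E f)
  have hJJ : ∀ f, J (J' f) = f := fun f => by simp [J, J']
  let K' : Set (WeakDual ℝ E) := J ⁻¹' K
  -- A norm-closed convex set is weakly closed: a point outside is strictly separated by a
  -- functional, which is evaluation at the vector `z`. Banach–Alaoglu then gives compactness.
  have hK'cl : IsClosed K' := by
    rw [← isOpen_compl_iff, isOpen_iff_mem_nhds]
    intro φ hφ
    obtain ⟨l, u, h1, h2⟩ := geometric_hahn_banach_point_closed hconv hcl (x := J φ) hφ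
    set z := (InnerProductSpace.toDual ℝ E).symm l
    have hl : ∀ f, l f = ⟪z, f⟫_ℝ := fun f => (InnerProductSpace.toDual_symm_apply).symm
    have ho : IsOpen {ψ : WeakDual ℝ E | ψ z < u} :=
      isOpen_lt (WeakDual.eval_continuous z) continuous_const
    refine mem_of_superset (ho.mem_nhds ?_) ?_
    · show φ z < u
      rw [← hJ, ← hl]; exact h1
    · intro ψ hψ hψK
      have := h2 _ hψK
      rw [hl, hJ] at this
      exact lt_asymm this hψ
  have hK'b : Bornology.IsBounded (StrongDual.toWeakDual (𝕜 := ℝ) (E := E) ⁻¹' K') := by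
    obtain ⟨R, hR⟩ := hb.exists_norm_le
    refine isBounded_iff_forall_norm_le.2 ⟨R, fun φ hφ => ?_⟩
    have := hR _ hφ
    simpa [J] using this
  have hK'c : IsCompact K' := WeakDual.isCompact_of_bounded_of_closed hK'b hK'cl
  obtain ⟨φ, hφK, hφ⟩ := hK'c.inter_iInter_nonempty (fun x : S => {ψ : WeakDual ℝ E | |ψ x| ≤ 1})
    (fun x => isClosed_le (continuous_abs.comp (WeakDual.eval_continuous _)) continuous_const)
    (fun u => by
      classical
      obtain ⟨f, hf, hfu⟩ := h (u.image Subtype.val) (by simp)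
      refine ⟨J' f, ?_, ?_⟩
      · show J (J' f) ∈ K
        rwa [hJJ]
      · simp only [Set.mem_iInter, Set.mem_ofPred_eq]
        intro x hx
        rw [← hJ, hJJ]
        exact hfu _ (Finset.mem_image_of_mem _ hx))
  refine ⟨J φ, hφK, fun x hx => ?_⟩
  rw [hJ]
  exact Set.mem_iInter.1 hφ ⟨x, hx⟩

/-- Continuous linear functionals on `c₀` are summable series. -/
theorem exists_summable_of_strongDual_c0 {ι : Type*} [TopologicalSpace ι] [DiscreteTopology ι]
    (l : StrongDual ℝ (ZeroAtInftyContinuousMap ι ℝ)) :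
    ∃ a : ι → ℝ, Summable (fun i => |a i|) ∧
      ∀ y : ZeroAtInftyContinuousMap ι ℝ, HasSum (fun i => a i * y i) (l y) := by
  classical
  -- Finitely supported functions vanish at infinity; they serve as unit vectors, as test functions
  -- of signs and as truncations.
  have mk : ∀ (F : Finset ι) (c : ι → ℝ), ∃ y : ZeroAtInftyContinuousMap ι ℝ,
      ∀ i, y i = if i ∈ F then c i else 0 := fun F c =>
    ⟨⟨⟨fun i => if i ∈ F then c i else 0, continuous_of_discreteTopology⟩, by
      rw [cocompact_eq_cofinite]
      refine tendsto_const_nhds.congr' ?_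
      filter_upwards [F.finite_toSet.compl_mem_cofinite] with i hi
      exact (if_neg (by simpa using hi)).symm⟩, fun i => rfl⟩
  choose e he using fun i => mk {i} 1
  have hsum : ∀ (F : Finset ι) (c : ι → ℝ) (y : ZeroAtInftyContinuousMap ι ℝ),
      (∀ i, y i = if i ∈ F then c i else 0) → y = ∑ i ∈ F, c i • e i := by
    intro F c y hy
    ext j
    have hco : (∑ i ∈ F, c i • e i) j = ∑ i ∈ F, (c i • e i) j :=
      map_sum (⟨⟨fun y => y j, rfl⟩, fun _ _ => rfl⟩ : ZeroAtInftyContinuousMap ι ℝ →+ ℝ) _ _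
    rw [hy, hco]
    simp [he]
  have hnorm : ∀ (y : ZeroAtInftyContinuousMap ι ℝ) (C : ℝ), 0 ≤ C → (∀ i, |y i| ≤ C) → ‖y‖ ≤ C := by
    intro y C hC h
    rw [← ZeroAtInftyContinuousMap.norm_toBCF_eq_norm]
    exact (BoundedContinuousFunction.norm_le hC).2 h
  refine ⟨fun i => l (e i), ?_, fun y => ?_⟩
  · refine summable_of_sum_le (c := ‖l‖) (fun i => abs_nonneg _) fun F => ?_
    -- Testing on the signs of `l (e i)`, a function of norm at most `1`, bounds every partial sum
    -- of `|l (e i)|` by `‖l‖`.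
    obtain ⟨y, hy⟩ := mk F fun i => SignType.sign (l (e i))
    have h1 : l y = ∑ i ∈ F, |l (e i)| := by
      rw [hsum F _ y hy, map_sum]
      exact Finset.sum_congr rfl fun i _ => by rw [map_smul, smul_eq_mul, sign_mul_self]
    have h2 : ‖y‖ ≤ 1 := hnorm y 1 zero_le_one fun i => by
      rw [hy]; split_ifs
      · rcases lt_trichotomy (l (e i)) 0 with h | h | h <;> simp [h]
      · simp
    rw [← h1]
    calc l y ≤ ‖l y‖ := le_abs_self _
      _ ≤ ‖l‖ * ‖y‖ := l.le_opNorm _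
      _ ≤ ‖l‖ * 1 := by gcongr
      _ = ‖l‖ := mul_one _
  · choose t ht using fun F : Finset ι => mk F y
    -- Truncations of a function vanishing at infinity converge uniformly, so continuity of `l`
    -- yields the series.
    have h1 : Tendsto t atTop (𝓝 y) := by
      rw [Metric.tendsto_atTop]
      intro ε hε
      have h0 : Tendsto y cofinite (𝓝 0) := by
        rw [← cocompact_eq_cofinite]; exact zero_at_infty y
      have h2 : {i | ¬ |y i| < ε / 2}.Finite := by
        have := h0.eventually (Metric.ball_mem_nhds (0 : ℝ) (half_pos hε))
        simpa [eventually_cofinite, Real.dist_eq] using this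
      refine ⟨h2.toFinset, fun F hF => ?_⟩
      rw [dist_eq_norm]
      refine lt_of_le_of_lt (hnorm _ (ε / 2) (half_pos hε).le fun i => ?_) (half_lt_self hε)
      rw [ZeroAtInftyContinuousMap.sub_apply, ht]
      split_ifs with hi
      · simpa using (half_pos hε).le
      · have : i ∉ h2.toFinset := fun h => hi (hF h)
        simp only [Set.Finite.mem_toFinset, Set.mem_ofPred_eq, not_not] at this
        rw [zero_sub, abs_neg]; exact this.le
    have h2 : Tendsto (fun F => l (t F)) atTop (𝓝 (l y)) := (l.continuous.tendsto y).comp h1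
    refine h2.congr fun F => ?_
    rw [hsum F _ _ (ht F), map_sum]
    exact Finset.sum_congr rfl fun i _ => by rw [map_smul, smul_eq_mul, mul_comm]

/-- The elements of a Hilbert space which are bounded by `r` in the norm dual to the seminorm
`q`. -/
def dualBall (q : Seminorm ℝ E) (r : ℝ) : Set E := {f | ∀ x, |⟪x, f⟫_ℝ| ≤ r * q x}

/-- Testing the defining bound on `x = f` gives `‖f‖² ≤ r c ‖f‖`. -/
theorem norm_le_of_mem_dualBall {q : Seminorm ℝ E} {c r : ℝ} (hr : 0 ≤ r) (hc : 0 ≤ c)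
    (hq : ∀ x, q x ≤ c * ‖x‖) {f : E} (hf : f ∈ dualBall q r) : ‖f‖ ≤ r * c := by
  have h1 := hf f
  rw [real_inner_self_eq_norm_sq, abs_of_nonneg (sq_nonneg _)] at h1
  have h2 : ‖f‖ ^ 2 ≤ r * c * ‖f‖ := h1.trans (by
    rw [mul_assoc]; exact mul_le_mul_of_nonneg_left (hq f) hr)
  rcases (norm_nonneg f).eq_or_lt with h | h
  · rw [← h]; positivity
  · nlinarith

theorem convex_dualBall (q : Seminorm ℝ E) (r : ℝ) : Convex ℝ (dualBall q r) := by
  intro f hf g hg a b ha hb hab x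
  rw [inner_add_right, inner_smul_right, inner_smul_right]
  calc |a * ⟪x, f⟫_ℝ + b * ⟪x, g⟫_ℝ| ≤ |a * ⟪x, f⟫_ℝ| + |b * ⟪x, g⟫_ℝ| := abs_add_le _ _
    _ = a * |⟪x, f⟫_ℝ| + b * |⟪x, g⟫_ℝ| := by
      rw [abs_mul, abs_mul, abs_of_nonneg ha, abs_of_nonneg hb]
    _ ≤ a * (r * q x) + b * (r * q x) := by
      gcongr
      exacts [hf x, hg x]
    _ = r * q x := by rw [← add_mul, hab, one_mul]

theorem dualBall_mono (q : Seminorm ℝ E) {r r' : ℝ} (h : r ≤ r') : dualBall q r ⊆ dualBall q r' :=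
  fun _ hf x => (hf x).trans (mul_le_mul_of_nonneg_right h (apply_nonneg q x))

/-- A version of the Krein–Šmulian theorem: a convex set `C` which does not contain `0`, and whose
intersections with the balls of the norm dual to `q` are closed, is separated from `0` on the union
of these balls by a series which converges absolutely with respect to `q`. -/
theorem exists_separating_series [CompleteSpace E] (q : Seminorm ℝ E) {c : ℝ} (hc : 0 ≤ c) (hq : ∀ x, q x ≤ c * ‖x‖)
    {C : Set E} (hC : Convex ℝ C) (hcl : ∀ r, 0 < r → IsClosed (C ∩ dualBall q r))
    (h0 : (0 : E) ∉ C) :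
    ∃ (F : ℕ → Finset E) (a : (Σ n, F n) → ℝ) (B : ℝ), Summable (fun i => |a i|) ∧
      (∀ i : Σ n, F n, q i.2 ≤ B) ∧
      ∀ r, ∀ f ∈ C ∩ dualBall q r, ∃ v, 1 ≤ v ∧ HasSum (fun i => a i * ⟪(i.2 : E), f⟫_ℝ) v := by
  classical
  -- Small dual balls lie in small norm balls, and the part of `C` in the unit dual ball is closed
  -- without containing `0`; hence some dual ball misses `C`.
  obtain ⟨δ, hδ, hδC⟩ : ∃ δ, 0 < δ ∧ C ∩ dualBall q δ = ∅ := by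
    have h1 : (C ∩ dualBall q 1)ᶜ ∈ 𝓝 (0 : E) :=
      (hcl 1 one_pos).isOpen_compl.mem_nhds fun h => h0 h.1
    obtain ⟨ε, hε, h2⟩ := Metric.mem_nhds_iff.1 h1
    refine ⟨min 1 (ε / (c + 1)), by positivity, ?_⟩
    rw [Set.eq_empty_iff_forall_notMem]
    rintro f ⟨hfC, hf⟩
    refine h2 (?_ : f ∈ Metric.ball 0 ε) ⟨hfC, dualBall_mono q (min_le_left _ _) hf⟩
    rw [mem_ball_zero_iff]
    calc ‖f‖ ≤ min 1 (ε / (c + 1)) * c := norm_le_of_mem_dualBall (by positivity) hc hq hf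
      _ ≤ ε / (c + 1) * c := by gcongr; exact min_le_right _ _
      _ < ε := by
        rw [div_mul_eq_mul_div, div_lt_iff₀ (by positivity)]
        nlinarith
  let r : ℕ → ℝ := fun n => δ * (n + 1)
  have hr : ∀ n, 0 < r n := fun n => by positivity
  -- The polar of the finite set `G` misses the part of `C` in the dual ball of radius `r n`. The
  -- sets are enlarged step by step as the radius grows.
  let Pr : ℕ → Finset E → Prop := fun n G =>
    ∀ f ∈ C ∩ dualBall q (r n), ∃ x ∈ G, 1 < |⟪x, f⟫_ℝ|
  have step : ∀ n G, Pr n G → ∃ F : Finset E, (∀ x ∈ F, q x ≤ 1 / r n) ∧ Pr (n + 1) (G ∪ F) := by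
    intro n G hG
    -- If no finite `F` works, weak compactness of `K` gives one `f ∈ K` that is at most `1` in
    -- modulus on the whole set `q ≤ 1 / r n`. By homogeneity `f` lies in the smaller dual ball of
    -- radius `r n`, where `G` already excludes it.
    by_contra! hcon
    let K : Set E := (C ∩ dualBall q (r (n + 1))) ∩ {f | ∀ x ∈ G, |⟪x, f⟫_ℝ| ≤ 1}
    have hpol : {f : E | ∀ x ∈ G, |⟪x, f⟫_ℝ| ≤ 1} = ⋂ x ∈ G, {f | |⟪x, f⟫_ℝ| ≤ 1} := by
      ext; simp
    have hK1 : Convex ℝ K := by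
      refine (hC.inter (convex_dualBall q _)).inter ?_
      rw [hpol]
      refine convex_iInter fun x => convex_iInter fun _ => ?_
      intro f hf g hg a b ha hb hab
      simp only [Set.mem_ofPred_eq] at *
      rw [inner_add_right, inner_smul_right, inner_smul_right]
      rw [abs_le] at *
      constructor <;> nlinarith
    have hK2 : IsClosed K := by
      refine (hcl _ (hr _)).inter ?_
      rw [hpol]
      exact isClosed_biInter fun x _ => isClosed_le (by fun_prop) continuous_const
    have hK3 : Bornology.IsBounded K := isBounded_iff_forall_norm_le.2
      ⟨_, fun f hf => norm_le_of_mem_dualBall (hr _).le hc hq hf.1.2⟩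
    obtain ⟨f, hfK, hf⟩ := exists_mem_forall_abs_inner_le_one hK1 hK2 hK3
      {x | q x ≤ 1 / r n} fun F hF => by
        have := hcon F hF
        simp only [Pr, not_forall, not_exists, not_and, not_lt] at this
        obtain ⟨f, hf, hf'⟩ := this
        exact ⟨f, ⟨hf, fun x hx => hf' x (Finset.mem_union_left _ hx)⟩,
          fun x hx => hf' x (Finset.mem_union_right _ hx)⟩
    have hfr : f ∈ dualBall q (r n) := by
      intro x
      refine le_of_forall_pos_le_add fun ε hε => ?_
      -- The summand with `ε` keeps the normalizing factor positive when `q x = 0`.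
      set s := q x + ε / r n with hs
      have hsp : 0 < s := by have := apply_nonneg q x; have := hr n; positivity
      have h1 := hf ((1 / (r n * s)) • x) (by
        show q _ ≤ _
        rw [map_smul_eq_mul, Real.norm_of_nonneg (by have := hr n; positivity)]
        have h3 : q x ≤ s := by have := hr n; rw [hs]; exact le_add_of_nonneg_right (by positivity)
        calc 1 / (r n * s) * q x ≤ 1 / (r n * s) * s := by have := hr n; gcongr
          _ = 1 / r n := by have := hr n; field_simp)
      rw [inner_smul_left, abs_mul, RCLike.conj_to_real,
        abs_of_nonneg (by have := hr n; positivity), div_mul_eq_mul_div, one_mul,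
        div_le_one (by have := hr n; positivity)] at h1
      calc |⟪x, f⟫_ℝ| ≤ r n * s := h1
        _ = r n * q x + ε := by have := (hr n).ne'; rw [hs]; field_simp
    obtain ⟨x, hx, hx1⟩ := hG f ⟨hfK.1.1, hfr⟩
    exact absurd (hfK.2 x hx) (not_le.2 hx1)
  choose! Φ hΦ1 hΦ2 using step
  have base : Pr 0 ∅ := by
    intro f hf
    have : f ∈ C ∩ dualBall q δ := by simpa [r] using hf
    rw [hδC] at this
    exact this.elim
  let G : (n : ℕ) → {G // Pr n G} := fun n =>
    Nat.rec ⟨∅, base⟩ (fun n G => ⟨G.1 ∪ Φ n G.1, hΦ2 n G.1 G.2⟩) n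
  let F : ℕ → Finset E := fun n => Φ n (G n).1
  have hFq : ∀ n, ∀ x ∈ F n, q x ≤ 1 / r n := fun n => hΦ1 n _ (G n).2
  have hGF : ∀ n, ∀ x ∈ (G n).1, ∃ m, x ∈ F m := by
    intro n
    induction n with
    | zero => intro x hx; exact absurd hx (Finset.notMem_empty x)
    | succ n ih =>
      intro x hx
      rcases Finset.mem_union.1 (show x ∈ (G n).1 ∪ Φ n (G n).1 from hx) with h | h
      · exact ih x h
      · exact ⟨n, h⟩
  let ι := Σ n, F n
  let _ : TopologicalSpace ι := ⊥
  have _ : DiscreteTopology ι := ⟨rfl⟩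
  have hqι : ∀ i : ι, q i.2 ≤ 1 / r i.1 := fun i => hFq i.1 _ i.2.2
  have htend : Tendsto (fun i : ι => 1 / r i.1) cofinite (𝓝 0) := by
    have h1 : Tendsto (fun n : ℕ => 1 / r n) atTop (𝓝 0) := by
      refine tendsto_const_nhds.div_atTop ?_
      exact (tendsto_atTop_add_const_right _ _ tendsto_natCast_atTop_atTop).const_mul_atTop hδ
    refine h1.comp ?_
    rw [← Nat.cofinite_eq_atTop]
    refine Tendsto.cofinite_of_finite_preimage_singleton fun n => ?_
    refine (Set.finite_range fun x : F n => (⟨n, x⟩ : ι)).subset ?_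
    rintro ⟨m, x⟩ hm
    obtain rfl : m = n := hm
    exact ⟨x, rfl⟩
  -- Pairing `f` with the countably many selected vectors gives a null sequence, because `q` is at
  -- most `1 / r n` on the finite set `F n`.
  have hTex : ∀ f : E, (∃ r, f ∈ dualBall q r) → ∃ y : ZeroAtInftyContinuousMap ι ℝ,
      ∀ i : ι, y i = ⟪(i.2 : E), f⟫_ℝ := by
    rintro f ⟨s, hf⟩
    refine ⟨⟨⟨fun i => ⟪(i.2 : E), f⟫_ℝ, continuous_of_discreteTopology⟩, ?_⟩, fun i => rfl⟩
    rw [cocompact_eq_cofinite]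
    refine squeeze_zero_norm (a := fun i : ι => |s| * (1 / r i.1)) (fun i => ?_)
      (by simpa using htend.const_mul |s|)
    calc ‖⟪(i.2 : E), f⟫_ℝ‖ ≤ s * q i.2 := hf _
      _ ≤ |s| * (1 / r i.1) :=
        mul_le_mul (le_abs_self s) (hqι i) (apply_nonneg q _) (abs_nonneg s)
  let T : Set (ZeroAtInftyContinuousMap ι ℝ) :=
    {y | ∃ f ∈ C, (∃ r, f ∈ dualBall q r) ∧ ∀ i : ι, y i = ⟪(i.2 : E), f⟫_ℝ}
  have hTconv : Convex ℝ T := by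
    rintro y ⟨f, hf, ⟨s, hs⟩, hy⟩ y' ⟨f', hf', ⟨s', hs'⟩, hy'⟩ a b ha hb hab
    refine ⟨a • f + b • f', hC hf hf' ha hb hab, ⟨max s s', convex_dualBall q _
      (dualBall_mono q (le_max_left _ _) hs) (dualBall_mono q (le_max_right _ _) hs') ha hb hab⟩,
      fun i => ?_⟩
    rw [inner_add_right, inner_smul_right, inner_smul_right, ← hy, ← hy']
    simp
  -- Every `f ∈ C` in some dual ball has a selected vector pairing with it above `1` in modulus, so
  -- its image in `c₀` has norm greater than `1`. Hahn–Banach in `c₀` produces a functional, that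
  -- is, an absolutely summable series.
  have hdisj : Disjoint (Metric.ball (0 : ZeroAtInftyContinuousMap ι ℝ) 1) T := by
    rw [Set.disjoint_left]
    rintro y hy ⟨f, hf, ⟨s, hs⟩, hyf⟩
    obtain ⟨n, hn⟩ : ∃ n, s ≤ r n := by
      obtain ⟨n, hn⟩ := exists_nat_ge (s / δ)
      refine ⟨n, ?_⟩
      rw [div_le_iff₀ hδ] at hn
      simp only [r]
      nlinarith
    obtain ⟨x, hx, hx1⟩ := (G n).2 f ⟨hf, dualBall_mono q hn hs⟩
    obtain ⟨m, hm⟩ := hGF n x hx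
    have h1 : y ⟨m, ⟨x, hm⟩⟩ = ⟪x, f⟫_ℝ := hyf _
    have h2 : |y ⟨m, ⟨x, hm⟩⟩| ≤ ‖y‖ := by
      rw [← ZeroAtInftyContinuousMap.norm_toBCF_eq_norm]
      exact y.toBCF.norm_coe_le_norm _
    rw [mem_ball_zero_iff] at hy
    rw [h1] at h2
    linarith
  obtain ⟨l, u, hl1, hl2⟩ := geometric_hahn_banach_open (convex_ball _ _) Metric.isOpen_ball
    hTconv hdisj
  have hu : 0 < u := by simpa using hl1 0 (Metric.mem_ball_self one_pos)
  obtain ⟨a, ha, hal⟩ := exists_summable_of_strongDual_c0 l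
  refine ⟨F, fun i => u⁻¹ * a i, 1 / δ, ?_, fun i => ?_, ?_⟩
  · simpa [abs_mul] using ha.mul_left |u⁻¹|
  · refine (hqι i).trans (one_div_le_one_div_of_le hδ ?_)
    simp only [r]
    have : (0 : ℝ) ≤ i.1 := Nat.cast_nonneg _
    nlinarith
  · rintro s f ⟨hf, hs⟩
    obtain ⟨y, hy⟩ := hTex f ⟨s, hs⟩
    refine ⟨u⁻¹ * l y, ?_, ?_⟩
    · have := hl2 y ⟨f, hf, ⟨s, hs⟩, hy⟩
      rw [← div_eq_inv_mul, one_le_div hu]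
      exact this
    · have := (hal y).mul_left u⁻¹
      simpa only [hy, mul_assoc] using this

end KreinSmulian

end RiskProc


namespace RiskProc

/-! ### Parthasarathy's extension theorem -/

section Extension

open ProbabilityTheory Preorder

/-- Consistent finite-dimensional laws of a sequence of random variables extend to a law on the
space of trajectories. -/
theorem exists_law_of_consistent {Ω : Type*} {m : MeasurableSpace Ω} (e : ℕ → Ω → ℝ)
    (he : ∀ n, Measurable (e n)) (Q : ℕ → Measure Ω) [∀ n, IsProbabilityMeasure (Q n)]
    (hQ : ∀ n, (Q (n + 1)).map (fun ω (i : Finset.Iic n) => e i ω) =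
      (Q n).map (fun ω (i : Finset.Iic n) => e i ω)) :
    ∃ ν : Measure (ℕ → ℝ), IsProbabilityMeasure ν ∧
      ∀ n, ν.map (frestrictLe n) = (Q n).map (fun ω (i : Finset.Iic n) => e i ω) := by
  let E : (n : ℕ) → Ω → ((i : Finset.Iic n) → ℝ) := fun n ω i => e i ω
  have hE : ∀ n, Measurable (E n) := fun n => measurable_pi_lambda _ fun i => he i
  -- The kernels are regular conditional laws of the next variable given the past; the
  -- Ionescu-Tulcea construction strings them together.
  let κ : (n : ℕ) → Kernel ((i : Finset.Iic n) → ℝ) ℝ := fun n =>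
    condDistrib (e (n + 1)) (E n) (Q (n + 1))
  have hprob : ∀ n, IsProbabilityMeasure ((Q n).map (E n)) := fun n =>
    Measure.isProbabilityMeasure_map (hE n).aemeasurable
  have hp0 := hprob 0
  refine ⟨Kernel.traj (X := fun _ => ℝ) κ 0 ∘ₘ ((Q 0).map (E 0)), inferInstance, fun n => ?_⟩
  rw [Measure.map_comp _ _ (measurable_frestrictLe n), Kernel.traj_map_frestrictLe]
  induction n with
  | zero =>
    rw [Kernel.partialTraj_self, Measure.id_comp]
  | succ n ih =>
    have := hprob n
    have := hprob (n + 1)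
    rw [Kernel.partialTraj_succ_of_le (Nat.zero_le n), ← Measure.map_comp _ _ (measurable_IicProdIoc (X := fun _ => ℝ)),
      ← Measure.comp_assoc, ih, ← hQ n]
    -- Consistency allows the law of the past to be taken under `Q (n + 1)`. Attaching the
    -- conditional law of the next variable then restores the joint law.
    change ((Kernel.id ×ₖ (κ n).map (MeasurableEquiv.piSingleton (X := fun _ => ℝ) n)) ∘ₘ
      ((Q (n + 1)).map (E n))).map _ = (Q (n + 1)).map (E (n + 1))
    have : IsProbabilityMeasure ((Q (n + 1)).map (E n)) :=
      Measure.isProbabilityMeasure_map (hE n).aemeasurable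
    rw [← Measure.compProd_eq_comp_prod, Measure.compProd_map (by fun_prop),
      compProd_map_condDistrib (he _).aemeasurable,
      Measure.map_map (measurable_IicProdIoc (X := fun _ => ℝ)) (by fun_prop),
      Measure.map_map ((measurable_IicProdIoc (X := fun _ => ℝ)).comp (by fun_prop)) (by fun_prop)]
    congr 1
    ext ω i
    simp only [Function.comp_apply, Prod.map_apply, id_eq, E]
    rcases i with ⟨i, hi⟩
    have hi' := Finset.mem_Iic.1 hi
    unfold IicProdIoc
    simp only
    split_ifs with h
    · rfl
    · obtain rfl : i = n + 1 := by omega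
      rfl

/-- A `σ`-field which is `σ`-isomorphic to the Borel `σ`-field of a Polish space is generated by a
real random variable with measurable range; the atoms are its level sets. -/
theorem exists_generating_real {Ω : Type*} {m : MeasurableSpace Ω} {Y : Type*} [TopologicalSpace Y]
    [PolishSpace Y] (h : SigmaIsomorphic m (borel Y)) :
    ∃ e : Ω → ℝ, MeasurableSpace.comap e (borel ℝ) = m ∧ MeasurableSet (Set.range e) := by
  borelize Y
  obtain ⟨Φ, hc, hU⟩ := h
  -- The inverse isomorphism of σ-fields; it is shown to be the preimage map of a point map `f : Ω →
  -- Y`.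
  let Ψ : {B : Set Y // MeasurableSet B} → Set Ω := fun B => (Φ.symm B).1
  have hΨm : ∀ B, MeasurableSet[m] (Ψ B) := fun B => (Φ.symm B).2
  have hΨsurj : ∀ A, MeasurableSet[m] A → ∃ B, Ψ B = A := fun A hA =>
    ⟨Φ ⟨A, hA⟩, by simp [Ψ]⟩
  have hΨc : ∀ B : {B : Set Y // MeasurableSet B}, Ψ ⟨B.1ᶜ, B.2.compl⟩ = (Ψ B)ᶜ := by
    intro B
    have h1 := hc (Φ.symm B)
    have h2 : Φ ⟨((Φ.symm B).1)ᶜ, (Φ.symm B).2.compl⟩ = ⟨B.1ᶜ, B.2.compl⟩ := by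
      apply Subtype.ext
      rw [h1]; simp
    simp only [Ψ]
    rw [← h2, Equiv.symm_apply_apply]
  have hΨU : ∀ B : ℕ → {B : Set Y // MeasurableSet B},
      Ψ ⟨⋃ n, (B n).1, MeasurableSet.iUnion fun n => (B n).2⟩ = ⋃ n, Ψ (B n) := by
    intro B
    have h1 := hU fun n => Φ.symm (B n)
    have h2 : Φ ⟨⋃ n, (Φ.symm (B n)).1, MeasurableSet.iUnion fun n => (Φ.symm (B n)).2⟩ =
        ⟨⋃ n, (B n).1, MeasurableSet.iUnion fun n => (B n).2⟩ := by
      apply Subtype.ext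
      rw [h1]; simp
    simp only [Ψ]
    rw [← h2, Equiv.symm_apply_apply]
  have hΨinj : Function.Injective Ψ := fun B B' h => Φ.symm.injective (Subtype.ext h)
  have hΨmono : ∀ B B' : {B : Set Y // MeasurableSet B}, B.1 ⊆ B'.1 → Ψ B ⊆ Ψ B' := by
    intro B B' hBB
    -- The sequence `B, B', B', …` has union `B'`, so monotonicity follows from countable unions.
    have h1 := hΨU fun n => if n = 0 then B else B'
    have h2 : (⟨⋃ n : ℕ, (if n = 0 then B else B').1, MeasurableSet.iUnion fun n =>
        (if n = 0 then B else B').2⟩ : {B : Set Y // MeasurableSet B}) = B' := by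
      apply Subtype.ext
      apply Set.Subset.antisymm
      · refine Set.iUnion_subset fun n => ?_
        split_ifs
        exacts [hBB, subset_rfl]
      · exact Set.subset_iUnion_of_subset 1 (by simp)
    rw [h2] at h1
    rw [h1]
    exact Set.subset_iUnion_of_subset 0 (by simp)
  have hΨe : Ψ ⟨∅, MeasurableSet.empty⟩ = ∅ := by
    obtain ⟨B, hB⟩ := hΨsurj ∅ (@MeasurableSet.empty _ m)
    exact Set.subset_empty_iff.1 (hB ▸ hΨmono ⟨∅, MeasurableSet.empty⟩ B (Set.empty_subset _))
  have hΨI : ∀ B B' : {B : Set Y // MeasurableSet B}, Ψ B ∩ Ψ B' = Ψ ⟨B.1 ∩ B'.1, B.2.inter B'.2⟩ := by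
    intro B B'
    apply Set.Subset.antisymm
    · obtain ⟨B'', hB''⟩ := hΨsurj _ ((hΨm B).inter (hΨm B'))
      -- `Ψ` also reflects inclusions: a point of `C` outside `D` would have a singleton with empty
      -- image, against injectivity.
      have key : ∀ C D : {B : Set Y // MeasurableSet B}, Ψ C ⊆ Ψ D → C.1 ⊆ D.1 := by
        intro C D hCD y hy
        by_contra hyD
        have h1 : Ψ ⟨{y}, measurableSet_singleton y⟩ ⊆ Ψ C := hΨmono _ _ (by simpa using hy)
        have h2 : Ψ ⟨{y}, measurableSet_singleton y⟩ ⊆ (Ψ D)ᶜ := by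
          rw [← hΨc]; exact hΨmono _ _ (by simpa using hyD)
        have h3 : Ψ ⟨{y}, measurableSet_singleton y⟩ = ∅ :=
          Set.subset_empty_iff.1 fun ω hω => (h2 hω) (hCD (h1 hω))
        rw [← hΨe] at h3
        have h4 := congrArg Subtype.val (hΨinj h3)
        exact (Set.singleton_ne_empty y) h4
      rw [← hB'']
      exact hΨmono _ _ (Set.subset_inter (key _ _ (hB'' ▸ Set.inter_subset_left))
        (key _ _ (hB'' ▸ Set.inter_subset_right)))
    · exact Set.subset_inter (hΨmono _ _ Set.inter_subset_left) (hΨmono _ _ Set.inter_subset_right)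
  let b : ℕ → {B : Set Y // MeasurableSet B} := fun n =>
    ⟨MeasurableSpace.natGeneratingSequence Y n, MeasurableSpace.measurableSet_natGeneratingSequence n⟩
  -- every point lies in an atom
  have hatom : ∀ ω, ∃ y, ω ∈ Ψ ⟨{y}, measurableSet_singleton y⟩ := by
    classical
    intro ω
    -- Of each generator and its complement, `c n` is the one whose image omits `ω`. The image of
    -- the union omits `ω`, so the union is not all of `Y`. The generators separate points, so at
    -- most one point `y` is left out, and the image of `{y}` must contain `ω`.
    let c : ℕ → {B : Set Y // MeasurableSet B} := fun n =>
      if ω ∈ Ψ (b n) then ⟨(b n).1ᶜ, (b n).2.compl⟩ else b n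
    have hcn : ∀ n, ω ∉ Ψ (c n) := fun n => by
      by_cases h : ω ∈ Ψ (b n)
      · simp only [c, h, if_true]; rw [hΨc]; exact fun h' => h' h
      · simp [c, h]
    have h1 : ω ∉ Ψ ⟨⋃ n, (c n).1, MeasurableSet.iUnion fun n => (c n).2⟩ := by
      rw [hΨU]; simpa using hcn
    have h2 : ∃ y, y ∉ ⋃ n, (c n).1 := by
      by_contra! h
      have h3 : (⟨⋃ n, (c n).1, MeasurableSet.iUnion fun n => (c n).2⟩ :
          {B : Set Y // MeasurableSet B}) = ⟨(∅ : Set Y)ᶜ, MeasurableSet.empty.compl⟩ :=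
        Subtype.ext ((Set.eq_univ_of_forall h).trans Set.compl_empty.symm)
      rw [h3, hΨc ⟨∅, MeasurableSet.empty⟩, hΨe] at h1
      simp at h1
    obtain ⟨y, hy⟩ := h2
    refine ⟨y, ?_⟩
    by_contra hyω
    refine h1 ?_
    have h4 : ({y} : Set Y)ᶜ ⊆ ⋃ n, (c n).1 := by
      intro z hz
      by_contra hzc
      refine hz ?_
      have : MeasurableSpace.mapNatBool Y z = MeasurableSpace.mapNatBool Y y := by
        funext n
        simp only [Set.mem_iUnion, not_exists] at hy hzc
        have hyn := hy n
        have hzn := hzc n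
        by_cases h : ω ∈ Ψ (b n)
        · simp only [c, h, if_true, Set.mem_compl_iff, not_not] at hyn hzn
          simp only [MeasurableSpace.mapNatBool]
          simp [show y ∈ MeasurableSpace.natGeneratingSequence Y n from hyn,
            show z ∈ MeasurableSpace.natGeneratingSequence Y n from hzn]
        · simp only [c, h, if_false] at hyn hzn
          simp only [MeasurableSpace.mapNatBool]
          simp [show y ∉ MeasurableSpace.natGeneratingSequence Y n from hyn,
            show z ∉ MeasurableSpace.natGeneratingSequence Y n from hzn]
      exact MeasurableSpace.injective_mapNatBool Y this
    refine hΨmono ⟨{y}ᶜ, (measurableSet_singleton y).compl⟩ _ h4 ?_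
    rw [hΨc ⟨{y}, measurableSet_singleton y⟩]
    exact hyω
  choose f hf using hatom
  have hfΨ : ∀ B : {B : Set Y // MeasurableSet B}, f ⁻¹' B.1 = Ψ B := by
    intro B
    ext ω
    constructor
    · intro h
      exact hΨmono ⟨{f ω}, measurableSet_singleton _⟩ B (by simpa using h) (hf ω)
    · intro h
      by_contra hB
      have h1 : ω ∈ Ψ B ∩ Ψ ⟨{f ω}, measurableSet_singleton _⟩ := ⟨h, hf ω⟩
      rw [hΨI] at h1
      have h2 : (⟨B.1 ∩ {f ω}, B.2.inter (measurableSet_singleton _)⟩ :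
          {B : Set Y // MeasurableSet B}) = ⟨∅, MeasurableSet.empty⟩ :=
        Subtype.ext (Set.inter_singleton_eq_empty.2 hB)
      rw [h2, hΨe] at h1
      exact h1
  have hfsurj : Function.Surjective f := by
    intro y
    have h1 : (Ψ ⟨{y}, measurableSet_singleton y⟩).Nonempty := by
      rw [Set.nonempty_iff_ne_empty, ← hΨe]
      exact fun h => Set.singleton_ne_empty y (congrArg Subtype.val (hΨinj h))
    obtain ⟨ω, hω⟩ := h1
    rw [← hfΨ] at hω
    exact ⟨ω, hω⟩
  -- A Polish space embeds measurably in `ℝ` with measurable range, and surjectivity of `f` makes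
  -- this the range of the composition.
  have hemb := measurableEmbedding_embeddingReal Y
  refine ⟨embeddingReal Y ∘ f, ?_, ?_⟩
  · rw [← MeasurableSpace.comap_comp]
    have h1 : MeasurableSpace.comap (embeddingReal Y) (borel ℝ) = borel Y := by
      have := hemb.comap_eq
      rw [← BorelSpace.measurable_eq (α := ℝ), this]
    rw [h1]
    ext A
    constructor
    · rintro ⟨B, hB, rfl⟩
      have hB' : MeasurableSet B := by rw [BorelSpace.measurable_eq (α := Y)]; exact hB
      rw [show f ⁻¹' B = Ψ ⟨B, hB'⟩ from hfΨ ⟨B, hB'⟩]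
      exact hΨm _
    · intro hA
      obtain ⟨B, rfl⟩ := hΨsurj A hA
      refine ⟨B.1, ?_, hfΨ B⟩
      rw [← BorelSpace.measurable_eq (α := Y)]; exact B.2
  · rw [Set.range_comp, hfsurj.range_eq, Set.image_univ]
    exact hemb.measurableSet_range

/-- Parthasarathy's extension theorem: consistent probability measures on the `σ`-fields of a
standard system extend to the generated `σ`-field. -/
theorem exists_extension {Ω : Type*} {m : MeasurableSpace Ω} (F : ℕ → MeasurableSpace Ω)
    (hmono : Monotone F) (hgen : m = ⨆ n, F n)
    (hstd : ∀ n, ∃ (Y : Type) (_ : TopologicalSpace Y) (_ : PolishSpace Y),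
      SigmaIsomorphic (F n) (borel Y))
    (hatoms : ∀ A : ℕ → Set Ω, Antitone A → (∀ n, IsAtomOf (F n) (A n)) → (⋂ n, A n).Nonempty)
    (Q : ℕ → Measure Ω) [∀ n, IsProbabilityMeasure (Q n)]
    (hQ : ∀ n A, MeasurableSet[F n] A → Q (n + 1) A = Q n A) :
    ∃ R : Measure Ω, IsProbabilityMeasure R ∧ ∀ n A, MeasurableSet[F n] A → R A = Q n A := by
  have hex : ∀ n, ∃ e : Ω → ℝ, MeasurableSpace.comap e (borel ℝ) = F n ∧
      MeasurableSet (Set.range e) := fun n => by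
    obtain ⟨Y, _, _, h⟩ := hstd n
    exact exists_generating_real h
  choose e he hrange using hex
  replace he : ∀ n, MeasurableSpace.comap (e n) Real.measurableSpace = F n := he
  have hFm : ∀ n, F n ≤ m := fun n => hgen ▸ le_iSup F n
  have heF : ∀ n, Measurable[F n] (e n) := fun n => by
    rw [← he n]; exact comap_measurable _
  have hem : ∀ n, Measurable (e n) := fun n => (heF n).mono (hFm n) le_rfl
  -- Since `F n ≤ F (n + 1)`, each generating variable is a measurable function of the next one.
  have hfac : ∀ n, ∃ h : ℝ → ℝ, Measurable h ∧ e n = h ∘ e (n + 1) := fun n => by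
    have h1 : Measurable[MeasurableSpace.comap (e (n + 1)) inferInstance] (e n) := by
      rw [he (n + 1)]; exact (heF n).mono (hmono n.le_succ) le_rfl
    exact h1.exists_eq_measurable_comp
  choose h hhm hhe using hfac
  obtain ⟨ν, hν, hνQ⟩ := exists_law_of_consistent e hem Q fun n => by
    have hE : Measurable[F n] fun ω (i : Finset.Iic n) => e i ω :=
      @measurable_pi_lambda _ _ _ (F n) _ _ fun i =>
        (heF i).mono (hmono (Finset.mem_Iic.1 i.2)) le_rfl
    have hE' := hE.mono (hFm n) le_rfl
    ext S hS
    rw [Measure.map_apply hE' hS, Measure.map_apply hE' hS]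
    exact hQ n _ (hE hS)
  have hνmap : ∀ n (S : Set (Finset.Iic n → ℝ)), MeasurableSet S →
      ν (frestrictLe n ⁻¹' S) = Q n ((fun ω (i : Finset.Iic n) => e i ω) ⁻¹' S) := fun n S hS => by
    rw [← Measure.map_apply (measurable_frestrictLe n) hS, hνQ,
      Measure.map_apply (f := fun ω (i : Finset.Iic n) => e i ω)
        (measurable_pi_lambda _ fun i => hem i) hS]
  -- The trajectories that look like those of a sample point. Each condition involves finitely many
  -- coordinates and holds identically on `Ω`, so `L` has full measure under `ν`.
  let L : Set (ℕ → ℝ) := ⋂ n, {y | y n ∈ Set.range (e n) ∧ y n = h n (y (n + 1))}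
  have hLm : ∀ n, MeasurableSet {y : ℕ → ℝ | y n ∈ Set.range (e n) ∧ y n = h n (y (n + 1))} :=
    fun n => by
      have h1 : MeasurableSet {y : ℕ → ℝ | y n ∈ Set.range (e n)} := measurable_pi_apply n (hrange n)
      have h2 : Measurable fun y : ℕ → ℝ => h n (y (n + 1)) :=
        (hhm n).comp (measurable_pi_apply (n + 1))
      exact h1.inter (measurableSet_eq_fun (measurable_pi_apply n) h2)
  have hLn : ∀ n, ∀ᵐ y ∂ν, y n ∈ Set.range (e n) ∧ y n = h n (y (n + 1)) := by
    intro n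
    let S : Set (Finset.Iic (n + 1) → ℝ) :=
      {y | y ⟨n, by simp⟩ ∈ Set.range (e n) ∧ y ⟨n, by simp⟩ = h n (y ⟨n + 1, by simp⟩)}
    have hS : MeasurableSet S := by
      have h1 : MeasurableSet {y : Finset.Iic (n + 1) → ℝ | y ⟨n, by simp⟩ ∈ Set.range (e n)} :=
        measurable_pi_apply _ (hrange n)
      have h2 : Measurable fun y : Finset.Iic (n + 1) → ℝ => h n (y ⟨n + 1, by simp⟩) :=
        (hhm n).comp (measurable_pi_apply _)
      exact h1.inter (measurableSet_eq_fun (measurable_pi_apply _) h2)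
    have h1 := hνmap (n + 1) Sᶜ hS.compl
    have h2 : ((fun ω (i : Finset.Iic (n + 1)) => e i ω) ⁻¹' Sᶜ) = ∅ := by
      rw [Set.preimage_compl, Set.compl_empty_iff, Set.eq_univ_iff_forall]
      intro ω
      exact ⟨⟨ω, rfl⟩, congrFun (hhe n) ω⟩
    rw [h2, measure_empty] at h1
    exact measure_mono_null (fun y hy => hy) h1
  have hL : ∀ᵐ y ∂ν, y ∈ L := by
    filter_upwards [ae_all_iff.2 hLn] with y hy using Set.mem_iInter.2 hy
  have hLmeas : MeasurableSet L := MeasurableSet.iInter hLm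
  have hLsec : ∀ y ∈ L, ∃ ω, ∀ n, e n ω = y n := by
    intro y hy
    have hy' := fun n => Set.mem_iInter.1 hy n
    -- The level sets of the `e n` along a trajectory in `L` are decreasing atoms; the assumption on
    -- atoms provides a sample point realizing the trajectory.
    obtain ⟨ω, hω⟩ := hatoms (fun n => e n ⁻¹' {y n})
      (antitone_nat_of_succ_le fun n ω hω => by
        have h1 : e (n + 1) ω = y (n + 1) := hω
        show e n ω = y n
        rw [(hy' n).2, ← h1]
        exact congrFun (hhe n) ω)
      (fun n => ⟨heF n (measurableSet_singleton _), by
        exact (hy' n).1, fun B hB hBs => by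
          rw [← he n] at hB
          obtain ⟨S, -, rfl⟩ := hB
          by_cases h1 : y n ∈ S
          · right
            refine Set.Subset.antisymm hBs fun ω hω => ?_
            show e n ω ∈ S
            rw [show e n ω = y n from hω]; exact h1
          · left
            rw [Set.eq_empty_iff_forall_notMem]
            intro ω hω
            exact h1 (show y n ∈ S from (show e n ω = y n from hBs hω) ▸ hω)⟩)
    exact ⟨ω, fun n => Set.mem_iInter.1 hω n⟩
  obtain ⟨ω₀⟩ : Nonempty Ω := (IsProbabilityMeasure.neZero (Q 0)).1 |> fun hne => by
    by_contra hemp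
    rw [not_nonempty_iff] at hemp
    exact hne (Measure.eq_zero_of_isEmpty _)
  classical
  let g : (ℕ → ℝ) → Ω := fun y => if hy : y ∈ L then (hLsec y hy).choose else ω₀
  have hg : ∀ y ∈ L, ∀ n, e n (g y) = y n := fun y hy n => by
    simp only [g, dif_pos hy]
    exact (hLsec y hy).choose_spec n
  -- A choice of realizing points is measurable since the σ-field is generated by the `e n`, and `e
  -- n ∘ g` is a coordinate on `L`. The extension is the image of `ν` under `g`.
  have hgm : Measurable g := by
    rw [measurable_iff_comap_le, hgen, MeasurableSpace.comap_iSup]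
    refine iSup_le fun n => ?_
    rw [← measurable_iff_comap_le, ← he n, measurable_comap_iff]
    have : e n ∘ g = L.piecewise (fun y => y n) (fun _ => e n ω₀) := by
      funext y
      by_cases hy : y ∈ L
      · simp [hy, hg]
      · simp [hy, g]
    rw [this]
    exact Measurable.piecewise hLmeas (measurable_pi_apply n) measurable_const
  refine ⟨ν.map g, Measure.isProbabilityMeasure_map hgm.aemeasurable, fun n A hA => ?_⟩
  rw [Measure.map_apply hgm (hFm n _ hA)]
  have hA' := hA
  rw [← he n] at hA'
  obtain ⟨S, hS, rfl⟩ := hA'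
  replace hS : MeasurableSet S := hS
  have hev : Measurable fun y : Finset.Iic n → ℝ => y ⟨n, by simp⟩ := measurable_pi_apply _
  have h1 := hνmap n ((fun y => y ⟨n, by simp⟩) ⁻¹' S) (hev hS)
  have h2 : ν (g ⁻¹' (e n ⁻¹' S)) = ν (frestrictLe n ⁻¹' ((fun y => y ⟨n, by simp⟩) ⁻¹' S)) := by
    refine measure_congr ?_
    filter_upwards [hL] with y hy
    show (e n (g y) ∈ S) = (y n ∈ S)
    rw [hg y hy]
  rw [h2, h1]
  rfl

end Extension

end RiskProc


namespace RiskProc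

/-! ### Essential suprema, the optional σ-field and integration against `Q ⊗ γ` -/

section Basics

variable {Ω : Type*} {mΩ : MeasurableSpace Ω} {H : Horizon} {ℱ : Filtration H.Time mΩ}

instance : Countable ℕ∞ := inferInstanceAs (Countable (Option ℕ))

instance : Countable H.Time := inferInstance

theorem Horizon.finite_Iio {t : H.Time} (ht : t.1 ≠ ⊤) : (Set.Iio t).Finite := by
  obtain ⟨n, hn⟩ := ENat.ne_top_iff_exists.1 ht
  refine Set.Finite.of_finite_image (f := fun s : H.Time => s.1) ?_ Subtype.val_injective.injOn
  refine ((Set.finite_Iio n).image (fun k : ℕ => (k : ℕ∞))).subset ?_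
  rintro _ ⟨s, hs, rfl⟩
  have hs' : s.1 < n := hn ▸ hs
  obtain ⟨k, hk⟩ := ENat.ne_top_iff_exists.1 (ne_top_of_lt hs')
  refine ⟨k, ?_, hk⟩
  rw [← hk] at hs'
  exact_mod_cast hs'

/-! ### Essential suprema of families -/

/-- Replacing `h` by `⊤` off `B` gives a majorant on all of `Ω`. This localizes the minimality of
the essential supremum, as needed on events where mass is left. -/
theorem familyEssSup_le_on (μ : Measure Ω) [IsFiniteMeasure μ] {m : MeasurableSpace Ω}
    (hm : m ≤ mΩ) {S : Set (Ω → EReal)} {B : Set Ω} (hB : MeasurableSet[m] B) {h : Ω → EReal}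
    (hh : Measurable[m] h) (hS : ∀ f ∈ S, ∀ᵐ ω ∂μ, ω ∈ B → f ω ≤ h ω) :
    ∀ᵐ ω ∂μ, ω ∈ B → familyEssSup μ m S ω ≤ h ω := by
  classical
  have h1 := (familyEssSup_spec μ hm S).least (B.piecewise h fun _ => ⊤)
    (Measurable.piecewise hB hh measurable_const) fun f hf => by
      filter_upwards [hS f hf] with ω hω
      by_cases hωB : ω ∈ B
      · simpa [hωB] using hω hωB
      · simp [hωB]
  filter_upwards [h1] with ω hω hωB
  simpa [hωB] using hω

theorem le_familyEssSup (μ : Measure Ω) [IsFiniteMeasure μ] {m : MeasurableSpace Ω}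
    (hm : m ≤ mΩ) {S : Set (Ω → EReal)} {f : Ω → EReal} (hf : f ∈ S) :
    f ≤ᵐ[μ] familyEssSup μ m S := (familyEssSup_spec μ hm S).upper f hf

theorem measurable_familyEssSup (μ : Measure Ω) [IsFiniteMeasure μ] {m : MeasurableSpace Ω}
    (hm : m ≤ mΩ) (S : Set (Ω → EReal)) : Measurable[m] (familyEssSup μ m S) :=
  (familyEssSup_spec μ hm S).measurable

/-- Essential suprema over families whose members agree almost surely agree almost surely. -/
theorem familyEssSup_congr (μ : Measure Ω) [IsFiniteMeasure μ] {m : MeasurableSpace Ω}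
    (hm : m ≤ mΩ) {S S' : Set (Ω → EReal)} (h1 : ∀ f ∈ S, ∃ g ∈ S', f =ᵐ[μ] g)
    (h2 : ∀ g ∈ S', ∃ f ∈ S, f =ᵐ[μ] g) :
    familyEssSup μ m S =ᵐ[μ] familyEssSup μ m S' := by
  refine EventuallyLE.antisymm ?_ ?_
  · refine (familyEssSup_spec μ hm S).least _ (measurable_familyEssSup μ hm S') fun f hf => ?_
    obtain ⟨g, hg, hfg⟩ := h1 f hf
    exact hfg.le.trans (le_familyEssSup μ hm hg)
  · refine (familyEssSup_spec μ hm S').least _ (measurable_familyEssSup μ hm S) fun g hg => ?_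
    obtain ⟨f, hf, hfg⟩ := h2 g hg
    exact hfg.symm.le.trans (le_familyEssSup μ hm hf)

/-! ### The optional `σ`-field -/

theorem measurable_atTime_adapted (s : H.Time) : Measurable[ℱ s] (atTime ℱ s) := by
  refine @measurable_generateFrom _ _ (ℱ s) _ _ ?_
  rintro B ⟨r, A, hA, rfl⟩
  by_cases h : s = r
  · have e : atTime ℱ s ⁻¹' rect ℱ A {r} = A := by
      ext ω; simp [atTime, rect, h]
    rw [e, h]; exact hA
  · have e : atTime ℱ s ⁻¹' rect ℱ A {r} = ∅ := by
      ext ω; simp [atTime, rect, h]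
    rw [e]; exact @MeasurableSet.empty _ (ℱ s)

theorem measurableSet_rect_singleton {s : H.Time} {A : Set Ω} (hA : MeasurableSet[ℱ s] A) :
    MeasurableSet (rect ℱ A {s}) :=
  MeasurableSpace.measurableSet_generateFrom ⟨s, A, hA, rfl⟩

/-- The time set is countable, so every set is the countable union of its sections placed at single
times; optional functions are exactly the adapted processes. -/
theorem measurableSet_optSpace_iff {B : Set (OptSpace ℱ)} :
    MeasurableSet B ↔ ∀ s, MeasurableSet[ℱ s] {ω | (⟨ω, s⟩ : OptSpace ℱ) ∈ B} := by
  refine ⟨fun hB s => measurable_atTime_adapted s hB, fun h => ?_⟩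
  have : B = ⋃ s, rect ℱ {ω | (⟨ω, s⟩ : OptSpace ℱ) ∈ B} {s} := by
    ext ⟨ω, s⟩
    simp only [rect, Set.mem_iUnion, Set.mem_ofPred_eq, Set.mem_singleton_iff]
    constructor
    · intro hp; exact ⟨s, hp, rfl⟩
    · rintro ⟨r, hr, rfl⟩; exact hr
  rw [this]
  exact MeasurableSet.iUnion fun s => measurableSet_rect_singleton (h s)

theorem measurable_optSpace_iff {β : Type*} [MeasurableSpace β] {F : OptSpace ℱ → β} :
    Measurable F ↔ ∀ s, Measurable[ℱ s] fun ω => F ⟨ω, s⟩ := by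
  refine ⟨fun hF s => hF.comp (measurable_atTime_adapted s), fun h => ?_⟩
  intro B hB
  rw [measurableSet_optSpace_iff]
  exact fun s => h s hB

theorem measurableSet_rect_Ici {t : H.Time} {A : Set Ω} (hA : MeasurableSet[ℱ t] A) :
    MeasurableSet (rect ℱ A (Set.Ici t)) := by
  rw [measurableSet_optSpace_iff]
  intro s
  by_cases h : t ≤ s
  · convert ℱ.mono h _ hA using 1
    ext ω; simp [rect, h]
  · convert @MeasurableSet.empty _ (ℱ s) using 1
    ext ω; simp [rect, h]

theorem lintegral_optProd {Q : Measure Ω} {γ : H.Time → Ω → ℝ}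
    (hγ : ∀ s, Measurable[ℱ s] (γ s)) {F : OptSpace ℱ → ℝ≥0∞} (hF : Measurable F) :
    ∫⁻ p, F p ∂optProd ℱ Q γ = ∑' s, ∫⁻ ω, ENNReal.ofReal (γ s ω) * F ⟨ω, s⟩ ∂Q := by
  rw [optProd, lintegral_sum_measure]
  congr 1
  funext s
  have hγs : Measurable fun ω => ENNReal.ofReal (γ s ω) := ((hγ s).mono (ℱ.le s) le_rfl).ennreal_ofReal
  rw [lintegral_map hF (measurable_atTime ℱ s)]
  exact lintegral_withDensity_eq_lintegral_mul _ hγs (hF.comp (measurable_atTime ℱ s))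

theorem optProd_apply {Q : Measure Ω} {γ : H.Time → Ω → ℝ}
    (hγ : ∀ s, Measurable[ℱ s] (γ s)) {B : Set (OptSpace ℱ)} (hB : MeasurableSet B) :
    optProd ℱ Q γ B = ∑' s, ∫⁻ ω in {ω | (⟨ω, s⟩ : OptSpace ℱ) ∈ B}, ENNReal.ofReal (γ s ω) ∂Q := by
  rw [← lintegral_indicator_one hB, lintegral_optProd hγ (measurable_one.indicator hB)]
  congr 1
  funext s
  rw [← lintegral_indicator (ℱ.le s _ (measurableSet_optSpace_iff.1 hB s))]
  refine lintegral_congr fun ω => ?_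
  by_cases h : (⟨ω, s⟩ : OptSpace ℱ) ∈ B
  · simp [Set.indicator, h]
  · simp [Set.indicator, h]

theorem optProd_rect_singleton {Q : Measure Ω} {γ : H.Time → Ω → ℝ}
    (hγ : ∀ s, Measurable[ℱ s] (γ s)) {s : H.Time} {A : Set Ω} (hA : MeasurableSet[ℱ s] A) :
    optProd ℱ Q γ (rect ℱ A {s}) = ∫⁻ ω in A, ENNReal.ofReal (γ s ω) ∂Q := by
  rw [optProd_apply hγ (measurableSet_rect_singleton hA), tsum_eq_single s]
  · congr 2
    ext ω; simp [rect]
  · intro r hr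
    have : {ω | (⟨ω, r⟩ : OptSpace ℱ) ∈ rect ℱ A {s}} = ∅ := by
      ext ω; simp [rect, hr]
    simp [this]

/-- The measure charges time `s` only where `γ s` is positive. This is the dictionary between null
sets on the product space and null sets on `Ω`. -/
theorem ae_optProd_iff {Q : Measure Ω} {γ : H.Time → Ω → ℝ}
    (hγ : ∀ s, Measurable[ℱ s] (γ s)) {p : OptSpace ℱ → Prop} (hp : MeasurableSet {x | p x}) :
    (∀ᵐ x ∂optProd ℱ Q γ, p x) ↔ ∀ s, ∀ᵐ ω ∂Q, 0 < γ s ω → p ⟨ω, s⟩ := by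
  have hγm : ∀ s, Measurable fun ω => ENNReal.ofReal (γ s ω) := fun s =>
    ((hγ s).mono (ℱ.le s) le_rfl).ennreal_ofReal
  rw [ae_iff, show {a | ¬ p a} = {x | p x}ᶜ from rfl, optProd_apply hγ hp.compl, ENNReal.tsum_eq_zero]
  refine forall_congr' fun s => ?_
  have hm := ℱ.le s _ (measurableSet_optSpace_iff.1 hp.compl s)
  rw [lintegral_eq_zero_iff (hγm s), EventuallyEq, ae_restrict_iff' hm]
  refine eventually_congr (Eventually.of_forall fun ω => ?_)
  simp only [Set.mem_compl_iff, Set.mem_ofPred_eq, Pi.zero_apply, ENNReal.ofReal_eq_zero]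
  constructor
  · intro h hpos
    by_contra hc
    exact absurd (h hc) (not_le.2 hpos)
  · intro h hc
    by_contra hpos
    exact hc (h (not_le.1 hpos))

/-- Integrals with respect to `Q ⊗ γ` are expectations of sums over time. -/
theorem integral_optProd {Q : Measure Ω} {γ : H.Time → Ω → ℝ}
    (hγ : ∀ s, Measurable[ℱ s] (γ s)) (hnn : ∀ᵐ ω ∂Q, ∀ s, 0 ≤ γ s ω) {F : OptSpace ℱ → ℝ}
    (hFm : Measurable F) (hF : Integrable F (optProd ℱ Q γ)) :
    (∀ᵐ ω ∂Q, Summable fun s => γ s ω * F ⟨ω, s⟩) ∧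
    Integrable (fun ω => ∑' s, γ s ω * F ⟨ω, s⟩) Q ∧
    ∫ p, F p ∂optProd ℱ Q γ = ∫ ω, ∑' s, γ s ω * F ⟨ω, s⟩ ∂Q := by
  have hγm : ∀ s, Measurable (γ s) := fun s => (hγ s).mono (ℱ.le s) le_rfl
  have hFs : ∀ s, Measurable fun ω => F ⟨ω, s⟩ := fun s =>
    (measurable_optSpace_iff.1 hFm s).mono (ℱ.le s) le_rfl
  have hmul : ∀ s, Measurable fun ω => γ s ω * F ⟨ω, s⟩ := fun s => (hγm s).mul (hFs s)
  have hnorm : ∫⁻ ω, ∑' s, ‖γ s ω * F ⟨ω, s⟩‖ₑ ∂Q = ∫⁻ p, ‖F p‖ₑ ∂optProd ℱ Q γ := by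
    rw [lintegral_optProd hγ hFm.enorm, ← lintegral_tsum
      (f := fun s ω => ENNReal.ofReal (γ s ω) * ‖F ⟨ω, s⟩‖ₑ) fun s => (((hγm s).ennreal_ofReal).mul (hFs s).enorm).aemeasurable]
    refine lintegral_congr_ae ?_
    filter_upwards [hnn] with ω hω
    refine tsum_congr fun s => ?_
    rw [enorm_mul, Real.enorm_of_nonneg (hω s)]
  have hfin : ∫⁻ ω, ∑' s, ‖γ s ω * F ⟨ω, s⟩‖ₑ ∂Q < ∞ := by
    rw [hnorm]; exact hF.2
  have hsum : ∀ᵐ ω ∂Q, Summable fun s => γ s ω * F ⟨ω, s⟩ := by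
    filter_upwards [ae_lt_top (Measurable.tsum fun s => (hmul s).enorm) hfin.ne] with ω hω
    exact Summable.of_norm (tsum_enorm_ne_top_iff_summable_norm.1 hω.ne)
  have hint : Integrable (fun ω => ∑' s, γ s ω * F ⟨ω, s⟩) Q := by
    refine ⟨(Measurable.tsum hmul).aestronglyMeasurable, ?_⟩
    refine lt_of_le_of_lt (lintegral_mono fun ω => ?_) hfin
    exact enorm_tsum_le_tsum_enorm
  refine ⟨hsum, hint, ?_⟩
  rw [integral_tsum (fun s => (hmul s).aestronglyMeasurable)
    (by rw [← lintegral_tsum fun s => (hmul s).enorm.aemeasurable]; exact hfin.ne)]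
  have hF' := hF
  rw [optProd] at hF'
  rw [optProd, integral_sum_measure hF']
  refine tsum_congr fun s => ?_
  rw [integral_map (measurable_atTime ℱ s).aemeasurable hFm.aestronglyMeasurable,
    integral_withDensity_eq_integral_toReal_smul (hγm s).ennreal_ofReal
      (Eventually.of_forall fun ω => ENNReal.ofReal_lt_top)]
  refine integral_congr_ae ?_
  filter_upwards [hnn] with ω hω
  rw [ENNReal.toReal_ofReal (hω s), smul_eq_mul]
  rfl

end Basics

end RiskProc


namespace RiskProc

/-! ### Weight processes, remaining mass and conditional losses -/

section Weights

variable {Ω : Type*} {mΩ : MeasurableSpace Ω} {H : Horizon} {ℱ : Filtration H.Time mΩ}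

/-- `γ` is an adapted process of weights on the time set, which defines a finite measure `Q ⊗ γ`. -/
structure IsWeight (ℱ : Filtration H.Time mΩ) (Q : Measure Ω) (γ : H.Time → Ω → ℝ) : Prop where
  adapted : ∀ s, Measurable[ℱ s] (γ s)
  nonneg : ∀ᵐ ω ∂Q, ∀ s, 0 ≤ γ s ω
  finite : IsFiniteMeasure (optProd ℱ Q γ)

/-- `X` is adapted, and bounded almost surely with respect to the measure `ν` on `Ω × 𝕋`. -/
structure IsBddProc (ℱ : Filtration H.Time mΩ) (ν : Measure (OptSpace ℱ)) (X : H.Time → Ω → ℝ) :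
    Prop where
  adapted : ∀ s, Measurable[ℱ s] (X s)
  bounded : ∃ C : ℝ, ∀ᵐ p ∂ν, |X p.time p.outcome| ≤ C

/-- The conditional mass `E_Q[∑_{s ≥ t} γ_s | ℱ_t]`. -/
noncomputable def massFrom (ℱ : Filtration H.Time mΩ) (t : H.Time) (Q : Measure Ω) (γ : H.Time → Ω → ℝ) :
    Ω → ℝ :=
  Q[sumFrom t γ 1 | ℱ t]

theorem measurable_massFrom (t : H.Time) (Q : Measure Ω) (γ : H.Time → Ω → ℝ) :
    Measurable[ℱ t] (massFrom ℱ t Q γ) := stronglyMeasurable_condExp.measurable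

theorem measurable_condLoss (t : H.Time) (Q : Measure Ω) (γ X : H.Time → Ω → ℝ) :
    Measurable[ℱ t] (condLoss ℱ t Q γ X) := stronglyMeasurable_condExp.measurable

theorem measurableSet_abs_le {X : H.Time → Ω → ℝ} (hX : ∀ s, Measurable[ℱ s] (X s)) (C : ℝ) :
    MeasurableSet {p : OptSpace ℱ | |X p.time p.outcome| ≤ C} :=
  measurableSet_le (measurable_optSpace_iff (F := fun p => X p.time p.outcome).2 hX).abs
    measurable_const

theorem IsBddProc.measurable {ν : Measure (OptSpace ℱ)} {X : H.Time → Ω → ℝ}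
    (hX : IsBddProc ℱ ν X) : Measurable fun p : OptSpace ℱ => X p.time p.outcome :=
  measurable_optSpace_iff.2 hX.adapted

theorem IsBddProc.integrable {ν : Measure (OptSpace ℱ)} [IsFiniteMeasure ν] {X : H.Time → Ω → ℝ}
    (hX : IsBddProc ℱ ν X) : Integrable (fun p : OptSpace ℱ => X p.time p.outcome) ν := by
  obtain ⟨C, hC⟩ := hX.bounded
  exact Integrable.of_bound hX.measurable.aestronglyMeasurable C hC

theorem IsBddProc.one (ν : Measure (OptSpace ℱ)) : IsBddProc ℱ ν 1 :=
  ⟨fun s => @measurable_const _ _ _ (ℱ s) 1, 1, Eventually.of_forall fun _ => by simp⟩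

theorem measurable_cashFrom {t : H.Time} {c : Ω → ℝ} (hc : Measurable[ℱ t] c) (s : H.Time) :
    Measurable[ℱ s] (cashFrom t c s) := by
  unfold cashFrom
  by_cases h : t ≤ s
  · simpa [h] using hc.mono (ℱ.mono h) le_rfl
  · simp [h]

theorem IsBddProc.cashFrom {Q : Measure Ω} {γ : H.Time → Ω → ℝ} (hγ : IsWeight ℱ Q γ)
    {t : H.Time} {c : Ω → ℝ} (hc : Measurable[ℱ t] c) {C : ℝ} (hC : ∀ᵐ ω ∂Q, |c ω| ≤ C) :
    IsBddProc ℱ (optProd ℱ Q γ) (cashFrom t c) := by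
  have hm := measurable_cashFrom hc (ℱ := ℱ)
  refine ⟨hm, |C|, ?_⟩
  rw [ae_optProd_iff hγ.adapted (measurableSet_abs_le hm _)]
  intro s
  filter_upwards [hC] with ω hω _
  simp only [RiskProc.cashFrom]
  split_ifs
  · exact hω.trans (le_abs_self C)
  · simp

/-- Almost surely bounded processes are bounded with respect to all random weights. -/
theorem MemR.isBddProc {P : Measure Ω} {N : H.Time → Ω → ℝ} (hN : ∀ s, Measurable[ℱ s] (N s))
    {X : H.Time → Ω → ℝ} (hX : MemR P ℱ X) : IsBddProc ℱ (optProd ℱ P N) X := by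
  obtain ⟨C, hC⟩ := hX.bounded
  refine ⟨hX.adapted, C, ?_⟩
  rw [ae_optProd_iff hN (measurableSet_abs_le hX.adapted _)]
  intro s
  filter_upwards [hC] with ω hω _ using hω s

theorem sumFrom_eq_tsum_indicator (t : H.Time) (γ X : H.Time → Ω → ℝ) (A : Set Ω) (ω : Ω) :
    A.indicator (sumFrom t γ X) ω =
      ∑' s, γ s ω * (rect ℱ A (Set.Ici t)).indicator (fun p => X p.time p.outcome) ⟨ω, s⟩ := by
  classical
  by_cases h : ω ∈ A
  · rw [Set.indicator_of_mem h]
    refine tsum_congr fun s => ?_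
    by_cases hs : t ≤ s <;> simp [Set.indicator, rect, h, hs]
  · rw [Set.indicator_of_notMem h]
    simp [Set.indicator, rect, h]

namespace IsWeight

variable {Q : Measure Ω} {γ : H.Time → Ω → ℝ}

theorem summable (hγ : IsWeight ℱ Q γ) {X : H.Time → Ω → ℝ}
    (hX : IsBddProc ℱ (optProd ℱ Q γ) X) (t : H.Time) :
    ∀ᵐ ω ∂Q, Summable fun s => if t ≤ s then γ s ω * X s ω else 0 := by
  have := hγ.finite
  have h1 := (integral_optProd hγ.adapted hγ.nonneg
    (hX.measurable.indicator (measurableSet_rect_Ici (t := t) MeasurableSet.univ))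
    (hX.integrable.indicator (measurableSet_rect_Ici (t := t) MeasurableSet.univ))).1
  filter_upwards [h1] with ω hω
  refine hω.congr fun s => ?_
  by_cases hs : t ≤ s <;> simp [Set.indicator, rect, hs]

theorem integrable_sumFrom (hγ : IsWeight ℱ Q γ) {X : H.Time → Ω → ℝ}
    (hX : IsBddProc ℱ (optProd ℱ Q γ) X) (t : H.Time) : Integrable (sumFrom t γ X) Q := by
  have := hγ.finite
  have h1 := (integral_optProd hγ.adapted hγ.nonneg
    (hX.measurable.indicator (measurableSet_rect_Ici (t := t) MeasurableSet.univ))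
    (hX.integrable.indicator (measurableSet_rect_Ici (t := t) MeasurableSet.univ))).2.1
  refine h1.congr (Eventually.of_forall fun ω => ?_)
  simp only [← sumFrom_eq_tsum_indicator, Set.indicator_univ]

theorem setIntegral_sumFrom (hγ : IsWeight ℱ Q γ) {X : H.Time → Ω → ℝ}
    (hX : IsBddProc ℱ (optProd ℱ Q γ) X) {t : H.Time} {A : Set Ω} (hA : MeasurableSet[ℱ t] A) :
    ∫ ω in A, sumFrom t γ X ω ∂Q =
      ∫ p in rect ℱ A (Set.Ici t), X p.time p.outcome ∂optProd ℱ Q γ := by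
  have := hγ.finite
  have h1 := (integral_optProd hγ.adapted hγ.nonneg
    (hX.measurable.indicator (measurableSet_rect_Ici hA))
    (hX.integrable.indicator (measurableSet_rect_Ici hA))).2.2
  rw [← integral_indicator (ℱ.le t _ hA), ← integral_indicator (measurableSet_rect_Ici hA), h1]
  exact integral_congr_ae (Eventually.of_forall fun ω => sumFrom_eq_tsum_indicator t γ X A ω)

theorem sumFrom_add (hγ : IsWeight ℱ Q γ) {X Y : H.Time → Ω → ℝ}
    (hX : IsBddProc ℱ (optProd ℱ Q γ) X) (hY : IsBddProc ℱ (optProd ℱ Q γ) Y) (t : H.Time) :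
    sumFrom t γ (X + Y) =ᵐ[Q] sumFrom t γ X + sumFrom t γ Y := by
  filter_upwards [hγ.summable hX t, hγ.summable hY t] with ω h1 h2
  rw [Pi.add_apply, sumFrom, sumFrom, sumFrom, ← h1.tsum_add h2]
  refine tsum_congr fun s => ?_
  split_ifs <;> simp [mul_add]

theorem sumFrom_one_nonneg (hγ : IsWeight ℱ Q γ) (t : H.Time) : 0 ≤ᵐ[Q] sumFrom t γ 1 := by
  filter_upwards [hγ.nonneg] with ω h
  refine tsum_nonneg fun s => ?_
  split_ifs
  · simpa using h s
  · exact le_rfl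

theorem abs_sumFrom_le (hγ : IsWeight ℱ Q γ) {X : H.Time → Ω → ℝ}
    (hX : ∀ s, Measurable[ℱ s] (X s)) {C : ℝ}
    (hC : ∀ᵐ p ∂optProd ℱ Q γ, |X p.time p.outcome| ≤ C) (t : H.Time) :
    ∀ᵐ ω ∂Q, |sumFrom t γ X ω| ≤ C * sumFrom t γ 1 ω := by
  have h1 := (ae_optProd_iff hγ.adapted (measurableSet_abs_le hX _)).1 hC
  filter_upwards [hγ.summable ⟨hX, C, hC⟩ t, hγ.summable (IsBddProc.one _) t, hγ.nonneg,
    ae_all_iff.2 h1] with ω h2 h3 h4 h5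
  have hb : ∀ s, |if t ≤ s then γ s ω * X s ω else 0| ≤
      C * if t ≤ s then γ s ω * (1 : H.Time → Ω → ℝ) s ω else 0 := by
    intro s
    split_ifs
    · rw [abs_mul, abs_of_nonneg (h4 s)]
      rcases (h4 s).eq_or_lt with h | h
      · simp [← h]
      · simp only [Pi.one_apply, mul_one]
        rw [mul_comm]
        exact mul_le_mul_of_nonneg_right (h5 s h) (h4 s)
    · simp
  rw [sumFrom, sumFrom, ← tsum_mul_left]
  exact (norm_tsum_le_tsum_norm h2.norm).trans
    (Summable.tsum_le_tsum hb h2.norm (h3.mul_left C))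

theorem massFrom_nonneg (_hγ : IsWeight ℱ Q γ) (t : H.Time) : 0 ≤ᵐ[Q] massFrom ℱ t Q γ :=
  condExp_nonneg (_hγ.sumFrom_one_nonneg t)

/-- On the events `A × 𝕋_t` with `A ∈ ℱ_t` the measure has the conditional remaining mass as its
density. -/
theorem optProd_rect_Ici [IsFiniteMeasure Q] (hγ : IsWeight ℱ Q γ) {t : H.Time} {A : Set Ω}
    (hA : MeasurableSet[ℱ t] A) :
    optProd ℱ Q γ (rect ℱ A (Set.Ici t)) = ∫⁻ ω in A, ENNReal.ofReal (massFrom ℱ t Q γ ω) ∂Q := by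
  have := hγ.finite
  have h1 := hγ.setIntegral_sumFrom (IsBddProc.one _) hA
  simp only [Pi.one_apply, setIntegral_const, smul_eq_mul, mul_one] at h1
  rw [← ofReal_measureReal, ← h1, ← setIntegral_condExp (ℱ.le t)
    (hγ.integrable_sumFrom (IsBddProc.one _) t) hA]
  exact ofReal_integral_eq_lintegral_ofReal integrable_condExp.integrableOn
    (ae_restrict_of_ae (hγ.massFrom_nonneg t))

/-- `ℱ_t`-measurable events which are almost sure where mass is left at time `t`. -/
theorem ae_massFrom_iff [IsFiniteMeasure Q] (hγ : IsWeight ℱ Q γ) {t : H.Time} {p : Ω → Prop}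
    (hp : MeasurableSet[ℱ t] {ω | p ω}) :
    (∀ᵐ ω ∂Q, 0 < massFrom ℱ t Q γ ω → p ω) ↔
      optProd ℱ Q γ (rect ℱ {ω | p ω}ᶜ (Set.Ici t)) = 0 := by
  rw [hγ.optProd_rect_Ici hp.compl, lintegral_eq_zero_iff
    ((measurable_massFrom t Q γ).mono (ℱ.le t) le_rfl).ennreal_ofReal, EventuallyEq,
    ae_restrict_iff' (ℱ.le t _ hp.compl)]
  refine eventually_congr (Eventually.of_forall fun ω => ?_)
  simp only [Set.mem_compl_iff, Set.mem_ofPred_eq, Pi.zero_apply, ENNReal.ofReal_eq_zero]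
  constructor
  · intro h hc
    by_contra hpos
    exact hc (h (not_le.1 hpos))
  · intro h hpos
    by_contra hc
    exact absurd (h hc) (not_le.2 hpos)

/-- Holding almost surely where mass is left at `t` is a property of the product measure alone. It
carries `ℱ_t`-measurable relations between `Q` and `P` without comparing these two measures
directly. -/
theorem ae_massFrom_congr [IsFiniteMeasure Q] {P : Measure Ω} [IsFiniteMeasure P]
    {N : H.Time → Ω → ℝ} (hγ : IsWeight ℱ Q γ) (hN : IsWeight ℱ P N)
    (heq : optProd ℱ Q γ = optProd ℱ P N) {t : H.Time} {p : Ω → Prop}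
    (hp : MeasurableSet[ℱ t] {ω | p ω}) :
    (∀ᵐ ω ∂Q, 0 < massFrom ℱ t Q γ ω → p ω) ↔ ∀ᵐ ω ∂P, 0 < massFrom ℱ t P N ω → p ω := by
  rw [hγ.ae_massFrom_iff hp, hN.ae_massFrom_iff hp, heq]

theorem setIntegral_condLoss [IsFiniteMeasure Q] (hγ : IsWeight ℱ Q γ) {X : H.Time → Ω → ℝ}
    (hX : IsBddProc ℱ (optProd ℱ Q γ) X) {t : H.Time} {A : Set Ω} (hA : MeasurableSet[ℱ t] A) :
    ∫ ω in A, condLoss ℱ t Q γ X ω ∂Q =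
      -∫ p in rect ℱ A (Set.Ici t), X p.time p.outcome ∂optProd ℱ Q γ := by
  rw [condLoss, setIntegral_condExp (f := fun ω => -sumFrom t γ X ω) (ℱ.le t)
    (hγ.integrable_sumFrom hX t).neg hA, integral_neg, hγ.setIntegral_sumFrom hX hA]

theorem setIntegral_mul_massFrom [IsFiniteMeasure Q] (hγ : IsWeight ℱ Q γ) {t : H.Time} {c : Ω → ℝ}
    (hc : Measurable[ℱ t] c) (hb : IsBddProc ℱ (optProd ℱ Q γ) (cashFrom t c)) {A : Set Ω}
    (hA : MeasurableSet[ℱ t] A) :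
    IntegrableOn (fun ω => c ω * massFrom ℱ t Q γ ω) Set.univ Q ∧
    ∫ ω in A, c ω * massFrom ℱ t Q γ ω ∂Q =
      ∫ p in rect ℱ A (Set.Ici t), cashFrom t c p.time p.outcome ∂optProd ℱ Q γ := by
  have h1 : sumFrom t γ (RiskProc.cashFrom t c) = fun ω => c ω * sumFrom t γ 1 ω := by
    funext ω
    rw [sumFrom, sumFrom, ← tsum_mul_left]
    refine tsum_congr fun s => ?_
    by_cases h : t ≤ s <;> simp [h, RiskProc.cashFrom, mul_comm]
  have h2 := hγ.integrable_sumFrom hb t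
  rw [h1] at h2
  have h3 : Q[fun ω => c ω * sumFrom t γ 1 ω | ℱ t] =ᵐ[Q] fun ω => c ω * massFrom ℱ t Q γ ω :=
    condExp_mul_of_stronglyMeasurable_left hc.stronglyMeasurable h2
      (hγ.integrable_sumFrom (IsBddProc.one _) t)
  refine ⟨by rw [integrableOn_univ]; exact integrable_condExp.congr h3, ?_⟩
  rw [← setIntegral_congr_ae (ℱ.le t _ hA) (h3.mono fun ω h _ => h),
    setIntegral_condExp (ℱ.le t) h2 hA, ← hγ.setIntegral_sumFrom hb hA, h1]

/-- The conditional loss per unit of mass depends only on the measure `Q ⊗ γ`. -/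
theorem condLoss_congr [IsFiniteMeasure Q] {P : Measure Ω} [IsFiniteMeasure P]
    {N : H.Time → Ω → ℝ} (hγ : IsWeight ℱ Q γ) (hN : IsWeight ℱ P N)
    (heq : optProd ℱ Q γ = optProd ℱ P N) {t : H.Time} {X : H.Time → Ω → ℝ}
    (hX : IsBddProc ℱ (optProd ℱ P N) X) {c : Ω → ℝ} (hc : Measurable[ℱ t] c) {C : ℝ}
    (hC : ∀ᵐ ω ∂Q, |c ω| ≤ C)
    (hcU : (fun ω => c ω * massFrom ℱ t Q γ ω) =ᵐ[Q] condLoss ℱ t Q γ X) :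
    (fun ω => c ω * massFrom ℱ t P N ω) =ᵐ[P] condLoss ℱ t P N X := by
  have hb := IsBddProc.cashFrom hγ hc hC
  have hb' := hb
  have hX' := hX
  rw [heq] at hb'
  rw [← heq] at hX'
  have hint := (hN.setIntegral_mul_massFrom hc hb' MeasurableSet.univ).1
  rw [integrableOn_univ] at hint
  have hsm : StronglyMeasurable[ℱ t] fun ω => c ω * massFrom ℱ t P N ω :=
    hc.stronglyMeasurable.mul stronglyMeasurable_condExp
  -- Integrated over `A ∈ ℱ_t`, both sides become integrals over `A × 𝕋_t` against the common
  -- product measure, where the identity known under `Q` can be used.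
  refine ae_eq_condExp_of_forall_setIntegral_eq (ℱ.le t) (hN.integrable_sumFrom hX t).neg
    (fun _ _ _ => hint.integrableOn) (fun A hA _ => ?_) hsm.aestronglyMeasurable
  rw [(hN.setIntegral_mul_massFrom hc hb' hA).2, integral_neg, hN.setIntegral_sumFrom hX hA, ← heq,
    ← (hγ.setIntegral_mul_massFrom hc hb hA).2, ← hγ.setIntegral_condLoss hX' hA]
  exact setIntegral_congr_ae (ℱ.le t _ hA) (hcU.mono fun ω h _ => h)

end IsWeight

end Weights

end RiskProc


namespace RiskProc

/-! ### Penalties and penalized losses in terms of density processes -/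

section Terms

variable {Ω : Type*} {mΩ : MeasurableSpace Ω} {H : Horizon} {ℱ : Filtration H.Time mΩ}
  {P Q : Measure Ω} {γ N X Y : H.Time → Ω → ℝ} {t : H.Time} {ρ : (H.Time → Ω → ℝ) → Ω → ℝ}

theorem measurable_tsum_real {α ι : Type*} {m : MeasurableSpace α} [Countable ι] {f : ι → α → ℝ}
    (hf : ∀ i, Measurable (f i)) : Measurable fun a => ∑' i, f i a := Measurable.tsum hf

theorem measurable_discOf (hγ : ∀ s, Measurable[ℱ s] (γ s)) (s : H.Time) :
    Measurable[ℱ s] (discOf γ s) := by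
  have h : Measurable[ℱ s] fun ω => ∑' r : H.Time, if r < s then γ r ω else 0 := by
    refine measurable_tsum_real (m := ℱ s) fun r => ?_
    by_cases hr : r < s
    · simpa [hr] using (hγ r).mono (ℱ.mono hr.le) le_rfl
    · simp [hr]
  unfold discOf
  by_cases hs : s.1 = ⊤
  · simpa [hs] using hγ s
  · simpa [hs] using h.const_sub 1

theorem MemGamma.optProd_univ [IsProbabilityMeasure Q] (hγ : MemGamma P ℱ Q γ) :
    IsProbabilityMeasure (optProd ℱ Q γ) := by
  constructor
  rw [optProd_apply hγ.adapted MeasurableSet.univ]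
  simp only [Set.mem_univ, Set.ofPred_true, Measure.restrict_univ]
  rw [← lintegral_tsum fun s => ((hγ.adapted s).mono (ℱ.le s) le_rfl).ennreal_ofReal.aemeasurable]
  have : ∀ᵐ ω ∂Q, ∑' s, ENNReal.ofReal (γ s ω) = 1 := by
    filter_upwards [hγ.nonneg, hγ.hasSum] with ω h1 h2
    rw [← ENNReal.ofReal_tsum_of_nonneg h1 h2.summable, h2.tsum_eq, ENNReal.ofReal_one]
  rw [lintegral_congr_ae this, lintegral_one, measure_univ]

theorem MemGamma.isWeight [IsProbabilityMeasure Q] (hγ : MemGamma P ℱ Q γ) : IsWeight ℱ Q γ :=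
  ⟨hγ.adapted, hγ.nonneg, by have := hγ.optProd_univ; infer_instance⟩

theorem discOf_eq_sumFrom (ht : t.1 ≠ ⊤) {ω : Ω} (h : HasSum (fun s => γ s ω) 1) :
    discOf γ t ω = sumFrom t γ 1 ω := by
  have h1 : Summable fun r : H.Time => if r < t then γ r ω else 0 :=
    summable_of_hasFiniteSupport ((Horizon.finite_Iio ht).subset fun r hr => by
      by_contra hc
      exact hr (if_neg hc))
  have h2 : Summable fun r : H.Time => if t ≤ r then γ r ω else 0 := by
    refine (h.summable.sub h1).congr fun r => ?_
    by_cases hr : r < t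
    · simp [hr, not_le.2 hr]
    · simp [hr, not_lt.1 hr]
  have h3 := h1.tsum_add h2
  have h4 : ∑' r : H.Time, ((if r < t then γ r ω else 0) + if t ≤ r then γ r ω else 0) = 1 := by
    rw [← h.tsum_eq]
    refine tsum_congr fun r => ?_
    by_cases hr : r < t
    · simp [hr, not_le.2 hr]
    · simp [hr, not_lt.1 hr]
  rw [discOf, if_neg ht, ← h4, h3]
  simp [sumFrom]

/-- For normalized `γ` the remaining mass is `1` minus the mass of the past, which is already
`ℱ_t`-measurable; conditioning does nothing. -/
theorem MemGamma.massFrom_eq [IsProbabilityMeasure Q] (hγ : MemGamma P ℱ Q γ) (ht : t.1 ≠ ⊤) :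
    massFrom ℱ t Q γ =ᵐ[Q] discOf γ t := by
  have h1 : sumFrom t γ 1 =ᵐ[Q] discOf γ t := by
    filter_upwards [hγ.hasSum] with ω h using (discOf_eq_sumFrom ht h).symm
  have h2 : Integrable (discOf γ t) Q :=
    (hγ.isWeight.integrable_sumFrom (IsBddProc.one _) t).congr h1
  refine (condExp_congr_ae h1).trans ?_
  rw [condExp_of_stronglyMeasurable (ℱ.le t) (measurable_discOf hγ.adapted t).stronglyMeasurable h2]

theorem MemGamma.discOf_nonneg [IsProbabilityMeasure Q] (hγ : MemGamma P ℱ Q γ) (ht : t.1 ≠ ⊤) :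
    0 ≤ᵐ[Q] discOf γ t := by
  filter_upwards [hγ.hasSum, hγ.isWeight.sumFrom_one_nonneg t] with ω h h1
  rw [discOf_eq_sumFrom ht h]; exact h1

theorem sumFrom_normalize (t : H.Time) (γ X : H.Time → Ω → ℝ) (ω : Ω) :
    sumFrom t (normalize t γ) X ω = (discOf γ t ω)⁻¹ * sumFrom t γ X ω := by
  rw [sumFrom, sumFrom, ← tsum_mul_left]
  refine tsum_congr fun s => ?_
  by_cases h : t ≤ s
  · simp only [h, if_true, normalize]; ring
  · simp [h]

/-- Normalized conditional losses are bounded, and they are conditional losses per unit of mass. -/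
theorem MemGamma.condLoss_normalize [IsProbabilityMeasure Q] (hγ : MemGamma P ℱ Q γ)
    (ht : t.1 ≠ ⊤) (hX : IsBddProc ℱ (optProd ℱ Q γ) X) :
    (∃ C : ℝ, ∀ᵐ ω ∂Q, |condLoss ℱ t Q (normalize t γ) X ω| ≤ C) ∧
    (fun ω => condLoss ℱ t Q (normalize t γ) X ω * massFrom ℱ t Q γ ω) =ᵐ[Q]
      condLoss ℱ t Q γ X := by
  obtain ⟨C, hC⟩ := hX.bounded
  have hS : ∀ᵐ ω ∂Q, |sumFrom t γ X ω| ≤ C * discOf γ t ω := by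
    filter_upwards [hγ.isWeight.abs_sumFrom_le hX.adapted hC t, hγ.hasSum] with ω h1 h2
    rwa [discOf_eq_sumFrom ht h2]
  have hb : ∀ᵐ ω ∂Q, |-sumFrom t (normalize t γ) X ω| ≤ |C| := by
    filter_upwards [hS, hγ.discOf_nonneg ht] with ω h1 h2
    rw [abs_neg, sumFrom_normalize, abs_mul, abs_inv, abs_of_nonneg h2]
    rcases h2.eq_or_lt with h | h
    · rw [← h]; simp
    · rw [inv_mul_le_iff₀ h, mul_comm]
      exact h1.trans (mul_le_mul_of_nonneg_right (le_abs_self C) h.le)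
  refine ⟨⟨|C|, ae_bdd_abs_condExp_of_ae_bdd_abs hb⟩, ?_⟩
  have hSint := hγ.isWeight.integrable_sumFrom hX t
  have hDm := measurable_discOf hγ.adapted t
  have hnm : AEStronglyMeasurable (fun ω => -sumFrom t (normalize t γ) X ω) Q := by
    have : (fun ω => -sumFrom t (normalize t γ) X ω) =
        fun ω => -((discOf γ t ω)⁻¹ * sumFrom t γ X ω) := by
      funext ω; rw [sumFrom_normalize]
    rw [this]
    exact (((hDm.mono (ℱ.le t) le_rfl).inv.aestronglyMeasurable).mul hSint.1).neg
  have hnint : Integrable (fun ω => -sumFrom t (normalize t γ) X ω) Q :=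
    Integrable.of_bound hnm |C| hb
  -- Where `D_t = 0` the sum from `t` on vanishes by the bound `hS`, so the default value of
  -- division by zero is harmless.
  have hprod : (fun ω => discOf γ t ω * -sumFrom t (normalize t γ) X ω) =ᵐ[Q]
      fun ω => -sumFrom t γ X ω := by
    filter_upwards [hS] with ω h1
    rw [sumFrom_normalize]
    by_cases h : discOf γ t ω = 0
    · rw [h, mul_zero] at h1
      have : sumFrom t γ X ω = 0 := abs_nonpos_iff.1 h1
      simp [h, this]
    · field_simp
  have h1 : Q[fun ω => discOf γ t ω * -sumFrom t (normalize t γ) X ω | ℱ t] =ᵐ[Q]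
      fun ω => discOf γ t ω * condLoss ℱ t Q (normalize t γ) X ω :=
    condExp_mul_of_stronglyMeasurable_left hDm.stronglyMeasurable
      (hSint.neg.congr hprod.symm) hnint
  filter_upwards [h1, condExp_congr_ae (m := ℱ t) hprod, hγ.massFrom_eq ht] with ω h2 h3 h4
  rw [h4, mul_comm, ← h2, h3]
  rfl

/-- The conditional loss of `X` per unit of mass at time `t` for the density process `N`. -/
noncomputable def lossRatio (P : Measure Ω) (ℱ : Filtration H.Time mΩ) (t : H.Time)
    (N X : H.Time → Ω → ℝ) (ω : Ω) : ℝ :=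
  condLoss ℱ t P N X ω / massFrom ℱ t P N ω

/-- The penalty in terms of the density process `N`. -/
noncomputable def densityPenalty (P : Measure Ω) (ℱ : Filtration H.Time mΩ) (t : H.Time)
    (ρ : (H.Time → Ω → ℝ) → Ω → ℝ) (N : H.Time → Ω → ℝ) : Ω → EReal :=
  familyEssSup P (ℱ t)
    {f | ∃ X, MemAccept P ℱ t ρ X ∧ f = fun ω => (lossRatio P ℱ t N X ω : EReal)}

/-- The penalized loss in terms of the density process `N`. -/
noncomputable def densityTerm (P : Measure Ω) (ℱ : Filtration H.Time mΩ) (t : H.Time)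
    (ρ : (H.Time → Ω → ℝ) → Ω → ℝ) (N X : H.Time → Ω → ℝ) (ω : Ω) : EReal :=
  (lossRatio P ℱ t N X ω : EReal) - densityPenalty P ℱ t ρ N ω

/-- The normalized loss under `Q`, multiplied by the remaining mass, is the loss; this
characterization transfers to the density process under `P`. -/
theorem condLoss_normalize_eq_lossRatio [IsProbabilityMeasure P] [IsProbabilityMeasure Q]
    (hγ : MemGamma P ℱ Q γ) (hN : IsWeight ℱ P N) (heq : optProd ℱ Q γ = optProd ℱ P N)
    (ht : t.1 ≠ ⊤) (hX : MemR P ℱ X) :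
    ∀ᵐ ω ∂P, 0 < massFrom ℱ t P N ω →
      condLoss ℱ t Q (normalize t γ) X ω = lossRatio P ℱ t N X ω := by
  have hX1 := hX.isBddProc hN.adapted
  have hX2 := hX1
  rw [← heq] at hX2
  obtain ⟨⟨C, hC⟩, h⟩ := hγ.condLoss_normalize ht hX2
  filter_upwards [hγ.isWeight.condLoss_congr hN heq hX1 (measurable_condLoss t Q _ X) hC h]
    with ω h1 h2
  rw [lossRatio, ← h1]
  field_simp

/-- The essential suprema are formed under different measures. Their members agree where mass is
left, and so do the `ℱ_t`-measurable inequalities that characterize the suprema there. -/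
theorem penalty_eq_densityPenalty [IsProbabilityMeasure P] [IsProbabilityMeasure Q]
    (hγ : MemGamma P ℱ Q γ) (hN : IsWeight ℱ P N) (heq : optProd ℱ Q γ = optProd ℱ P N)
    (ht : t.1 ≠ ⊤) :
    ∀ᵐ ω ∂P, 0 < massFrom ℱ t P N ω →
      penalty P ℱ t ρ Q γ ω = densityPenalty P ℱ t ρ N ω := by
  have hpm : Measurable[ℱ t] (penalty P ℱ t ρ Q γ) := measurable_familyEssSup Q (ℱ.le t) _
  have hdm : Measurable[ℱ t] (densityPenalty P ℱ t ρ N) := measurable_familyEssSup P (ℱ.le t) _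
  have hBQ : MeasurableSet[ℱ t] {ω | 0 < massFrom ℱ t Q γ ω} :=
    measurableSet_lt measurable_const (measurable_massFrom t Q γ)
  have hBP : MeasurableSet[ℱ t] {ω | 0 < massFrom ℱ t P N ω} :=
    measurableSet_lt measurable_const (measurable_massFrom t P N)
  have h1 : ∀ᵐ ω ∂P, 0 < massFrom ℱ t P N ω →
      penalty P ℱ t ρ Q γ ω ≤ densityPenalty P ℱ t ρ N ω := by
    rw [← hγ.isWeight.ae_massFrom_congr hN heq (measurableSet_le hpm hdm)]
    refine familyEssSup_le_on Q (ℱ.le t) hBQ hdm ?_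
    rintro f ⟨X, hX, rfl⟩
    refine (hγ.isWeight.ae_massFrom_congr hN heq (measurableSet_le
      (measurable_coe_real_ereal.comp (measurable_condLoss t Q _ X)) hdm)).2 ?_
    filter_upwards [condLoss_normalize_eq_lossRatio hγ hN heq ht hX.memRt.memR,
      le_familyEssSup P (ℱ.le t) (S := {f | ∃ X, MemAccept P ℱ t ρ X ∧
        f = fun ω => (lossRatio P ℱ t N X ω : EReal)}) ⟨X, hX, rfl⟩] with ω h2 h3 h4
    simp only [Function.comp_apply, h2 h4]
    exact h3
  have h2 : ∀ᵐ ω ∂P, 0 < massFrom ℱ t P N ω →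
      densityPenalty P ℱ t ρ N ω ≤ penalty P ℱ t ρ Q γ ω := by
    refine familyEssSup_le_on P (ℱ.le t) hBP hpm ?_
    rintro f ⟨X, hX, rfl⟩
    have h3 : ∀ᵐ ω ∂Q, 0 < massFrom ℱ t Q γ ω →
        ((condLoss ℱ t Q (normalize t γ) X ω : ℝ) : EReal) ≤ penalty P ℱ t ρ Q γ ω := by
      filter_upwards [le_familyEssSup Q (ℱ.le t) (S := {f | ∃ X, MemAccept P ℱ t ρ X ∧
        f = fun ω => (condLoss ℱ t Q (normalize t γ) X ω : EReal)}) ⟨X, hX, rfl⟩] with ω h _ using h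
    replace h3 := (hγ.isWeight.ae_massFrom_congr hN heq (measurableSet_le
      (measurable_coe_real_ereal.comp (measurable_condLoss t Q _ X)) hpm)).1 h3
    filter_upwards [h3, condLoss_normalize_eq_lossRatio hγ hN heq ht hX.memRt.memR]
      with ω h4 h5 (h6 : 0 < massFrom ℱ t P N ω)
    rw [← h5 h6]
    exact h4 h6
  filter_upwards [h1, h2] with ω h3 h4 h5 using le_antisymm (h3 h5) (h4 h5)

/-! ### Conditional losses under the reference measure -/

theorem condLoss_add [IsProbabilityMeasure P] (hN : IsWeight ℱ P N)
    (hX : IsBddProc ℱ (optProd ℱ P N) X) (hY : IsBddProc ℱ (optProd ℱ P N) Y) :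
    condLoss ℱ t P N (X + Y) =ᵐ[P] condLoss ℱ t P N X + condLoss ℱ t P N Y := by
  have h1 : (fun ω => -sumFrom t N (X + Y) ω) =ᵐ[P]
      (fun ω => -sumFrom t N X ω) + fun ω => -sumFrom t N Y ω := by
    filter_upwards [hN.sumFrom_add hX hY t] with ω h
    rw [h]
    simp only [Pi.add_apply]
    ring
  exact (condExp_congr_ae h1).trans (condExp_add (hN.integrable_sumFrom hX t).neg
    (hN.integrable_sumFrom hY t).neg _)

theorem sumFrom_cashFrom (t : H.Time) (N : H.Time → Ω → ℝ) (m : Ω → ℝ) (ω : Ω) :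
    sumFrom t N (cashFrom t m) ω = m ω * sumFrom t N 1 ω := by
  rw [sumFrom, sumFrom, ← tsum_mul_left]
  refine tsum_congr fun s => ?_
  by_cases h : t ≤ s <;> simp [h, cashFrom, mul_comm]

theorem condLoss_cashFrom [IsProbabilityMeasure P] (hN : IsWeight ℱ P N) {m : Ω → ℝ}
    (hm : MemLinf P (ℱ t) m) :
    condLoss ℱ t P N (cashFrom t m) =ᵐ[P] fun ω => -(m ω * massFrom ℱ t P N ω) := by
  obtain ⟨C, hC⟩ := hm.bounded
  have h1 := hN.integrable_sumFrom (IsBddProc.cashFrom hN hm.measurable hC) t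
  have h2 : sumFrom t N (cashFrom t m) = fun ω => m ω * sumFrom t N 1 ω :=
    funext (sumFrom_cashFrom t N m)
  have h3 : condLoss ℱ t P N (cashFrom t m) =ᵐ[P] -P[sumFrom t N (cashFrom t m) | ℱ t] :=
    condExp_neg _ _
  refine h3.trans ?_
  rw [h2] at h1 ⊢
  have h4 : P[fun ω => m ω * sumFrom t N 1 ω | ℱ t] =ᵐ[P] fun ω => m ω * massFrom ℱ t P N ω :=
    condExp_mul_of_stronglyMeasurable_left hm.measurable.stronglyMeasurable h1
      (hN.integrable_sumFrom (IsBddProc.one _) t)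
  filter_upwards [h4] with ω h
  simp only [Pi.neg_apply, h]

theorem MemRt.add (hX : MemRt P ℱ t X) (hY : MemRt P ℱ t Y) : MemRt P ℱ t (X + Y) := by
  obtain ⟨C, hC⟩ := hX.memR.bounded
  obtain ⟨C', hC'⟩ := hY.memR.bounded
  refine ⟨⟨fun s => (hX.memR.adapted s).add (hY.memR.adapted s), C + C', ?_⟩, fun s hs => ?_⟩
  · filter_upwards [hC, hC'] with ω h h' s
    exact (abs_add_le _ _).trans (add_le_add (h s) (h' s))
  · simp [hX.eq_zero s hs, hY.eq_zero s hs]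

theorem MemLinf.memRt_cashFrom {m : Ω → ℝ} (hm : MemLinf P (ℱ t) m) :
    MemRt P ℱ t (cashFrom t m) := by
  obtain ⟨C, hC⟩ := hm.bounded
  refine ⟨⟨fun s => ?_, |C|, ?_⟩, fun s hs => ?_⟩
  · exact measurable_cashFrom hm.measurable s
  · filter_upwards [hC] with ω h s
    by_cases hs : t ≤ s
    · simpa [cashFrom, hs] using h.trans (le_abs_self C)
    · simp [cashFrom, hs]
  · funext ω; simp [cashFrom, not_le.2 hs]

theorem MemRt.zero : MemRt P ℱ t 0 :=
  ⟨⟨fun s => @measurable_const _ _ _ (ℱ s) 0, 0, by simp⟩, fun _ _ => rfl⟩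

theorem MemAccept.zero (hρ : IsCondConvexRisk P ℱ t ρ) : MemAccept P ℱ t ρ 0 :=
  ⟨MemRt.zero, hρ.normalized.le⟩

/-- Cash invariance brings the risk to exactly zero; this is the acceptable process tested in the
penalty bound. -/
theorem memAccept_add_cashFrom (hρ : IsCondConvexRisk P ℱ t ρ) (hX : MemRt P ℱ t X) :
    MemAccept P ℱ t ρ (X + cashFrom t (ρ X)) := by
  have hm := hρ.memLinf X hX
  refine ⟨hX.add hm.memRt_cashFrom, ?_⟩
  filter_upwards [hρ.cash X _ hX hm] with ω h
  rw [h]; simp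

theorem zero_le_densityPenalty [IsProbabilityMeasure P] (hρ : IsCondConvexRisk P ℱ t ρ) :
    ∀ᵐ ω ∂P, 0 ≤ densityPenalty P ℱ t ρ N ω := by
  have h1 := le_familyEssSup P (ℱ.le t) (S := {f | ∃ X, MemAccept P ℱ t ρ X ∧
        f = fun ω => (lossRatio P ℱ t N X ω : EReal)}) ⟨0, MemAccept.zero hρ, rfl⟩
  have h2 : sumFrom t N 0 = 0 := by
    funext ω; simp [sumFrom]
  have h3 : lossRatio P ℱ t N 0 = 0 := by
    funext ω
    have : (fun ω => -sumFrom t N 0 ω) = (0 : Ω → ℝ) := by rw [h2]; simp; rfl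
    rw [lossRatio, condLoss, this, condExp_zero]; simp
  filter_upwards [h1] with ω h
  simp only [h3, Pi.zero_apply, EReal.coe_zero] at h
  exact h

/-- Penalized losses are dominated by the risk. -/
theorem densityTerm_le [IsProbabilityMeasure P] (hρ : IsCondConvexRisk P ℱ t ρ)
    (hN : IsWeight ℱ P N) (hX : MemRt P ℱ t X) :
    ∀ᵐ ω ∂P, 0 < massFrom ℱ t P N ω → densityTerm P ℱ t ρ N X ω ≤ (ρ X ω : EReal) := by
  have hm := hρ.memLinf X hX
  filter_upwards [zero_le_densityPenalty (N := N) hρ,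
    le_familyEssSup P (ℱ.le t) (S := {f | ∃ X, MemAccept P ℱ t ρ X ∧
        f = fun ω => (lossRatio P ℱ t N X ω : EReal)}) ⟨_, memAccept_add_cashFrom hρ hX, rfl⟩,
    condLoss_add (t := t) hN (hX.memR.isBddProc hN.adapted)
      (hm.memRt_cashFrom.memR.isBddProc hN.adapted),
    condLoss_cashFrom hN hm] with ω h0 h1 h2 h3 h4
  -- Cash shifts the loss per unit of mass by its own amount, so the acceptable process `X + ρ(X)`
  -- bounds the penalty below by the loss of `X` minus `ρ(X)`.
  have h5 : lossRatio P ℱ t N (X + cashFrom t (ρ X)) ω = lossRatio P ℱ t N X ω - ρ X ω := by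
    rw [lossRatio, h2, Pi.add_apply, h3, lossRatio]
    field_simp
    ring
  have h6 : ((lossRatio P ℱ t N X ω - ρ X ω : ℝ) : EReal) ≤ densityPenalty P ℱ t ρ N ω := by
    rw [← h5]; exact h1
  rw [densityTerm]
  generalize densityPenalty P ℱ t ρ N ω = a at *
  induction a with
  | bot => simp at h0
  | top => simp
  | coe a =>
    norm_cast at h6 ⊢
    linarith

end Terms

end RiskProc


namespace RiskProc

/-! ### Representations imply continuity from above -/

section Continuity

variable {Ω : Type*} {mΩ : MeasurableSpace Ω} {H : Horizon} {ℱ : Filtration H.Time mΩ}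
  {P : Measure Ω} {t : H.Time} {ρ : (H.Time → Ω → ℝ) → Ω → ℝ}

/-- Dominated convergence for conditional expectations, along a subsequence. -/
theorem exists_subseq_tendsto_condExp {m : MeasurableSpace Ω} [IsFiniteMeasure P]
    {F : ℕ → Ω → ℝ} {f b : Ω → ℝ} (hF : ∀ n, AEStronglyMeasurable[mΩ] (F n) P) (hb : Integrable b P)
    (hFb : ∀ n, ∀ᵐ ω ∂P, ‖F n ω‖ ≤ b ω)
    (hlim : ∀ᵐ ω ∂P, Tendsto (fun n => F n ω) atTop (𝓝 (f ω))) :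
    ∃ φ : ℕ → ℕ, StrictMono φ ∧
      ∀ᵐ ω ∂P, Tendsto (fun k => P[F (φ k) | m] ω) atTop (𝓝 (P[f | m] ω)) := by
  have hFi : ∀ n, Integrable (F n) P := fun n => hb.mono' (hF n) (hFb n)
  have hfm : AEStronglyMeasurable[mΩ] f P := aestronglyMeasurable_of_tendsto_ae _ hF hlim
  have hfi : Integrable f P := by
    refine hb.mono' hfm ?_
    filter_upwards [hlim, ae_all_iff.2 hFb] with ω h1 h2
    exact le_of_tendsto' h1.norm h2
  have h1 := tendsto_lintegral_norm_of_dominated_convergence hF hb.2 hFb hlim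
  -- Conditional expectation contracts `L¹`, so dominated convergence survives it; almost sure
  -- convergence is recovered along a subsequence.
  have h2 : Tendsto (fun n => eLpNorm (P[F n | m] - P[f | m]) 1 P) atTop (𝓝 0) := by
    refine tendsto_of_tendsto_of_tendsto_of_le_of_le tendsto_const_nhds h1 (fun n => zero_le)
      fun n => ?_
    rw [← eLpNorm_congr_ae (condExp_sub (hFi n) hfi m)]
    refine (eLpNorm_condExp_le_eLpNorm _ le_rfl).trans ?_
    rw [eLpNorm_one_eq_lintegral_enorm]
    refine lintegral_mono fun ω => ?_
    rw [Pi.sub_apply, ← ofReal_norm]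
  have h3 : TendstoInMeasure P (fun n => P[F n | m]) atTop (P[f | m]) :=
    tendstoInMeasure_of_tendsto_eLpNorm one_ne_zero
      (fun n => integrable_condExp.aestronglyMeasurable) integrable_condExp.aestronglyMeasurable h2
  exact h3.exists_seq_tendsto_ae

theorem MemR.memRt_proj {X : H.Time → Ω → ℝ} (hX : MemR P ℱ X) (t : H.Time) :
    MemRt P ℱ t (proj t X) := by
  obtain ⟨C, hC⟩ := hX.bounded
  refine ⟨⟨fun s => ?_, |C|, ?_⟩, fun s hs => ?_⟩
  · unfold proj
    by_cases h : t ≤ s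
    · simpa [h] using hX.adapted s
    · simp [h]
  · filter_upwards [hC] with ω h s
    by_cases hs : t ≤ s
    · simpa [proj, hs] using (h s).trans (le_abs_self C)
    · simp [proj, hs]
  · funext ω; simp [proj, not_le.2 hs]

theorem proj_eq_self {X : H.Time → Ω → ℝ} (hX : ∀ s < t, X s = 0) : proj t X = X := by
  funext s ω
  by_cases h : t ≤ s
  · simp [proj, h]
  · simp [proj, h, hX s (not_le.1 h)]

/-- If the risk is the essential supremum of penalized losses over a fixed family of density
processes, then it is continuous from above. -/
theorem contFromAbove_of_representation [IsProbabilityMeasure P] (hρ : IsCondConvexRisk P ℱ t ρ)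
    (S : Set (H.Time → Ω → ℝ)) (hw : ∀ N ∈ S, IsWeight ℱ P N)
    (hpos : ∀ N ∈ S, ∀ᵐ ω ∂P, 0 < massFrom ℱ t P N ω)
    (hle : ∀ X, MemRt P ℱ t X → ∀ h : Ω → EReal, Measurable[ℱ t] h →
      (∀ N ∈ S, densityTerm P ℱ t ρ N X ≤ᵐ[P] h) → (fun ω => (ρ X ω : EReal)) ≤ᵐ[P] h) :
    ContFromAbove P ℱ t ρ := by
  intro Xn X hXn hX hconv
  set Y : ℕ → H.Time → Ω → ℝ := fun n => proj t (Xn n) with hYdef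
  have hY : ∀ n, MemRt P ℱ t (Y n) := fun n => (hXn n).memRt_proj t
  have hZ : MemRt P ℱ t (proj t X) := hX.memRt_proj t
  have hconv' : ∀ s, ∀ᵐ ω ∂P, Antitone (fun n => Y n s ω) ∧
      Tendsto (fun n => Y n s ω) atTop (𝓝 (proj t X s ω)) := by
    intro s
    by_cases hs : t ≤ s
    · filter_upwards [hconv s hs] with ω h
      simpa [hYdef, proj, hs] using h
    · simp [hYdef, proj, hs, antitone_const]
  have hmono : ∀ᵐ ω ∂P, Monotone fun n => ρ (Y n) ω := by
    have h1 : ∀ n, ρ (Y n) ≤ᵐ[P] ρ (Y (n + 1)) := fun n =>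
      hρ.mono _ _ (hY _) (hY _) fun s => by
        filter_upwards [hconv' s] with ω h using h.1 n.le_succ
    filter_upwards [ae_all_iff.2 h1] with ω h using monotone_nat_of_le_succ h
  have hup : ∀ᵐ ω ∂P, ∀ n, ρ (Y n) ω ≤ ρ (proj t X) ω := by
    refine ae_all_iff.2 fun n => hρ.mono _ _ hZ (hY n) fun s => ?_
    filter_upwards [hconv' s] with ω h using h.1.le_of_tendsto h.2 n
  -- `h` is the limit of the increasing risks. It remains to see that `h` dominates every penalized
  -- loss of the limit process, for then it dominates the risk of that process.
  set h : Ω → EReal := fun ω => ⨆ n, (ρ (Y n) ω : EReal) with hh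
  have hhm : Measurable[ℱ t] h := Measurable.iSup fun n =>
    measurable_coe_real_ereal.comp (hρ.memLinf _ (hY n)).measurable
  have key := hle (proj t X) hZ h hhm fun N hN => by
    have hwN := hw N hN
    obtain ⟨C, hC⟩ := (hY 0).memR.bounded
    obtain ⟨C', hC'⟩ := hZ.memR.bounded
    have hbd : ∀ᵐ ω ∂P, ∀ n s, |Y n s ω| ≤ C + C' := by
      filter_upwards [hC, hC', ae_all_iff.2 hconv'] with ω h1 h2 h3 n s
      have h4 := h1 s
      have h5 := h2 s
      have h6 := (h3 s).1 (Nat.zero_le n)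
      have h7 := (h3 s).1.le_of_tendsto (h3 s).2 n
      simp only at h6 h7
      rw [abs_le] at *
      have : 0 ≤ C := (abs_nonneg _).trans (h1 s)
      have : 0 ≤ C' := (abs_nonneg _).trans (h2 s)
      constructor <;> linarith
    have hsum1 := hwN.summable (IsBddProc.one _) t
    have hlim : ∀ᵐ ω ∂P, Tendsto (fun n => -sumFrom t N (Y n) ω) atTop
        (𝓝 (-sumFrom t N (proj t X) ω)) := by
      filter_upwards [hbd, ae_all_iff.2 hconv', hwN.nonneg, hsum1] with ω h1 h2 h3 h4
      refine Tendsto.neg ?_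
      refine tendsto_tsum_of_dominated_convergence (h4.mul_left (C + C')) (fun s => ?_)
        (Eventually.of_forall fun n s => ?_)
      · split_ifs
        · exact (h2 s).2.const_mul _
        · exact tendsto_const_nhds
      · split_ifs
        · simp only [Pi.one_apply, mul_one, norm_mul, Real.norm_eq_abs, abs_of_nonneg (h3 s)]
          rw [mul_comm]
          exact mul_le_mul_of_nonneg_right (h1 n s) (h3 s)
        · simp
    have hdom : ∀ n, ∀ᵐ ω ∂P, ‖-sumFrom t N (Y n) ω‖ ≤ (C + C') * sumFrom t N 1 ω := by
      intro n
      have hb : ∀ᵐ p ∂optProd ℱ P N, |Y n p.time p.outcome| ≤ C + C' := by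
        rw [ae_optProd_iff hwN.adapted (measurableSet_abs_le (hY n).memR.adapted _)]
        intro s
        filter_upwards [hbd] with ω h _ using h n s
      filter_upwards [hwN.abs_sumFrom_le (hY n).memR.adapted hb t] with ω h
      simpa using h
    -- A subsequence is enough because all penalized losses of the `Y n` lie below `h`.
    obtain ⟨φ, -, hφ⟩ := exists_subseq_tendsto_condExp (m := ℱ t)
      (fun n => (hwN.integrable_sumFrom ((hY n).memR.isBddProc hwN.adapted) t).neg.1)
      ((hwN.integrable_sumFrom (IsBddProc.one _) t).const_mul (C + C')) hdom hlim
    filter_upwards [hφ, hpos N hN, ae_all_iff.2 fun n => densityTerm_le hρ hwN (hY n)]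
      with ω h1 h2 h3
    have h4 : ∀ n, densityTerm P ℱ t ρ N (Y n) ω ≤ h ω := fun n =>
      (h3 n h2).trans (le_iSup (fun n => (ρ (Y n) ω : EReal)) n)
    have h5 : Tendsto (fun k => lossRatio P ℱ t N (Y (φ k)) ω) atTop
        (𝓝 (lossRatio P ℱ t N (proj t X) ω)) := h1.div_const _
    simp only [densityTerm] at h4 ⊢
    generalize densityPenalty P ℱ t ρ N ω = a at *
    induction a with
    | bot =>
      have := h4 0
      rw [EReal.coe_sub_bot] at this ⊢
      exact this
    | top => simp
    | coe a =>
      refine le_of_tendsto' ((continuous_coe_real_ereal.tendsto _).comp (h5.sub_const a))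
        fun k => ?_
      simpa using h4 (φ k)
  filter_upwards [hmono, hup, key] with ω h1 h2 h3
  refine ⟨h1, tendsto_atTop_isLUB h1 ⟨?_, fun b hb => ?_⟩⟩
  · rintro _ ⟨n, rfl⟩
    exact h2 n
  · have h4 : h ω ≤ (b : EReal) := iSup_le fun n => by
      exact_mod_cast hb ⟨n, rfl⟩
    exact_mod_cast h3.trans h4

end Continuity

end RiskProc


namespace RiskProc

/-! ### Separation in `L²` by integrable functions -/

section L2Separation

open scoped InnerProductSpace

variable {S : Type*} {mS : MeasurableSpace S} (ν : Measure S)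

theorem inner_Lp_two (x f : Lp ℝ 2 ν) : ⟪x, f⟫_ℝ = ∫ s, x s * f s ∂ν := by
  rw [L2.inner_def]
  refine integral_congr_ae (Eventually.of_forall fun s => ?_)
  simp [mul_comm]

theorem integral_mul_abs_le {x f : S → ℝ} (hx : Integrable x ν) (hf : AEStronglyMeasurable f ν)
    {r : ℝ} (hr : ∀ᵐ s ∂ν, |f s| ≤ r) :
    Integrable (fun s => x s * f s) ν ∧ ∫ s, |x s * f s| ∂ν ≤ r * ∫ s, |x s| ∂ν := by
  have h1 : Integrable (fun s => x s * f s) ν := hx.mul_bdd hf hr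
  refine ⟨h1, ?_⟩
  rw [← integral_const_mul]
  refine integral_mono_ae h1.abs (hx.abs.const_mul r) ?_
  filter_upwards [hr] with s hs
  rw [abs_mul, mul_comm]
  exact mul_le_mul_of_nonneg_right hs (abs_nonneg _)

variable [IsFiniteMeasure ν]

theorem Lp_two_integrable (x : Lp ℝ 2 ν) : Integrable x ν :=
  (Lp.memLp x).integrable one_le_two

/-- The `L¹`-norm on `L²` of a finite measure. -/
noncomputable def l1Seminorm : Seminorm ℝ (Lp ℝ 2 ν) :=
  Seminorm.of (fun x => ∫ s, |x s| ∂ν)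
    (fun x y => by
      rw [← integral_add (Lp_two_integrable ν x).abs (Lp_two_integrable ν y).abs]
      refine integral_mono_ae (Lp_two_integrable ν _).abs
        ((Lp_two_integrable ν x).abs.add (Lp_two_integrable ν y).abs) ?_
      filter_upwards [Lp.coeFn_add x y] with s hs
      rw [hs]
      exact abs_add_le _ _)
    (fun a x => by
      rw [← integral_const_mul]
      refine integral_congr_ae ?_
      filter_upwards [Lp.coeFn_smul a x] with s hs
      rw [hs]
      simp [abs_mul])

theorem l1Seminorm_apply (x : Lp ℝ 2 ν) : l1Seminorm ν x = ∫ s, |x s| ∂ν := rfl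

theorem l1Seminorm_le (x : Lp ℝ 2 ν) :
    l1Seminorm ν x ≤ (ν Set.univ).toReal ^ (1 / 2 : ℝ) * ‖x‖ := by
  have h1 := eLpNorm_le_eLpNorm_mul_rpow_measure_univ (p := 1) (q := 2) (μ := ν) one_le_two
    (Lp.memLp x).1
  rw [l1Seminorm_apply, Lp.norm_def, mul_comm, ENNReal.toReal_rpow, ← ENNReal.toReal_mul]
  have h2 : ∫ s, |x s| ∂ν = (eLpNorm x 1 ν).toReal := by
    rw [eLpNorm_one_eq_lintegral_enorm]
    exact integral_norm_eq_lintegral_enorm (Lp.memLp x).1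
  rw [h2]
  refine ENNReal.toReal_mono (ENNReal.mul_ne_top (Lp.memLp x).2.ne
    (ENNReal.rpow_ne_top_of_nonneg (by norm_num) (measure_ne_top ν _))) (h1.trans_eq ?_)
  norm_num

/-- Tests against indicators turn the dual bound into an almost sure bound; the converse is Hölder's
inequality for `L¹` and `L^∞`. Thus the dual balls of the abstract separation theorem are the balls
of `L^∞`. -/
theorem mem_dualBall_l1Seminorm {r : ℝ} (f : Lp ℝ 2 ν) :
    f ∈ dualBall (l1Seminorm ν) r ↔ ∀ᵐ s ∂ν, |f s| ≤ r := by
  constructor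
  · intro hf
    have key : ∀ A, MeasurableSet A → |∫ s in A, f s ∂ν| ≤ r * (ν A).toReal := by
      intro A hA
      have h1 := hf (indicatorConstLp 2 hA (measure_ne_top ν A) 1)
      rw [L2.inner_indicatorConstLp_one, l1Seminorm_apply] at h1
      have h2 : ∫ s, |(indicatorConstLp 2 hA (measure_ne_top ν A) (1 : ℝ) : Lp ℝ 2 ν) s| ∂ν =
          (ν A).toReal := by
        have h3 : (fun s => |(indicatorConstLp 2 hA (measure_ne_top ν A) (1 : ℝ) : Lp ℝ 2 ν) s|)
            =ᵐ[ν] A.indicator 1 := by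
          filter_upwards [indicatorConstLp_coeFn (p := 2) (hs := hA) (hμs := measure_ne_top ν A)
            (c := (1 : ℝ))] with s hs
          rw [hs]
          by_cases h : s ∈ A <;> simp [h]
        rw [integral_congr_ae h3, integral_indicator_one hA]
        rfl
      rwa [h2] at h1
    have hfi := Lp_two_integrable ν f
    have h1 : f ≤ᵐ[ν] fun _ => r := by
      refine ae_le_of_forall_setIntegral_le hfi (integrable_const r) fun A hA _ => ?_
      rw [setIntegral_const, smul_eq_mul, mul_comm]
      exact (le_abs_self _).trans (key A hA)
    have h2 : (fun _ => -r) ≤ᵐ[ν] f := by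
      refine ae_le_of_forall_setIntegral_le (integrable_const _) hfi fun A hA _ => ?_
      rw [setIntegral_const, smul_eq_mul, mul_comm, neg_mul]
      exact neg_le.1 ((neg_le_abs _).trans (key A hA))
    filter_upwards [h1, h2] with s h3 h4 using abs_le.2 ⟨h4, h3⟩
  · intro hf x
    rw [inner_Lp_two, l1Seminorm_apply]
    refine (abs_integral_le_integral_abs).trans ?_
    exact (integral_mul_abs_le ν (Lp_two_integrable ν x) (Lp.memLp f).1 hf).2

/-- A convex subset of `L²` whose bounded parts are closed is separated from `0`, as far as its
bounded elements are concerned, by an integrable function. -/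
theorem exists_integrable_separating {C : Set (Lp ℝ 2 ν)} (hC : Convex ℝ C)
    (hcl : ∀ r, 0 < r → IsClosed (C ∩ {f | ∀ᵐ s ∂ν, |f s| ≤ r})) (h0 : (0 : Lp ℝ 2 ν) ∉ C) :
    ∃ Z : S → ℝ, Measurable Z ∧ Integrable Z ν ∧ ∀ f ∈ C, ∀ r, (∀ᵐ s ∂ν, |f s| ≤ r) →
      1 ≤ ∫ s, Z s * f s ∂ν := by
  have hball : ∀ r, dualBall (l1Seminorm ν) r = {f : Lp ℝ 2 ν | ∀ᵐ s ∂ν, |f s| ≤ r} := fun r =>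
    Set.ext fun f => mem_dualBall_l1Seminorm ν f
  obtain ⟨F, a, B, ha, hB, hsep⟩ := exists_separating_series (l1Seminorm ν)
    (by positivity) (l1Seminorm_le ν) hC (fun r hr => by rw [hball]; exact hcl r hr) h0
  -- The terms are bounded in `L¹` and the coefficients are summable, so `∑ a i * x i` converges in
  -- `L¹`. It need not be in `L²`, but pairing it with a bounded `f` can still be done term by term.
  let x : (Σ n, F n) → S → ℝ := fun i s => (i.2 : Lp ℝ 2 ν) s
  have hx : ∀ i, Integrable (x i) ν := fun i => Lp_two_integrable ν _
  have hxm : ∀ i, Measurable (x i) := fun i => (Lp.stronglyMeasurable _).measurable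
  have hxB : ∀ i, ∫ s, |x i s| ∂ν ≤ B := hB
  have hB0 : 0 ≤ |B| := abs_nonneg B
  have hsum : ∑' i, ∫⁻ s, ‖a i * x i s‖ₑ ∂ν ≠ ∞ := by
    have h1 : ∀ i, ∫⁻ s, ‖a i * x i s‖ₑ ∂ν ≤ ENNReal.ofReal (|a i| * |B|) := by
      intro i
      rw [← ofReal_integral_norm_eq_lintegral_enorm ((hx i).const_mul (a i))]
      refine ENNReal.ofReal_le_ofReal ?_
      simp only [norm_mul, Real.norm_eq_abs]
      rw [integral_const_mul]
      exact mul_le_mul_of_nonneg_left ((hxB i).trans (le_abs_self B)) (abs_nonneg _)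
    exact ne_top_of_le_ne_top (ha.mul_right |B|).tsum_ofReal_ne_top (ENNReal.tsum_le_tsum h1)
  have hZm : Measurable fun s => ∑' i, a i * x i s :=
    measurable_tsum_real fun i => (hxm i).const_mul _
  refine ⟨fun s => ∑' i, a i * x i s, hZm, ⟨hZm.aestronglyMeasurable, ?_⟩, fun f hf r hr => ?_⟩
  · refine lt_of_le_of_lt (lintegral_mono fun s => enorm_tsum_le_tsum_enorm) ?_
    rw [lintegral_tsum fun i => ((hxm i).const_mul _).enorm.aemeasurable]
    exact hsum.lt_top
  · obtain ⟨v, hv, hvs⟩ := hsep r f ⟨hf, by rw [hball]; exact hr⟩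
    have h1 : ∀ i, Integrable (fun s => a i * x i s * f s) ν := fun i =>
      (integral_mul_abs_le ν ((hx i).const_mul (a i)) (Lp.memLp f).1 hr).1
    have h2 : Summable fun i => ∫ s, ‖a i * x i s * f s‖ ∂ν := by
      refine Summable.of_nonneg_of_le (fun i => integral_nonneg fun s => norm_nonneg _) (fun i => ?_)
        (ha.mul_right (|r| * |B|))
      have hr' : ∀ᵐ s ∂ν, |f s| ≤ |r| := hr.mono fun s h => h.trans (le_abs_self r)
      refine (integral_mul_abs_le ν ((hx i).const_mul (a i)) (Lp.memLp f).1 hr').2.trans ?_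
      simp only [abs_mul]
      rw [integral_const_mul, mul_left_comm]
      exact mul_le_mul_of_nonneg_left (mul_le_mul_of_nonneg_left
        ((hxB i).trans (le_abs_self B)) (abs_nonneg _)) (abs_nonneg _)
    have h3 := hasSum_integral_of_summable_integral_norm h1 h2
    have h4 : (fun i => ∫ s, a i * x i s * f s ∂ν) =
        fun i : (Σ n, F n) => a i * ⟪(i.2 : Lp ℝ 2 ν), f⟫_ℝ := by
      funext i
      rw [inner_Lp_two, ← integral_const_mul]
      simp only [mul_assoc, x]
    rw [h4] at h3
    have h5 := h3.unique hvs
    simp only [tsum_mul_right] at h5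
    rw [h5]
    exact hv

end L2Separation

end RiskProc


namespace RiskProc

/-! ### Bounds and closedness for the expected risk -/

section RiskBasics

variable {Ω : Type*} {mΩ : MeasurableSpace Ω} {H : Horizon} {ℱ : Filtration H.Time mΩ}
  {P : Measure Ω} {t : H.Time} {ρ : (H.Time → Ω → ℝ) → Ω → ℝ} {X Y μ : H.Time → Ω → ℝ}

theorem MemRt.combine {l : Ω → ℝ} (hl : MemLinf P (ℱ t) l) (hX : MemRt P ℱ t X)
    (hY : MemRt P ℱ t Y) : MemRt P ℱ t fun s ω => l ω * X s ω + (1 - l ω) * Y s ω := by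
  obtain ⟨C, hC⟩ := hX.memR.bounded
  obtain ⟨C', hC'⟩ := hY.memR.bounded
  obtain ⟨L, hL⟩ := hl.bounded
  have hz : ∀ s < t, (fun ω => l ω * X s ω + (1 - l ω) * Y s ω) = 0 := fun s hs => by
    funext ω; simp [hX.eq_zero s hs, hY.eq_zero s hs]
  refine ⟨⟨fun s => ?_, L * C + (1 + L) * C', ?_⟩, hz⟩
  · by_cases hs : t ≤ s
    · have h1 : Measurable[ℱ s] l := hl.measurable.mono (ℱ.mono hs) le_rfl
      exact (h1.mul (hX.memR.adapted s)).add ((h1.const_sub 1).mul (hY.memR.adapted s))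
    · have := hz s (not_le.1 hs)
      rw [this]
      exact @measurable_const _ _ _ (ℱ s) 0
  · filter_upwards [hC, hC', hL] with ω h1 h2 h3 s
    have h4 : |1 - l ω| ≤ 1 + L := by
      rw [abs_le] at h3 ⊢
      constructor <;> linarith [h3.1, h3.2]
    refine (abs_add_le _ _).trans (add_le_add ?_ ?_)
    · rw [abs_mul]
      exact mul_le_mul h3 (h1 s) (abs_nonneg _) ((abs_nonneg _).trans h3)
    · rw [abs_mul]
      exact mul_le_mul h4 (h2 s) (abs_nonneg _) ((abs_nonneg _).trans h4)

theorem MemLinf.const (P : Measure Ω) (m : MeasurableSpace Ω) (c : ℝ) :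
    MemLinf P m fun _ => c :=
  ⟨@measurable_const _ _ _ m c, |c|, by simp⟩

theorem MemRt.smul (hX : MemRt P ℱ t X) (c : ℝ) : MemRt P ℱ t fun s ω => c * X s ω := by
  obtain ⟨C, hC⟩ := hX.memR.bounded
  refine ⟨⟨fun s => (hX.memR.adapted s).const_mul c, |c| * C, ?_⟩, fun s hs => ?_⟩
  · filter_upwards [hC] with ω h s
    rw [abs_mul]
    exact mul_le_mul_of_nonneg_left (h s) (abs_nonneg c)
  · funext ω; simp [hX.eq_zero s hs]

namespace IsCondConvexRisk

theorem congr (hρ : IsCondConvexRisk P ℱ t ρ) (hX : MemRt P ℱ t X) (hY : MemRt P ℱ t Y) (h : ∀ s, X s =ᵐ[P] Y s) :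
    ρ X =ᵐ[P] ρ Y := by
  filter_upwards [hρ.mono X Y hX hY fun s => (h s).le, hρ.mono Y X hY hX fun s => (h s).symm.le]
    with ω h1 h2 using le_antisymm h2 h1

theorem apply_cashFrom (hρ : IsCondConvexRisk P ℱ t ρ) {m : Ω → ℝ} (hm : MemLinf P (ℱ t) m) :
    ρ (cashFrom t m) =ᵐ[P] fun ω => -m ω := by
  have h := hρ.cash 0 m MemRt.zero hm
  rw [zero_add] at h
  filter_upwards [h, hρ.normalized] with ω h1 h2
  rw [h1, Pi.sub_apply, h2]
  simp

/-- Monotonicity compares `X` with the constant processes `±C` on `𝕋_t`, whose risks are `∓C`. -/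
theorem abs_le (hρ : IsCondConvexRisk P ℱ t ρ) (hX : MemRt P ℱ t X) {C : ℝ} (hC : ∀ s, ∀ᵐ ω ∂P, |X s ω| ≤ C) :
    ∀ᵐ ω ∂P, |ρ X ω| ≤ C := by
  have hc : ∀ c : ℝ, MemLinf P (ℱ t) fun _ => c := MemLinf.const P (ℱ t)
  have h1 := hρ.mono X _ hX (hc C).memRt_cashFrom fun s => by
    by_cases hs : t ≤ s
    · filter_upwards [hC s] with ω h
      simpa [cashFrom, hs] using (_root_.abs_le.1 h).2
    · refine Eventually.of_forall fun ω => ?_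
      simp [cashFrom, hs, hX.eq_zero s (not_le.1 hs)]
  have h2 := hρ.mono _ X (hc (-C)).memRt_cashFrom hX fun s => by
    by_cases hs : t ≤ s
    · filter_upwards [hC s] with ω h
      simpa [cashFrom, hs] using (_root_.abs_le.1 h).1
    · refine Eventually.of_forall fun ω => ?_
      simp [cashFrom, hs, hX.eq_zero s (not_le.1 hs)]
  filter_upwards [h1, h2, hρ.apply_cashFrom (hc C), hρ.apply_cashFrom (hc (-C))] with ω h3 h4 h5 h6
  rw [h5] at h3
  rw [h6] at h4
  exact _root_.abs_le.2 ⟨h3, by linarith⟩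

theorem integrable (hρ : IsCondConvexRisk P ℱ t ρ) [IsFiniteMeasure P] (hX : MemRt P ℱ t X) : Integrable (ρ X) P := by
  obtain ⟨C, hC⟩ := (hρ.memLinf X hX).bounded
  exact Integrable.of_bound
    ((hρ.memLinf X hX).measurable.mono (ℱ.le t) le_rfl).aestronglyMeasurable C hC

/-- The expected risk is closed under bounded pointwise convergence. -/
theorem integral_nonpos_of_tendsto (hρ : IsCondConvexRisk P ℱ t ρ) [IsFiniteMeasure P]
    (hcont : ContFromAbove P ℱ t ρ)
    {Yn : ℕ → H.Time → Ω → ℝ} {R : ℝ} (hR : 0 ≤ R) (hYn : ∀ n, MemRt P ℱ t (Yn n))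
    (hb : ∀ n s, ∀ᵐ ω ∂P, |Yn n s ω| ≤ R) (hle : ∀ n, ∫ ω, ρ (Yn n) ω ∂P ≤ 0) :
    ∃ Y, MemRt P ℱ t Y ∧ ∫ ω, ρ Y ω ∂P ≤ 0 ∧
      ∀ s ω, (∀ n, |Yn n s ω| ≤ R) → ∀ l, Tendsto (fun n => Yn n s ω) atTop (𝓝 l) → Y s ω = l := by
  -- Clamping to `[-R, R]` changes the processes only on null sets and makes all suprema and infima
  -- finite everywhere.
  let K : ℕ → H.Time → Ω → ℝ := fun n s ω => max (-R) (min R (Yn n s ω))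
  have hK : ∀ n s ω, K n s ω ∈ Set.Icc (-R) R := fun n s ω =>
    ⟨le_max_left _ _, max_le (by linarith) (min_le_left _ _)⟩
  have hKeq : ∀ n s ω, |Yn n s ω| ≤ R → K n s ω = Yn n s ω := fun n s ω h => by
    rw [_root_.abs_le] at h
    simp only [K]
    rw [min_eq_right h.2, max_eq_right h.1]
  have hKm : ∀ n s, Measurable[ℱ s] (K n s) := fun n s =>
    Measurable.max measurable_const (Measurable.min measurable_const ((hYn n).memR.adapted s))
  -- The tail suprema decrease to the limit superior, so continuity from above applies to them; they
  -- dominate the given processes, so their expected risk is nonpositive.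
  let V : ℕ → H.Time → Ω → ℝ := fun n s ω => ⨆ k, K (n + k) s ω
  have hbdd : ∀ n s ω, BddAbove (Set.range fun k => K (n + k) s ω) := fun n s ω =>
    ⟨R, by rintro _ ⟨k, rfl⟩; exact (hK _ s ω).2⟩
  have hV : ∀ n s ω, V n s ω ∈ Set.Icc (-R) R := fun n s ω =>
    ⟨(hK _ s ω).1.trans (le_ciSup (hbdd n s ω) 0), ciSup_le fun k => (hK _ s ω).2⟩
  have hVanti : ∀ s ω, Antitone fun n => V n s ω := fun s ω =>
    antitone_nat_of_succ_le fun n => ciSup_le fun k => by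
      have := le_ciSup (hbdd n s ω) (k + 1)
      simpa [add_assoc, add_comm 1 k] using this
  have hVbdd : ∀ s ω, BddBelow (Set.range fun n => V n s ω) := fun s ω =>
    ⟨-R, by rintro _ ⟨k, rfl⟩; exact (hV _ s ω).1⟩
  let Y : H.Time → Ω → ℝ := fun s ω => ⨅ n, V n s ω
  have hVY : ∀ s ω, Tendsto (fun n => V n s ω) atTop (𝓝 (Y s ω)) := fun s ω =>
    tendsto_atTop_ciInf (hVanti s ω) (hVbdd s ω)
  have hY : ∀ s ω, Y s ω ∈ Set.Icc (-R) R := fun s ω =>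
    isClosed_Icc.mem_of_tendsto (hVY s ω) (Eventually.of_forall fun n => hV n s ω)
  have hVm : ∀ n s, Measurable[ℱ s] (V n s) := fun n s => Measurable.iSup fun k => hKm _ s
  have hYm : ∀ s, Measurable[ℱ s] (Y s) := fun s => Measurable.iInf fun n => hVm n s
  have hK0 : ∀ n, ∀ s < t, K n s = 0 := fun n s hs => by
    funext ω; simp [K, (hYn n).eq_zero s hs, hR]
  have hV0 : ∀ n, ∀ s < t, V n s = 0 := fun n s hs => by
    funext ω; simp [V, hK0 _ s hs]
  have hY0 : ∀ s < t, Y s = 0 := fun s hs => by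
    funext ω; simp [Y, hV0 _ s hs]
  have hVR : ∀ n, MemRt P ℱ t (V n) := fun n =>
    ⟨⟨hVm n, R, Eventually.of_forall fun ω s => _root_.abs_le.2 (hV n s ω)⟩, hV0 n⟩
  have hYR : MemRt P ℱ t Y :=
    ⟨⟨hYm, R, Eventually.of_forall fun ω s => _root_.abs_le.2 (hY s ω)⟩, hY0⟩
  have hlim := hcont V Y (fun n => (hVR n).memR) hYR.memR fun s _ =>
    Eventually.of_forall fun ω => ⟨hVanti s ω, hVY s ω⟩
  have hlim' : ∀ᵐ ω ∂P, Tendsto (fun n => ρ (V n) ω) atTop (𝓝 (ρ Y ω)) := by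
    filter_upwards [hlim] with ω h
    have h2 := h.2
    rw [proj_eq_self hYR.eq_zero] at h2
    simpa only [proj_eq_self (hV0 _)] using h2
  refine ⟨Y, hYR, ?_, fun s ω h l hl => ?_⟩
  · refine le_of_tendsto' (tendsto_integral_of_dominated_convergence (fun _ => R)
      (fun n => (hρ.integrable (hVR n)).1) (integrable_const R)
      (fun n => hρ.abs_le (hVR n) fun s => Eventually.of_forall fun ω =>
        _root_.abs_le.2 (hV n s ω)) hlim') fun n => ?_
    refine (integral_mono_ae (hρ.integrable (hVR n)) (hρ.integrable (hYn n)) ?_).trans (hle n)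
    refine hρ.mono _ _ (hYn n) (hVR n) fun s => ?_
    filter_upwards [hb n s] with ω h
    rw [← hKeq n s ω h]
    exact le_ciSup (hbdd n s ω) 0
  · have h1 : ∀ n, K n s ω = Yn n s ω := fun n => hKeq n s ω (h n)
    refine tendsto_nhds_unique (hVY s ω) ?_
    rw [Metric.tendsto_atTop] at hl ⊢
    intro ε hε
    obtain ⟨M, hM⟩ := hl (ε / 2) (half_pos hε)
    refine ⟨M, fun n hn => lt_of_le_of_lt ?_ (half_lt_self hε)⟩
    rw [Real.dist_eq, _root_.abs_le]
    have h2 : ∀ k, l - ε / 2 ≤ K (n + k) s ω ∧ K (n + k) s ω ≤ l + ε / 2 := fun k => by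
      have h3 := (hM (n + k) (by omega)).le
      rw [Real.dist_eq, _root_.abs_le] at h3
      rw [h1]
      constructor <;> linarith
    constructor
    · linarith [(h2 0).1, le_ciSup (hbdd n s ω) 0]
    · linarith [ciSup_le fun k => (h2 k).2]

end IsCondConvexRisk

end RiskBasics

end RiskProc


namespace RiskProc

/-! ### Separation of the acceptance region on the optional σ-field -/

section Separation

variable {Ω : Type*} {mΩ : MeasurableSpace Ω} {H : Horizon} {ℱ : Filtration H.Time mΩ}
  {P : Measure Ω} {t : H.Time} {ρ : (H.Time → Ω → ℝ) → Ω → ℝ} {X Y μ : H.Time → Ω → ℝ}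

theorem IsReference.isProbabilityMeasure [IsProbabilityMeasure P] (hμ : IsReference P ℱ μ) :
    IsProbabilityMeasure (optProd ℱ P μ) := by
  constructor
  rw [optProd_apply hμ.adapted MeasurableSet.univ]
  simp only [Set.mem_univ, Set.ofPred_true, Measure.restrict_univ]
  rw [← lintegral_tsum fun s => ((hμ.adapted s).mono (ℱ.le s) le_rfl).ennreal_ofReal.aemeasurable]
  have : ∀ᵐ ω ∂P, ∑' s, ENNReal.ofReal (μ s ω) = 1 := by
    filter_upwards [hμ.pos, hμ.hasSum] with ω h1 h2
    rw [← ENNReal.ofReal_tsum_of_nonneg (fun s => (h1 s).le) h2.summable, h2.tsum_eq,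
      ENNReal.ofReal_one]
  rw [lintegral_congr_ae this, lintegral_one, measure_univ]

theorem IsReference.isWeight [IsProbabilityMeasure P] (hμ : IsReference P ℱ μ) :
    IsWeight ℱ P μ :=
  ⟨hμ.adapted, hμ.pos.mono fun _ h s => (h s).le,
    by have := hμ.isProbabilityMeasure; infer_instance⟩

/-- Since the reference weights are positive at every time, each time section of a null set is null.
-/
theorem IsReference.ae_of_ae_optProd (hμ : IsReference P ℱ μ) {q : OptSpace ℱ → Prop}
    (h : ∀ᵐ p ∂optProd ℱ P μ, q p) (s : H.Time) : ∀ᵐ ω ∂P, q ⟨ω, s⟩ := by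
  obtain ⟨B, hsub, hB, hB0⟩ := exists_measurable_superset_of_null (ae_iff.1 h)
  have h1 : ∀ᵐ p ∂optProd ℱ P μ, p ∈ Bᶜ := compl_mem_ae_iff.2 hB0
  filter_upwards [(ae_optProd_iff hμ.adapted (p := fun p => p ∈ Bᶜ) hB.compl).1 h1 s, hμ.pos]
    with ω h2 h3
  by_contra hc
  exact h2 (h3 s) (hsub hc)

/-- Multiplying weights by an optional density. -/
theorem optProd_mul {μ : H.Time → Ω → ℝ} (hμ : ∀ s, Measurable[ℱ s] (μ s))
    {W : OptSpace ℱ → ℝ} (hW : Measurable W) (hW0 : ∀ p, 0 ≤ W p) :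
    optProd ℱ P (fun s ω => μ s ω * W ⟨ω, s⟩) =
      (optProd ℱ P μ).withDensity fun p => ENNReal.ofReal (W p) := by
  ext B hB
  have hN : ∀ s, Measurable[ℱ s] fun ω => μ s ω * W ⟨ω, s⟩ := fun s =>
    (hμ s).mul (measurable_optSpace_iff.1 hW s)
  rw [withDensity_apply _ hB, ← lintegral_indicator hB,
    lintegral_optProd hμ (hW.ennreal_ofReal.indicator hB), optProd_apply hN hB]
  congr 1
  funext s
  rw [← lintegral_indicator (ℱ.le s _ (measurableSet_optSpace_iff.1 hB s))]
  refine lintegral_congr fun ω => ?_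
  by_cases h : (⟨ω, s⟩ : OptSpace ℱ) ∈ B
  · rw [Set.indicator_of_mem (show ω ∈ {ω | (⟨ω, s⟩ : OptSpace ℱ) ∈ B} from h),
      Set.indicator_of_mem h, ENNReal.ofReal_mul' (hW0 _)]
  · rw [Set.indicator_of_notMem (show ω ∉ {ω | (⟨ω, s⟩ : OptSpace ℱ) ∈ B} from h),
      Set.indicator_of_notMem h, mul_zero]

theorem IsReference.isWeight_mul [IsProbabilityMeasure P] (hμ : IsReference P ℱ μ)
    {W : OptSpace ℱ → ℝ} (hW : Measurable W) (hW0 : ∀ p, 0 ≤ W p)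
    (hWi : Integrable W (optProd ℱ P μ)) : IsWeight ℱ P fun s ω => μ s ω * W ⟨ω, s⟩ := by
  refine ⟨fun s => (hμ.adapted s).mul (measurable_optSpace_iff.1 hW s), ?_, ?_⟩
  · filter_upwards [hμ.pos] with ω h s using mul_nonneg (h s).le (hW0 _)
  · rw [optProd_mul hμ.adapted hW hW0]
    exact isFiniteMeasure_withDensity_ofReal hWi.2

theorem IsReference.memLp [IsProbabilityMeasure P] (hμ : IsReference P ℱ μ) (hX : MemR P ℱ X) :
    MemLp (fun p : OptSpace ℱ => X p.time p.outcome) 2 (optProd ℱ P μ) := by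
  have := hμ.isProbabilityMeasure
  have h := hX.isBddProc hμ.adapted
  obtain ⟨C, hC⟩ := h.bounded
  exact MemLp.of_bound h.measurable.aestronglyMeasurable C hC

/-- A process with positive expected risk is strictly separated from the acceptance set. -/
theorem exists_optional_separating [IsProbabilityMeasure P] (hμ : IsReference P ℱ μ)
    (hρ : IsCondConvexRisk P ℱ t ρ) (hcont : ContFromAbove P ℱ t ρ) (hX : MemRt P ℱ t X)
    (hpos : 0 < ∫ ω, ρ X ω ∂P) :
    ∃ Z : OptSpace ℱ → ℝ, Measurable Z ∧ Integrable Z (optProd ℱ P μ) ∧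
      ∀ Y, MemRt P ℱ t Y → ∫ ω, ρ Y ω ∂P ≤ 0 →
        1 ≤ ∫ p, Z p * (Y p.time p.outcome - X p.time p.outcome) ∂optProd ℱ P μ := by
  have := hμ.isProbabilityMeasure
  set ν := optProd ℱ P μ with hν
  obtain ⟨c, hc⟩ := (hX.memR.isBddProc hμ.adapted).bounded
  -- The region of nonpositive expected risk, translated by `-X`, so that the point to be separated
  -- is `0`.
  let C : Set (Lp ℝ 2 ν) := {f | ∃ Y, MemRt P ℱ t Y ∧ ∫ ω, ρ Y ω ∂P ≤ 0 ∧
    ∀ᵐ p ∂ν, f p = Y p.time p.outcome - X p.time p.outcome}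
  have hconv : Convex ℝ C := by
    rintro f ⟨Y, hY, hYρ, hf⟩ g ⟨Y', hY', hYρ', hg⟩ a b ha hb hab
    have hb' : b = 1 - a := by linarith
    subst hb'
    have hl := MemLinf.const P (ℱ t) a
    refine ⟨_, MemRt.combine hl hY hY', ?_, ?_⟩
    · refine (integral_mono_ae (hρ.integrable (MemRt.combine hl hY hY'))
        (((hρ.integrable hY).const_mul a).add ((hρ.integrable hY').const_mul (1 - a)))
        (hρ.convex Y Y' _ hY hY' hl (Eventually.of_forall fun _ => ⟨ha, by linarith⟩))).trans ?_
      rw [integral_add' ((hρ.integrable hY).const_mul a) ((hρ.integrable hY').const_mul (1 - a)),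
        integral_const_mul, integral_const_mul]
      nlinarith
    · filter_upwards [hf, hg, Lp.coeFn_add (a • f) ((1 - a) • g), Lp.coeFn_smul a f,
        Lp.coeFn_smul (1 - a) g] with p h1 h2 h3 h4 h5
      rw [h3, Pi.add_apply, h4, h5, Pi.smul_apply, Pi.smul_apply, h1, h2, smul_eq_mul, smul_eq_mul]
      ring
  have hcl : ∀ r, 0 < r → IsClosed (C ∩ {f | ∀ᵐ p ∂ν, |f p| ≤ r}) := by
    intro r hr
    refine IsSeqClosed.isClosed fun f g hf hfg => ?_
    have hball : IsClosed {f : Lp ℝ 2 ν | ∀ᵐ p ∂ν, |f p| ≤ r} := by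
      have : {f : Lp ℝ 2 ν | ∀ᵐ p ∂ν, |f p| ≤ r} = dualBall (l1Seminorm ν) r :=
        Set.ext fun f => (mem_dualBall_l1Seminorm ν f).symm
      rw [this]
      simp only [dualBall, Set.ofPred_forall]
      exact isClosed_iInter fun x => isClosed_le (by fun_prop) continuous_const
    refine ⟨?_, hball.mem_of_tendsto hfg (Eventually.of_forall fun n => (hf n).2)⟩
    -- An almost surely convergent subsequence is bounded after adding back `X`, and bounded limits
    -- keep nonpositive expected risk.
    obtain ⟨φ, -, hφ⟩ := (tendstoInMeasure_of_tendsto_Lp hfg).exists_seq_tendsto_ae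
    choose Yn hYn hYρ hYf using fun n => (hf (φ n)).1
    have hae : ∀ᵐ p ∂ν, ∀ n, |Yn n p.time p.outcome| ≤ r + |c| := by
      filter_upwards [ae_all_iff.2 hYf, ae_all_iff.2 fun n => (hf (φ n)).2, hc] with p h1 h2 h3 n
      have h4 : Yn n p.time p.outcome = f (φ n) p + X p.time p.outcome := by rw [h1]; ring
      rw [h4]
      exact (abs_add_le _ _).trans (add_le_add (h2 n) (h3.trans (le_abs_self c)))
    obtain ⟨Y, hY, hYρ', hYlim⟩ := hρ.integral_nonpos_of_tendsto hcont
      (by positivity : 0 ≤ r + |c|) hYn (fun n s => by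
        filter_upwards [hμ.ae_of_ae_optProd hae s] with ω h using h n) hYρ
    refine ⟨Y, hY, hYρ', ?_⟩
    filter_upwards [hae, hφ, ae_all_iff.2 hYf] with p h1 h2 h3
    have h4 := hYlim p.time p.outcome h1 (g p + X p.time p.outcome) (by
      refine (h2.add_const (X p.time p.outcome)).congr fun n => ?_
      rw [h3]; ring)
    rw [h4]; ring
  have h0 : (0 : Lp ℝ 2 ν) ∉ C := by
    rintro ⟨Y, hY, hYρ, h0⟩
    -- If `0` were in `C`, then `X` would agree with a process of nonpositive expected risk at all
    -- times.
    have h1 : ∀ s, Y s =ᵐ[P] X s := fun s => by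
      have h2 : ∀ᵐ p ∂ν, Y p.time p.outcome = X p.time p.outcome := by
        filter_upwards [h0, Lp.coeFn_zero ℝ 2 ν] with p h2 h3
        rw [h3, Pi.zero_apply] at h2
        linarith
      exact hμ.ae_of_ae_optProd h2 s
    rw [integral_congr_ae (hρ.congr hY hX h1)] at hYρ
    exact absurd hYρ (not_le.2 hpos)
  obtain ⟨Z, hZm, hZi, hZ⟩ := exists_integrable_separating ν hconv hcl h0
  refine ⟨Z, hZm, hZi, fun Y hY hYρ => ?_⟩
  have hmem := (hμ.memLp hY.memR).sub (hμ.memLp hX.memR)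
  obtain ⟨c', hc'⟩ := (hY.memR.isBddProc hμ.adapted).bounded
  have hcoe := hmem.coeFn_toLp
  have h1 := hZ (hmem.toLp _) ⟨Y, hY, hYρ, hcoe⟩ (c' + c) (by
    filter_upwards [hcoe, hc, hc'] with p h1 h2 h3
    rw [h1]
    exact (abs_sub _ _).trans (add_le_add h3 h2))
  refine h1.trans_eq (integral_congr_ae ?_)
  filter_upwards [hcoe] with p h
  rw [h]
  rfl

end Separation

end RiskProc


namespace RiskProc

/-! ### Normalizing the separating function to a density process -/

section SeparatingWeight

variable {Ω : Type*} {mΩ : MeasurableSpace Ω} {H : Horizon} {ℱ : Filtration H.Time mΩ}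
  {P : Measure Ω} {t : H.Time} {ρ : (H.Time → Ω → ℝ) → Ω → ℝ} {X Y μ N : H.Time → Ω → ℝ}

theorem integrable_condLoss (t : H.Time) (P : Measure Ω) (N X : H.Time → Ω → ℝ) :
    Integrable (condLoss ℱ t P N X) P := integrable_condExp

theorem integral_condLoss [IsFiniteMeasure P] (hN : IsWeight ℱ P N)
    (hX : IsBddProc ℱ (optProd ℱ P N) X) :
    ∫ ω, condLoss ℱ t P N X ω ∂P =
      -∫ p in rect ℱ Set.univ (Set.Ici t), X p.time p.outcome ∂optProd ℱ P N := by
  rw [← hN.setIntegral_condLoss hX MeasurableSet.univ, Measure.restrict_univ]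

theorem massFrom_eq_one [IsProbabilityMeasure P] (hN : IsWeight ℱ P N)
    (h : ∀ A, MeasurableSet[ℱ t] A → (optProd ℱ P N).real (rect ℱ A (Set.Ici t)) = P.real A) :
    massFrom ℱ t P N =ᵐ[P] 1 := by
  refine (ae_eq_condExp_of_forall_setIntegral_eq (ℱ.le t)
    (hN.integrable_sumFrom (IsBddProc.one _) t)
    (fun _ _ _ => (integrable_const (1 : ℝ)).integrableOn) (fun A hA _ => ?_)
    (@stronglyMeasurable_const _ _ (ℱ t) _ (1 : ℝ)).aestronglyMeasurable).symm
  rw [hN.setIntegral_sumFrom (IsBddProc.one _) hA]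
  simp only [Pi.one_apply, setIntegral_const, smul_eq_mul, mul_one]
  rw [h A hA]

/-- A density process which almost attains the expected risk. -/
theorem exists_weight_separating [IsProbabilityMeasure P] (hμ : IsReference P ℱ μ)
    (hρ : IsCondConvexRisk P ℱ t ρ) (hcont : ContFromAbove P ℱ t ρ) (hX : MemRt P ℱ t X)
    {ε : ℝ} (hε : 0 < ε) :
    ∃ N, IsWeight ℱ P N ∧ (∀ s < t, N s = 0) ∧ massFrom ℱ t P N =ᵐ[P] 1 ∧
      ∀ Y, MemRt P ℱ t Y → ∫ ω, ρ Y ω ∂P ≤ 0 →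
        ∫ ω, condLoss ℱ t P N Y ω ∂P ≤
          ∫ ω, condLoss ℱ t P N X ω ∂P - ∫ ω, ρ X ω ∂P + ε := by
  have := hμ.isProbabilityMeasure
  set ν := optProd ℱ P μ with hν
  -- The shift is chosen so that `X + c₀` has expected risk exactly `ε > 0` and can be separated.
  set c₀ : ℝ := ∫ ω, ρ X ω ∂P - ε with hc₀
  have hmc := MemLinf.const P (ℱ t) c₀
  have hX' : MemRt P ℱ t (X + cashFrom t fun _ => c₀) := hX.add hmc.memRt_cashFrom
  have hpos : ∫ ω, ρ (X + cashFrom t fun _ => c₀) ω ∂P = ε := by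
    rw [integral_congr_ae (hρ.cash X _ hX hmc), integral_sub' (hρ.integrable hX)
      (integrable_const c₀)]
    simp [hc₀]
  obtain ⟨Z, hZm, hZi, hZ⟩ := exists_optional_separating hμ hρ hcont hX' (by rw [hpos]; exact hε)
  set X' := X + cashFrom t fun _ => c₀ with hX'def
  let z : (H.Time → Ω → ℝ) → ℝ := fun Y => ∫ p, Z p * Y p.time p.outcome ∂ν
  have hzint : ∀ Y, MemRt P ℱ t Y → Integrable (fun p : OptSpace ℱ => Z p * Y p.time p.outcome) ν := by
    intro Y hY
    obtain ⟨C, hC⟩ := (hY.memR.isBddProc hμ.adapted).bounded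
    exact (integral_mul_abs_le ν hZi
      (hY.memR.isBddProc hμ.adapted).measurable.aestronglyMeasurable hC).1
  have hz : ∀ Y, MemRt P ℱ t Y → ∫ ω, ρ Y ω ∂P ≤ 0 → z X' + 1 ≤ z Y := by
    intro Y hY h
    have h1 := hZ Y hY h
    simp only [mul_sub] at h1
    rw [integral_sub (hzint Y hY) (hzint X' hX')] at h1
    simp only [z]
    linarith
  -- A linear functional bounded below on the multiples `n Y` is nonnegative at `Y`.
  have hscale : ∀ Y, MemRt P ℱ t Y → (∀ n : ℕ, ∫ ω, ρ (fun s ω => (n : ℝ) * Y s ω) ω ∂P ≤ 0) →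
      0 ≤ z Y := by
    intro Y hY h
    by_contra! hc
    obtain ⟨n, hn⟩ := exists_nat_gt ((z X' + 1) / z Y)
    have h1 := hz _ (hY.smul n) (h n)
    have h2 : z (fun s ω => (n : ℝ) * Y s ω) = n * z Y := by
      simp only [z]
      rw [← integral_const_mul]
      congr 1
      funext p
      ring
    rw [h2] at h1
    rw [div_lt_iff_of_neg hc] at hn
    linarith
  have hnonneg : ∀ Y, MemRt P ℱ t Y → (∀ s ω, 0 ≤ Y s ω) → 0 ≤ z Y := by
    intro Y hY h0
    refine hscale Y hY fun n => ?_
    have h1 := hρ.mono 0 _ MemRt.zero (hY.smul n) fun s =>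
      Eventually.of_forall fun ω => mul_nonneg (Nat.cast_nonneg n) (h0 s ω)
    refine integral_nonpos_of_ae ?_
    filter_upwards [h1, hρ.normalized] with ω h2 h3
    rw [h3] at h2
    exact h2
  -- `Z` is nonnegative from time `t` on
  have hIci : MeasurableSet (rect ℱ Set.univ (Set.Ici t)) :=
    measurableSet_rect_Ici MeasurableSet.univ
  have hZ0 : ∀ᵐ p ∂ν, p.time ∈ Set.Ici t → 0 ≤ Z p := by
    -- The indicator of the set where `Z` is negative is a nonnegative process, so its pairing with
    -- `Z` is both nonnegative and nonpositive.
    set B : Set (OptSpace ℱ) := rect ℱ Set.univ (Set.Ici t) ∩ {p | Z p < 0} with hB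
    have hBm : MeasurableSet B := hIci.inter (measurableSet_lt hZm measurable_const)
    have hind : Measurable (B.indicator fun _ => (1 : ℝ)) := measurable_const.indicator hBm
    have hY : MemRt P ℱ t fun s ω => B.indicator (fun _ => (1 : ℝ)) ⟨ω, s⟩ := by
      refine ⟨⟨measurable_optSpace_iff.1 hind, 1, Eventually.of_forall fun ω s => ?_⟩,
        fun s hs => ?_⟩
      · by_cases h : (⟨ω, s⟩ : OptSpace ℱ) ∈ B <;> simp [h]
      · funext ω
        exact Set.indicator_of_notMem (fun h => (not_le.2 hs) h.1.2) _
    have h1 := hnonneg _ hY fun s ω => Set.indicator_nonneg (fun _ _ => zero_le_one) _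
    have h2 : ∀ p, Z p * B.indicator (fun _ => (1 : ℝ)) p ≤ 0 := fun p => by
      by_cases h : p ∈ B
      · simpa [h] using h.2.le
      · simp [h]
    have h3 : ∫ p, -(Z p * B.indicator (fun _ => (1 : ℝ)) p) ∂ν = 0 := by
      rw [integral_neg]
      have h4 : ∫ p, Z p * B.indicator (fun _ => (1 : ℝ)) p ∂ν ≤ 0 := integral_nonpos h2
      simp only [z] at h1
      linarith
    rw [integral_eq_zero_iff_of_nonneg (fun p => neg_nonneg.2 (h2 p)) (hzint _ hY).neg] at h3
    filter_upwards [h3] with p h4 h5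
    by_contra! hc
    have h6 : p ∈ B := ⟨⟨trivial, h5⟩, hc⟩
    simp only [Set.indicator_of_mem h6, Pi.zero_apply] at h4
    linarith
  -- the total mass is constant
  have hcash : ∀ A, MeasurableSet[ℱ t] A → ∀ p : OptSpace ℱ,
      Z p * cashFrom t (A.indicator 1) p.time p.outcome =
        (rect ℱ A (Set.Ici t)).indicator Z p := by
    intro A _ p
    by_cases h1 : p.outcome ∈ A <;> by_cases h2 : t ≤ p.time <;>
      simp [cashFrom, Set.indicator, rect, h1, h2]
  have hA1 : ∀ A, MeasurableSet[ℱ t] A → MemLinf P (ℱ t) (A.indicator 1) := fun A hA =>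
    ⟨(@measurable_const _ _ _ (ℱ t) (1 : ℝ)).indicator hA, 1, Eventually.of_forall fun ω => by
      by_cases h : ω ∈ A <;> simp [h]⟩
  have hmass : ∀ A, MeasurableSet[ℱ t] A →
      ∫ p in rect ℱ A (Set.Ici t), Z p ∂ν =
        P.real A * ∫ p in rect ℱ Set.univ (Set.Ici t), Z p ∂ν := by
    intro A hA
    have hzA : ∀ A, MeasurableSet[ℱ t] A →
        z (cashFrom t (A.indicator 1)) = ∫ p in rect ℱ A (Set.Ici t), Z p ∂ν := fun A hA => by
      rw [← integral_indicator (measurableSet_rect_Ici hA)]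
      exact integral_congr_ae (Eventually.of_forall (hcash A hA))
    -- Cash `a (1_A - P(A))` has mean zero, hence expected risk zero for every real `a` of either
    -- sign. So `Z` pairs with it to zero, which is the claim that the mass of `Z` on `A × 𝕋_t` is
    -- proportional to `P(A)`.
    have hm : ∀ a : ℝ, MemLinf P (ℱ t) fun ω => a * (A.indicator 1 ω - P.real A) := fun a =>
      ⟨((hA1 A hA).measurable.sub_const _).const_mul a, |a| * (1 + |P.real A|),
        Eventually.of_forall fun ω => by
          rw [abs_mul]
          refine mul_le_mul_of_nonneg_left ((abs_sub _ _).trans (add_le_add ?_ le_rfl))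
            (abs_nonneg a)
          by_cases h : ω ∈ A <;> simp [h]⟩
    have hint0 : ∀ a : ℝ, ∫ ω, a * (A.indicator (1 : Ω → ℝ) ω - P.real A) ∂P = 0 := fun a => by
      have h1 : Integrable (A.indicator (1 : Ω → ℝ)) P :=
        (integrable_const (1 : ℝ)).indicator (ℱ.le t _ hA)
      rw [integral_const_mul, integral_sub h1 (integrable_const _),
        integral_indicator_one (ℱ.le t _ hA)]
      simp
    have hza : ∀ a : ℝ, z (cashFrom t fun ω => a * (A.indicator 1 ω - P.real A)) =
        a * (z (cashFrom t (A.indicator 1)) - P.real A * z (cashFrom t (Set.univ.indicator 1))) := by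
      intro a
      simp only [z]
      rw [← integral_const_mul, ← integral_sub (hzint _ (hA1 A hA).memRt_cashFrom)
        ((hzint _ (hA1 _ MeasurableSet.univ).memRt_cashFrom).const_mul _), ← integral_const_mul]
      congr 1
      funext p
      by_cases h2 : t ≤ p.time
      · simp only [cashFrom, h2, if_true, Set.indicator_univ, Pi.one_apply]; ring
      · simp [cashFrom, h2]
    have h0 : ∀ a : ℝ, 0 ≤ a *
        (z (cashFrom t (A.indicator 1)) - P.real A * z (cashFrom t (Set.univ.indicator 1))) := by
      intro a
      rw [← hza]
      refine hscale _ (hm a).memRt_cashFrom fun n => ?_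
      have h1 : (fun s ω => (n : ℝ) * cashFrom t (fun ω => a * (A.indicator 1 ω - P.real A)) s ω) =
          cashFrom t fun ω => (n * a) * (A.indicator 1 ω - P.real A) := by
        funext s ω
        by_cases h2 : t ≤ s <;> simp [cashFrom, h2, mul_assoc]
      rw [h1, integral_congr_ae (hρ.apply_cashFrom (hm _)), integral_neg, hint0, neg_zero]
    have h1 := h0 1
    have h2 := h0 (-1)
    rw [← hzA A hA, ← hzA _ MeasurableSet.univ]
    linarith
  set c : ℝ := ∫ p in rect ℱ Set.univ (Set.Ici t), Z p ∂ν with hc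
  have hZ0' : 0 ≤ᵐ[ν.restrict (rect ℱ Set.univ (Set.Ici t))] Z := by
    refine (ae_restrict_iff' hIci).2 ?_
    filter_upwards [hZ0] with p h1 h2 using h1 h2.2
  have hzout : ∀ Y, MemRt P ℱ t Y → z Y =
      ∫ p in rect ℱ Set.univ (Set.Ici t), Z p * Y p.time p.outcome ∂ν := by
    intro Y hY
    symm
    refine setIntegral_eq_integral_of_forall_compl_eq_zero fun p hp => ?_
    rw [hY.eq_zero p.time (not_le.1 fun h => hp ⟨trivial, h⟩), Pi.zero_apply, mul_zero]
  have hcpos : 0 < c := by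
    -- If the total mass were zero, `Z` would vanish from `t` on and could not separate the process
    -- `0` from `X'`.
    refine lt_of_le_of_ne (integral_nonneg_of_ae hZ0') fun h0 => ?_
    have h1 := (integral_eq_zero_iff_of_nonneg_ae hZ0' hZi.integrableOn).1 h0.symm
    have h2 : ∀ Y, MemRt P ℱ t Y → z Y = 0 := fun Y hY => by
      rw [hzout Y hY]
      refine integral_eq_zero_of_ae ?_
      filter_upwards [h1] with p h
      simp [h]
    have h3 := hz 0 MemRt.zero (by
      rw [integral_congr_ae hρ.normalized]; simp)
    rw [h2 _ hX', h2 _ MemRt.zero] at h3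
    linarith
  -- the normalized density
  set W : OptSpace ℱ → ℝ := (rect ℱ Set.univ (Set.Ici t)).indicator fun p => max (Z p) 0 / c
    with hW
  have hWm : Measurable W := ((hZm.max measurable_const).div_const c).indicator hIci
  have hW0 : ∀ p, 0 ≤ W p := fun p =>
    Set.indicator_nonneg (fun p _ => div_nonneg (le_max_right _ _) hcpos.le) p
  have hWi : Integrable W ν := (hZi.pos_part.div_const c).indicator hIci
  have hN := hμ.isWeight_mul hWm hW0 hWi
  have key : ∀ A, MeasurableSet[ℱ t] A → ∀ Y : H.Time → Ω → ℝ,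
      ∫ p in rect ℱ A (Set.Ici t), Y p.time p.outcome
        ∂optProd ℱ P (fun s ω => μ s ω * W ⟨ω, s⟩) =
      c⁻¹ * ∫ p in rect ℱ A (Set.Ici t), Z p * Y p.time p.outcome ∂ν := by
    intro A hA Y
    rw [optProd_mul hμ.adapted hWm hW0, setIntegral_withDensity_eq_setIntegral_toReal_smul
      hWm.ennreal_ofReal (Eventually.of_forall fun _ => ENNReal.ofReal_lt_top) _
      (measurableSet_rect_Ici hA), ← integral_const_mul]
    refine setIntegral_congr_ae (measurableSet_rect_Ici hA) ?_
    filter_upwards [hZ0] with p h1 h2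
    rw [ENNReal.toReal_ofReal (hW0 p), smul_eq_mul, hW,
      Set.indicator_of_mem (show p ∈ rect ℱ Set.univ (Set.Ici t) from ⟨trivial, h2.2⟩),
      max_eq_left (h1 h2.2)]
    ring
  have hmass1 : massFrom ℱ t P (fun s ω => μ s ω * W ⟨ω, s⟩) =ᵐ[P] 1 := by
    refine massFrom_eq_one hN fun A hA => ?_
    have h1 := key A hA 1
    simp only [Pi.one_apply, mul_one, setIntegral_const, smul_eq_mul] at h1
    rw [h1, hmass A hA]
    field_simp
  refine ⟨_, hN, fun s hs => ?_, hmass1, fun Y hY hYρ => ?_⟩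
  · funext ω
    have : W ⟨ω, s⟩ = 0 := Set.indicator_of_notMem (fun h => (not_le.2 hs) h.2) _
    simp [this]
  · have hcl : ∀ Y, MemRt P ℱ t Y →
        ∫ ω, condLoss ℱ t P (fun s ω => μ s ω * W ⟨ω, s⟩) Y ω ∂P = -(c⁻¹ * z Y) := fun Y hY => by
      rw [integral_condLoss hN (hY.memR.isBddProc hN.adapted), key _ MeasurableSet.univ,
        ← hzout Y hY]
    have h1 : ∫ ω, condLoss ℱ t P (fun s ω => μ s ω * W ⟨ω, s⟩) X' ω ∂P =
        ∫ ω, condLoss ℱ t P (fun s ω => μ s ω * W ⟨ω, s⟩) X ω ∂P - c₀ := by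
      have h2 := (condLoss_add (t := t) hN (hX.memR.isBddProc hN.adapted)
        (hmc.memRt_cashFrom.memR.isBddProc hN.adapted))
      rw [integral_congr_ae h2, integral_add' (integrable_condLoss t P _ _)
        (integrable_condLoss t P _ _)]
      have h3 : condLoss ℱ t P (fun s ω => μ s ω * W ⟨ω, s⟩) (cashFrom t fun _ => c₀) =ᵐ[P]
          fun _ => -c₀ := by
        filter_upwards [condLoss_cashFrom hN hmc, hmass1] with ω h4 h5
        rw [h4, h5]; simp
      rw [integral_congr_ae h3]
      simp [sub_eq_add_neg]
    have h2 := hz Y hY hYρ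
    -- The gap `1` in the separation is no longer needed; the shift `c₀` in `X'` produces the terms
    -- `-E[ρ(X)] + ε`.
    have h3 : -(c⁻¹ * z Y) ≤ -(c⁻¹ * z X') :=
      neg_le_neg (mul_le_mul_of_nonneg_left (by linarith) (inv_nonneg.2 hcpos.le))
    rw [← hcl Y hY, ← hcl X' hX', h1] at h3
    rw [hc₀] at h3
    linarith

end SeparatingWeight

end RiskProc


namespace RiskProc

/-! ### The dual representation over density processes -/

section Dual

variable {Ω : Type*} {mΩ : MeasurableSpace Ω} {H : Horizon} {ℱ : Filtration H.Time mΩ}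
  {P : Measure Ω} {t : H.Time} {ρ : (H.Time → Ω → ℝ) → Ω → ℝ} {X Y μ N : H.Time → Ω → ℝ}

/-- Upward directed families of random variables with bounded expectations have a dominating
function with the same bound. -/
theorem exists_lintegral_le_of_directed {ν : Measure Ω} {m : MeasurableSpace Ω} (hm : m ≤ mΩ)
    {S : Set (Ω → ℝ)} (hS : S.Nonempty) (hmeas : ∀ f ∈ S, Measurable[m] f)
    (hdir : ∀ f ∈ S, ∀ g ∈ S, ∃ k ∈ S, ∀ᵐ ω ∂ν, f ω ≤ k ω ∧ g ω ≤ k ω) {K : ℝ≥0∞} (hK : K ≠ ∞)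
    (hle : ∀ f ∈ S, ∫⁻ ω, ENNReal.ofReal (f ω) ∂ν ≤ K) :
    ∃ G : Ω → ℝ≥0∞, Measurable[m] G ∧ (∀ f ∈ S, ∀ᵐ ω ∂ν, ENNReal.ofReal (f ω) ≤ G ω) ∧
      ∫⁻ ω, G ω ∂ν ≤ K := by
  let J : (Ω → ℝ) → ℝ≥0∞ := fun f => ∫⁻ ω, ENNReal.ofReal (f ω) ∂ν
  have hVne : (J '' S).Nonempty := hS.image J
  obtain ⟨u, -, hu, huV⟩ := exists_seq_tendsto_sSup hVne (OrderTop.bddAbove _)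
  choose g hgS hgu using huV
  choose! d hdS hd using hdir
  -- Successive upper bounds turn a maximizing sequence into an increasing one, whose limit attains
  -- the supremum of the integrals.
  let k : ℕ → S := fun n => n.rec ⟨g 0, hgS 0⟩ fun n f => ⟨d f (g (n + 1)), hdS _ f.2 _ (hgS _)⟩
  have hk : ∀ n, ∀ᵐ ω ∂ν, (k n).1 ω ≤ (k (n + 1)).1 ω ∧
      g (n + 1) ω ≤ (k (n + 1)).1 ω := fun n => by
    have h := hd (k n).1 (k n).2 (g (n + 1)) (hgS (n + 1))
    exact h
  have hgk : ∀ n, ∀ᵐ ω ∂ν, g n ω ≤ (k n).1 ω := by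
    rintro (_ | n)
    · exact Eventually.of_forall fun ω => le_rfl
    · exact (hk n).mono fun ω h => h.2
  have hmono : ∀ᵐ ω ∂ν, Monotone fun n => ENNReal.ofReal ((k n).1 ω) := by
    filter_upwards [ae_all_iff.2 hk] with ω h
    exact monotone_nat_of_le_succ fun n => ENNReal.ofReal_le_ofReal (h n).1
  have hmk : ∀ n, Measurable[mΩ] fun ω => ENNReal.ofReal ((k n).1 ω) := fun n =>
    ((hmeas _ (k n).2).mono hm le_rfl).ennreal_ofReal
  let G : Ω → ℝ≥0∞ := fun ω => ⨆ n, ENNReal.ofReal ((k n).1 ω)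
  have hGm : Measurable[m] G := Measurable.iSup fun n => (hmeas _ (k n).2).ennreal_ofReal
  have hG : ∫⁻ ω, G ω ∂ν = ⨆ n, J (k n).1 :=
    lintegral_iSup' (fun n => (hmk n).aemeasurable) hmono
  have hGs : ∫⁻ ω, G ω ∂ν = sSup (J '' S) := by
    refine le_antisymm (hG ▸ iSup_le fun n => le_sSup ⟨_, (k n).2, rfl⟩) ?_
    refine le_of_tendsto' hu fun n => ?_
    rw [← hgu n, hG]
    refine le_trans (lintegral_mono_ae ?_) (le_iSup (fun n => J (k n).1) n)
    filter_upwards [hgk n] with ω h using ENNReal.ofReal_le_ofReal h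
  have hGK : ∫⁻ ω, G ω ∂ν ≤ K := hG ▸ iSup_le fun n => hle _ (k n).2
  refine ⟨G, hGm, fun f hf => ?_, hGK⟩
  -- Each member combined with `k n` is again dominated by a member, so `max f G` has no larger
  -- integral than the maximal `G`; hence they agree almost surely.
  have hmax : ∫⁻ ω, max (ENNReal.ofReal (f ω)) (G ω) ∂ν ≤ ∫⁻ ω, G ω ∂ν := by
    have h1 : ∀ ω, max (ENNReal.ofReal (f ω)) (G ω) =
        ⨆ n, max (ENNReal.ofReal (f ω)) (ENNReal.ofReal ((k n).1 ω)) := fun ω => by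
      rw [← sup_iSup]
    simp only [h1]
    have hmf : Measurable[mΩ] fun ω => ENNReal.ofReal (f ω) :=
      ((hmeas f hf).mono hm le_rfl).ennreal_ofReal
    rw [lintegral_iSup' (fun n => (hmf.max (hmk n)).aemeasurable) (by
      filter_upwards [hmono] with ω h
      exact fun i j hij => max_le_max le_rfl (h hij)), hGs]
    refine iSup_le fun n => ?_
    refine le_trans (lintegral_mono_ae ?_) (le_sSup ⟨_, hdS f hf _ (k n).2, rfl⟩)
    filter_upwards [hd f hf _ (k n).2] with ω h
    exact max_le (ENNReal.ofReal_le_ofReal h.1) (ENNReal.ofReal_le_ofReal h.2)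
  have heq := ae_eq_of_ae_le_of_lintegral_le
    (Eventually.of_forall fun ω => le_max_right (ENNReal.ofReal (f ω)) (G ω))
    (ne_top_of_le_ne_top hK hGK)
    ((((hmeas f hf).mono hm le_rfl).ennreal_ofReal.max (hGm.mono hm le_rfl)).aemeasurable) hmax
  filter_upwards [heq] with ω h
  rw [h]
  exact le_max_left _ _

theorem condLoss_mul [IsProbabilityMeasure P] (hN : IsWeight ℱ P N) (hX : MemRt P ℱ t X)
    {l : Ω → ℝ} (hl : MemLinf P (ℱ t) l) :
    condLoss ℱ t P N (fun s ω => l ω * X s ω) =ᵐ[P] fun ω => l ω * condLoss ℱ t P N X ω := by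
  have h1 : ∀ ω, -sumFrom t N (fun s ω => l ω * X s ω) ω = l ω * -sumFrom t N X ω := fun ω => by
    rw [mul_neg, sumFrom, sumFrom, ← tsum_mul_left]
    congr 1
    refine tsum_congr fun s => ?_
    split_ifs
    · ring
    · simp
  unfold condLoss
  simp only [h1]
  obtain ⟨C, hC⟩ := hl.bounded
  have hi := (hN.integrable_sumFrom (hX.memR.isBddProc hN.adapted) t).neg
  exact condExp_mul_of_stronglyMeasurable_left hl.measurable.stronglyMeasurable
    (hi.bdd_mul (hl.measurable.mono (ℱ.le t) le_rfl).aestronglyMeasurable hC) hi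

theorem MemLinf.one_sub {l : Ω → ℝ} (hl : MemLinf P (ℱ t) l) :
    MemLinf P (ℱ t) fun ω => 1 - l ω := by
  obtain ⟨C, hC⟩ := hl.bounded
  refine ⟨hl.measurable.const_sub 1, 1 + C, hC.mono fun ω h => ?_⟩
  exact (abs_sub _ _).trans (by simpa using h)

theorem MemRt.mul (hX : MemRt P ℱ t X) {l : Ω → ℝ} (hl : MemLinf P (ℱ t) l) :
    MemRt P ℱ t fun s ω => l ω * X s ω := by
  simpa using MemRt.combine hl hX MemRt.zero

theorem condLoss_combine [IsProbabilityMeasure P] (hN : IsWeight ℱ P N) (hX : MemRt P ℱ t X)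
    (hY : MemRt P ℱ t Y) {l : Ω → ℝ} (hl : MemLinf P (ℱ t) l) :
    condLoss ℱ t P N (fun s ω => l ω * X s ω + (1 - l ω) * Y s ω) =ᵐ[P]
      fun ω => l ω * condLoss ℱ t P N X ω + (1 - l ω) * condLoss ℱ t P N Y ω := by
  have h := condLoss_add (t := t) hN ((hX.mul hl).memR.isBddProc hN.adapted)
    ((hY.mul hl.one_sub).memR.isBddProc hN.adapted)
  filter_upwards [h, condLoss_mul hN hX hl, condLoss_mul hN hY hl.one_sub] with ω h1 h2 h3
  refine h1.trans ?_
  rw [Pi.add_apply, h2, h3]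

theorem MemLinf.indicator_one {A : Set Ω} (hA : MeasurableSet[ℱ t] A) :
    MemLinf P (ℱ t) (A.indicator 1) :=
  ⟨(@measurable_const _ _ _ (ℱ t) (1 : ℝ)).indicator hA, 1, Eventually.of_forall fun ω => by
    by_cases h : ω ∈ A <;> simp [h]⟩

/-- The conditional losses of acceptable processes are directed upwards. -/
theorem exists_memAccept_condLoss_le [IsProbabilityMeasure P] (hρ : IsCondConvexRisk P ℱ t ρ)
    (hN : IsWeight ℱ P N) (hX : MemAccept P ℱ t ρ X) (hY : MemAccept P ℱ t ρ Y) :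
    ∃ V, MemAccept P ℱ t ρ V ∧ ∀ᵐ ω ∂P, condLoss ℱ t P N X ω ≤ condLoss ℱ t P N V ω ∧
      condLoss ℱ t P N Y ω ≤ condLoss ℱ t P N V ω := by
  -- Taking `X` on `B` and `Y` off it is a convex combination with an `ℱ_t`-measurable weight;
  -- conditional convexity keeps it acceptable, and its loss is the larger of the two.
  set B : Set Ω := {ω | condLoss ℱ t P N Y ω ≤ condLoss ℱ t P N X ω} with hB
  have hBm : MeasurableSet[ℱ t] B :=
    measurableSet_le (measurable_condLoss t P N Y) (measurable_condLoss t P N X)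
  have hl : MemLinf P (ℱ t) (B.indicator 1) := MemLinf.indicator_one hBm
  have h01 : ∀ ω, (0 : ℝ) ≤ B.indicator 1 ω ∧ B.indicator (1 : Ω → ℝ) ω ≤ 1 := fun ω => by
    by_cases h : ω ∈ B <;> simp [h]
  refine ⟨_, ⟨MemRt.combine hl hX.memRt hY.memRt, ?_⟩, ?_⟩
  · filter_upwards [hρ.convex X Y _ hX.memRt hY.memRt hl (Eventually.of_forall h01), hX.nonpos,
      hY.nonpos] with ω h1 h2 h3
    refine h1.trans ?_
    have h4 := mul_nonpos_of_nonneg_of_nonpos (h01 ω).1 h2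
    have h5 := mul_nonpos_of_nonneg_of_nonpos (sub_nonneg.2 (h01 ω).2) h3
    simp only [Pi.zero_apply] at h4 h5 ⊢
    linarith
  · filter_upwards [condLoss_combine hN hX.memRt hY.memRt hl] with ω h
    simp only [h]
    by_cases hω : ω ∈ B
    · simp only [Set.indicator_of_mem hω, Pi.one_apply, one_mul, sub_self, zero_mul, add_zero]
      exact ⟨le_rfl, hω⟩
    · simp only [Set.indicator_of_notMem hω, zero_mul, sub_zero, one_mul, zero_add]
      exact ⟨(not_le.1 hω).le, le_rfl⟩

/-- Density processes which start at time `t` with unit conditional mass, and whose penalty is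
integrable. -/
structure IsUnitDensity (P : Measure Ω) (ℱ : Filtration H.Time mΩ) (t : H.Time)
    (ρ : (H.Time → Ω → ℝ) → Ω → ℝ) (N : H.Time → Ω → ℝ) : Prop where
  isWeight : IsWeight ℱ P N
  eq_zero : ∀ s < t, N s = 0
  mass : massFrom ℱ t P N =ᵐ[P] 1
  penalty : ∫⁻ ω, (densityPenalty P ℱ t ρ N ω).toENNReal ∂P ≠ ∞

theorem lossRatio_eq_condLoss (h : massFrom ℱ t P N =ᵐ[P] 1) :
    lossRatio P ℱ t N X =ᵐ[P] condLoss ℱ t P N X := by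
  filter_upwards [h] with ω h
  rw [lossRatio, h]
  simp

theorem condLoss_zero (t : H.Time) (P : Measure Ω) (N : H.Time → Ω → ℝ) :
    condLoss ℱ t P N 0 = 0 := by
  have h2 : (fun ω => -sumFrom t N 0 ω) = (0 : Ω → ℝ) := by
    funext ω; simp [sumFrom]
  rw [condLoss, h2, condExp_zero]

/-- The losses of acceptable processes are directed upwards, so a bound on all their expectations is
a bound on the expectation of their essential supremum. -/
theorem lintegral_densityPenalty_le [IsProbabilityMeasure P] (hρ : IsCondConvexRisk P ℱ t ρ)
    (hN : IsWeight ℱ P N) (hmass : massFrom ℱ t P N =ᵐ[P] 1) {K : ℝ}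
    (hK : ∀ Y, MemAccept P ℱ t ρ Y → ∫ ω, condLoss ℱ t P N Y ω ∂P ≤ K) :
    ∫⁻ ω, (densityPenalty P ℱ t ρ N ω).toENNReal ∂P ≤ ENNReal.ofReal K := by
  obtain ⟨G, hGm, hG, hGK⟩ := exists_lintegral_le_of_directed (ν := P) (ℱ.le t)
    (S := {f | ∃ Y, MemAccept P ℱ t ρ Y ∧ f = condLoss ℱ t P N Y}) ⟨_, 0, MemAccept.zero hρ, rfl⟩
    (by rintro f ⟨Y, -, rfl⟩; exact measurable_condLoss t P N Y)
    (by
      rintro f ⟨X, hX, rfl⟩ g ⟨Y, hY, rfl⟩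
      obtain ⟨V, hV, h⟩ := exists_memAccept_condLoss_le hρ hN hX hY
      exact ⟨_, ⟨V, hV, rfl⟩, h⟩) ENNReal.ofReal_ne_top (K := ENNReal.ofReal K)
    (by
      rintro f ⟨Y, hY, rfl⟩
      -- A loss dominating both that of `Y` and that of `0` also dominates the positive part, so its
      -- expectation bounds the nonnegative integral.
      obtain ⟨V, hV, h⟩ := exists_memAccept_condLoss_le hρ hN hY (MemAccept.zero hρ)
      have h0 : 0 ≤ᵐ[P] condLoss ℱ t P N V := by
        filter_upwards [h] with ω h1
        simpa [condLoss_zero] using h1.2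
      refine (lintegral_mono_ae ?_).trans ((ofReal_integral_eq_lintegral_ofReal
        (integrable_condLoss t P N V) h0).symm.le.trans (ENNReal.ofReal_le_ofReal (hK V hV)))
      filter_upwards [h] with ω h1 using ENNReal.ofReal_le_ofReal h1.1)
  have h1 : densityPenalty P ℱ t ρ N ≤ᵐ[P] fun ω => (G ω : EReal) := by
    refine (familyEssSup_spec P (ℱ.le t) _).least _
      (measurable_coe_ennreal_ereal.comp hGm) ?_
    rintro f ⟨Y, hY, rfl⟩
    filter_upwards [lossRatio_eq_condLoss (X := Y) hmass, hG _ ⟨Y, hY, rfl⟩] with ω h2 h3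
    rw [h2]
    refine le_trans ?_ (EReal.coe_ennreal_le_coe_ennreal_iff.2 h3)
    rw [EReal.coe_ennreal_ofReal]
    exact EReal.coe_le_coe_iff.2 (le_max_left _ _)
  refine (lintegral_mono_ae ?_).trans hGK
  filter_upwards [h1] with ω h
  exact (EReal.toENNReal_le_toENNReal h).trans_eq EReal.toENNReal_coe

/-- The dual representation of a risk measure which is continuous from above. -/
theorem le_of_forall_densityTerm_le [IsProbabilityMeasure P] (hμ : IsReference P ℱ μ)
    (hρ : IsCondConvexRisk P ℱ t ρ) (hcont : ContFromAbove P ℱ t ρ) (hX : MemRt P ℱ t X)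
    {h : Ω → EReal}
    (hh : ∀ N, IsUnitDensity P ℱ t ρ N → densityTerm P ℱ t ρ N X ≤ᵐ[P] h) :
    (fun ω => (ρ X ω : EReal)) ≤ᵐ[P] h := by
  -- `f` is the gap between `ρ(X)` and the penalized loss of a density separating up to `1 / (n +
  -- 1)`. The gap is almost surely nonnegative, with mean at most that number.
  have hstep : ∀ n : ℕ, ∃ f : Ω → ℝ, Measurable f ∧
      (∀ᵐ ω ∂P, ((ρ X ω - f ω : ℝ) : EReal) ≤ h ω) ∧
      ∫⁻ ω, ENNReal.ofReal (f ω) ∂P ≤ ENNReal.ofReal (1 / ((n : ℝ) + 1)) := by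
    intro n
    obtain ⟨N, hN, hN0, hmass, hsep⟩ :=
      exists_weight_separating hμ hρ hcont hX (ε := 1 / ((n : ℝ) + 1)) (by positivity)
    set K : ℝ := ∫ ω, condLoss ℱ t P N X ω ∂P - ∫ ω, ρ X ω ∂P + 1 / ((n : ℝ) + 1) with hKdef
    have hK : ∀ Y, MemAccept P ℱ t ρ Y → ∫ ω, condLoss ℱ t P N Y ω ∂P ≤ K := fun Y hY =>
      hsep Y hY.memRt (integral_nonpos_of_ae hY.nonpos)
    have hK0 : 0 ≤ K := by
      have := hK 0 (MemAccept.zero hρ)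
      simpa [condLoss_zero] using this
    have hpen := lintegral_densityPenalty_le hρ hN hmass hK
    have hunit : IsUnitDensity P ℱ t ρ N :=
      ⟨hN, hN0, hmass, ne_top_of_le_ne_top ENNReal.ofReal_ne_top hpen⟩
    have hpm : Measurable (densityPenalty P ℱ t ρ N) :=
      (measurable_familyEssSup P (ℱ.le t) _).mono (ℱ.le t) le_rfl
    have hpm' : Measurable fun ω => (densityPenalty P ℱ t ρ N ω).toENNReal :=
      measurable_ereal_toENNReal.comp hpm
    have hfin := ae_lt_top hpm' hunit.penalty
    set π : Ω → ℝ := fun ω => (densityPenalty P ℱ t ρ N ω).toENNReal.toReal with hπ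
    have hcoe : ∀ᵐ ω ∂P, densityPenalty P ℱ t ρ N ω = (π ω : EReal) := by
      filter_upwards [hfin, zero_le_densityPenalty (N := N) hρ] with ω h1 h2
      rw [hπ, EReal.coe_ennreal_toReal h1.ne, EReal.coe_toENNReal h2]
    have hπi : Integrable π P := integrable_toReal_of_lintegral_ne_top hpm'.aemeasurable hunit.penalty
    have hπle : ∫ ω, π ω ∂P ≤ K := by
      rw [integral_toReal hpm'.aemeasurable hfin]
      exact (ENNReal.toReal_mono ENNReal.ofReal_ne_top hpen).trans_eq (ENNReal.toReal_ofReal hK0)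
    have hci := integrable_condLoss (ℱ := ℱ) t P N X
    have hρi := hρ.integrable hX
    have hterm : ∀ᵐ ω ∂P, densityTerm P ℱ t ρ N X ω = ((condLoss ℱ t P N X ω - π ω : ℝ) : EReal) := by
      filter_upwards [hcoe, lossRatio_eq_condLoss (X := X) hmass] with ω h1 h2
      rw [densityTerm, h1, h2, EReal.coe_sub]
    refine ⟨fun ω => ρ X ω - condLoss ℱ t P N X ω + π ω, ?_, ?_, ?_⟩
    · exact (((hρ.memLinf X hX).measurable.mono (ℱ.le t) le_rfl).sub
        ((measurable_condLoss t P N X).mono (ℱ.le t) le_rfl)).add hpm'.ennreal_toReal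
    · filter_upwards [hh N hunit, hterm] with ω h1 h2
      rw [h2] at h1
      convert h1 using 2
      ring
    · have h0 : 0 ≤ᵐ[P] fun ω => ρ X ω - condLoss ℱ t P N X ω + π ω := by
        filter_upwards [densityTerm_le hρ hN hX, hterm, hmass] with ω h1 h2 h3
        have h4 := h1 (by rw [h3]; exact zero_lt_one)
        rw [h2, EReal.coe_le_coe_iff] at h4
        simp only [Pi.zero_apply]
        linarith
      refine (ofReal_integral_eq_lintegral_ofReal ((hρi.sub hci).add hπi) h0).symm.trans_le ?_
      refine ENNReal.ofReal_le_ofReal ?_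
      have h5 : ∫ ω, (ρ X ω - condLoss ℱ t P N X ω + π ω) ∂P =
          ∫ ω, ρ X ω ∂P - ∫ ω, condLoss ℱ t P N X ω ∂P + ∫ ω, π ω ∂P := by
        rw [← integral_sub hρi hci]
        exact integral_add (hρi.sub hci) hπi
      have h6 := h5.trans_le (add_le_add_right hπle _)
      refine h6.trans ?_
      rw [hKdef]
      linarith
  choose f hfm hfh hfi using hstep
  -- The means tend to zero, so the infimum of the gaps vanishes almost surely. Since `h` dominates
  -- every penalized loss, it dominates the risk.
  have hzero : ∫⁻ ω, ⨅ n, ENNReal.ofReal (f n ω) ∂P = 0 := by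
    refine le_antisymm ?_ zero_le
    have hlim : Tendsto (fun n : ℕ => ENNReal.ofReal (1 / ((n : ℝ) + 1))) atTop (𝓝 0) := by
      have := ENNReal.tendsto_ofReal (tendsto_one_div_add_atTop_nhds_zero_nat (𝕜 := ℝ))
      simpa using this
    exact ge_of_tendsto' hlim fun n => (lintegral_mono fun ω => iInf_le _ n).trans (hfi n)
  rw [lintegral_eq_zero_iff (Measurable.iInf fun n => (hfm n).ennreal_ofReal)] at hzero
  filter_upwards [hzero, ae_all_iff.2 hfh] with ω h1 h2
  refine le_of_forall_lt fun c hc => ?_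
  obtain ⟨a, hca, haρ⟩ := EReal.lt_iff_exists_real_btwn.1 hc
  have h3 : (⨅ n, ENNReal.ofReal (f n ω)) < ENNReal.ofReal (ρ X ω - a) := by
    have h4 : (⨅ n, ENNReal.ofReal (f n ω)) = 0 := h1
    rw [h4, ENNReal.ofReal_pos, sub_pos]
    exact_mod_cast haρ
  obtain ⟨n, hn⟩ := iInf_lt_iff.1 h3
  have h5 : f n ω < ρ X ω - a := by
    by_contra! h6
    exact absurd (ENNReal.ofReal_le_ofReal h6) (not_le.2 hn)
  refine hca.trans (lt_of_lt_of_le ?_ (h2 n))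
  exact EReal.coe_lt_coe_iff.2 (by linarith)

end Dual

end RiskProc


namespace RiskProc

/-! ### Limits of density processes and absolute continuity on the product space -/

section Singular

variable {Ω : Type*} {mΩ : MeasurableSpace Ω} {H : Horizon} {ℱ : Filtration H.Time mΩ}
  {P Q : Measure Ω} {γ μ : H.Time → Ω → ℝ}

/-! ### Time points as natural numbers -/

theorem Horizon.coe_ofNat {n : ℕ} (hn : (n : ℕ∞) ∈ H.times) : (H.ofNat n).1 = n := by
  cases H with
  | finite T =>
    have h : n ≤ T := Nat.cast_le.1 (show (n : ℕ∞) ≤ T from hn)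
    simp [Horizon.ofNat, h]
  | nat => rfl
  | natInfty => rfl

theorem Horizon.ofNat_ne_top (n : ℕ) : (H.ofNat n).1 ≠ ⊤ := by
  cases H with
  | finite T => exact ENat.natCast_ne_top _
  | nat => exact ENat.natCast_ne_top n
  | natInfty => exact ENat.natCast_ne_top n

theorem Horizon.exists_eq_ofNat {s : H.Time} (hs : s.1 ≠ ⊤) :
    ∃ n : ℕ, s.1 = n ∧ s = H.ofNat n := by
  obtain ⟨n, hn⟩ := ENat.ne_top_iff_exists.1 hs
  refine ⟨n, hn.symm, Subtype.ext ?_⟩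
  rw [Horizon.coe_ofNat (hn ▸ s.2), hn]

theorem Horizon.ofNat_mono : Monotone H.ofNat := by
  intro m n h
  cases H with
  | finite T =>
    exact (Nat.cast_le (α := ℕ∞)).2 (min_le_min_right T h)
  | nat => exact (Nat.cast_le (α := ℕ∞)).2 h
  | natInfty => exact (Nat.cast_le (α := ℕ∞)).2 h

/-- The filtration along the natural numbers. -/
def natFiltration (ℱ : Filtration H.Time mΩ) : Filtration ℕ mΩ where
  seq n := ℱ (H.ofNat n)
  mono' _ _ h := ℱ.mono (Horizon.ofNat_mono h)
  le' _ := ℱ.le _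

theorem IsStandardFiltration.iSup_natFiltration (hℱ : IsStandardFiltration ℱ) :
    ⨆ n, natFiltration ℱ n = mΩ := by
  refine le_antisymm (iSup_le fun n => (natFiltration ℱ).le n) ?_
  conv_lhs => rw [hℱ.generates]
  refine iSup_le fun s => iSup_le fun hs => ?_
  obtain ⟨n, -, hn⟩ := Horizon.exists_eq_ofNat hs
  rw [hn]
  exact le_iSup (fun n => (natFiltration ℱ n : MeasurableSpace Ω)) n

/-! ### The singular part -/

/-- The densities on the `𝒢 n` are conditional expectations of the global density under `K`; Lévy's
upward theorem gives the limit. -/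
theorem tendsto_rnDeriv_trim {K : Measure Ω} [IsFiniteMeasure P] [IsFiniteMeasure K]
    (𝒢 : Filtration ℕ mΩ) (hgen : ⨆ n, 𝒢 n = mΩ) (hPR : P ≪ K) :
    ∀ᵐ ω ∂K, Tendsto (fun n => (P.trim (𝒢.le n)).rnDeriv (K.trim (𝒢.le n)) ω) atTop
      (𝓝 (P.rnDeriv K ω)) := by
  have h1 := tendsto_ae_condExp (μ := K) (ℱ := 𝒢) fun ω => (P.rnDeriv K ω).toReal
  have h2 : K[fun ω => (P.rnDeriv K ω).toReal | ⨆ n, 𝒢 n] = fun ω => (P.rnDeriv K ω).toReal :=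
    condExp_of_stronglyMeasurable hgen.le
      (by rw [hgen]; exact (Measure.measurable_rnDeriv P K).ennreal_toReal.stronglyMeasurable)
      Measure.integrable_toReal_rnDeriv
  rw [h2] at h1
  have h3 : ∀ n, ∀ᵐ ω ∂K, ((P.trim (𝒢.le n)).rnDeriv (K.trim (𝒢.le n)) ω).toReal =
      (K[fun ω => (P.rnDeriv K ω).toReal | 𝒢 n]) ω := fun n =>
    ae_of_ae_trim (𝒢.le n) (toReal_rnDeriv_trim (𝒢.le n) hPR)
  have h4 : ∀ n, ∀ᵐ ω ∂K, (P.trim (𝒢.le n)).rnDeriv (K.trim (𝒢.le n)) ω ≠ ∞ := fun n =>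
    ae_of_ae_trim (𝒢.le n) (Measure.rnDeriv_ne_top _ _)
  filter_upwards [h1, ae_all_iff.2 h3, ae_all_iff.2 h4, Measure.rnDeriv_ne_top P K]
    with ω h5 h6 h7 h8
  rw [← ENNReal.tendsto_toReal_iff h7 h8]
  exact h5.congr fun n => (h6 n).symm

/-- The limit of the density processes along a filtration. -/
theorem density_limit [IsProbabilityMeasure P] [IsProbabilityMeasure Q]
    (𝒢 : Filtration ℕ mΩ) (hgen : ⨆ n, 𝒢 n = mΩ)
    (hac : ∀ n, Q.trim (𝒢.le n) ≪ P.trim (𝒢.le n)) :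
    (∀ A, P A = 0 → ∀ᵐ ω ∂Q, ω ∈ A →
      Tendsto (fun n => (Q.trim (𝒢.le n)).rnDeriv (P.trim (𝒢.le n)) ω) atTop (𝓝 ∞)) ∧
    ∀ᵐ ω ∂P,
      ¬Tendsto (fun n => (Q.trim (𝒢.le n)).rnDeriv (P.trim (𝒢.le n)) ω) atTop (𝓝 ∞) := by
  -- The density process is the quotient of the densities of `Q` and `P` with respect to `K`, whose
  -- limits `q` and `p` satisfy `p + q = 1`. On a `P`-null set `p = 0` and `q = 1`, so the quotient
  -- explodes. Almost surely under `P` one has `p > 0`, and an exploding quotient would make `q`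
  -- infinite.
  set K := P + Q with hR
  have hPR : P ≪ K := Measure.absolutelyContinuous_of_le (Measure.le_add_right le_rfl)
  have hQR : Q ≪ K := Measure.absolutelyContinuous_of_le (Measure.le_add_left le_rfl)
  have h1 := tendsto_rnDeriv_trim 𝒢 hgen hPR
  have h2 := tendsto_rnDeriv_trim 𝒢 hgen hQR
  have h3 : ∀ n, ∀ᵐ ω ∂K, (Q.trim (𝒢.le n)).rnDeriv (P.trim (𝒢.le n)) ω *
      (P.trim (𝒢.le n)).rnDeriv (K.trim (𝒢.le n)) ω =
        (Q.trim (𝒢.le n)).rnDeriv (K.trim (𝒢.le n)) ω := fun n =>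
    ae_of_ae_trim (𝒢.le n) (Measure.rnDeriv_mul_rnDeriv (hac n))
  have h4 : ∀ᵐ ω ∂K, P.rnDeriv K ω + Q.rnDeriv K ω = 1 := by
    filter_upwards [Measure.rnDeriv_add' P Q K, Measure.rnDeriv_self K] with ω h5 h6
    rw [← Pi.add_apply, ← h5, ← hR, h6]
  have h3' := ae_all_iff.2 h3
  constructor
  · intro A hA
    have hA0 : ∀ᵐ ω ∂K, ω ∈ A → P.rnDeriv K ω = 0 := by
      obtain ⟨B, hAB, hB, hB0⟩ := exists_measurable_superset_of_null hA
      have h5 : ∫⁻ ω in B, P.rnDeriv K ω ∂K = 0 := by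
        rw [Measure.setLIntegral_rnDeriv hPR, hB0]
      rw [lintegral_eq_zero_iff (Measure.measurable_rnDeriv P K), EventuallyEq,
        ae_restrict_iff' hB] at h5
      filter_upwards [h5] with ω h6 h7 using h6 (hAB h7)
    refine hQR ?_
    filter_upwards [h1, h2, h3', h4, hA0] with ω h5 h6 h7 h8 h9 h10
    rw [h9 h10] at h5 h8
    rw [zero_add] at h8
    rw [h8] at h6
    have h11 := ENNReal.Tendsto.div h6 (Or.inl one_ne_zero) h5 (Or.inl ENNReal.zero_ne_top)
    rw [ENNReal.div_zero one_ne_zero] at h11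
    refine tendsto_of_tendsto_of_tendsto_of_le_of_le h11 tendsto_const_nhds (fun n => ?_)
      fun n => le_top
    exact ENNReal.div_le_of_le_mul (h7 n).ge
  · have hpos := Measure.rnDeriv_pos hPR
    filter_upwards [hPR h1, hPR h2, hPR h3', hpos, hPR (Measure.rnDeriv_ne_top Q K)]
      with ω h5 h6 h7 h8 h9 h10
    have h11 := ENNReal.Tendsto.mul h10 (Or.inl ENNReal.top_ne_zero) h5 (Or.inl h8.ne')
    rw [ENNReal.top_mul h8.ne'] at h11
    have h12 := tendsto_nhds_unique (h11.congr h7) h6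
    exact h9 h12.symm

theorem MemMloc.trim_absolutelyContinuous (hQ : MemMloc P ℱ Q) {s : H.Time} (hs : s.1 ≠ ⊤) :
    Q.trim (ℱ.le s) ≪ P.trim (ℱ.le s) := by
  refine Measure.AbsolutelyContinuous.mk fun A hA h => ?_
  rw [trim_measurableSet_eq _ hA] at h ⊢
  exact hQ.locally_ac s hs A hA h

/-- `Q` is absolutely continuous with respect to `P` outside of the singular event. -/
theorem MemMloc.ae_singularEvent [IsProbabilityMeasure P] (hℱ : IsStandardFiltration ℱ)
    (hQ : MemMloc P ℱ Q) {A : Set Ω} (hA : P A = 0) :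
    ∀ᵐ ω ∂Q, ω ∈ A → ω ∈ singularEvent P ℱ Q := by
  have := hQ.prob
  exact (density_limit (natFiltration ℱ) hℱ.iSup_natFiltration fun n =>
    hQ.trim_absolutelyContinuous (Horizon.ofNat_ne_top n)).1 A hA

theorem MemMloc.ae_notMem_singularEvent [IsProbabilityMeasure P] (hℱ : IsStandardFiltration ℱ)
    (hQ : MemMloc P ℱ Q) : ∀ᵐ ω ∂P, ω ∉ singularEvent P ℱ Q := by
  have := hQ.prob
  exact (density_limit (natFiltration ℱ) hℱ.iSup_natFiltration fun n =>
    hQ.trim_absolutelyContinuous (Horizon.ofNat_ne_top n)).2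

/-- Random measures on the time set which are normalized under a locally absolutely continuous
measure charge no `P ⊗ μ`-null sets. -/
theorem MemGamma.absolutelyContinuous [IsProbabilityMeasure P] (hℱ : IsStandardFiltration ℱ)
    (hμ : IsReference P ℱ μ) (hQ : MemMloc P ℱ Q) (hγ : MemGamma P ℱ Q γ) :
    optProd ℱ Q γ ≪ optProd ℱ P μ := by
  refine Measure.AbsolutelyContinuous.mk fun B hB h0 => ?_
  have h1 : ∀ᵐ p ∂optProd ℱ P μ, p ∈ Bᶜ := compl_mem_ae_iff.2 h0
  have h2 : ∀ s, P {ω | (⟨ω, s⟩ : OptSpace ℱ) ∈ B} = 0 := fun s => by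
    have h3 := hμ.ae_of_ae_optProd h1 s
    rw [ae_iff] at h3
    simpa using h3
  have h4 : ∀ᵐ p ∂optProd ℱ Q γ, p ∈ Bᶜ := by
    rw [ae_optProd_iff hγ.adapted (p := fun p => p ∈ Bᶜ) hB.compl]
    intro s
    -- At finite times local absolute continuity suffices. At `∞` a `P`-null section lies, up to a
    -- `Q`-null set, in the singular event, where `γ` gives no mass to `∞`.
    by_cases hs : s.1 = ⊤
    · filter_upwards [hQ.ae_singularEvent hℱ (h2 s), hγ.singular s hs] with ω h5 h6 h7 h8
      exact absurd (h6 (h5 h8)) h7.ne'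
    · have h5 : Q {ω | (⟨ω, s⟩ : OptSpace ℱ) ∈ B} = 0 :=
        hQ.locally_ac s hs _ (measurableSet_optSpace_iff.1 hB s) (h2 s)
      have h6 : ∀ᵐ ω ∂Q, ¬(⟨ω, s⟩ : OptSpace ℱ) ∈ B := by
        rw [ae_iff]; simpa using h5
      filter_upwards [h6] with ω h7 _ using h7
  exact compl_mem_ae_iff.1 h4

/-- Measures on the optional `σ`-field have density processes. -/
theorem IsReference.exists_weight [IsProbabilityMeasure P] (hμ : IsReference P ℱ μ)
    {Qbar : Measure (OptSpace ℱ)} [IsFiniteMeasure Qbar] (h : Qbar ≪ optProd ℱ P μ) :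
    ∃ N, IsWeight ℱ P N ∧ Qbar = optProd ℱ P N ∧ ∀ᵐ ω ∂P, ∀ s, 0 ≤ N s ω := by
  have := hμ.isProbabilityMeasure
  have hW : Measurable fun p => (Qbar.rnDeriv (optProd ℱ P μ) p).toReal :=
    (Measure.measurable_rnDeriv _ _).ennreal_toReal
  have hN := hμ.isWeight_mul hW (fun p => ENNReal.toReal_nonneg) Measure.integrable_toReal_rnDeriv
  refine ⟨_, hN, ?_, hN.nonneg⟩
  rw [optProd_mul hμ.adapted hW fun p => ENNReal.toReal_nonneg]
  conv_lhs => rw [← Measure.withDensity_rnDeriv_eq _ _ h]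
  refine withDensity_congr_ae ?_
  filter_upwards [Measure.rnDeriv_ne_top Qbar (optProd ℱ P μ)] with p hp
  rw [ENNReal.ofReal_toReal hp]

end Singular

end RiskProc


namespace RiskProc

/-! ### Multiplicative decomposition of the conditional tail mass -/

section Martingale

variable {Ω : Type*} {mΩ : MeasurableSpace Ω} {P : Measure Ω}

/-- Both sides integrate `g` against measures that agree on `m`; no integrability of the product is
required. -/
theorem lintegral_mul_condExp [IsFiniteMeasure P] {m : MeasurableSpace Ω} (hm : m ≤ mΩ)
    {f : Ω → ℝ} (hf : Integrable f P) (hf0 : 0 ≤ᵐ[P] f) {g : Ω → ℝ≥0∞} (hg : Measurable[m] g) :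
    ∫⁻ ω, ENNReal.ofReal (P[f | m] ω) * g ω ∂P = ∫⁻ ω, ENNReal.ofReal (f ω) * g ω ∂P := by
  have h1 : ∀ F : Ω → ℝ, Integrable F P →
      ∫⁻ ω, ENNReal.ofReal (F ω) * g ω ∂P =
        ∫⁻ ω, g ω ∂(P.withDensity fun ω => ENNReal.ofReal (F ω)).trim hm := by
    intro F hF
    rw [lintegral_trim hm hg, lintegral_withDensity_eq_lintegral_mul₀
      hF.1.aemeasurable.ennreal_ofReal (hg.mono hm le_rfl).aemeasurable]
    rfl
  rw [h1 _ hf, h1 _ integrable_condExp]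
  congr 1
  refine @Measure.ext _ m _ _ fun A hA => ?_
  rw [trim_measurableSet_eq hm hA, trim_measurableSet_eq hm hA, withDensity_apply _ (hm A hA),
    withDensity_apply _ (hm A hA), ← ofReal_integral_eq_lintegral_ofReal hf.integrableOn
      (ae_restrict_of_ae hf0), ← ofReal_integral_eq_lintegral_ofReal
      integrable_condExp.integrableOn (ae_restrict_of_ae (condExp_nonneg hf0)),
    setIntegral_condExp hm hf hA]

/-- Multiplicative decomposition: an adapted process of weights is factorized into a nonnegative
martingale and a process of weights with total mass one. -/
theorem exists_multiplicative_decomposition [IsProbabilityMeasure P] (𝒢 : Filtration ℕ mΩ)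
    {a S : ℕ → Ω → ℝ} (ha : ∀ n, Measurable[𝒢 n] (a n)) (ha0 : ∀ n, 0 ≤ᵐ[P] a n)
    (hS : ∀ n, Integrable (S n) P) (hS0 : ∀ n, 0 ≤ᵐ[P] S n)
    (hstep : ∀ n, S n =ᵐ[P] a n + S (n + 1)) (h1 : P[S 0 | 𝒢 0] =ᵐ[P] 1) :
    ∃ M γ : ℕ → Ω → ℝ, (∀ n, Measurable[𝒢 n] (M n)) ∧ (∀ n, Measurable[𝒢 n] (γ n)) ∧
      (∀ n ω, 0 ≤ M n ω) ∧ (∀ n ω, 0 ≤ γ n ω) ∧ (∀ ω, M 0 ω = 1) ∧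
      (∀ n A, MeasurableSet[𝒢 n] A → ∫⁻ ω in A, ENNReal.ofReal (M (n + 1) ω) ∂P =
        ∫⁻ ω in A, ENNReal.ofReal (M n ω) ∂P) ∧
      ∀ n, ∀ᵐ ω ∂P, M n ω * γ n ω = a n ω ∧
        M n ω * (1 - ∑ r ∈ Finset.range n, γ r ω) = (P[S n | 𝒢 n]) ω := by
  -- `U n` and `K n` are the conditional masses from `n` on and after `n`, truncated to be
  -- nonnegative everywhere; almost surely `U n = a n + K n`.
  let U : ℕ → Ω → ℝ := fun n ω => max ((P[S n | 𝒢 n]) ω) 0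
  let K : ℕ → Ω → ℝ := fun n ω => max ((P[S (n + 1) | 𝒢 n]) ω) 0
  have hUm : ∀ n, Measurable[𝒢 n] (U n) := fun n =>
    stronglyMeasurable_condExp.measurable.max measurable_const
  have hKm : ∀ n, Measurable[𝒢 n] (K n) := fun n =>
    stronglyMeasurable_condExp.measurable.max measurable_const
  have hU0 : ∀ n ω, 0 ≤ U n ω := fun n ω => le_max_right _ _
  have hK0 : ∀ n ω, 0 ≤ K n ω := fun n ω => le_max_right _ _
  have hU : ∀ n, ∀ᵐ ω ∂P, U n ω = (P[S n | 𝒢 n]) ω := fun n =>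
    (condExp_nonneg (m := 𝒢 n) (hS0 n)).mono fun ω h => max_eq_left h
  have hK : ∀ n, ∀ᵐ ω ∂P, K n ω = (P[S (n + 1) | 𝒢 n]) ω := fun n =>
    (condExp_nonneg (m := 𝒢 n) (hS0 (n + 1))).mono fun ω h => max_eq_left h
  have hai : ∀ n, Integrable (a n) P := fun n => by
    refine ((hS n).sub (hS (n + 1))).congr ?_
    filter_upwards [hstep n] with ω h
    simp [h]
  have hUK : ∀ n, ∀ᵐ ω ∂P, U n ω = a n ω + K n ω := fun n => by
    have h2 : P[S n | 𝒢 n] =ᵐ[P] P[a n | 𝒢 n] + P[S (n + 1) | 𝒢 n] :=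
      (condExp_congr_ae (hstep n)).trans (condExp_add (hai n) (hS (n + 1)) _)
    rw [condExp_of_stronglyMeasurable (𝒢.le n) (ha n).stronglyMeasurable (hai n)] at h2
    filter_upwards [h2, hU n, hK n] with ω h3 h4 h5
    rw [h4, h5, h3, Pi.add_apply]
  have hlint : ∀ n, ∀ g : Ω → ℝ≥0∞, Measurable[𝒢 n] g →
      ∫⁻ ω, ENNReal.ofReal (U (n + 1) ω) * g ω ∂P = ∫⁻ ω, ENNReal.ofReal (K n ω) * g ω ∂P := by
    intro n g hg
    have h2 := lintegral_mul_condExp (𝒢.le n) (hS (n + 1)) (hS0 (n + 1)) hg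
    have h3 := lintegral_mul_condExp (𝒢.le (n + 1)) (hS (n + 1)) (hS0 (n + 1))
      (hg.mono (𝒢.mono n.le_succ) le_rfl)
    have h4 : ∫⁻ ω, ENNReal.ofReal (U (n + 1) ω) * g ω ∂P =
        ∫⁻ ω, ENNReal.ofReal ((P[S (n + 1) | 𝒢 (n + 1)]) ω) * g ω ∂P :=
      lintegral_congr_ae ((hU (n + 1)).mono fun ω h => by simp only [h])
    have h5 : ∫⁻ ω, ENNReal.ofReal (K n ω) * g ω ∂P =
        ∫⁻ ω, ENNReal.ofReal ((P[S (n + 1) | 𝒢 n]) ω) * g ω ∂P :=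
      lintegral_congr_ae ((hK n).mono fun ω h => by simp only [h])
    rw [h4, h5, h2, h3]
  -- When no mass is expected after `n`, none is found at `n + 1`, because `U (n + 1)` has
  -- conditional expectation `K n`.
  have hKU : ∀ n, ∀ᵐ ω ∂P, K n ω = 0 → U (n + 1) ω = 0 := fun n => by
    have hB : MeasurableSet[𝒢 n] {ω | K n ω = 0} := hKm n (measurableSet_singleton 0)
    have h2 := hlint n ({ω | K n ω = 0}.indicator 1)
      ((@measurable_const _ _ _ (𝒢 n) (1 : ℝ≥0∞)).indicator hB)
    have h3 : ∀ ω, ENNReal.ofReal (K n ω) * {ω | K n ω = 0}.indicator 1 ω = 0 := fun ω => by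
      by_cases h : K n ω = 0 <;> simp [h]
    simp only [h3, lintegral_zero] at h2
    have hm : Measurable[mΩ] fun ω =>
        ENNReal.ofReal (U (n + 1) ω) * {ω | K n ω = 0}.indicator 1 ω :=
      ((hUm (n + 1)).mono (𝒢.le _) le_rfl).ennreal_ofReal.mul
        (measurable_const.indicator (𝒢.le n _ hB))
    filter_upwards [(lintegral_eq_zero_iff hm).1 h2] with ω h4 h5
    have h6 : ω ∈ {ω | K n ω = 0} := h5
    simp only [Set.indicator_of_mem h6, Pi.one_apply, mul_one] at h4
    exact le_antisymm (ENNReal.ofReal_eq_zero.1 h4) (hU0 _ ω)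
  -- The factor `U (n + 1) / K n` has conditional mean one where `K n` is positive. Where `K n = 0`
  -- the martingale is frozen, since a vanishing factor would lose mass.
  let M : ℕ → Ω → ℝ := fun n => n.rec (fun _ => 1) fun n f ω =>
    if K n ω = 0 then f ω else f ω * U (n + 1) ω / K n ω
  have hMs : ∀ n ω, M (n + 1) ω = if K n ω = 0 then M n ω else M n ω * U (n + 1) ω / K n ω :=
    fun n ω => rfl
  have hMm : ∀ n, Measurable[𝒢 n] (M n) := by
    intro n
    induction n with
    | zero => exact @measurable_const _ _ _ (𝒢 0) (1 : ℝ)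
    | succ n ih =>
      have h2 := ih.mono (𝒢.mono n.le_succ) le_rfl
      have h3 := (hKm n).mono (𝒢.mono n.le_succ) le_rfl
      exact Measurable.ite (h3 (measurableSet_singleton 0)) h2 ((h2.mul (hUm (n + 1))).div h3)
  have hM0 : ∀ n ω, 0 ≤ M n ω := by
    intro n ω
    induction n with
    | zero => exact zero_le_one
    | succ n ih =>
      rw [hMs]
      split_ifs
      · exact ih
      · exact div_nonneg (mul_nonneg ih (hU0 _ ω)) (hK0 _ ω)
  -- Where `M n = 0` the quotient defaults to `0`; this is consistent because `U n = M n * D n`, and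
  -- with it `a n`, vanishes there.
  let γ : ℕ → Ω → ℝ := fun n ω => max (a n ω) 0 / M n ω
  have hγm : ∀ n, Measurable[𝒢 n] (γ n) := fun n => ((ha n).max measurable_const).div (hMm n)
  refine ⟨M, γ, hMm, hγm, hM0, fun n ω => div_nonneg (le_max_right _ _) (hM0 n ω), fun ω => rfl,
    fun n A hA => ?_, fun n => ?_⟩
  · set g : Ω → ℝ≥0∞ := A.indicator fun ω =>
      if K n ω = 0 then 0 else ENNReal.ofReal (M n ω / K n ω) with hg
    have hgm : Measurable[𝒢 n] g := (Measurable.ite (hKm n (measurableSet_singleton 0))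
      measurable_const ((hMm n).div (hKm n)).ennreal_ofReal).indicator hA
    have hrest : Measurable[𝒢 n] (A.indicator fun ω =>
        if K n ω = 0 then ENNReal.ofReal (M n ω) else 0) :=
      (Measurable.ite (hKm n (measurableSet_singleton 0)) (hMm n).ennreal_ofReal
        measurable_const).indicator hA
    have h2 : ∀ V : Ω → ℝ, (∀ ω, 0 ≤ V ω) → ∀ ω,
        ENNReal.ofReal (V ω) * g ω = A.indicator (fun ω =>
          if K n ω = 0 then 0 else ENNReal.ofReal (M n ω * V ω / K n ω)) ω := by
      intro V hV ω
      by_cases h3 : ω ∈ A <;> by_cases h4 : K n ω = 0 <;> simp only [hg, h3, h4,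
        Set.indicator_of_mem, Set.indicator_of_notMem, not_false_eq_true, mul_zero, if_true, if_false]
      rw [← ENNReal.ofReal_mul (hV ω)]
      congr 1
      ring
    rw [← lintegral_indicator ((𝒢.le n) _ hA), ← lintegral_indicator ((𝒢.le n) _ hA)]
    -- Both integrands split into the frozen part on `{K n = 0}` and a `𝒢 n`-measurable factor times
    -- `U (n + 1)` or `K n`; only the latter parts are compared by conditioning.
    have h3 : ∀ ω, A.indicator (fun ω => ENNReal.ofReal (M (n + 1) ω)) ω =
        A.indicator (fun ω => if K n ω = 0 then ENNReal.ofReal (M n ω) else 0) ω +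
          ENNReal.ofReal (U (n + 1) ω) * g ω := fun ω => by
      rw [h2 _ (hU0 (n + 1))]
      by_cases h3 : ω ∈ A <;> by_cases h4 : K n ω = 0 <;> simp [hMs, h3, h4]
    have h4 : ∀ ω, A.indicator (fun ω => ENNReal.ofReal (M n ω)) ω =
        A.indicator (fun ω => if K n ω = 0 then ENNReal.ofReal (M n ω) else 0) ω +
          ENNReal.ofReal (K n ω) * g ω := fun ω => by
      rw [h2 _ (hK0 n)]
      by_cases h3 : ω ∈ A <;> by_cases h4 : K n ω = 0 <;> simp [h3, h4]
    rw [lintegral_congr h3, lintegral_congr h4, lintegral_add_left (hrest.mono (𝒢.le n) le_rfl),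
      lintegral_add_left (hrest.mono (𝒢.le n) le_rfl), hlint n g hgm]
  · have hMγ : ∀ n, ∀ᵐ ω ∂P, (M n ω = 0 → U n ω = 0) → M n ω * γ n ω = a n ω := fun n => by
      filter_upwards [hUK n, ha0 n] with ω h2 h3 h4
      have h5 : 0 ≤ a n ω := h3
      simp only [γ, max_eq_left h5]
      by_cases h6 : M n ω = 0
      · have := h4 h6
        have := hK0 n ω
        rw [h6, zero_mul]
        linarith
      · field_simp
    -- The invariant `M n * D n = U n`. Subtracting `M n * γ n = a n` leaves `M n * D (n + 1) = K
    -- n`, and the factor of the martingale replaces `K n` by `U (n + 1)`.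
    have hD : ∀ n, ∀ᵐ ω ∂P, M n ω * (1 - ∑ r ∈ Finset.range n, γ r ω) = U n ω := by
      intro n
      induction n with
      | zero =>
        filter_upwards [hU 0, h1] with ω h2 h3
        rw [h2, h3]
        simp [M]
      | succ n ih =>
        filter_upwards [ih, hMγ n, hUK n, hKU n] with ω h2 h3 h4 h5
        have h6 := h3 fun h => by rw [← h2, h, zero_mul]
        have h7 : M n ω * (1 - ∑ r ∈ Finset.range (n + 1), γ r ω) = K n ω := by
          rw [Finset.sum_range_succ]
          linarith
        rw [hMs]
        split_ifs with h8
        · rw [h7, h8, h5 h8]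
        · rw [div_mul_eq_mul_div, mul_right_comm, h7]
          field_simp
    filter_upwards [hD n, hMγ n, hU n] with ω h2 h3 h4
    exact ⟨h3 fun h => by rw [← h2, h, zero_mul], h2.trans h4⟩

end Martingale

end RiskProc


namespace RiskProc

/-! ### Sums over the time set and the measure generated by a martingale -/

section Tails

variable {Ω : Type*} {mΩ : MeasurableSpace Ω} {H : Horizon} {ℱ : Filtration H.Time mΩ}
  {P Q : Measure Ω} {N : H.Time → Ω → ℝ}

open Classical in
/-- The values of a process along the natural numbers, extended by `0` beyond the horizon. -/
noncomputable def atNat (f : H.Time → Ω → ℝ) (n : ℕ) (ω : Ω) : ℝ :=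
  if h : (n : ℕ∞) ∈ H.times then f ⟨n, h⟩ ω else 0

open Classical in
/-- The value of a process at time `∞`, and `0` if `∞` does not belong to the time set. -/
noncomputable def atInfty (f : H.Time → Ω → ℝ) (ω : Ω) : ℝ :=
  if h : (⊤ : ℕ∞) ∈ H.times then f ⟨⊤, h⟩ ω else 0

open Classical in
/-- The tail sums of a process along the natural numbers. -/
noncomputable def tailSum (f : H.Time → Ω → ℝ) (n : ℕ) (ω : Ω) : ℝ :=
  ∑' s : H.Time, if (n : ℕ∞) ≤ s.1 then f s ω else 0

theorem Horizon.mk_eq_ofNat {n : ℕ} (h : (n : ℕ∞) ∈ H.times) : (⟨n, h⟩ : H.Time) = H.ofNat n :=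
  Subtype.ext (Horizon.coe_ofNat h).symm

theorem atNat_of_mem (f : H.Time → Ω → ℝ) {n : ℕ} (h : (n : ℕ∞) ∈ H.times) :
    atNat f n = f (H.ofNat n) := by
  funext ω
  rw [atNat, dif_pos h, Horizon.mk_eq_ofNat h]

theorem measurable_atNat {f : H.Time → Ω → ℝ} (hf : ∀ s, Measurable[ℱ s] (f s)) (n : ℕ) :
    Measurable[natFiltration ℱ n] (atNat f n) := by
  by_cases h : (n : ℕ∞) ∈ H.times
  · rw [atNat_of_mem f h]; exact hf _
  · have : atNat f n = fun _ => 0 := by funext ω; simp [atNat, h]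
    rw [this]; exact @measurable_const _ _ _ (natFiltration ℱ n) (0 : ℝ)

/-- The sum over the time set is the series over natural times plus the value at `∞`; the extensions
by `0` cover all three kinds of time sets at once. -/
theorem hasSum_of_hasSum_atNat {f : H.Time → Ω → ℝ} {ω : Ω} {b : ℝ}
    (h : HasSum (fun n => atNat f n ω) b) : HasSum (fun s => f s ω) (b + atInfty f ω) := by
  classical
  let g : ℕ∞ → ℝ := fun x => if h : x ∈ H.times then f ⟨x, h⟩ ω else 0
  have h1 : (fun s : H.Time => f s ω) = g ∘ Subtype.val := by
    funext s
    simp [g, s.2]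
  have h2 : ∀ x ∉ Set.range (Subtype.val : H.Time → ℕ∞), g x = 0 := fun x hx => by
    have : x ∉ H.times := fun h => hx ⟨⟨x, h⟩, rfl⟩
    simp [g, this]
  rw [h1, Subtype.val_injective.hasSum_iff h2]
  have h3 : HasSum (fun x : ℕ∞ => if x = ⊤ then 0 else g x) b := by
    have hinj : Function.Injective ((↑) : ℕ → ℕ∞) := Nat.cast_injective
    refine (hinj.hasSum_iff fun x hx => ?_).1 ?_
    · by_contra hc
      have hx' : x ≠ ⊤ := fun h => hc (if_pos h)
      obtain ⟨n, hn⟩ := ENat.ne_top_iff_exists.1 hx'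
      exact hx ⟨n, hn⟩
    · convert h using 2 with n
      simp [g, atNat]
  have h4 := h3.add (hasSum_ite_eq (⊤ : ℕ∞) (g ⊤))
  have h5 : atInfty f ω = g ⊤ := rfl
  rw [h5]
  convert h4 using 2 with x
  by_cases hx : x = ⊤ <;> simp [hx]

theorem summable_tail {f : H.Time → ℝ} (hf : Summable f) (p : H.Time → Prop) [DecidablePred p] :
    Summable fun s => if p s then f s else 0 := by
  refine (hf.indicator {s | p s}).congr fun s => ?_
  by_cases h : p s <;> simp [h]

theorem tailSum_eq_add {f : H.Time → Ω → ℝ} {ω : Ω} (hf : Summable fun s => f s ω) (n : ℕ) :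
    tailSum f n ω = atNat f n ω + tailSum f (n + 1) ω := by
  classical
  have h1 : ∑' s : H.Time, (if s.1 = n then f s ω else 0) = atNat f n ω := by
    by_cases h : (n : ℕ∞) ∈ H.times
    · rw [tsum_eq_single (⟨n, h⟩ : H.Time) fun s hs => if_neg fun h' => hs (Subtype.ext h')]
      simp [atNat, h]
    · have : ∀ s : H.Time, s.1 ≠ n := fun s hs => h (hs ▸ s.2)
      simp [atNat, h, this]
  rw [← h1, tailSum, tailSum, ← (summable_tail hf _).tsum_add (summable_tail hf _)]
  refine tsum_congr fun s => ?_
  have h2 : ((n + 1 : ℕ) : ℕ∞) ≤ s.1 ↔ (n : ℕ∞) < s.1 := by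
    rw [Nat.cast_add, Nat.cast_one, ENat.add_one_le_iff (ENat.natCast_ne_top n)]
  simp only [h2]
  rcases lt_trichotomy (n : ℕ∞) s.1 with h | h | h
  · rw [if_pos h.le, if_neg h.ne', if_pos h, zero_add]
  · rw [if_pos h.le, if_pos h.symm, if_neg h.not_lt, add_zero]
  · rw [if_neg h.not_ge, if_neg h.ne, if_neg h.not_gt, zero_add]

theorem tailSum_of_mem (f : H.Time → Ω → ℝ) {n : ℕ} (h : (n : ℕ∞) ∈ H.times) :
    tailSum f n = sumFrom (H.ofNat n) f 1 := by
  classical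
  funext ω
  refine tsum_congr fun s => ?_
  have : H.ofNat n ≤ s ↔ (n : ℕ∞) ≤ s.1 := by
    rw [← Subtype.coe_le_coe, Horizon.coe_ofNat h]
  by_cases hs : (n : ℕ∞) ≤ s.1 <;> simp [this, hs]

theorem tailSum_of_notMem (f : H.Time → Ω → ℝ) {n : ℕ} (h : (n : ℕ∞) ∉ H.times) :
    tailSum f n = 0 := by
  classical
  funext ω
  have : ∀ s : H.Time, ¬(n : ℕ∞) ≤ s.1 := fun s hs => h (Horizon.mem_times_of_le s.2 hs)
  simp [tailSum, this]

/-- Every finite time eventually leaves the tail, while `∞` belongs to all tails. -/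
theorem tendsto_tailSum {f : H.Time → Ω → ℝ} {ω : Ω} (hf : Summable fun s => f s ω) :
    Tendsto (fun n => tailSum f n ω) atTop (𝓝 (atInfty f ω)) := by
  classical
  have h1 : ∑' s : H.Time, (if s.1 = ⊤ then f s ω else 0) = atInfty f ω := by
    by_cases h : (⊤ : ℕ∞) ∈ H.times
    · rw [tsum_eq_single (⟨⊤, h⟩ : H.Time) fun s hs => if_neg fun h' => hs (Subtype.ext h')]
      simp [atInfty, h]
    · have : ∀ s : H.Time, s.1 ≠ ⊤ := fun s hs => h (hs ▸ s.2)
      simp [atInfty, h, this]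
  rw [← h1]
  refine tendsto_tsum_of_dominated_convergence hf.norm (fun s => ?_)
    (Eventually.of_forall fun n s => ?_)
  · refine tendsto_const_nhds.congr' ?_
    by_cases hs : s.1 = ⊤
    · simp [hs]
    · obtain ⟨k, hk, -⟩ := Horizon.exists_eq_ofNat hs
      filter_upwards [eventually_gt_atTop k] with n hn
      simp [hk, hn]
  · split_ifs
    · exact le_rfl
    · simp

theorem tailSum_nonneg {f : H.Time → Ω → ℝ} {ω : Ω} (hf : ∀ s, 0 ≤ f s ω) (n : ℕ) :
    0 ≤ tailSum f n ω :=
  tsum_nonneg fun s => by split_ifs; exacts [hf s, le_rfl]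

theorem Horizon.ofNat_zero_le (s : H.Time) : H.ofNat 0 ≤ s := by
  rw [← Subtype.coe_le_coe, Horizon.coe_ofNat (n := 0) H.zero_mem_times]
  simp

theorem Horizon.ofNat_zero : H.ofNat 0 = H.zero :=
  Subtype.ext (Horizon.coe_ofNat (n := 0) H.zero_mem_times)

theorem IsWeight.summable' (hN : IsWeight ℱ P N) : ∀ᵐ ω ∂P, Summable fun s => N s ω := by
  filter_upwards [hN.summable (IsBddProc.one _) (H.ofNat 0)] with ω h
  simpa [Horizon.ofNat_zero_le] using h

theorem IsWeight.integrable_tailSum [IsFiniteMeasure P] (hN : IsWeight ℱ P N) (n : ℕ) :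
    Integrable (tailSum N n) P := by
  by_cases h : (n : ℕ∞) ∈ H.times
  · rw [tailSum_of_mem N h]; exact hN.integrable_sumFrom (IsBddProc.one _) _
  · rw [tailSum_of_notMem N h]; exact integrable_zero _ _ _

/-- Consistent densities along the filtration define a measure. -/
theorem exists_measure_of_martingale [IsProbabilityMeasure P] (hℱ : IsStandardFiltration ℱ)
    {M : ℕ → Ω → ℝ} (hM1 : ∀ ω, M 0 ω = 1)
    (hM : ∀ n A, MeasurableSet[natFiltration ℱ n] A →
      ∫⁻ ω in A, ENNReal.ofReal (M (n + 1) ω) ∂P = ∫⁻ ω in A, ENNReal.ofReal (M n ω) ∂P) :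
    ∃ Q : Measure Ω, IsProbabilityMeasure Q ∧ ∀ n A, MeasurableSet[natFiltration ℱ n] A →
      Q A = ∫⁻ ω in A, ENNReal.ofReal (M n ω) ∂P := by
  have hle : ∀ n k A, n ≤ k → MeasurableSet[natFiltration ℱ n] A →
      ∫⁻ ω in A, ENNReal.ofReal (M k ω) ∂P = ∫⁻ ω in A, ENNReal.ofReal (M n ω) ∂P := by
    intro n k A hk hA
    induction k, hk using Nat.le_induction with
    | base => rfl
    | succ k hk ih => rw [hM k A ((natFiltration ℱ).mono hk _ hA), ih]
  have hprob : ∀ n, IsProbabilityMeasure (P.withDensity fun ω => ENNReal.ofReal (M n ω)) := by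
    intro n
    constructor
    rw [withDensity_apply _ MeasurableSet.univ, hle 0 n _ (Nat.zero_le n) MeasurableSet.univ]
    simp [hM1]
  by_cases hH : H.IsInfinite
  · obtain ⟨Q, hQ, h⟩ := exists_extension (fun n => (natFiltration ℱ n : MeasurableSpace Ω))
      (fun _ _ h => (natFiltration ℱ).mono h) hℱ.iSup_natFiltration.symm
      (fun n => hℱ.standard hH _ (Horizon.ofNat_ne_top n)) (hℱ.atoms hH)
      (fun n => P.withDensity fun ω => ENNReal.ofReal (M n ω)) fun n A hA => by
        rw [withDensity_apply _ ((natFiltration ℱ).le n _ hA),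
          withDensity_apply _ ((natFiltration ℱ).le n _ hA), hM n A hA]
    refine ⟨Q, hQ, fun n A hA => ?_⟩
    rw [h n A hA, withDensity_apply _ ((natFiltration ℱ).le n _ hA)]
  -- With a finite horizon no extension is necessary: `M T` is the density on the last σ-field, and
  -- later indices repeat it.
  · simp only [Horizon.IsInfinite, not_forall, not_not] at hH
    obtain ⟨T, rfl⟩ := hH
    refine ⟨_, hprob T, fun n A hA => ?_⟩
    rw [withDensity_apply _ ((natFiltration ℱ).le n _ hA)]
    rcases le_total n T with h | h
    · exact hle n T A h hA
    · refine (hle T n A h ?_).symm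
      have h1 : Horizon.ofNat (.finite T) n = Horizon.ofNat (.finite T) T :=
        Subtype.ext (by simp [Horizon.ofNat, h])
      have h2 : natFiltration ℱ n = natFiltration ℱ T := congrArg (fun s => ℱ s) h1
      rwa [h2] at hA

end Tails

end RiskProc


namespace RiskProc

/-! ### Factorization of a density process into `Q ⊗ γ` -/

section Decomposition

variable {Ω : Type*} {mΩ : MeasurableSpace Ω} {H : Horizon} {ℱ : Filtration H.Time mΩ}
  {P Q : Measure Ω} {N : H.Time → Ω → ℝ}

/-- Integration with respect to a measure which has a density on a sub-`σ`-field. -/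
theorem lintegral_eq_of_density {m : MeasurableSpace Ω} (hm : m ≤ mΩ) {M : Ω → ℝ}
    (hM : Measurable[m] M)
    (hQ : ∀ A, MeasurableSet[m] A → Q A = ∫⁻ ω in A, ENNReal.ofReal (M ω) ∂P)
    {F : Ω → ℝ≥0∞} (hF : Measurable[m] F) :
    ∫⁻ ω, F ω ∂Q = ∫⁻ ω, ENNReal.ofReal (M ω) * F ω ∂P := by
  have h1 : Q.trim hm = (P.withDensity fun ω => ENNReal.ofReal (M ω)).trim hm := by
    refine @Measure.ext _ m _ _ fun A hA => ?_
    rw [trim_measurableSet_eq hm hA, trim_measurableSet_eq hm hA, hQ A hA,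
      withDensity_apply _ (hm A hA)]
  rw [← lintegral_trim hm hF, h1, lintegral_trim hm hF, lintegral_withDensity_eq_lintegral_mul _
    (hM.mono hm le_rfl).ennreal_ofReal (hF.mono hm le_rfl)]
  rfl

theorem ae_of_density {m : MeasurableSpace Ω} {M : Ω → ℝ}
    (hQ : ∀ A, MeasurableSet[m] A → Q A = ∫⁻ ω in A, ENNReal.ofReal (M ω) ∂P)
    {p : Ω → Prop} (hp : MeasurableSet[m] {ω | p ω}) (h : ∀ᵐ ω ∂P, p ω) : ∀ᵐ ω ∂Q, p ω := by
  rw [ae_iff] at h ⊢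
  have h1 := hQ _ hp.compl
  rw [Measure.restrict_zero_set (s := {ω | p ω}ᶜ) h, lintegral_zero_measure] at h1
  exact h1

theorem ae_pos_of_density {m : MeasurableSpace Ω} (hm : m ≤ mΩ) {M : Ω → ℝ}
    (hM : Measurable[m] M)
    (hQ : ∀ A, MeasurableSet[m] A → Q A = ∫⁻ ω in A, ENNReal.ofReal (M ω) ∂P) :
    ∀ᵐ ω ∂Q, 0 < M ω := by
  have hB : MeasurableSet[m] {ω | M ω ≤ 0} := measurableSet_le hM measurable_const
  have h1 := hQ _ hB
  rw [setLIntegral_congr_fun (g := fun _ => 0) (hm _ hB)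
    (fun ω hω => ENNReal.ofReal_of_nonpos hω), lintegral_zero] at h1
  rw [ae_iff]
  simpa only [not_lt] using h1

theorem ext_of_natFiltration (hℱ : IsStandardFiltration ℱ) {ν ν' : Measure Ω} [IsFiniteMeasure ν]
    (h : ∀ n A, MeasurableSet[natFiltration ℱ n] A → ν A = ν' A) : ν = ν' := by
  refine ext_of_generate_finite (⋃ n, {A | MeasurableSet[natFiltration ℱ n] A}) ?_ ?_ ?_
    (h 0 _ MeasurableSet.univ)
  · exact ((MeasurableSpace.generateFrom_iUnion_measurableSet fun n =>
      (natFiltration ℱ n : MeasurableSpace Ω)).trans hℱ.iSup_natFiltration).symm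
  · exact isPiSystem_iUnion_of_monotone _
      (fun n => @MeasurableSpace.isPiSystem_measurableSet _ (natFiltration ℱ n))
      fun _ _ hmn => (natFiltration ℱ).mono hmn
  · intro A hA
    obtain ⟨n, hn⟩ := Set.mem_iUnion.1 hA
    exact h n A hn

/-- Every probability measure with a density process is of the form `Q ⊗ γ`. -/
theorem exists_decomposition [IsProbabilityMeasure P] (hℱ : IsStandardFiltration ℱ)
    (hN : IsWeight ℱ P N) (hprob : IsProbabilityMeasure (optProd ℱ P N)) :
    ∃ Q γ, MemMloc P ℱ Q ∧ MemGamma P ℱ Q γ ∧ optProd ℱ Q γ = optProd ℱ P N := by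
  classical
  set 𝒢 := natFiltration ℱ with h𝒢
  have hS0 : ∀ n, 0 ≤ᵐ[P] tailSum N n := fun n =>
    hN.nonneg.mono fun ω h => tailSum_nonneg h n
  have ha0 : ∀ᵐ ω ∂P, ∀ n, 0 ≤ atNat N n ω := by
    filter_upwards [hN.nonneg] with ω h n
    unfold atNat
    split_ifs
    · exact h _
    · exact le_rfl
  -- The σ-field at time `0` is trivial, so the initial conditional mass is the total mass, which is
  -- one.
  have h1 : P[tailSum N 0 | 𝒢 0] =ᵐ[P] 1 := by
    have hbot : (𝒢 0 : MeasurableSpace Ω) = ⊥ := by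
      rw [← hℱ.trivial_zero, ← Horizon.ofNat_zero]; rfl
    rw [hbot, condExp_bot, tailSum_of_mem N (n := 0) H.zero_mem_times]
    have h2 := hN.setIntegral_sumFrom (IsBddProc.one _) (t := H.ofNat 0) (A := Set.univ)
      MeasurableSet.univ
    have h3 : rect ℱ Set.univ (Set.Ici (H.ofNat 0)) = Set.univ := by
      ext p; simp [rect, Horizon.ofNat_zero_le]
    rw [Measure.restrict_univ, h3, Measure.restrict_univ] at h2
    rw [h2]
    refine Eventually.of_forall fun ω => ?_
    simp
  obtain ⟨M, γ', hMm, hγm, hM0, hγ0, hM1, hmart, hfac⟩ :=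
    exists_multiplicative_decomposition 𝒢 (measurable_atNat hN.adapted) (fun n => ha0.mono
      fun ω h => h n) hN.integrable_tailSum hS0 (fun n => by
        filter_upwards [hN.summable'] with ω h using tailSum_eq_add h n) h1
  obtain ⟨Q, hQp, hQ⟩ := exists_measure_of_martingale hℱ hM1 hmart
  have hQloc : MemMloc P ℱ Q := by
    refine ⟨hQp, fun s hs A hA h => ?_⟩
    obtain ⟨n, -, rfl⟩ := Horizon.exists_eq_ofNat hs
    rw [hQ n A hA, Measure.restrict_zero_set h, lintegral_zero_measure]
  have hMpos : ∀ᵐ ω ∂Q, ∀ n, 0 < M n ω := ae_all_iff.2 fun n =>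
    ae_pos_of_density (𝒢.le n) (hMm n) (hQ n)
  let D : ℕ → Ω → ℝ := fun n ω => 1 - ∑ r ∈ Finset.range n, γ' r ω
  have hDm : ∀ n, Measurable[𝒢 n] (D n) := fun n =>
    (Finset.measurable_fun_sum _ fun r hr =>
      (hγm r).mono (𝒢.mono (Finset.mem_range.1 hr).le) le_rfl).const_sub 1
  have hMD : ∀ n, ∀ᵐ ω ∂P, M n ω * D n ω = (P[tailSum N n | 𝒢 n]) ω := fun n =>
    (hfac n).mono fun ω h => h.2
  have hD0 : ∀ᵐ ω ∂Q, ∀ n, 0 ≤ D n ω := by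
    refine ae_all_iff.2 fun n => ?_
    have h2 : ∀ᵐ ω ∂P, 0 ≤ M n ω * D n ω := by
      filter_upwards [hMD n, condExp_nonneg (m := 𝒢 n) (hS0 n)] with ω h3 h4
      rw [h3]; exact h4
    filter_upwards [ae_of_density (hQ n) (measurableSet_le measurable_const
      ((hMm n).mul (hDm n))) h2, hMpos] with ω h3 h4
    exact nonneg_of_mul_nonneg_right h3 (h4 n)
  have hD1 : ∀ n ω, D n ω ≤ 1 := fun n ω =>
    sub_le_self _ (Finset.sum_nonneg fun r _ => hγ0 r ω)
  have hsummable : ∀ᵐ ω ∂Q, Summable fun n => γ' n ω := by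
    filter_upwards [hD0] with ω h
    exact summable_of_sum_range_le (c := 1) (fun n => hγ0 n ω) fun n => sub_nonneg.1 (h n)
  -- The mass not spent at finite times, which is the limit of `D n` under `Q`; it becomes the
  -- weight at `∞`.
  let L : Ω → ℝ := fun ω => 1 - ∑' n, γ' n ω
  have hDL : ∀ᵐ ω ∂Q, Tendsto (fun n => D n ω) atTop (𝓝 (L ω)) := by
    filter_upwards [hsummable] with ω h using h.hasSum.tendsto_sum_nat.const_sub 1
  have hL01 : ∀ᵐ ω ∂Q, 0 ≤ L ω ∧ L ω ≤ 1 := by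
    filter_upwards [hDL, hD0] with ω h2 h3
    exact ⟨ge_of_tendsto' h2 h3, le_of_tendsto' h2 fun n => hD1 n ω⟩
  have hDint : ∀ n A, MeasurableSet[𝒢 n] A → ∫⁻ ω in A, ENNReal.ofReal (D n ω) ∂Q =
      ∫⁻ ω in A, ENNReal.ofReal (tailSum N n ω) ∂P := by
    intro n A hA
    have hAi : Measurable[𝒢 n] (A.indicator (1 : Ω → ℝ≥0∞)) :=
      (@measurable_const _ _ _ (𝒢 n) (1 : ℝ≥0∞)).indicator hA
    have h2 := lintegral_mul_condExp (𝒢.le n) (hN.integrable_tailSum n) (hS0 n) hAi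
    have h3 := lintegral_eq_of_density (𝒢.le n) (hMm n) (hQ n)
      ((hDm n).ennreal_ofReal.indicator hA)
    rw [← lintegral_indicator (𝒢.le n _ hA), ← lintegral_indicator (𝒢.le n _ hA), h3]
    refine Eq.trans (lintegral_congr_ae ?_) (h2.trans (lintegral_congr fun ω => ?_))
    · filter_upwards [hMD n] with ω h4
      by_cases h5 : ω ∈ A
      · simp only [h5, Set.indicator_of_mem, Pi.one_apply, mul_one]
        rw [← ENNReal.ofReal_mul (hM0 n ω), h4]
      · simp [h5]
    · by_cases h5 : ω ∈ A <;> simp [h5]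
  have hNinf : Measurable (atInfty N) := by
    by_cases h : (⊤ : ℕ∞) ∈ H.times
    · have : atInfty N = N ⟨⊤, h⟩ := by funext ω; simp [atInfty, h]
      rw [this]; exact (hN.adapted _).mono (ℱ.le _) le_rfl
    · have : atInfty N = fun _ => 0 := by funext ω; simp [atInfty, h]
      rw [this]; exact measurable_const
  have hLm : Measurable L := (measurable_tsum_real fun n =>
    (hγm n).mono (𝒢.le n) le_rfl).const_sub 1
  -- For `n ≥ m` the `Q`-integral of `D n` over `A` is the `P`-integral of the tail sum of `N`.
  -- Letting `n` tend to infinity identifies `L dQ` with `N_∞ dP` on each `𝒢 m`, hence everywhere.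
  have hLint : ∀ m A, MeasurableSet[𝒢 m] A → ∫⁻ ω in A, ENNReal.ofReal (L ω) ∂Q =
      ∫⁻ ω in A, ENNReal.ofReal (atInfty N ω) ∂P := by
    intro m A hA
    have h2 : Tendsto (fun n => ∫⁻ ω in A, ENNReal.ofReal (D n ω) ∂Q) atTop
        (𝓝 (∫⁻ ω in A, ENNReal.ofReal (L ω) ∂Q)) := by
      refine tendsto_lintegral_of_dominated_convergence (fun _ => 1)
        (fun n => ((hDm n).mono (𝒢.le n) le_rfl).ennreal_ofReal)
        (fun n => Eventually.of_forall fun ω => ENNReal.ofReal_le_one.2 (hD1 n ω)) (by simp) ?_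
      filter_upwards [ae_restrict_of_ae hDL] with ω h3 using ENNReal.tendsto_ofReal h3
    have h3 : Tendsto (fun n => ∫⁻ ω in A, ENNReal.ofReal (tailSum N n ω) ∂P) atTop
        (𝓝 (∫⁻ ω in A, ENNReal.ofReal (atInfty N ω) ∂P)) := by
      refine tendsto_lintegral_of_dominated_convergence'
        (fun ω => ENNReal.ofReal (tailSum N 0 ω))
        (fun n => ((hN.integrable_tailSum n).1.aemeasurable.ennreal_ofReal).restrict)
        (fun n => ?_) ?_ ?_
      · filter_upwards [ae_restrict_of_ae hN.summable', ae_restrict_of_ae hN.nonneg] with ω h4 h5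
        refine ENNReal.ofReal_le_ofReal ?_
        refine Summable.tsum_le_tsum (fun s => ?_) (summable_tail h4 _) (summable_tail h4 _)
        split_ifs with h6 h7
        · exact le_rfl
        · exact absurd (by simp) h7
        · exact h5 s
        · exact le_rfl
      · exact ((lintegral_mono_ae (Eventually.of_forall fun ω => Real.ofReal_le_enorm _)).trans_lt
          (hN.integrable_tailSum 0).integrableOn.2).ne
      · filter_upwards [ae_restrict_of_ae hN.summable'] with ω h4
        exact ENNReal.tendsto_ofReal (tendsto_tailSum h4)
    refine tendsto_nhds_unique h2 (h3.congr' ?_)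
    filter_upwards [eventually_ge_atTop m] with n hn
    exact (hDint n A (𝒢.mono hn _ hA)).symm
  have hLfin : IsFiniteMeasure (Q.withDensity fun ω => ENNReal.ofReal (L ω)) := by
    refine isFiniteMeasure_withDensity (ne_of_lt (lt_of_le_of_lt (lintegral_mono_ae ?_)
      (?_ : ∫⁻ _, 1 ∂Q < ∞)))
    · filter_upwards [hL01] with ω h using ENNReal.ofReal_le_one.2 h.2
    · simp
  have hmeas : (Q.withDensity fun ω => ENNReal.ofReal (L ω)) =
      P.withDensity fun ω => ENNReal.ofReal (atInfty N ω) := by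
    refine ext_of_natFiltration hℱ fun n A hA => ?_
    rw [withDensity_apply _ (𝒢.le n _ hA), withDensity_apply _ (𝒢.le n _ hA), hLint n A hA]
  let γ : H.Time → Ω → ℝ := fun s ω => if s.1 = ⊤ then L ω else γ' s.1.toNat ω
  have hγfin : ∀ n : ℕ, (n : ℕ∞) ∈ H.times → γ (H.ofNat n) = γ' n := fun n hn => by
    funext ω
    simp only [γ, Horizon.coe_ofNat hn, ENat.natCast_ne_top, if_false, ENat.toNat_natCast]
  have hγadapted : ∀ s, Measurable[ℱ s] (γ s) := by
    intro s
    by_cases hs : s.1 = ⊤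
    · have h2 : γ s = L := by funext ω; simp [γ, hs]
      have h3 : ∀ n, (𝒢 n : MeasurableSpace Ω) ≤ ℱ s := fun n => ℱ.mono (by
        rw [← Subtype.coe_le_coe, hs]; exact le_top)
      rw [h2]
      exact (measurable_tsum_real (m := ℱ s) fun n => (hγm n).mono (h3 n) le_rfl).const_sub 1
    · obtain ⟨n, hn, rfl⟩ := Horizon.exists_eq_ofNat hs
      rw [hγfin n (hn ▸ (H.ofNat n).2)]
      exact hγm n
  have hzero : ∀ᵐ ω ∂Q, ∀ n : ℕ, (n : ℕ∞) ∉ H.times → γ' n ω = 0 := by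
    refine ae_all_iff.2 fun n => ?_
    by_cases hn : (n : ℕ∞) ∈ H.times
    · exact Eventually.of_forall fun ω h => absurd hn h
    · have h2 : ∀ᵐ ω ∂P, M n ω * γ' n ω = 0 := by
        filter_upwards [hfac n] with ω h
        rw [h.1]; simp [atNat, hn]
      filter_upwards [ae_of_density (hQ n)
        (((hMm n).mul (hγm n)) (measurableSet_singleton 0)) h2, hMpos] with ω h3 h4 _
      exact (mul_eq_zero.1 h3).resolve_left (h4 n).ne'
  -- Without the time point `∞` the measure `N_∞ dP` is zero, so all mass is spent at finite times.
  have hLtop : (⊤ : ℕ∞) ∉ H.times → ∀ᵐ ω ∂Q, L ω = 0 := fun h => by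
    have h2 : ∀ ω, ENNReal.ofReal (atInfty N ω) = 0 := fun ω => by simp [atInfty, h]
    simp only [h2] at hmeas
    have h3 : (Q.withDensity fun ω => ENNReal.ofReal (L ω)) = 0 := by
      rw [hmeas]; exact withDensity_zero
    rw [withDensity_eq_zero_iff hLm.ennreal_ofReal.aemeasurable] at h3
    filter_upwards [h3, hL01] with ω h4 h5
    exact le_antisymm (ENNReal.ofReal_eq_zero.1 h4) h5.1
  have hγ : MemGamma P ℱ Q γ := by
    refine ⟨hγadapted, ?_, ?_, fun i hi => ?_⟩
    · filter_upwards [hL01] with ω h s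
      simp only [γ]
      split_ifs
      · exact h.1
      · exact hγ0 _ ω
    · have hL' : ∀ᵐ ω ∂Q, atInfty γ ω = L ω := by
        by_cases h : (⊤ : ℕ∞) ∈ H.times
        · exact Eventually.of_forall fun ω => by simp [atInfty, h, γ]
        · filter_upwards [hLtop h] with ω h2
          simp [atInfty, h, h2]
      filter_upwards [hsummable, hzero, hL'] with ω h2 h3 h4
      have h5 : (fun n => atNat γ n ω) = fun n => γ' n ω := by
        funext n
        by_cases hn : (n : ℕ∞) ∈ H.times
        · rw [atNat_of_mem γ hn, hγfin n hn]
        · simp [atNat, hn, h3 n hn]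
      have h6 := hasSum_of_hasSum_atNat (f := γ) (ω := ω) (b := ∑' n, γ' n ω)
        (by rw [h5]; exact h2.hasSum)
      rw [h4] at h6
      simpa [L] using h6
    -- `L dQ = N_∞ dP` is absolutely continuous with respect to `P`, and the singular event is
    -- `P`-null; so `L` vanishes there under `Q`.
    · have h2 : ∀ᵐ ω ∂(Q.withDensity fun ω => ENNReal.ofReal (L ω)), ω ∉ singularEvent P ℱ Q := by
        rw [hmeas]
        exact withDensity_absolutelyContinuous _ _ (hQloc.ae_notMem_singularEvent hℱ)
      rw [ae_withDensity_iff hLm.ennreal_ofReal] at h2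
      filter_upwards [h2, hL01] with ω h3 h4 h5
      simp only [γ, hi, if_true]
      by_contra hc
      exact h3 (ENNReal.ofReal_pos.2 (lt_of_le_of_ne h4.1 (Ne.symm hc))).ne' h5
  refine ⟨Q, γ, hQloc, hγ, ?_⟩
  ext B hB
  rw [optProd_apply hγ.adapted hB, optProd_apply hN.adapted hB]
  congr 1
  funext s
  have hBs := measurableSet_optSpace_iff.1 hB s
  by_cases hs : s.1 = ⊤
  · have h2 : ∀ ω, γ s ω = L ω := fun ω => by simp [γ, hs]
    have h3 : ∀ ω, N s ω = atInfty N ω := fun ω => by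
      have h4 : (⊤ : ℕ∞) ∈ H.times := hs ▸ s.2
      have h5 : s = ⟨⊤, h4⟩ := Subtype.ext hs
      simp [atInfty, h4, h5]
    simp only [h2, h3]
    rw [← withDensity_apply _ (ℱ.le s _ hBs), ← withDensity_apply _ (ℱ.le s _ hBs), hmeas]
  · obtain ⟨n, hn, rfl⟩ := Horizon.exists_eq_ofNat hs
    have hn' : (n : ℕ∞) ∈ H.times := hn ▸ (H.ofNat n).2
    have h3 := lintegral_eq_of_density (𝒢.le n) (hMm n) (hQ n)
      ((hγm n).ennreal_ofReal.indicator hBs)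
    rw [hγfin n hn', ← lintegral_indicator (ℱ.le _ _ hBs), ← lintegral_indicator (ℱ.le _ _ hBs), h3]
    refine lintegral_congr_ae ?_
    filter_upwards [hfac n] with ω h4
    have h5 := h4.1
    rw [atNat_of_mem N hn'] at h5
    by_cases h6 : ω ∈ {ω | (⟨ω, H.ofNat n⟩ : OptSpace ℱ) ∈ B}
    · rw [Set.indicator_of_mem h6, Set.indicator_of_mem h6, ← ENNReal.ofReal_mul (hM0 n ω), h5]
    · rw [Set.indicator_of_notMem h6, Set.indicator_of_notMem h6, mul_zero]

end Decomposition

end RiskProc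


namespace RiskProc

/-! ### Parts (A) and (C) -/

section Representation

variable {Ω : Type*} {mΩ : MeasurableSpace Ω} {H : Horizon} {ℱ : Filtration H.Time mΩ}
  {P Q : Measure Ω} {t : H.Time} {ρ : (H.Time → Ω → ℝ) → Ω → ℝ} {X γ μ N : H.Time → Ω → ℝ}

theorem ae_iff_of_eq_on {m : MeasurableSpace Ω} (h : ∀ A, MeasurableSet[m] A → Q A = P A)
    {p : Ω → Prop} (hp : MeasurableSet[m] {ω | p ω}) : (∀ᵐ ω ∂Q, p ω) ↔ ∀ᵐ ω ∂P, p ω := by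
  rw [ae_iff, ae_iff]
  have := h _ hp.compl
  exact (iff_of_eq (congrArg (· = 0) this))

theorem lintegral_eq_of_eq_on {m : MeasurableSpace Ω} (hm : m ≤ mΩ)
    (h : ∀ A, MeasurableSet[m] A → Q A = P A) {F : Ω → ℝ≥0∞} (hF : Measurable[m] F) :
    ∫⁻ ω, F ω ∂Q = ∫⁻ ω, F ω ∂P := by
  have h1 : Q.trim hm = P.trim hm := @Measure.ext _ m _ _ fun A hA => by
    rw [trim_measurableSet_eq hm hA, trim_measurableSet_eq hm hA, h A hA]
  rw [← lintegral_trim hm hF, h1, lintegral_trim hm hF]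

theorem ae_eq_iff_of_eq_on {m : MeasurableSpace Ω} (h : ∀ A, MeasurableSet[m] A → Q A = P A)
    {f g : Ω → ℝ} (hf : Measurable[m] f) (hg : Measurable[m] g) : f =ᵐ[Q] g ↔ f =ᵐ[P] g :=
  ae_iff_of_eq_on h (measurableSet_eq_fun hf hg)

theorem MemGammaT.discOf_eq_one (hγ : MemGammaT P ℱ t Q γ) (ht : t.1 ≠ ⊤) :
    discOf γ t =ᵐ[Q] 1 := by
  have h1 : ∀ s, ∀ᵐ ω ∂Q, s < t → γ s ω = 0 := fun s => by
    by_cases hs : s < t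
    · filter_upwards [hγ.eq_zero s hs] with ω h _ using h
    · exact Eventually.of_forall fun ω h => absurd h hs
  filter_upwards [ae_all_iff.2 h1] with ω h
  have h2 : ∀ s : H.Time, (if s < t then γ s ω else 0) = 0 := fun s => by
    split_ifs with hs
    · exact h s hs
    · rfl
  simp [discOf, ht, h2]

theorem massFrom_eq_one_of_optProd_eq [IsProbabilityMeasure P] (hN : IsWeight ℱ P N)
    (hQ : MemQloc P ℱ t Q) (hγ : MemGammaT P ℱ t Q γ) (ht : t.1 ≠ ⊤)
    (heq : optProd ℱ Q γ = optProd ℱ P N) : massFrom ℱ t P N =ᵐ[P] 1 := by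
  have := hQ.memMloc.prob
  refine massFrom_eq_one hN fun A hA => ?_
  rw [Measure.real, Measure.real, ← heq, hγ.memGamma.isWeight.optProd_rect_Ici hA,
    ← hQ.eq_on A hA, ← setLIntegral_one]
  congr 1
  refine lintegral_congr_ae (ae_restrict_of_ae ?_)
  filter_upwards [hγ.memGamma.massFrom_eq ht, hγ.discOf_eq_one ht] with ω h1 h2
  rw [h1, h2]
  simp

/-- Here `D_t = 1`, so normalizing changes nothing. All terms are `ℱ_t`-measurable and `Q = P` on
`ℱ_t`, which turns identities under `Q` into identities under `P`. -/
theorem gammaTerm_eq_densityTerm [IsProbabilityMeasure P] (hN : IsWeight ℱ P N)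
    (hQ : MemQloc P ℱ t Q) (hγ : MemGammaT P ℱ t Q γ) (ht : t.1 ≠ ⊤)
    (heq : optProd ℱ Q γ = optProd ℱ P N) (hX : MemR P ℱ X) :
    gammaTerm P ℱ t ρ X Q γ =ᵐ[P] densityTerm P ℱ t ρ N X := by
  have := hQ.memMloc.prob
  have hmass := massFrom_eq_one_of_optProd_eq hN hQ hγ ht heq
  have hX' := hX.isBddProc hN.adapted
  rw [← heq] at hX'
  have h1 : condLoss ℱ t Q (normalize t γ) X =ᵐ[Q] condLoss ℱ t Q γ X := by
    filter_upwards [(hγ.memGamma.condLoss_normalize ht hX').2, hγ.memGamma.massFrom_eq ht,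
      hγ.discOf_eq_one ht] with ω h2 h3 h4
    rw [← h2, h3, h4]
    simp
  rw [ae_eq_iff_of_eq_on hQ.eq_on (measurable_condLoss t Q _ X)
    (measurable_condLoss t Q _ X)] at h1
  filter_upwards [h1, condLoss_normalize_eq_lossRatio hγ.memGamma hN heq ht hX,
    penalty_eq_densityPenalty (ρ := ρ) hγ.memGamma hN heq ht, hmass] with ω h2 h3 h4 h5
  have h6 : 0 < massFrom ℱ t P N ω := by rw [h5]; exact zero_lt_one
  rw [gammaTerm, densityTerm, ← h2, h3 h6, h4 h6]

/-- Density processes starting at time `t` with unit mass come from `Q ∈ 𝒬_t^loc` and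
`γ ∈ Γ_t(Q)`. -/
theorem exists_decomposition_of_massFrom [IsProbabilityMeasure P] (hℱ : IsStandardFiltration ℱ)
    (ht : t.1 ≠ ⊤) (hN : IsWeight ℱ P N) (h0 : ∀ s < t, N s = 0)
    (hmass : massFrom ℱ t P N =ᵐ[P] 1) :
    ∃ Q γ, MemQloc P ℱ t Q ∧ MemGammaT P ℱ t Q γ ∧ optProd ℱ Q γ = optProd ℱ P N := by
  have hmassA : ∀ A, MeasurableSet[ℱ t] A → optProd ℱ P N (rect ℱ A (Set.Ici t)) = P A := by
    intro A hA
    rw [hN.optProd_rect_Ici hA, ← setLIntegral_one]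
    refine lintegral_congr_ae (ae_restrict_of_ae ?_)
    filter_upwards [hmass] with ω h
    rw [h]; simp
  have hprob : IsProbabilityMeasure (optProd ℱ P N) := by
    constructor
    rw [← measure_univ (μ := P), ← hmassA _ MeasurableSet.univ]
    refine measure_congr ?_
    -- Nothing is charged before `t`, so the total mass is the mass from `t` on, namely `P(Ω) = 1`.
    have h1 : ∀ᵐ p ∂optProd ℱ P N, p ∈ rect ℱ Set.univ (Set.Ici t) := by
      rw [ae_optProd_iff hN.adapted (p := fun p => p ∈ rect ℱ Set.univ (Set.Ici t))
        (measurableSet_rect_Ici MeasurableSet.univ)]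
      refine fun s => Eventually.of_forall fun ω h => ⟨trivial, ?_⟩
      by_contra hs
      rw [h0 s (not_le.1 hs)] at h
      exact lt_irrefl _ h
    filter_upwards [h1] with p hp
    exact propext ⟨fun _ => hp, fun _ => trivial⟩
  obtain ⟨Q, γ, hQ, hγ, heq⟩ := exists_decomposition hℱ hN hprob
  have := hQ.prob
  have hγT : MemGammaT P ℱ t Q γ := by
    refine ⟨hγ, fun s hs => ?_⟩
    have h1 := optProd_rect_singleton (Q := Q) hγ.adapted (s := s) (A := Set.univ)
      MeasurableSet.univ
    rw [heq, optProd_rect_singleton hN.adapted MeasurableSet.univ, h0 s hs] at h1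
    simp only [Pi.zero_apply, ENNReal.ofReal_zero, lintegral_zero, Measure.restrict_univ] at h1
    have h2 := (lintegral_eq_zero_iff
      (((hγ.adapted s).mono (ℱ.le s) le_rfl).ennreal_ofReal)).1 h1.symm
    filter_upwards [h2, hγ.nonneg] with ω h3 h4
    exact le_antisymm (ENNReal.ofReal_eq_zero.1 h3) (h4 s)
  refine ⟨Q, γ, ⟨hQ, fun A hA => ?_⟩, hγT, heq⟩
  rw [← hmassA A hA, ← heq, hγ.isWeight.optProd_rect_Ici hA, ← setLIntegral_one]
  refine lintegral_congr_ae (ae_restrict_of_ae ?_)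
  filter_upwards [hγ.massFrom_eq ht, hγT.discOf_eq_one ht] with ω h1 h2
  rw [h1, h2]; simp

/-- Representations over families of density processes characterize continuity from above. -/
theorem contFromAbove_iff_of_family [IsProbabilityMeasure P] (hρ : IsCondConvexRisk P ℱ t ρ)
    (S : Set (H.Time → Ω → ℝ)) (rep : (H.Time → Ω → ℝ) → Ω → EReal)
    (hw : ∀ N ∈ S, IsWeight ℱ P N) (hpos : ∀ N ∈ S, ∀ᵐ ω ∂P, 0 < massFrom ℱ t P N ω)
    (hupper : ∀ X, MemRt P ℱ t X → ∀ N ∈ S, densityTerm P ℱ t ρ N X ≤ᵐ[P] rep X)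
    (hleast : ∀ X, MemRt P ℱ t X → ∀ h : Ω → EReal, Measurable[ℱ t] h →
      (∀ N ∈ S, densityTerm P ℱ t ρ N X ≤ᵐ[P] h) → rep X ≤ᵐ[P] h)
    (hdual : ContFromAbove P ℱ t ρ → ∀ X, MemRt P ℱ t X → ∀ h : Ω → EReal,
      (∀ N ∈ S, densityTerm P ℱ t ρ N X ≤ᵐ[P] h) → (fun ω => (ρ X ω : EReal)) ≤ᵐ[P] h) :
    ContFromAbove P ℱ t ρ ↔ ∀ X, MemRt P ℱ t X → ∀ᵐ ω ∂P, (ρ X ω : EReal) = rep X ω := by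
  constructor
  · intro hcont X hX
    have h1 := hleast X hX (fun ω => (ρ X ω : EReal))
      (measurable_coe_real_ereal.comp (hρ.memLinf X hX).measurable) fun N hN => by
        filter_upwards [densityTerm_le hρ (hw N hN) hX, hpos N hN] with ω h1 h2 using h1 h2
    filter_upwards [h1, hdual hcont X hX _ (hupper X hX)] with ω h2 h3 using le_antisymm h3 h2
  · intro hrep
    refine contFromAbove_of_representation hρ S hw hpos fun X hX h hh hS => ?_
    filter_upwards [hrep X hX, hleast X hX h hh hS] with ω h1 h2
    rw [h1]; exact h2

theorem exists_weight_of_memGamma [IsProbabilityMeasure P] (hℱ : IsStandardFiltration ℱ)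
    (hμ : IsReference P ℱ μ) (hQ : MemMloc P ℱ Q) (hγ : MemGamma P ℱ Q γ) :
    ∃ N, IsWeight ℱ P N ∧ optProd ℱ Q γ = optProd ℱ P N ∧ ∀ᵐ ω ∂P, ∀ s, 0 ≤ N s ω := by
  have := hQ.prob
  have := hγ.optProd_univ
  exact hμ.exists_weight (hγ.absolutelyContinuous hℱ hμ hQ)

/-- Continuity from above is equivalent to the robust representation. -/
theorem contFromAbove_iff_gammaRep [IsProbabilityMeasure P] (hℱ : IsStandardFiltration ℱ)
    (hμ : IsReference P ℱ μ) (ht : t.1 ≠ ⊤) (hρ : IsCondConvexRisk P ℱ t ρ) :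
    ContFromAbove P ℱ t ρ ↔
      ∀ X, MemRt P ℱ t X → ∀ᵐ ω ∂P, (ρ X ω : EReal) = gammaRep P ℱ t ρ X ω := by
  -- The family consists of the densities of all admissible pairs. Absolute continuity provides a
  -- density for each pair, and the factorization a pair for each separating density.
  refine contFromAbove_iff_of_family hρ {N | IsWeight ℱ P N ∧ ∃ Q γ, MemQloc P ℱ t Q ∧
    MemGammaT P ℱ t Q γ ∧ optProd ℱ Q γ = optProd ℱ P N} _ (fun N hN => hN.1) ?_ ?_ ?_ ?_
  · rintro N ⟨hN, Q, γ, hQ, hγ, heq⟩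
    filter_upwards [massFrom_eq_one_of_optProd_eq hN hQ hγ ht heq] with ω h
    rw [h]; exact zero_lt_one
  · rintro X hX N ⟨hN, Q, γ, hQ, hγ, heq⟩
    refine (gammaTerm_eq_densityTerm hN hQ hγ ht heq hX.memR).symm.le.trans ?_
    exact EventuallyLE.trans (le_familyEssSup P (ℱ.le t) (S := {f | ∃ γ, MemGammaT P ℱ t Q γ ∧
        f = gammaTerm P ℱ t ρ X Q γ}) ⟨γ, hγ, rfl⟩)
      (le_familyEssSup P (ℱ.le t) ⟨Q, hQ, rfl⟩)
  · intro X hX h hh hS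
    refine (familyEssSup_spec P (ℱ.le t) _).least h hh ?_
    rintro f ⟨Q, hQ, rfl⟩
    refine (familyEssSup_spec P (ℱ.le t) _).least h hh ?_
    rintro f ⟨γ, hγ, rfl⟩
    obtain ⟨N, hN, heq, -⟩ := exists_weight_of_memGamma hℱ hμ hQ.memMloc hγ.memGamma
    exact (gammaTerm_eq_densityTerm hN hQ hγ ht heq hX.memR).le.trans
      (hS N ⟨hN, Q, γ, hQ, hγ, heq⟩)
  · intro hcont X hX h hS
    refine le_of_forall_densityTerm_le hμ hρ hcont hX fun N hN => hS N ⟨hN.isWeight, ?_⟩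
    exact exists_decomposition_of_massFrom hℱ ht hN.isWeight hN.eq_zero hN.mass

/-- The weight is at most `1`, and `Q = P` on `ℱ_t`, so the integrable penalty of a separating
density bounds the expected penalty. -/
theorem expectedPenalty_lt_top [IsProbabilityMeasure P] (hμ : IsReference P ℱ μ)
    (ht : t.1 ≠ ⊤) (hN : IsUnitDensity P ℱ t ρ N)
    (hQ : MemQloc P ℱ t Q) (hγ : MemGammaT P ℱ t Q γ)
    (heq : optProd ℱ Q γ = optProd ℱ P N) : expectedPenalty P ℱ μ t ρ Q γ < ∞ := by
  have := hQ.memMloc.prob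
  have hpm : Measurable[ℱ t] (penalty P ℱ t ρ Q γ) := measurable_familyEssSup Q (ℱ.le t) _
  have h0 := lintegral_eq_of_eq_on (ℱ.le t) hQ.eq_on
    (F := fun ω => ENNReal.ofReal (discOf μ t ω) * (penalty P ℱ t ρ Q γ ω).toENNReal)
    ((measurable_discOf hμ.adapted t).ennreal_ofReal.mul (measurable_ereal_toENNReal.comp hpm))
  rw [expectedPenalty, h0]
  refine lt_of_le_of_lt (lintegral_mono_ae ?_) hN.penalty.lt_top
  filter_upwards [hμ.pos, penalty_eq_densityPenalty (ρ := ρ) hγ.memGamma hN.isWeight heq ht,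
    hN.mass] with ω h1 h2 h3
  rw [h2 (by rw [h3]; exact zero_lt_one)]
  refine mul_le_of_le_one_left' (ENNReal.ofReal_le_one.2 ?_)
  rw [discOf, if_neg ht, sub_le_self_iff]
  exact tsum_nonneg fun s => by split_ifs; exacts [(h1 s).le, le_rfl]

/-- Continuity from above is equivalent to the robust representation over measures with finite
expected penalty. -/
theorem contFromAbove_iff_finitePenaltyRep [IsProbabilityMeasure P] (hℱ : IsStandardFiltration ℱ)
    (hμ : IsReference P ℱ μ) (ht : t.1 ≠ ⊤) (hρ : IsCondConvexRisk P ℱ t ρ) :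
    ContFromAbove P ℱ t ρ ↔
      ∀ X, MemRt P ℱ t X → ∀ᵐ ω ∂P, (ρ X ω : EReal) = finitePenaltyRep P ℱ μ t ρ X ω := by
  refine contFromAbove_iff_of_family hρ {N | IsWeight ℱ P N ∧ ∃ Q γ, MemQloc P ℱ t Q ∧
    MemGammaT P ℱ t Q γ ∧ expectedPenalty P ℱ μ t ρ Q γ < ∞ ∧
    optProd ℱ Q γ = optProd ℱ P N} _ (fun N hN => hN.1) ?_ ?_ ?_ ?_
  · rintro N ⟨hN, Q, γ, hQ, hγ, -, heq⟩
    filter_upwards [massFrom_eq_one_of_optProd_eq hN hQ hγ ht heq] with ω h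
    rw [h]; exact zero_lt_one
  · rintro X hX N ⟨hN, Q, γ, hQ, hγ, hfin, heq⟩
    exact (gammaTerm_eq_densityTerm hN hQ hγ ht heq hX.memR).symm.le.trans
      (le_familyEssSup P (ℱ.le t) ⟨Q, γ, hQ, hγ, hfin, rfl⟩)
  · intro X hX h hh hS
    refine (familyEssSup_spec P (ℱ.le t) _).least h hh ?_
    rintro f ⟨Q, γ, hQ, hγ, hfin, rfl⟩
    obtain ⟨N, hN, heq, -⟩ := exists_weight_of_memGamma hℱ hμ hQ.memMloc hγ.memGamma
    exact (gammaTerm_eq_densityTerm hN hQ hγ ht heq hX.memR).le.trans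
      (hS N ⟨hN, Q, γ, hQ, hγ, hfin, heq⟩)
  · intro hcont X hX h hS
    refine le_of_forall_densityTerm_le hμ hρ hcont hX fun N hN => hS N ⟨hN.isWeight, ?_⟩
    obtain ⟨Q, γ, hQ, hγ, heq⟩ :=
      exists_decomposition_of_massFrom hℱ ht hN.isWeight hN.eq_zero hN.mass
    exact ⟨Q, γ, hQ, hγ, expectedPenalty_lt_top hμ ht hN hQ hγ heq, heq⟩

end Representation

end RiskProc


namespace RiskProc

/-! ### Part (B): discounting processes and summation by parts -/

section Discounting

variable {Ω : Type*} {mΩ : MeasurableSpace Ω} {H : Horizon} {ℱ : Filtration H.Time mΩ}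
  {P Q : Measure Ω} {t : H.Time} {ρ : (H.Time → Ω → ℝ) → Ω → ℝ} {X γ γ' D N : H.Time → Ω → ℝ}

theorem atNat_of_notMem (f : H.Time → Ω → ℝ) {n : ℕ} (h : (n : ℕ∞) ∉ H.times) :
    atNat f n = 0 := by
  funext ω; simp [atNat, h]

theorem Horizon.natCast_mem_of_le {m n : ℕ} (h : m ≤ n) (hn : (n : ℕ∞) ∈ H.times) :
    (m : ℕ∞) ∈ H.times :=
  Horizon.mem_times_of_le hn (Nat.cast_le.2 h)

theorem atNat_gammaOf (D : H.Time → Ω → ℝ) (n : ℕ) (ω : Ω) :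
    atNat (gammaOf D) n ω = atNat D n ω - atNat D (n + 1) ω := by
  by_cases h : (n : ℕ∞) ∈ H.times
  · have h1 : ((⟨n, h⟩ : H.Time) : ℕ∞) ≠ ⊤ := ENat.natCast_ne_top n
    rw [atNat, dif_pos h, gammaOf, if_neg h1, atNat, dif_pos h]
    congr 1
  · have h' : ((n + 1 : ℕ) : ℕ∞) ∉ H.times := fun hc =>
      h (Horizon.natCast_mem_of_le n.le_succ hc)
    simp [atNat_of_notMem _ h, atNat_of_notMem _ h']

theorem atInfty_gammaOf (D : H.Time → Ω → ℝ) (ω : Ω) : atInfty (gammaOf D) ω = atInfty D ω := by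
  unfold atInfty
  split_ifs
  · simp [gammaOf]
  · rfl

theorem Horizon.pred_ofNat {n : ℕ} (h : ((n + 1 : ℕ) : ℕ∞) ∈ H.times) :
    Horizon.pred (H.ofNat (n + 1)) = H.ofNat n := by
  refine Subtype.ext ?_
  have h1 : (Horizon.pred (H.ofNat (n + 1))).1 = (H.ofNat (n + 1)).1 - 1 := rfl
  rw [h1, Horizon.coe_ofNat (Horizon.natCast_mem_of_le n.le_succ h), Horizon.coe_ofNat h]
  norm_cast

theorem Horizon.ofNat_succ_ne_zero {n : ℕ} (h : ((n + 1 : ℕ) : ℕ∞) ∈ H.times) :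
    H.ofNat (n + 1) ≠ H.zero := fun hc => by
  have := congrArg Subtype.val hc
  rw [Horizon.coe_ofNat h] at this
  simp [Horizon.zero] at this

/-- Summation by parts. -/
theorem discSum_eq (D : H.Time → Ω → ℝ) (hX : ∀ s < t, X s = 0) (n : ℕ) (ω : Ω) :
    discSum t D X n ω = ∑ k ∈ Finset.range (n + 1), atNat (gammaOf D) k ω * atNat X k ω +
      atNat D (n + 1) ω * atNat X n ω := by
  have hX0 : ∀ k : ℕ, ¬t.1 ≤ (k : ℕ∞) → atNat X k ω = 0 := fun k hk => by
    by_cases h : (k : ℕ∞) ∈ H.times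
    · rw [atNat_of_mem X h, hX _ (by
        rw [← Subtype.coe_lt_coe, Horizon.coe_ofNat h]; exact not_le.1 hk)]
      rfl
    · rw [atNat_of_notMem X h]; rfl
  unfold discSum
  induction n with
  | zero =>
    rw [Finset.sum_range_one, Finset.sum_range_one, atNat_gammaOf]
    have h0 : ((0 : ℕ) : ℕ∞) ∈ H.times := H.zero_mem_times
    split_ifs with h
    · rw [delta, if_pos (Horizon.ofNat_zero), atNat_of_mem X h0, atNat_of_mem D h0]
      ring
    · rw [hX0 0 fun hc => h ⟨h0, hc⟩]
      ring
  | succ n ih =>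
    rw [Finset.sum_range_succ, ih, Finset.sum_range_succ _ (n + 1), atNat_gammaOf D (n + 1)]
    by_cases h : ((n + 1 : ℕ) : ℕ∞) ∈ H.times
    · by_cases ht : t.1 ≤ ((n + 1 : ℕ) : ℕ∞)
      · rw [if_pos ⟨h, ht⟩, delta, if_neg (Horizon.ofNat_succ_ne_zero h), Horizon.pred_ofNat h,
          atNat_of_mem X h, atNat_of_mem D h,
          atNat_of_mem X (Horizon.natCast_mem_of_le n.le_succ h)]
        ring
      · rw [if_neg fun hc => ht hc.2, hX0 _ ht, hX0 n fun hc =>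
          ht (hc.trans (Nat.cast_le.2 n.le_succ))]
        ring
    · have h' : ((n + 1 + 1 : ℕ) : ℕ∞) ∉ H.times := fun hc =>
        h (Horizon.natCast_mem_of_le (n + 1).le_succ hc)
      rw [if_neg fun hc => h hc.1, atNat_of_notMem D h, atNat_of_notMem D h', atNat_of_notMem X h]
      simp

theorem sumFrom_eq_tsum (hX : ∀ s < t, X s = 0) (γ : H.Time → Ω → ℝ) (ω : Ω) :
    sumFrom t γ X ω = ∑' s, γ s ω * X s ω := by
  refine tsum_congr fun s => ?_
  split_ifs with h
  · rfl
  · rw [hX s (not_le.1 h)]; simp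

/-- Since values beyond the horizon and at a missing `∞` are `0`, the three terminal conditions on
`D` become one limit statement. -/
theorem MemDisc.tendsto_atNat (hD : MemDisc P ℱ Q D) :
    ∀ᵐ ω ∂Q, Tendsto (fun n => atNat D n ω) atTop (𝓝 (atInfty D ω)) := by
  rcases H with T | _ | _
  · refine Eventually.of_forall fun ω => tendsto_const_nhds.congr' ?_
    filter_upwards [eventually_gt_atTop T] with n hn
    have h : (n : ℕ∞) ∉ (Horizon.finite T).times := fun hc =>
      absurd (Nat.cast_le.1 (show (n : ℕ∞) ≤ T from hc)) (not_le.2 hn)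
    have h' : (⊤ : ℕ∞) ∉ (Horizon.finite T).times := fun hc =>
      absurd (show (⊤ : ℕ∞) ≤ T from hc) (by simp)
    rw [atNat_of_notMem D h, atInfty, dif_neg h']
    rfl
  · filter_upwards [hD.tendsto_zero rfl] with ω h
    have h1 : (fun n => atNat D n ω) = fun n => D (Horizon.nat.ofNat n) ω := by
      funext n
      rw [atNat_of_mem D (show (n : ℕ∞) ∈ Horizon.nat.times from ENat.natCast_ne_top n)]
    have h' : (⊤ : ℕ∞) ∉ Horizon.nat.times := fun hc => hc rfl
    rw [h1, atInfty, dif_neg h']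
    exact h
  · have htop : (⊤ : ℕ∞) ∈ Horizon.natInfty.times := trivial
    filter_upwards [hD.tendsto_top ⟨⊤, htop⟩ rfl] with ω h
    have h1 : (fun n => atNat D n ω) = fun n => D (Horizon.natInfty.ofNat n) ω := by
      funext n
      rw [atNat_of_mem D (show (n : ℕ∞) ∈ Horizon.natInfty.times from trivial)]
    rw [h1, atInfty, dif_pos htop]
    exact h

theorem MemDisc.gammaOf_nonneg (hD : MemDisc P ℱ Q D) : ∀ᵐ ω ∂Q, ∀ s, 0 ≤ gammaOf D s ω := by
  filter_upwards [hD.antitone, hD.nonneg] with ω h1 h2 s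
  rw [gammaOf]
  split_ifs with hs hs'
  · exact h2 s
  · exact sub_nonneg.2 (h1 (a := s) (b := ⟨s.1 + 1, hs'⟩) (Subtype.coe_le_coe.1 le_self_add))
  · simpa using h2 s

theorem atNat_nonneg {f : H.Time → Ω → ℝ} {ω : Ω} (h : ∀ s, 0 ≤ f s ω) (n : ℕ) :
    0 ≤ atNat f n ω := by
  unfold atNat
  split_ifs
  exacts [h _, le_rfl]

theorem MemDisc.hasSum_atNat_gammaOf (hD : MemDisc P ℱ Q D) :
    ∀ᵐ ω ∂Q, HasSum (fun n => atNat (gammaOf D) n ω) (1 - atInfty D ω) := by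
  filter_upwards [hD.tendsto_atNat, hD.gammaOf_nonneg, hD.zero] with ω h1 h2 h3
  rw [hasSum_iff_tendsto_nat_of_nonneg fun n => atNat_nonneg h2 n]
  have h4 : ∀ n, ∑ k ∈ Finset.range n, atNat (gammaOf D) k ω = 1 - atNat D n ω := by
    intro n
    simp only [atNat_gammaOf]
    rw [Finset.sum_range_sub', atNat_of_mem D (n := 0) H.zero_mem_times, Horizon.ofNat_zero, h3]
    rfl
  simp only [h4]
  exact h1.const_sub 1

theorem MemDisc.memGamma (hD : MemDisc P ℱ Q D) : MemGamma P ℱ Q (gammaOf D) := by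
  have hDm : ∀ s, Measurable[ℱ s] (D s) := fun s =>
    (hD.predictable s).mono (ℱ.mono (Subtype.coe_le_coe.1 tsub_le_self)) le_rfl
  refine ⟨fun s => ?_, hD.gammaOf_nonneg, ?_, fun i hi => ?_⟩
  · unfold gammaOf
    by_cases hs : s.1 = ⊤
    · simpa [hs] using hDm s
    · by_cases h : s.1 + 1 ∈ H.times
      · have h1 : Horizon.pred (⟨s.1 + 1, h⟩ : H.Time) = s := Subtype.ext (by
          obtain ⟨n, hn, -⟩ := Horizon.exists_eq_ofNat hs
          have h3 : (Horizon.pred (⟨s.1 + 1, h⟩ : H.Time)).1 = s.1 + 1 - 1 := rfl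
          rw [h3, hn]
          norm_cast)
        have h2 := hD.predictable ⟨s.1 + 1, h⟩
        rw [h1] at h2
        simp only [hs, h, if_false, dif_pos]
        exact Measurable.sub (hDm s) h2
      · simpa [hs, h] using hDm s
  · filter_upwards [hD.hasSum_atNat_gammaOf] with ω h
    have h1 := hasSum_of_hasSum_atNat h
    rwa [atInfty_gammaOf, sub_add_cancel] at h1
  · filter_upwards [hD.singular i hi] with ω h h1
    simpa [gammaOf, hi] using h h1

theorem MemDiscT.memGammaT (hD : MemDiscT P ℱ t Q D) :
    MemGammaT P ℱ t Q (gammaOf D) := by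
  refine ⟨hD.memDisc.memGamma, fun s hs => ?_⟩
  have hs' : s.1 ≠ ⊤ := ne_top_of_lt (Subtype.coe_lt_coe.2 hs)
  have h1 : s.1 + 1 ≤ t.1 := (ENat.add_one_le_iff hs').2 (Subtype.coe_lt_coe.2 hs)
  have h2 : s.1 + 1 ∈ H.times := Horizon.mem_times_of_le t.2 h1
  filter_upwards [hD.eq_one s hs.le, hD.eq_one ⟨s.1 + 1, h2⟩ h1] with ω h3 h4
  simp [gammaOf, hs', h2, h3, h4]

theorem measurableSet_abs_le_const {m : MeasurableSpace Ω} {f : Ω → ℝ} (hf : Measurable f) (C : ℝ) :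
    MeasurableSet {ω | |f ω| ≤ C} :=
  measurableSet_le hf.abs measurable_const

/-- The discounted sums converge to the sum weighted by the associated random measure. -/
theorem MemDisc.tendsto_discSum [IsProbabilityMeasure P] (hℱ : IsStandardFiltration ℱ)
    (hQ : MemMloc P ℱ Q) (hD : MemDisc P ℱ Q D) (hX : MemXt P ℱ t X) :
    ∀ᵐ ω ∂Q, Tendsto (fun n => discSum t D X n ω) atTop (𝓝 (sumFrom t (gammaOf D) X ω)) := by
  obtain ⟨C, hC⟩ := hX.memRt.memR.bounded
  -- The bound on `X` is known under `P` and reaches `Q` only at finite times, by local absolute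
  -- continuity; these are the times that occur in the partial sums.
  have hb : ∀ᵐ ω ∂Q, ∀ n, |atNat X n ω| ≤ |C| := by
    refine ae_all_iff.2 fun n => ?_
    by_cases h : (n : ℕ∞) ∈ H.times
    · have h1 : P {ω | |X (H.ofNat n) ω| ≤ C}ᶜ = 0 :=
        ae_iff.1 (hC.mono fun ω h => h (H.ofNat n))
      have h2 : ∀ᵐ ω ∂Q, |X (H.ofNat n) ω| ≤ C :=
        hQ.locally_ac _ (Horizon.ofNat_ne_top n) _ (measurableSet_abs_le_const
          (m := ℱ (H.ofNat n)) (hX.memRt.memR.adapted _) C).compl h1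
      filter_upwards [h2] with ω h3
      rw [atNat_of_mem X h]
      exact h3.trans (le_abs_self C)
    · exact Eventually.of_forall fun ω => by
        rw [atNat_of_notMem X h]; simp
  -- The convergence of `X` holds `P`-almost surely. Under `Q` it can fail only on the singular
  -- event, where `D_∞ = 0`.
  have hlim : ∀ᵐ ω ∂Q, ω ∉ singularEvent P ℱ Q → (⊤ : ℕ∞) ∈ H.times →
      Tendsto (fun n => atNat X n ω) atTop (𝓝 (atInfty X ω)) := by
    by_cases h : (⊤ : ℕ∞) ∈ H.times
    · filter_upwards [hQ.ae_singularEvent hℱ (ae_iff.1 (hX.tendsto ⟨⊤, h⟩ rfl))] with ω h1 h2 _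
      have h3 := not_not.1 fun hc => h2 (h1 hc)
      rw [atInfty, dif_pos h]
      refine h3.congr fun n => ?_
      rw [atNat_of_mem X (Horizon.mem_times_of_le h le_top)]
    · exact Eventually.of_forall fun ω _ h' => absurd h' h
  have hsing : ∀ᵐ ω ∂Q, ω ∈ singularEvent P ℱ Q → atInfty D ω = 0 := by
    by_cases h : (⊤ : ℕ∞) ∈ H.times
    · filter_upwards [hD.singular ⟨⊤, h⟩ rfl] with ω h1 h2
      rw [atInfty, dif_pos h, h1 h2]
    · exact Eventually.of_forall fun ω _ => by simp [atInfty, h]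
  filter_upwards [hb, hlim, hsing, hD.hasSum_atNat_gammaOf, hD.gammaOf_nonneg, hD.tendsto_atNat]
    with ω h1 h2 h3 h4 h5 h6
  have hsum : Summable fun n => atNat (gammaOf D) n ω * atNat X n ω := by
    refine Summable.of_norm_bounded (h4.summable.mul_left |C|) fun n => ?_
    rw [norm_mul, Real.norm_eq_abs, Real.norm_eq_abs, abs_of_nonneg (atNat_nonneg h5 n), mul_comm]
    exact mul_le_mul_of_nonneg_right (h1 n) (atNat_nonneg h5 n)
  -- Where `D_∞ = 0`, boundedness of `X` alone sends the boundary term to zero; elsewhere both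
  -- factors converge. The limit supplies the summand at `∞`.
  have hboundary : Tendsto (fun n => atNat D (n + 1) ω * atNat X n ω) atTop
      (𝓝 (atInfty D ω * atInfty X ω)) := by
    have h7 := (tendsto_add_atTop_iff_nat 1).2 h6
    by_cases h8 : atInfty D ω = 0
    · rw [h8] at h7 ⊢
      rw [zero_mul]
      exact h7.zero_mul_isBoundedUnder_le 
        ⟨|C|, eventually_map.2 (Eventually.of_forall fun n => h1 n)⟩
    · have h9 : (⊤ : ℕ∞) ∈ H.times := by
        by_contra hc
        exact h8 (by simp [atInfty, hc])
      exact h7.mul (h2 (fun hc => h8 (h3 hc)) h9)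
  have hmul : ∀ n, atNat (fun s ω => gammaOf D s ω * X s ω) n ω =
      atNat (gammaOf D) n ω * atNat X n ω := fun n => by
    unfold atNat
    split_ifs <;> simp
  have hmul' : atInfty (fun s ω => gammaOf D s ω * X s ω) ω = atInfty D ω * atInfty X ω := by
    rw [← atInfty_gammaOf]
    unfold atInfty
    split_ifs
    · rfl
    · simp
  have htot := hasSum_of_hasSum_atNat (f := fun s ω => gammaOf D s ω * X s ω) (ω := ω)
    (b := ∑' n, atNat (gammaOf D) n ω * atNat X n ω) (by simp only [hmul]; exact hsum.hasSum)
  rw [sumFrom_eq_tsum hX.memRt.eq_zero, htot.tsum_eq, hmul']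
  simp only [discSum_eq D hX.memRt.eq_zero]
  exact ((tendsto_add_atTop_iff_nat 1).2 hsum.hasSum.tendsto_sum_nat).add hboundary

theorem discTerm_eq_gammaTerm [IsProbabilityMeasure P] (hℱ : IsStandardFiltration ℱ)
    (hQ : MemQloc P ℱ t Q) (hD : MemDisc P ℱ Q D) (hX : MemXt P ℱ t X) :
    discTerm P ℱ t ρ X Q D =ᵐ[P] gammaTerm P ℱ t ρ X Q (gammaOf D) := by
  have h1 : (Q[fun ω => -discSumLim t D X ω | ℱ t]) =ᵐ[Q] condLoss ℱ t Q (gammaOf D) X := by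
    refine condExp_congr_ae ?_
    filter_upwards [hD.tendsto_discSum hℱ hQ.memMloc hX] with ω h
    rw [discSumLim, h.limUnder_eq]
  rw [ae_eq_iff_of_eq_on hQ.eq_on stronglyMeasurable_condExp.measurable
    (measurable_condLoss t Q _ X)] at h1
  filter_upwards [h1] with ω h2
  rw [discTerm, gammaTerm, h2]

theorem condLoss_congr_weight (h : ∀ᵐ ω ∂Q, ∀ s, γ s ω = γ' s ω) :
    condLoss ℱ t Q γ X =ᵐ[Q] condLoss ℱ t Q γ' X := by
  refine condExp_congr_ae ?_
  filter_upwards [h] with ω h1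
  simp only [sumFrom, h1]

theorem discOf_congr_weight (h : ∀ᵐ ω ∂Q, ∀ s, γ s ω = γ' s ω) (s : H.Time) :
    discOf γ s =ᵐ[Q] discOf γ' s := by
  filter_upwards [h] with ω h1
  simp only [discOf, h1]

theorem normalize_congr_weight (h : ∀ᵐ ω ∂Q, ∀ s, γ s ω = γ' s ω) :
    ∀ᵐ ω ∂Q, ∀ s, normalize t γ s ω = normalize t γ' s ω := by
  filter_upwards [h, discOf_congr_weight h t] with ω h1 h2 s
  simp only [normalize, h1, h2]

theorem penalty_congr_weight [IsFiniteMeasure Q] (h : ∀ᵐ ω ∂Q, ∀ s, γ s ω = γ' s ω) :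
    penalty P ℱ t ρ Q γ =ᵐ[Q] penalty P ℱ t ρ Q γ' := by
  have h1 : ∀ X, (fun ω => (condLoss ℱ t Q (normalize t γ) X ω : EReal)) =ᵐ[Q]
      fun ω => (condLoss ℱ t Q (normalize t γ') X ω : EReal) := fun X => by
    filter_upwards [condLoss_congr_weight (ℱ := ℱ) (t := t) (X := X)
      (normalize_congr_weight (t := t) h)] with ω h2
    rw [h2]
  refine familyEssSup_congr Q (ℱ.le t) ?_ ?_
  · rintro f ⟨X, hX, rfl⟩
    exact ⟨_, ⟨X, hX, rfl⟩, h1 X⟩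
  · rintro f ⟨X, hX, rfl⟩
    exact ⟨_, ⟨X, hX, rfl⟩, h1 X⟩

theorem gammaTerm_congr_weight (hQ : MemQloc P ℱ t Q) (h : ∀ᵐ ω ∂Q, ∀ s, γ s ω = γ' s ω) :
    gammaTerm P ℱ t ρ X Q γ =ᵐ[P] gammaTerm P ℱ t ρ X Q γ' := by
  have := hQ.memMloc.prob
  have h1 := (ae_eq_iff_of_eq_on hQ.eq_on (measurable_condLoss t Q _ X)
    (measurable_condLoss t Q _ X)).1 (condLoss_congr_weight (ℱ := ℱ) (t := t) (X := X) h)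
  have h2 := (ae_iff_of_eq_on hQ.eq_on (measurableSet_eq_fun
    (measurable_familyEssSup Q (ℱ.le t) _) (measurable_familyEssSup Q (ℱ.le t) _))).1
    (penalty_congr_weight (P := P) (ℱ := ℱ) (t := t) (ρ := ρ) h)
  filter_upwards [h1, h2] with ω h3 h4
  simp only [gammaTerm, h3]
  exact congrArg _ h4

theorem discOf_eq_tsum {ω : Ω} (h : HasSum (fun s => γ s ω) 1) (s : H.Time) :
    discOf γ s ω = sumFrom s γ 1 ω := by
  by_cases hs : s.1 = ⊤
  · rw [discOf, if_pos hs, sumFrom, tsum_eq_single s fun r hr => if_neg fun hc => hr ?_]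
    · simp
    · refine le_antisymm ?_ hc
      rw [← Subtype.coe_le_coe, hs]
      exact le_top
  · exact discOf_eq_sumFrom hs h

theorem atNat_discOf {ω : Ω} (h : HasSum (fun s => γ s ω) 1) (n : ℕ) :
    atNat (discOf γ) n ω = tailSum γ n ω := by
  by_cases hn : (n : ℕ∞) ∈ H.times
  · rw [atNat_of_mem _ hn, tailSum_of_mem γ hn, discOf_eq_tsum h]
  · rw [atNat_of_notMem _ hn, tailSum_of_notMem γ hn]

/-- For normalized `γ` the discounts are tail sums, whose successive differences return the weights.
-/
theorem gammaOf_discOf {ω : Ω} (h : HasSum (fun s => γ s ω) 1) (s : H.Time) :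
    gammaOf (discOf γ) s ω = γ s ω := by
  by_cases hs : s.1 = ⊤
  · simp [gammaOf, discOf, hs]
  · obtain ⟨n, hn, rfl⟩ := Horizon.exists_eq_ofNat hs
    have hn' : (n : ℕ∞) ∈ H.times := hn ▸ (H.ofNat n).2
    rw [← atNat_of_mem (gammaOf _) hn', ← atNat_of_mem γ hn', atNat_gammaOf, atNat_discOf h,
      atNat_discOf h, tailSum_eq_add h.summable]
    ring

/-- Only weights at times before `s` enter. At `∞` the predecessor is `∞` itself, so there
predictability asks no more than adaptedness. -/
theorem measurable_discOf_pred (hγ : ∀ s, Measurable[ℱ s] (γ s)) (s : H.Time) :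
    Measurable[ℱ (Horizon.pred s)] (discOf γ s) := by
  by_cases hs : s.1 = ⊤
  · have : Horizon.pred s = s := Subtype.ext (by simp [Horizon.pred, hs])
    rw [this]
    exact measurable_discOf hγ s
  · have h : Measurable[ℱ (Horizon.pred s)] fun ω => ∑' r : H.Time, if r < s then γ r ω else 0 := by
      refine measurable_tsum_real (m := ℱ (Horizon.pred s)) fun r => ?_
      by_cases hr : r < s
      · have hr' : r ≤ Horizon.pred s := by
          rw [← Subtype.coe_le_coe]
          exact ENat.le_sub_one_of_lt (Subtype.coe_lt_coe.2 hr)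
        simpa [hr] using (hγ r).mono (ℱ.mono hr') le_rfl
      · simp [hr]
    unfold discOf
    simpa [hs] using h.const_sub 1

theorem MemGamma.memDisc (hγ : MemGamma P ℱ Q γ) : MemDisc P ℱ Q (discOf γ) := by
  have hs : ∀ {ω : Ω}, (∀ s, 0 ≤ γ s ω) → ∀ s r : H.Time,
      0 ≤ if s ≤ r then γ r ω * (1 : H.Time → Ω → ℝ) r ω else 0 := fun h s r => by
    split_ifs
    · simpa using h r
    · exact le_rfl
  have hsm : ∀ {ω : Ω}, HasSum (fun s => γ s ω) 1 → ∀ s : H.Time,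
      Summable fun r => if s ≤ r then γ r ω * (1 : H.Time → Ω → ℝ) r ω else 0 := fun h s => by
    simpa using summable_tail h.summable fun r => s ≤ r
  have htail : ∀ᵐ ω ∂Q, Tendsto (fun n => atNat (discOf γ) n ω) atTop (𝓝 (atInfty γ ω)) := by
    filter_upwards [hγ.hasSum] with ω h
    simp only [atNat_discOf h]
    exact tendsto_tailSum h.summable
  refine ⟨measurable_discOf_pred hγ.adapted, ?_, ?_, ?_, ?_, fun i hi => ?_, fun i hi => ?_⟩
  · refine Eventually.of_forall fun ω => ?_
    have h0 : H.zero.1 ≠ ⊤ := ENat.zero_ne_top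
    have h1 : ∀ r : H.Time, ¬r < H.zero := fun r hr =>
      absurd (Subtype.coe_lt_coe.2 hr) (by simp [Horizon.zero])
    simp [discOf, h0, h1]
  · filter_upwards [hγ.hasSum, hγ.nonneg] with ω h h0 s s' hss
    simp only [discOf_eq_tsum h]
    refine Summable.tsum_le_tsum (fun r => ?_) (hsm h s') (hsm h s)
    split_ifs with h1 h2
    · exact le_rfl
    · exact absurd (hss.trans h1) h2
    · simpa using h0 r
    · exact le_rfl
  · filter_upwards [hγ.hasSum, hγ.nonneg] with ω h h0 s
    rw [discOf_eq_tsum h]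
    exact tsum_nonneg (hs h0 s)
  · rintro rfl
    filter_upwards [htail] with ω h
    have h' : (⊤ : ℕ∞) ∉ Horizon.nat.times := fun hc => hc rfl
    rw [atInfty, dif_neg h'] at h
    refine h.congr fun n => ?_
    rw [atNat_of_mem _ (show (n : ℕ∞) ∈ Horizon.nat.times from ENat.natCast_ne_top n)]
  · filter_upwards [htail] with ω h
    have h' : (⊤ : ℕ∞) ∈ H.times := hi ▸ i.2
    have h1 : discOf γ i ω = atInfty γ ω := by
      have : i = ⟨⊤, h'⟩ := Subtype.ext hi
      rw [discOf, if_pos hi, atInfty, dif_pos h', this]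
    rw [h1]
    refine h.congr fun n => ?_
    rw [atNat_of_mem _ (Horizon.mem_times_of_le h' le_top)]
  · filter_upwards [hγ.singular i hi] with ω h h1
    rw [discOf, if_pos hi, h h1]

theorem MemGammaT.memDiscT (ht : t.1 ≠ ⊤) (hγ : MemGammaT P ℱ t Q γ) :
    MemDiscT P ℱ t Q (discOf γ) := by
  refine ⟨hγ.memGamma.memDisc, fun s hs => ?_⟩
  exact MemGammaT.discOf_eq_one ⟨hγ.memGamma, fun r hr => hγ.eq_zero r (hr.trans_le hs)⟩
    (ne_top_of_le_ne_top ht (Subtype.coe_le_coe.2 hs))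

/-- The two forms of the robust representation agree. -/
theorem gammaRep_eq_discRep [IsProbabilityMeasure P] (hℱ : IsStandardFiltration ℱ)
    (ht : t.1 ≠ ⊤) (hX : MemXt P ℱ t X) :
    gammaRep P ℱ t ρ X =ᵐ[P] discRep P ℱ t ρ X := by
  have key : ∀ Q, MemQloc P ℱ t Q →
      familyEssSup P (ℱ t) {f | ∃ γ, MemGammaT P ℱ t Q γ ∧ f = gammaTerm P ℱ t ρ X Q γ} =ᵐ[P]
      familyEssSup P (ℱ t) {f | ∃ D, MemDiscT P ℱ t Q D ∧ f = discTerm P ℱ t ρ X Q D} := by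
    intro Q hQ
    refine familyEssSup_congr P (ℱ.le t) ?_ ?_
    · rintro f ⟨γ, hγ, rfl⟩
      refine ⟨_, ⟨_, hγ.memDiscT ht, rfl⟩, ?_⟩
      refine EventuallyEq.trans ?_
        (discTerm_eq_gammaTerm hℱ hQ (hγ.memDiscT ht).memDisc hX).symm
      refine gammaTerm_congr_weight hQ ?_
      filter_upwards [hγ.memGamma.hasSum] with ω h s using (gammaOf_discOf h s).symm
    · rintro f ⟨D, hD, rfl⟩
      exact ⟨_, ⟨_, hD.memGammaT, rfl⟩, (discTerm_eq_gammaTerm hℱ hQ hD.memDisc hX).symm⟩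
  refine familyEssSup_congr P (ℱ.le t) ?_ ?_
  · rintro f ⟨Q, hQ, rfl⟩
    exact ⟨_, ⟨Q, hQ, rfl⟩, key Q hQ⟩
  · rintro f ⟨Q, hQ, rfl⟩
    exact ⟨_, ⟨Q, hQ, rfl⟩, key Q hQ⟩

end Discounting

end RiskProc


namespace RiskProc

/-! ### Pasting density processes at time `t` -/

section Pasting

variable {Ω : Type*} {mΩ : MeasurableSpace Ω} {H : Horizon} {ℱ : Filtration H.Time mΩ}
  {P : Measure Ω} {t : H.Time} {ρ : (H.Time → Ω → ℝ) → Ω → ℝ} {X N N' : H.Time → Ω → ℝ}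
  {c : Ω → ℝ}

/-- The weights `N` before time `t`, continued by the multiple `c` of the weights `N'`. -/
noncomputable def pasteFrom (t : H.Time) (N : H.Time → Ω → ℝ) (c : Ω → ℝ)
    (N' : H.Time → Ω → ℝ) (s : H.Time) (ω : Ω) : ℝ :=
  if t ≤ s then c ω * N' s ω else N s ω

theorem measurable_pasteFrom (hN : ∀ s, Measurable[ℱ s] (N s)) (hc : Measurable[ℱ t] c)
    (hN' : ∀ s, Measurable[ℱ s] (N' s)) (s : H.Time) :
    Measurable[ℱ s] (pasteFrom t N c N' s) := by
  unfold pasteFrom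
  by_cases h : t ≤ s
  · simp only [h, if_true]
    exact (hc.mono (ℱ.mono h) le_rfl).mul (hN' s)
  · simpa [h] using hN s

theorem sumFrom_pasteFrom (ω : Ω) :
    sumFrom t (pasteFrom t N c N') X ω = c ω * sumFrom t N' X ω := by
  rw [sumFrom, sumFrom, ← tsum_mul_left]
  refine tsum_congr fun s => ?_
  by_cases h : t ≤ s
  · simp only [h, if_true, pasteFrom]; ring
  · simp [h]

theorem optProd_univ_eq_add (hN : ∀ s, Measurable[ℱ s] (N s)) (t : H.Time) :
    optProd ℱ P N Set.univ = (∑' s, if t ≤ s then 0 else ∫⁻ ω, ENNReal.ofReal (N s ω) ∂P) +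
      optProd ℱ P N (rect ℱ Set.univ (Set.Ici t)) := by
  rw [optProd_apply hN MeasurableSet.univ, optProd_apply hN
    (measurableSet_rect_Ici MeasurableSet.univ), ← ENNReal.tsum_add]
  refine tsum_congr fun s => ?_
  by_cases h : t ≤ s <;> simp [h, rect]

theorem optProd_pasteFrom_rect_Ici [IsFiniteMeasure P] (hN : ∀ s, Measurable[ℱ s] (N s))
    (hN' : IsWeight ℱ P N') (hc : Measurable[ℱ t] c) (hc0 : 0 ≤ᵐ[P] c) {A : Set Ω}
    (hA : MeasurableSet[ℱ t] A) :
    optProd ℱ P (pasteFrom t N c N') (rect ℱ A (Set.Ici t)) =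
      ∫⁻ ω in A, ENNReal.ofReal (c ω * massFrom ℱ t P N' ω) ∂P := by
  have hAm := ℱ.le t _ hA
  have hcm := hc.mono (ℱ.le t) le_rfl
  let g : Ω → ℝ≥0∞ := A.indicator fun ω => ENNReal.ofReal (c ω)
  have hg : Measurable[ℱ t] g := Measurable.indicator (m := ℱ t) hc.ennreal_ofReal hA
  have h1 : ∀ s, ∫⁻ ω in {ω | (⟨ω, s⟩ : OptSpace ℱ) ∈ rect ℱ A (Set.Ici t)},
      ENNReal.ofReal (pasteFrom t N c N' s ω) ∂P =
      ∫⁻ ω, (if t ≤ s then ENNReal.ofReal (N' s ω) else 0) * g ω ∂P := by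
    intro s
    by_cases h : t ≤ s
    · have h2 : {ω | (⟨ω, s⟩ : OptSpace ℱ) ∈ rect ℱ A (Set.Ici t)} = A := by
        ext ω; simp [rect, h]
      rw [h2, ← lintegral_indicator hAm]
      refine lintegral_congr_ae ?_
      filter_upwards [hc0] with ω h3
      by_cases hω : ω ∈ A
      · simp only [g, Set.indicator_of_mem hω, h, if_true, pasteFrom]
        rw [ENNReal.ofReal_mul h3, mul_comm]
      · simp [g, Set.indicator_of_notMem hω]
    · have h2 : {ω | (⟨ω, s⟩ : OptSpace ℱ) ∈ rect ℱ A (Set.Ici t)} = ∅ := by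
        ext ω; simp [rect, h]
      simp [h2, h]
  have h2 : ∀ s, Measurable fun ω => (if t ≤ s then ENNReal.ofReal (N' s ω) else 0) * g ω := by
    intro s
    refine Measurable.mul ?_ (hg.mono (ℱ.le t) le_rfl)
    split_ifs
    · exact ((hN'.adapted s).mono (ℱ.le s) le_rfl).ennreal_ofReal
    · exact measurable_const
  rw [optProd_apply (measurable_pasteFrom hN hc hN'.adapted) (measurableSet_rect_Ici hA)]
  simp only [h1]
  rw [← lintegral_tsum fun s => (h2 s).aemeasurable]
  have h3 : ∀ᵐ ω ∂P, ∑' s, (if t ≤ s then ENNReal.ofReal (N' s ω) else 0) * g ω =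
      ENNReal.ofReal (sumFrom t N' 1 ω) * g ω := by
    filter_upwards [hN'.nonneg, hN'.summable (IsBddProc.one _) t] with ω h4 h5
    rw [ENNReal.tsum_mul_right, sumFrom, ENNReal.ofReal_tsum_of_nonneg _ h5]
    · congr 1
      refine tsum_congr fun s => ?_
      split_ifs <;> simp
    · intro s
      split_ifs
      · simpa using h4 s
      · exact le_rfl
  rw [lintegral_congr_ae h3, ← lintegral_mul_condExp (ℱ.le t)
    (hN'.integrable_sumFrom (IsBddProc.one _) t) (hN'.sumFrom_one_nonneg t) hg,
    ← lintegral_indicator hAm]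
  refine lintegral_congr_ae ?_
  filter_upwards [hc0] with ω h4
  by_cases hω : ω ∈ A
  · simp only [g, Set.indicator_of_mem hω]
    rw [ENNReal.ofReal_mul h4, mul_comm]
    rfl
  · simp [g, Set.indicator_of_notMem hω]

theorem isWeight_pasteFrom [IsFiniteMeasure P] (hN : IsWeight ℱ P N) (hN' : IsWeight ℱ P N')
    (hc : Measurable[ℱ t] c) (hc0 : 0 ≤ᵐ[P] c)
    (hi : Integrable (fun ω => c ω * massFrom ℱ t P N' ω) P) :
    IsWeight ℱ P (pasteFrom t N c N') := by
  have hm := measurable_pasteFrom hN.adapted hc hN'.adapted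
  refine ⟨hm, ?_, ⟨?_⟩⟩
  · filter_upwards [hN.nonneg, hN'.nonneg, hc0] with ω h1 h2 h3 s
    unfold pasteFrom
    split_ifs
    exacts [mul_nonneg h3 (h2 s), h1 s]
  · rw [optProd_univ_eq_add hm t, optProd_pasteFrom_rect_Ici hN.adapted hN' hc hc0
      MeasurableSet.univ, Measure.restrict_univ]
    have := hN.finite
    have h1 := measure_lt_top (optProd ℱ P N) Set.univ
    rw [optProd_univ_eq_add hN.adapted t] at h1
    refine ENNReal.add_lt_top.2 ⟨lt_of_le_of_lt (ENNReal.tsum_le_tsum fun s => ?_)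
      (ENNReal.add_lt_top.1 h1).1, hi.lintegral_lt_top⟩
    by_cases h : t ≤ s <;> simp [h, pasteFrom]

theorem condExp_sumFrom_pasteFrom [IsFiniteMeasure P] (hN' : IsWeight ℱ P N')
    (hK : IsWeight ℱ P (pasteFrom t N c N')) (hc : Measurable[ℱ t] c) (hX : MemR P ℱ X) :
    P[sumFrom t (pasteFrom t N c N') X | ℱ t] =ᵐ[P]
      fun ω => c ω * P[sumFrom t N' X | ℱ t] ω := by
  have h1 : sumFrom t (pasteFrom t N c N') X = fun ω => c ω * sumFrom t N' X ω :=
    funext sumFrom_pasteFrom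
  have h2 := hK.integrable_sumFrom (hX.isBddProc hK.adapted) t
  rw [h1] at h2 ⊢
  exact condExp_mul_of_stronglyMeasurable_left hc.stronglyMeasurable h2
    (hN'.integrable_sumFrom (hX.isBddProc hN'.adapted) t)

theorem MemR.one : MemR P ℱ (1 : H.Time → Ω → ℝ) :=
  ⟨fun s => @measurable_const _ _ _ (ℱ s) 1, 1, by simp⟩

theorem massFrom_pasteFrom [IsFiniteMeasure P] (hN' : IsWeight ℱ P N')
    (hK : IsWeight ℱ P (pasteFrom t N c N')) (hc : Measurable[ℱ t] c) :
    massFrom ℱ t P (pasteFrom t N c N') =ᵐ[P] fun ω => c ω * massFrom ℱ t P N' ω :=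
  condExp_sumFrom_pasteFrom hN' hK hc MemR.one

/-- The `ℱ_t`-measurable factor `c` scales loss and mass alike and cancels. -/
theorem lossRatio_pasteFrom [IsFiniteMeasure P] (hN' : IsWeight ℱ P N')
    (hK : IsWeight ℱ P (pasteFrom t N c N')) (hc : Measurable[ℱ t] c) (hX : MemR P ℱ X) :
    ∀ᵐ ω ∂P, 0 < c ω → lossRatio P ℱ t (pasteFrom t N c N') X ω = lossRatio P ℱ t N' X ω := by
  have h1 : ∀ K : H.Time → Ω → ℝ, condLoss ℱ t P K X =ᵐ[P] -P[sumFrom t K X | ℱ t] :=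
    fun K => condExp_neg _ _
  filter_upwards [h1 N', h1 (pasteFrom t N c N'), condExp_sumFrom_pasteFrom hN' hK hc hX,
    massFrom_pasteFrom hN' hK hc] with ω h2 h3 h4 h5 h6
  rw [lossRatio, lossRatio, h2, h3, h5, Pi.neg_apply, Pi.neg_apply, h4, ← mul_neg,
    mul_div_mul_left _ _ h6.ne']

theorem densityPenalty_congr_on [IsFiniteMeasure P] {B : Set Ω} (hB : MeasurableSet[ℱ t] B)
    (h : ∀ X, MemR P ℱ X → ∀ᵐ ω ∂P, ω ∈ B → lossRatio P ℱ t N X ω = lossRatio P ℱ t N' X ω) :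
    ∀ᵐ ω ∂P, ω ∈ B → densityPenalty P ℱ t ρ N ω = densityPenalty P ℱ t ρ N' ω := by
  have key : ∀ K K' : H.Time → Ω → ℝ, (∀ X, MemR P ℱ X →
      ∀ᵐ ω ∂P, ω ∈ B → lossRatio P ℱ t K X ω = lossRatio P ℱ t K' X ω) →
      ∀ᵐ ω ∂P, ω ∈ B → densityPenalty P ℱ t ρ K ω ≤ densityPenalty P ℱ t ρ K' ω := by
    intro K K' hKK
    refine familyEssSup_le_on P (ℱ.le t) hB (measurable_familyEssSup P (ℱ.le t) _) ?_
    rintro f ⟨X, hX, rfl⟩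
    filter_upwards [hKK X hX.memRt.memR, le_familyEssSup P (ℱ.le t) (S := {f | ∃ X,
      MemAccept P ℱ t ρ X ∧ f = fun ω => (lossRatio P ℱ t K' X ω : EReal)}) ⟨X, hX, rfl⟩]
      with ω h1 h2 h3
    rw [h1 h3]; exact h2
  filter_upwards [key N N' h, key N' N fun X hX => (h X hX).mono fun ω h1 h2 => (h1 h2).symm]
    with ω h1 h2 h3 using le_antisymm (h1 h3) (h2 h3)

theorem densityPenalty_pasteFrom [IsFiniteMeasure P] (hN' : IsWeight ℱ P N')
    (hK : IsWeight ℱ P (pasteFrom t N c N')) (hc : Measurable[ℱ t] c) :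
    ∀ᵐ ω ∂P, 0 < c ω →
      densityPenalty P ℱ t ρ (pasteFrom t N c N') ω = densityPenalty P ℱ t ρ N' ω :=
  densityPenalty_congr_on (B := {ω | 0 < c ω}) (measurableSet_lt measurable_const hc)
    fun _ hX => lossRatio_pasteFrom hN' hK hc hX

theorem densityTerm_pasteFrom [IsFiniteMeasure P] (hN' : IsWeight ℱ P N')
    (hK : IsWeight ℱ P (pasteFrom t N c N')) (hc : Measurable[ℱ t] c) (hX : MemR P ℱ X) :
    ∀ᵐ ω ∂P, 0 < c ω →
      densityTerm P ℱ t ρ (pasteFrom t N c N') X ω = densityTerm P ℱ t ρ N' X ω := by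
  filter_upwards [lossRatio_pasteFrom hN' hK hc hX, densityPenalty_pasteFrom (ρ := ρ) hN' hK hc]
    with ω h1 h2 h3
  rw [densityTerm, densityTerm, h1 h3, h2 h3]

/-- Weights which agree before `t`, and whose masses from `t` on agree, define measures which agree
on the optional `σ`-field at time `t`. -/
theorem optProd_eq_on_optFiltration [IsFiniteMeasure P] (hN : IsWeight ℱ P N)
    (hN' : IsWeight ℱ P N') (h : ∀ s < t, N s =ᵐ[P] N' s)
    (hmass : massFrom ℱ t P N =ᵐ[P] massFrom ℱ t P N') :
    (∀ B, MeasurableSet[optFiltration ℱ t] B → optProd ℱ P N B = optProd ℱ P N' B) ∧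
      optProd ℱ P N Set.univ = optProd ℱ P N' Set.univ := by
  have hIci : ∀ A, MeasurableSet[ℱ t] A →
      optProd ℱ P N (rect ℱ A (Set.Ici t)) = optProd ℱ P N' (rect ℱ A (Set.Ici t)) := by
    intro A hA
    rw [hN.optProd_rect_Ici hA, hN'.optProd_rect_Ici hA]
    exact lintegral_congr_ae (ae_restrict_of_ae (hmass.mono fun ω h => congrArg ENNReal.ofReal h))
  have huniv : optProd ℱ P N Set.univ = optProd ℱ P N' Set.univ := by
    rw [optProd_univ_eq_add hN.adapted t, optProd_univ_eq_add hN'.adapted t,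
      hIci _ MeasurableSet.univ]
    congr 1
    refine tsum_congr fun s => ?_
    split_ifs with hs
    · rfl
    · exact lintegral_congr_ae ((h s (not_le.1 hs)).mono fun ω h =>
        congrArg ENNReal.ofReal h)
  have hle : optFiltration ℱ t ≤ instMeasurableSpaceOptSpace ℱ := by
    refine MeasurableSpace.generateFrom_le ?_
    rintro B (⟨j, A, -, hA, rfl⟩ | ⟨A, hA, rfl⟩)
    exacts [measurableSet_rect_singleton hA, measurableSet_rect_Ici hA]
  have := hN.finite
  have := hN'.finite
  refine ⟨fun B hB => ?_, huniv⟩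
  have htrim : (optProd ℱ P N).trim hle = (optProd ℱ P N').trim hle := by
    refine @ext_of_generate_finite _ (optFiltration ℱ t) _ _ _ rfl ?_ _ ?_ ?_
    · rintro B₁ (⟨j, A, hj, hA, rfl⟩ | ⟨A, hA, rfl⟩) B₂ (⟨j', A', hj', hA', rfl⟩ | ⟨A', hA', rfl⟩)
        ⟨p, hp1, hp2⟩
      · left
        have hjj : j' = j := hp2.2.symm.trans hp1.2
        subst hjj
        refine ⟨j', A ∩ A', hj, MeasurableSet.inter hA hA', ?_⟩
        ext q
        simp only [rect, Set.mem_inter_iff, Set.mem_ofPred_eq, Set.mem_singleton_iff]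
        tauto
      · have h1 : p.time = j := hp1.2
        exact absurd (h1 ▸ hp2.2 : t ≤ j) (not_le.2 hj)
      · have h1 : p.time = j' := hp2.2
        exact absurd (h1 ▸ hp1.2 : t ≤ j') (not_le.2 hj')
      · right
        refine ⟨A ∩ A', MeasurableSet.inter hA hA', ?_⟩
        ext q
        simp only [rect, Set.mem_inter_iff, Set.mem_ofPred_eq]
        tauto
    · intro B hB
      rw [trim_measurableSet_eq hle (MeasurableSpace.measurableSet_generateFrom hB),
        trim_measurableSet_eq hle (MeasurableSpace.measurableSet_generateFrom hB)]
      rcases hB with ⟨j, A, hj, hA, rfl⟩ | ⟨A, hA, rfl⟩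
      · rw [optProd_rect_singleton hN.adapted hA, optProd_rect_singleton hN'.adapted hA]
        exact lintegral_congr_ae (ae_restrict_of_ae ((h j hj).mono fun ω h =>
          congrArg ENNReal.ofReal h))
      · exact hIci A hA
    · rw [trim_measurableSet_eq hle MeasurableSet.univ, trim_measurableSet_eq hle
        MeasurableSet.univ, huniv]
  rw [← trim_measurableSet_eq hle hB, htrim, trim_measurableSet_eq hle hB]

/-- The measure restricted to time `s` has density `N s` on `ℱ_s`, and such densities are unique.
Together with `massFrom_ae_eq` this reads off from the optional σ-field at `t` the weights before
`t` and the remaining masses. -/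
theorem ae_eq_of_optProd_rect_singleton [IsFiniteMeasure P] (hN : IsWeight ℱ P N)
    (hN' : IsWeight ℱ P N') {s : H.Time} (h : ∀ A, MeasurableSet[ℱ s] A →
      optProd ℱ P N (rect ℱ A {s}) = optProd ℱ P N' (rect ℱ A {s})) : N s =ᵐ[P] N' s := by
  have key : ∀ K, IsWeight ℱ P K → ∀ A, MeasurableSet[ℱ s] A → optProd ℱ P K (rect ℱ A {s}) =
      ∫⁻ ω in A, ENNReal.ofReal (K s ω) ∂P.trim (ℱ.le s) := by
    intro K hK A hA
    rw [optProd_rect_singleton hK.adapted hA, restrict_trim (ℱ.le s) _ hA,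
      lintegral_trim (ℱ.le s) (hK.adapted s).ennreal_ofReal]
  have h1 : (fun ω => ENNReal.ofReal (N s ω)) =ᵐ[P.trim (ℱ.le s)]
      fun ω => ENNReal.ofReal (N' s ω) := by
    refine @ae_eq_of_forall_setLIntegral_eq_of_sigmaFinite _ (ℱ s) _ _ _ _
      (hN.adapted s).ennreal_ofReal (hN'.adapted s).ennreal_ofReal fun A hA _ => ?_
    rw [← key N hN A hA, ← key N' hN' A hA, h A hA]
  filter_upwards [ae_eq_of_ae_eq_trim h1, hN.nonneg, hN'.nonneg] with ω h2 h3 h4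
  exact (ENNReal.ofReal_eq_ofReal_iff (h3 s) (h4 s)).1 h2

theorem massFrom_ae_eq [IsFiniteMeasure P] (hN : IsWeight ℱ P N)
    (hN' : IsWeight ℱ P N') {s : H.Time} (h : ∀ A, MeasurableSet[ℱ s] A →
      optProd ℱ P N (rect ℱ A (Set.Ici s)) = optProd ℱ P N' (rect ℱ A (Set.Ici s))) :
    massFrom ℱ s P N =ᵐ[P] massFrom ℱ s P N' := by
  have key : ∀ K, IsWeight ℱ P K → ∀ A, MeasurableSet[ℱ s] A →
      optProd ℱ P K (rect ℱ A (Set.Ici s)) =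
      ∫⁻ ω in A, ENNReal.ofReal (massFrom ℱ s P K ω) ∂P.trim (ℱ.le s) := by
    intro K hK A hA
    rw [hK.optProd_rect_Ici hA, restrict_trim (ℱ.le s) _ hA,
      lintegral_trim (ℱ.le s) (measurable_massFrom s P K).ennreal_ofReal]
  have h1 : (fun ω => ENNReal.ofReal (massFrom ℱ s P N ω)) =ᵐ[P.trim (ℱ.le s)]
      fun ω => ENNReal.ofReal (massFrom ℱ s P N' ω) := by
    refine @ae_eq_of_forall_setLIntegral_eq_of_sigmaFinite _ (ℱ s) _ _ _ _
      (measurable_massFrom s P N).ennreal_ofReal (measurable_massFrom s P N').ennreal_ofReal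
      fun A hA _ => ?_
    rw [← key N hN A hA, ← key N' hN' A hA, h A hA]
  filter_upwards [ae_eq_of_ae_eq_trim h1, hN.massFrom_nonneg s, hN'.massFrom_nonneg s]
    with ω h2 h3 h4
  exact (ENNReal.ofReal_eq_ofReal_iff h3 h4).1 h2

/-- The times from `s` on are the single times in `[s, t)` together with the block `𝕋_t`. -/
theorem measurableSet_optFiltration_rect_Ici {s : H.Time} (hs : s ≤ t) {A : Set Ω}
    (hA : MeasurableSet[ℱ s] A) : MeasurableSet[optFiltration ℱ t] (rect ℱ A (Set.Ici s)) := by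
  have h1 : rect ℱ A (Set.Ici s) =
      (⋃ j : H.Time, if s ≤ j ∧ j < t then rect ℱ A {j} else ∅) ∪ rect ℱ A (Set.Ici t) := by
    ext p
    simp only [Set.mem_union, Set.mem_iUnion, rect, Set.mem_ofPred_eq, Set.mem_Ici]
    constructor
    · rintro ⟨h1, h2⟩
      rcases lt_or_ge p.time t with h3 | h3
      · exact Or.inl ⟨p.time, by rw [if_pos ⟨h2, h3⟩]; exact ⟨h1, rfl⟩⟩
      · exact Or.inr ⟨h1, h3⟩
    · rintro (⟨j, hj⟩ | ⟨h1, h2⟩)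
      · split_ifs at hj with h
        · obtain ⟨h1, h2⟩ := hj
          have h3 : p.time = j := h2
          exact ⟨h1, h3 ▸ h.1⟩
        · exact absurd hj (Set.notMem_empty _)
      · exact ⟨h1, hs.trans h2⟩
  rw [h1]
  refine @MeasurableSet.union _ (optFiltration ℱ t) _ _
    (@MeasurableSet.iUnion _ _ (optFiltration ℱ t) _ _ fun j => ?_)
    (MeasurableSpace.measurableSet_generateFrom (Or.inr ⟨A, ℱ.mono hs _ hA, rfl⟩))
  split_ifs with h
  · exact MeasurableSpace.measurableSet_generateFrom (Or.inl ⟨j, A, h.2, ℱ.mono h.1 _ hA, rfl⟩)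
  · exact @MeasurableSet.empty _ (optFiltration ℱ t)

end Pasting

end RiskProc


namespace RiskProc

/-! ### Part (D): representations under a general `Q ⊗ γ` -/

section Local

variable {Ω : Type*} {mΩ : MeasurableSpace Ω} {H : Horizon} {ℱ : Filtration H.Time mΩ}
  {P Q Q' : Measure Ω} {s t : H.Time} {ρ : (H.Time → Ω → ℝ) → Ω → ℝ}
  {X γ ξ μ N N' : H.Time → Ω → ℝ}

theorem discOf_succ (γ : H.Time → Ω → ℝ) {n : ℕ} (h : ((n + 1 : ℕ) : ℕ∞) ∈ H.times) (ω : Ω) :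
    discOf γ (H.ofNat (n + 1)) ω = discOf γ (H.ofNat n) ω - γ (H.ofNat n) ω := by
  have h0 : (n : ℕ∞) ∈ H.times := Horizon.natCast_mem_of_le n.le_succ h
  have hlt : ∀ r : H.Time, r < H.ofNat (n + 1) ↔ r < H.ofNat n ∨ r = H.ofNat n := by
    intro r
    rw [← le_iff_lt_or_eq, ← Subtype.coe_lt_coe, ← Subtype.coe_le_coe, Horizon.coe_ofNat h,
      Horizon.coe_ofNat h0, Nat.cast_add, Nat.cast_one,
      ENat.lt_add_one_iff (ENat.natCast_ne_top n)]
  have hs : ∀ m, Summable fun r : H.Time => if r < H.ofNat m then γ r ω else 0 := fun m =>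
    summable_of_hasFiniteSupport ((Horizon.finite_Iio (Horizon.ofNat_ne_top m)).subset
      fun r hr => by
        by_contra hc
        exact hr (if_neg hc))
  have h1 : ∑' r : H.Time, (if r < H.ofNat (n + 1) then γ r ω else 0) =
      ∑' r : H.Time, (if r < H.ofNat n then γ r ω else 0) + γ (H.ofNat n) ω := by
    have h2 := ((hs n).hasSum.add (hasSum_ite_eq (H.ofNat n) (γ (H.ofNat n) ω))).tsum_eq
    rw [← h2]
    refine tsum_congr fun r => ?_
    by_cases hr : r = H.ofNat n
    · simp [hlt, hr]
    · simp [hlt, hr]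
  rw [discOf, discOf, if_neg (Horizon.ofNat_ne_top _), if_neg (Horizon.ofNat_ne_top _), h1]
  ring

/-- Where no mass is left from `s` on, the larger set of times carries none, so neither does the
smaller one from `t` on. -/
theorem IsWeight.massFrom_pos_of_le [IsFiniteMeasure P] (hN : IsWeight ℱ P N) (hst : s ≤ t) :
    ∀ᵐ ω ∂P, 0 < massFrom ℱ t P N ω → 0 < massFrom ℱ s P N ω := by
  have hp : MeasurableSet[ℱ s] {ω | 0 < massFrom ℱ s P N ω} :=
    measurableSet_lt measurable_const (measurable_massFrom s P N)
  rw [hN.ae_massFrom_iff (ℱ.mono hst _ hp)]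
  have hsub : rect ℱ {ω | 0 < massFrom ℱ s P N ω}ᶜ (Set.Ici t) ⊆
      rect ℱ {ω | 0 < massFrom ℱ s P N ω}ᶜ (Set.Ici s) := fun p hp => ⟨hp.1, hst.trans hp.2⟩
  exact measure_mono_null hsub
    ((hN.ae_massFrom_iff hp).1 (Eventually.of_forall fun ω h => h))

theorem IsWeight.massFrom_pos [IsFiniteMeasure P] (hN : IsWeight ℱ P N)
    (h : ∀ᵐ ω ∂P, 0 < N t ω) : ∀ᵐ ω ∂P, 0 < massFrom ℱ t P N ω := by
  have hA : MeasurableSet[ℱ t] {ω | massFrom ℱ t P N ω ≤ 0} :=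
    measurableSet_le (measurable_massFrom t P N) measurable_const
  have h1 : optProd ℱ P N (rect ℱ {ω | massFrom ℱ t P N ω ≤ 0} (Set.Ici t)) = 0 := by
    rw [hN.optProd_rect_Ici hA, setLIntegral_congr_fun (g := fun _ => 0) (ℱ.le t _ hA)
      fun ω hω => ENNReal.ofReal_eq_zero.2 hω]
    simp
  have hsub : rect ℱ {ω | massFrom ℱ t P N ω ≤ 0} {t} ⊆
      rect ℱ {ω | massFrom ℱ t P N ω ≤ 0} (Set.Ici t) := fun p hp =>
    ⟨hp.1, le_of_eq (Eq.symm hp.2)⟩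
  have h2 := measure_mono_null hsub h1
  rw [optProd_rect_singleton hN.adapted hA, lintegral_eq_zero_iff
    ((hN.adapted t).mono (ℱ.le t) le_rfl).ennreal_ofReal] at h2
  filter_upwards [(ae_restrict_iff' (ℱ.le t _ hA)).1 h2, h] with ω h3 h4
  by_contra hc
  exact absurd (ENNReal.ofReal_eq_zero.1 (h3 (not_lt.1 hc))) (not_le.2 h4)

theorem MemGamma.discOf_pos [IsProbabilityMeasure P] [IsProbabilityMeasure Q]
    (hγ : MemGamma P ℱ Q γ) (hN : IsWeight ℱ P N) (heq : optProd ℱ Q γ = optProd ℱ P N)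
    (ht : t.1 ≠ ⊤) : ∀ᵐ ω ∂P, 0 < massFrom ℱ t P N ω → 0 < discOf γ t ω := by
  refine (hγ.isWeight.ae_massFrom_congr hN heq
    (measurableSet_lt measurable_const (measurable_discOf hγ.adapted t))).1 ?_
  filter_upwards [hγ.massFrom_eq ht] with ω h1 h2
  rwa [← h1]

/-- The normalized weights depend only on the measure `Q ⊗ γ`. -/
theorem MemGamma.div_discOf [IsProbabilityMeasure P] [IsProbabilityMeasure Q]
    (hγ : MemGamma P ℱ Q γ) (hN : IsWeight ℱ P N) (heq : optProd ℱ Q γ = optProd ℱ P N)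
    (ht : t.1 ≠ ⊤) : ∀ᵐ ω ∂P, 0 < massFrom ℱ t P N ω →
      γ t ω / discOf γ t ω = N t ω / massFrom ℱ t P N ω := by
  -- The loss of a single unit at time `t`: its conditional loss per unit of mass is `γ_t / D_t` on
  -- one side and the corresponding quotient for `N` on the other.
  let X : H.Time → Ω → ℝ := fun r _ => if r = t then -1 else 0
  have hX : MemR P ℱ X := by
    refine ⟨fun r => @measurable_const _ _ _ (ℱ r) _, 1, Eventually.of_forall fun ω r => ?_⟩
    simp only [X]
    split_ifs <;> simp
  have hsum : ∀ (K : H.Time → Ω → ℝ) ω, -sumFrom t K X ω = K t ω := fun K ω => by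
    rw [sumFrom, tsum_eq_single t fun r hr => by simp [X, hr]]
    simp [X]
  have hP : condLoss ℱ t P N X = N t := by
    unfold condLoss
    simp only [hsum]
    refine condExp_of_stronglyMeasurable (ℱ.le t) (hN.adapted t).stronglyMeasurable ?_
    have := (hN.integrable_sumFrom (hX.isBddProc hN.adapted) t).neg
    exact this.congr (Eventually.of_forall fun ω => hsum N ω)
  have hQ : condLoss ℱ t Q (normalize t γ) X = normalize t γ t := by
    have hm : Measurable[ℱ t] (normalize t γ t) :=
      (hγ.adapted t).div (measurable_discOf hγ.adapted t)
    unfold condLoss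
    simp only [hsum]
    refine condExp_of_stronglyMeasurable (ℱ.le t) hm.stronglyMeasurable
      (Integrable.of_bound (hm.mono (ℱ.le t) le_rfl).aestronglyMeasurable 1 ?_)
    filter_upwards [hγ.nonneg, hγ.hasSum] with ω h1 h2
    have h3 : γ t ω ≤ discOf γ t ω := by
      rw [discOf_eq_sumFrom ht h2, sumFrom]
      have h4 := (summable_tail h2.summable fun r => t ≤ r).le_tsum t fun r _ => by
        split_ifs
        exacts [h1 r, le_rfl]
      simpa using h4
    rw [normalize, Real.norm_eq_abs, abs_of_nonneg (div_nonneg (h1 t) ((h1 t).trans h3))]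
    exact div_le_one_of_le₀ h3 ((h1 t).trans h3)
  filter_upwards [condLoss_normalize_eq_lossRatio hγ hN heq ht hX] with ω h1 h2
  have h3 := h1 h2
  rwa [hQ, lossRatio, hP] at h3

/-- The discounting factor at time `t` depends only on the restriction of the measure to the
optional `σ`-field at time `t`. -/
theorem discOf_eq_of_eq_on [IsProbabilityMeasure P] [IsProbabilityMeasure Q]
    [IsProbabilityMeasure Q'] (hγ : MemGamma P ℱ Q γ) (hξ : MemGamma P ℱ Q' ξ)
    (hN : IsWeight ℱ P N) (hN' : IsWeight ℱ P N') (heq : optProd ℱ Q γ = optProd ℱ P N)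
    (heq' : optProd ℱ Q' ξ = optProd ℱ P N') (ht : t.1 ≠ ⊤) (hlt : ∀ s < t, N s =ᵐ[P] N' s)
    (hle : ∀ s ≤ t, massFrom ℱ s P N =ᵐ[P] massFrom ℱ s P N') :
    ∀ᵐ ω ∂P, 0 < massFrom ℱ t P N ω → discOf γ t ω = discOf ξ t ω := by
  -- `D_{n+1} = D_n (1 - γ_n / D_n)`, and each quotient is determined by the weight at `n` and the
  -- remaining mass. The induction runs forward from `D_0 = 1`, on the event where mass is still
  -- left.
  have key : ∀ n : ℕ, (n : ℕ∞) ∈ H.times → H.ofNat n ≤ t →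
      ∀ᵐ ω ∂P, 0 < massFrom ℱ (H.ofNat n) P N ω →
        discOf γ (H.ofNat n) ω = discOf ξ (H.ofNat n) ω := by
    intro n
    induction n with
    | zero =>
      intro _ _
      refine Eventually.of_forall fun ω _ => ?_
      have h1 : ∀ r : H.Time, ¬r < H.ofNat 0 := fun r => by
        rw [Horizon.ofNat_zero, ← Subtype.coe_lt_coe]
        simp [Horizon.zero]
      simp [discOf, Horizon.ofNat_ne_top, h1]
    | succ n ih =>
      intro h hn
      have h0 : (n : ℕ∞) ∈ H.times := Horizon.natCast_mem_of_le n.le_succ h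
      have hlt' : H.ofNat n < H.ofNat (n + 1) := by
        rw [← Subtype.coe_lt_coe, Horizon.coe_ofNat h0, Horizon.coe_ofNat h]
        exact Nat.cast_lt.2 n.lt_succ_self
      have hnt : H.ofNat n < t := hlt'.trans_le hn
      filter_upwards [ih h0 hnt.le, hN.massFrom_pos_of_le hlt'.le, hlt _ hnt, hle _ hnt.le,
        hγ.div_discOf hN heq (Horizon.ofNat_ne_top n),
        hξ.div_discOf hN' heq' (Horizon.ofNat_ne_top n),
        hγ.discOf_pos hN heq (Horizon.ofNat_ne_top n)] with ω h1 h2 h3 h4 h5 h6 h7 h8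
      have h9 := h2 h8
      have h10 := h5 h9
      rw [h3, h4, ← h6 (h4 ▸ h9), ← h1 h9, div_left_inj' (h7 h9).ne'] at h10
      rw [discOf_succ γ h, discOf_succ ξ h, h1 h9, h10]
  obtain ⟨n, hn, hn'⟩ := Horizon.exists_eq_ofNat ht
  have := key n (hn ▸ t.2) hn'.symm.le
  rwa [← hn'] at this

/-- The two discount factors at `t` agree where mass is left, so dividing the loss under `Q' ⊗ ξ` by
the factor of `γ` normalizes it correctly. -/
theorem localTerm_eq_densityTerm [IsProbabilityMeasure P] [IsProbabilityMeasure Q]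
    [IsProbabilityMeasure Q'] (hγ : MemGamma P ℱ Q γ) (hξ : MemGamma P ℱ Q' ξ)
    (hN : IsWeight ℱ P N) (hN' : IsWeight ℱ P N') (heq : optProd ℱ Q γ = optProd ℱ P N)
    (heq' : optProd ℱ Q' ξ = optProd ℱ P N') (ht : t.1 ≠ ⊤)
    (h : ∀ B, MeasurableSet[optFiltration ℱ t] B → optProd ℱ Q' ξ B = optProd ℱ Q γ B)
    (hX : MemR P ℱ X) :
    massFrom ℱ t P N =ᵐ[P] massFrom ℱ t P N' ∧ ∀ᵐ ω ∂P, 0 < massFrom ℱ t P N ω →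
      ((1 / discOf γ t ω * condLoss ℱ t Q' ξ X ω : ℝ) : EReal) - penalty P ℱ t ρ Q' ξ ω =
        densityTerm P ℱ t ρ N' X ω := by
  rw [heq, heq'] at h
  have hle : ∀ s ≤ t, massFrom ℱ s P N =ᵐ[P] massFrom ℱ s P N' := fun s hs =>
    massFrom_ae_eq hN hN' fun A hA => (h _ (measurableSet_optFiltration_rect_Ici hs hA)).symm
  have hlt : ∀ s < t, N s =ᵐ[P] N' s := fun s hs =>
    ae_eq_of_optProd_rect_singleton hN hN' fun A hA =>
      (h _ (MeasurableSpace.measurableSet_generateFrom (Or.inl ⟨s, A, hs, hA, rfl⟩))).symm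
  have hX' := hX.isBddProc hN'.adapted
  rw [← heq'] at hX'
  have h1 : ∀ᵐ ω ∂P, 0 < massFrom ℱ t P N' ω →
      condLoss ℱ t Q' (normalize t ξ) X ω * discOf ξ t ω = condLoss ℱ t Q' ξ X ω := by
    refine (hξ.isWeight.ae_massFrom_congr hN' heq' (measurableSet_eq_fun
      ((measurable_condLoss t Q' _ X).mul (measurable_discOf hξ.adapted t))
      (measurable_condLoss t Q' _ X))).1 ?_
    filter_upwards [(hξ.condLoss_normalize ht hX').2, hξ.massFrom_eq ht] with ω h2 h3 _
    rw [← h2, h3]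
    rfl
  refine ⟨hle t le_rfl, ?_⟩
  filter_upwards [h1, hle t le_rfl, discOf_eq_of_eq_on hγ hξ hN hN' heq heq' ht hlt hle,
    hξ.discOf_pos hN' heq' ht, condLoss_normalize_eq_lossRatio hξ hN' heq' ht hX,
    penalty_eq_densityPenalty (ρ := ρ) hξ hN' heq' ht] with ω h2 h3 h4 h5 h6 h7 h8
  have h9 := h8
  rw [h3] at h9
  have h10 := (h5 h9).ne'
  rw [densityTerm, ← h7 h9, ← h6 h9, h4 h8, ← h2 h9, mul_comm, mul_one_div,
    mul_div_cancel_right₀ _ h10]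

theorem localRep_eq [IsProbabilityMeasure P] (hℱ : IsStandardFiltration ℱ)
    (hμ : IsReference P ℱ μ) (ht : t.1 ≠ ⊤) (hρ : IsCondConvexRisk P ℱ t ρ)
    (hcont : ContFromAbove P ℱ t ρ) {Qbar : Measure (OptSpace ℱ)} (hQbar : MemMbar P ℱ μ Qbar)
    (hdec : IsDecomp P ℱ Qbar Q γ) (hX : MemRt P ℱ t X) :
    ∀ᵐ ω ∂Q, 0 < discOf γ t ω → (ρ X ω : EReal) = localRep P ℱ μ t ρ X Qbar Q γ ω := by
  obtain ⟨hQ, hγ, rfl⟩ := hdec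
  have := hQ.prob
  have := hQbar.prob
  obtain ⟨N, hN, heq, -⟩ := exists_weight_of_memGamma hℱ hμ hQ hγ
  have hρm : Measurable[ℱ t] fun ω => (ρ X ω : EReal) :=
    measurable_coe_real_ereal.comp (hρ.memLinf X hX).measurable
  have hLm : Measurable[ℱ t] (localRep P ℱ μ t ρ X (optProd ℱ Q γ) Q γ) :=
    measurable_familyEssSup Q (ℱ.le t) _
  have htm : ∀ (R : Measure Ω) (ξ : H.Time → Ω → ℝ) [IsFiniteMeasure R], Measurable[ℱ t] fun ω =>
      ((1 / discOf γ t ω * condLoss ℱ t R ξ X ω : ℝ) : EReal) - penalty P ℱ t ρ R ξ ω := by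
    intro R ξ _
    have h1 : Measurable[ℱ t] (discOf γ t) := measurable_discOf hγ.adapted t
    have h2 : Measurable[ℱ t] fun ω => 1 / discOf γ t ω * condLoss ℱ t R ξ X ω :=
      (h1.const_div 1).mul (measurable_condLoss t R ξ X)
    exact (measurable_coe_real_ereal.comp h2).sub (measurable_familyEssSup R (ℱ.le t) _)
  have hupper : ∀ᵐ ω ∂Q, 0 < massFrom ℱ t Q γ ω →
      localRep P ℱ μ t ρ X (optProd ℱ Q γ) Q γ ω ≤ (ρ X ω : EReal) := by
    refine familyEssSup_le_on Q (ℱ.le t) (B := {ω | 0 < massFrom ℱ t Q γ ω})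
      (measurableSet_lt measurable_const (measurable_massFrom t Q γ)) hρm ?_
    rintro f ⟨Rbar, R, ξ, hRbar, ⟨hR, hξ, rfl⟩, rfl⟩
    have := hR.prob
    obtain ⟨N', hN', heq', -⟩ := exists_weight_of_memGamma hℱ hμ hR hξ
    obtain ⟨h1, h2⟩ := localTerm_eq_densityTerm (ρ := ρ) hγ hξ hN hN' heq heq' ht hRbar.eq_on
      hX.memR
    refine (hγ.isWeight.ae_massFrom_congr hN heq (measurableSet_le (htm R ξ) hρm)).2 ?_
    filter_upwards [h1, h2, densityTerm_le hρ hN' hX] with ω h3 h4 h5 h6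
    rw [h4 h6]
    exact h5 (h3 ▸ h6)
  have hlower : ∀ᵐ ω ∂P, 0 < massFrom ℱ t P N ω →
      (ρ X ω : EReal) ≤ localRep P ℱ μ t ρ X (optProd ℱ Q γ) Q γ ω := by
    classical
    have h1 := le_of_forall_densityTerm_le (h := fun ω => if 0 < massFrom ℱ t P N ω then
      localRep P ℱ μ t ρ X (optProd ℱ Q γ) Q γ ω else ⊤) hμ hρ hcont hX ?_
    · filter_upwards [h1] with ω h2 h3
      simpa [h3] using h2
    intro N₁ hN₁
    -- The unit density `N₁`, scaled by the mass that `N` has left at `t`, is pasted after `t` onto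
    -- `N`. The product measure is unchanged on the optional σ-field at `t`, and the penalized loss
    -- is that of `N₁` wherever mass is left.
    have hUm := measurable_massFrom (ℱ := ℱ) t P N
    have hU0 := hN.massFrom_nonneg t
    have hUN : (fun ω => massFrom ℱ t P N ω * massFrom ℱ t P N₁ ω) =ᵐ[P]
        massFrom ℱ t P N := by
      filter_upwards [hN₁.mass] with ω h2
      rw [h2, Pi.one_apply, mul_one]
    have hK : IsWeight ℱ P (pasteFrom t N (massFrom ℱ t P N) N₁) :=
      isWeight_pasteFrom hN hN₁.isWeight hUm hU0 (integrable_condExp.congr hUN.symm)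
    obtain ⟨hon, huniv⟩ := optProd_eq_on_optFiltration hK hN (fun s hs => by
        refine Eventually.of_forall fun ω => ?_
        simp [pasteFrom, not_le.2 hs])
      ((massFrom_pasteFrom hN₁.isWeight hK hUm).trans hUN)
    have hprob : IsProbabilityMeasure (optProd ℱ P (pasteFrom t N (massFrom ℱ t P N) N₁)) :=
      ⟨by rw [huniv, ← heq]; exact measure_univ⟩
    obtain ⟨R, ξ, hR, hξ, heq'⟩ := exists_decomposition hℱ hK hprob
    have := hR.prob
    have hon' : ∀ B, MeasurableSet[optFiltration ℱ t] B →
        optProd ℱ R ξ B = optProd ℱ Q γ B := fun B hB => by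
      rw [heq', heq, hon B hB]
    obtain ⟨-, h2⟩ := localTerm_eq_densityTerm (ρ := ρ) hγ hξ hN hK heq heq' ht hon' hX.memR
    have h3 : ∀ᵐ ω ∂Q, 0 < massFrom ℱ t Q γ ω →
        ((1 / discOf γ t ω * condLoss ℱ t R ξ X ω : ℝ) : EReal) - penalty P ℱ t ρ R ξ ω ≤
          localRep P ℱ μ t ρ X (optProd ℱ Q γ) Q γ ω := by
      have hbar : MemQbar P ℱ μ t (optProd ℱ Q γ) (optProd ℱ R ξ) :=
        ⟨⟨hξ.optProd_univ, hξ.absolutelyContinuous hℱ hμ hR⟩, hon'⟩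
      have hle : (fun ω => ((1 / discOf γ t ω * condLoss ℱ t R ξ X ω : ℝ) : EReal) -
          penalty P ℱ t ρ R ξ ω) ≤ᵐ[Q] localRep P ℱ μ t ρ X (optProd ℱ Q γ) Q γ := by
        unfold localRep
        exact le_familyEssSup Q (ℱ.le t) ⟨_, R, ξ, hbar, ⟨hR, hξ, rfl⟩, rfl⟩
      exact hle.mono fun ω h _ => h
    rw [hγ.isWeight.ae_massFrom_congr hN heq (measurableSet_le (htm R ξ) hLm)] at h3
    filter_upwards [h2, h3, densityTerm_pasteFrom (ρ := ρ) hN₁.isWeight hK hUm hX.memR]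
      with ω h4 h5 h6
    split_ifs with h7
    · rw [← h6 h7, ← h4 h7]
      exact h5 h7
    · exact le_top
  have hlower' := (hγ.isWeight.ae_massFrom_congr hN heq (measurableSet_le hρm hLm)).2 hlower
  filter_upwards [hupper, hlower', hγ.massFrom_eq ht] with ω h1 h2 h3 h4
  rw [← h3] at h4
  exact le_antisymm (h2 h4) (h1 h4)

theorem MemMloc.refl [IsProbabilityMeasure P] : MemMloc P ℱ P :=
  ⟨inferInstance, fun _ _ _ _ h => h⟩

theorem IsReference.memGamma [IsProbabilityMeasure P] (hℱ : IsStandardFiltration ℱ)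
    (hμ : IsReference P ℱ μ) : MemGamma P ℱ P μ :=
  ⟨hμ.adapted, hμ.isWeight.nonneg, hμ.hasSum, fun _ _ =>
    (MemMloc.refl.ae_notMem_singularEvent hℱ).mono fun _ h h' => absurd h' h⟩

theorem IsReference.massFrom_pos [IsProbabilityMeasure P] (hμ : IsReference P ℱ μ) (t : H.Time) :
    ∀ᵐ ω ∂P, 0 < massFrom ℱ t P μ ω :=
  hμ.isWeight.massFrom_pos (hμ.pos.mono fun _ h => h t)

/-- Continuity from above is equivalent to the robust representations under all measures which are
absolutely continuous with respect to the reference measure on the optional `σ`-field. -/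
theorem contFromAbove_iff_localRep [IsProbabilityMeasure P] (hℱ : IsStandardFiltration ℱ)
    (hμ : IsReference P ℱ μ) (ht : t.1 ≠ ⊤) (hρ : IsCondConvexRisk P ℱ t ρ) :
    ContFromAbove P ℱ t ρ ↔ ∀ Qbar, MemMbar P ℱ μ Qbar → ∀ Q γ, IsDecomp P ℱ Qbar Q γ →
      ∀ X, MemRt P ℱ t X → ∀ᵐ ω ∂Q, 0 < discOf γ t ω →
        (ρ X ω : EReal) = localRep P ℱ μ t ρ X Qbar Q γ ω := by
  refine ⟨fun hcont Qbar hQbar Q γ hdec X hX => localRep_eq hℱ hμ ht hρ hcont hQbar hdec hX,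
    fun hrep => ?_⟩
  -- Only the representation under `P ⊗ μ` itself is needed for the converse; mass is left at `t`
  -- almost surely there, so nothing is lost by localization.
  have hγ := hμ.memGamma hℱ
  have hpos := hμ.massFrom_pos t
  refine contFromAbove_of_representation hρ {N | IsWeight ℱ P N ∧
    ∀ᵐ ω ∂P, 0 < massFrom ℱ t P N ω} (fun N hN => hN.1) (fun N hN => hN.2) fun X hX h hh hS => ?_
  have h1 : localRep P ℱ μ t ρ X (optProd ℱ P μ) P μ ≤ᵐ[P] h := by
    refine (familyEssSup_spec P (ℱ.le t) _).least h hh ?_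
    rintro f ⟨Rbar, R, ξ, hRbar, ⟨hR, hξ, rfl⟩, rfl⟩
    have := hR.prob
    obtain ⟨N', hN', heq', -⟩ := exists_weight_of_memGamma hℱ hμ hR hξ
    obtain ⟨h2, h3⟩ := localTerm_eq_densityTerm (ρ := ρ) hγ hξ hμ.isWeight hN' rfl heq' ht
      hRbar.eq_on hX.memR
    have hpos' : ∀ᵐ ω ∂P, 0 < massFrom ℱ t P N' ω := by
      filter_upwards [h2, hpos] with ω h4 h5
      rwa [← h4]
    filter_upwards [h3, hpos, hS N' ⟨hN', hpos'⟩] with ω h4 h5 h6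
    rw [h4 h5]
    exact h6
  filter_upwards [h1, hrep _ ⟨hμ.isProbabilityMeasure, Measure.AbsolutelyContinuous.rfl⟩ P μ
    ⟨MemMloc.refl, hγ, rfl⟩ X hX, hγ.massFrom_eq ht, hpos] with ω h2 h3 h4 h5
  rw [h3 (h4 ▸ h5)]
  exact h2

end Local

end RiskProc


namespace RiskProc

/-! ### Part (E): representations over equivalent measures -/

section Equivalent

variable {Ω : Type*} {mΩ : MeasurableSpace Ω} {H : Horizon} {ℱ : Filtration H.Time mΩ}
  {P Q : Measure Ω} {s t : H.Time} {ρ : (H.Time → Ω → ℝ) → Ω → ℝ}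
  {X γ μ N N' : H.Time → Ω → ℝ} {a b : ℝ}

/-- Nonnegative combinations of weights. -/
noncomputable def mixWeights (a : ℝ) (N : H.Time → Ω → ℝ) (b : ℝ) (N' : H.Time → Ω → ℝ)
    (s : H.Time) (ω : Ω) : ℝ :=
  a * N s ω + b * N' s ω

theorem isWeight_mixWeights (hN : IsWeight ℱ P N) (hN' : IsWeight ℱ P N')
    (ha : 0 ≤ a) (hb : 0 ≤ b) : IsWeight ℱ P (mixWeights a N b N') := by
  have hm : ∀ s, Measurable[ℱ s] (mixWeights a N b N' s) := fun s =>
    ((hN.adapted s).const_mul a).add ((hN'.adapted s).const_mul b)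
  refine ⟨hm, ?_, ⟨?_⟩⟩
  · filter_upwards [hN.nonneg, hN'.nonneg] with ω h1 h2 s
    exact add_nonneg (mul_nonneg ha (h1 s)) (mul_nonneg hb (h2 s))
  · have hNm : ∀ {K : H.Time → Ω → ℝ}, IsWeight ℱ P K → ∀ s,
        Measurable fun ω => ENNReal.ofReal (K s ω) := fun hK s =>
      ((hK.adapted s).mono (ℱ.le s) le_rfl).ennreal_ofReal
    have h1 : optProd ℱ P (mixWeights a N b N') Set.univ ≤
        ENNReal.ofReal a * optProd ℱ P N Set.univ +
          ENNReal.ofReal b * optProd ℱ P N' Set.univ := by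
      rw [optProd_apply hm MeasurableSet.univ, optProd_apply hN.adapted MeasurableSet.univ,
        optProd_apply hN'.adapted MeasurableSet.univ, ← ENNReal.tsum_mul_left,
        ← ENNReal.tsum_mul_left, ← ENNReal.tsum_add]
      refine ENNReal.tsum_le_tsum fun s => ?_
      rw [← lintegral_const_mul _ (hNm hN s), ← lintegral_const_mul _ (hNm hN' s),
        ← lintegral_add_left ((hNm hN s).const_mul _)]
      refine lintegral_mono fun ω => ?_
      simp only [mixWeights]
      rw [← ENNReal.ofReal_mul ha, ← ENNReal.ofReal_mul hb]
      exact ENNReal.ofReal_add_le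
    have := hN.finite
    have := hN'.finite
    exact h1.trans_lt (ENNReal.add_lt_top.2
      ⟨ENNReal.mul_lt_top ENNReal.ofReal_lt_top (measure_lt_top _ _),
        ENNReal.mul_lt_top ENNReal.ofReal_lt_top (measure_lt_top _ _)⟩)

theorem condExp_sumFrom_mixWeights [IsFiniteMeasure P] (hN : IsWeight ℱ P N)
    (hN' : IsWeight ℱ P N') (hX : MemR P ℱ X) :
    P[sumFrom t (mixWeights a N b N') X | ℱ t] =ᵐ[P] fun ω =>
      a * P[sumFrom t N X | ℱ t] ω + b * P[sumFrom t N' X | ℱ t] ω := by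
  have hX1 := hX.isBddProc hN.adapted
  have hX2 := hX.isBddProc hN'.adapted
  have h1 : sumFrom t (mixWeights a N b N') X =ᵐ[P]
      a • sumFrom t N X + b • sumFrom t N' X := by
    filter_upwards [hN.summable hX1 t, hN'.summable hX2 t] with ω h1 h2
    simp only [Pi.add_apply, Pi.smul_apply, smul_eq_mul, sumFrom]
    rw [← tsum_mul_left, ← tsum_mul_left, ← (h1.mul_left a).tsum_add (h2.mul_left b)]
    refine tsum_congr fun s => ?_
    split_ifs
    · simp only [mixWeights]; ring
    · simp
  have h2 := condExp_add (m := ℱ t) ((hN.integrable_sumFrom hX1 t).smul a)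
    ((hN'.integrable_sumFrom hX2 t).smul b)
  filter_upwards [condExp_congr_ae (m := ℱ t) h1, h2,
    condExp_smul (μ := P) (m := ℱ t) a (sumFrom t N X),
    condExp_smul (μ := P) (m := ℱ t) b (sumFrom t N' X)] with ω h3 h4 h5 h6
  rw [h3, h4, Pi.add_apply, h5, h6]
  rfl

theorem massFrom_mixWeights [IsFiniteMeasure P] (hN : IsWeight ℱ P N) (hN' : IsWeight ℱ P N')
    (hmass : massFrom ℱ t P N =ᵐ[P] 1) (hmass' : massFrom ℱ t P N' =ᵐ[P] 1) (hab : a + b = 1) :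
    massFrom ℱ t P (mixWeights a N b N') =ᵐ[P] 1 := by
  filter_upwards [condExp_sumFrom_mixWeights (a := a) (b := b) (t := t) hN hN' MemR.one, hmass,
    hmass'] with ω h1 h2 h3
  rw [massFrom, h1]
  change a * massFrom ℱ t P N ω + b * massFrom ℱ t P N' ω = 1
  rw [h2, h3]
  simpa using hab

theorem lossRatio_mixWeights [IsFiniteMeasure P] (hN : IsWeight ℱ P N) (hN' : IsWeight ℱ P N')
    (hmass : massFrom ℱ t P N =ᵐ[P] 1) (hmass' : massFrom ℱ t P N' =ᵐ[P] 1) (hab : a + b = 1)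
    (hX : MemR P ℱ X) : ∀ᵐ ω ∂P, lossRatio P ℱ t (mixWeights a N b N') X ω =
      a * lossRatio P ℱ t N X ω + b * lossRatio P ℱ t N' X ω := by
  have h1 : ∀ K : H.Time → Ω → ℝ, condLoss ℱ t P K X =ᵐ[P] -P[sumFrom t K X | ℱ t] :=
    fun K => condExp_neg _ _
  filter_upwards [condExp_sumFrom_mixWeights (a := a) (b := b) (t := t) hN hN' hX, hmass, hmass',
    massFrom_mixWeights hN hN' hmass hmass' hab, h1 N, h1 N', h1 (mixWeights a N b N')]
    with ω h2 h3 h4 h5 h6 h7 h8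
  simp only [lossRatio, h3, h4, h5, h6, h7, h8, Pi.neg_apply, h2, Pi.one_apply, div_one]
  ring

/-- With unit masses the loss ratio is affine in the density, so the penalty, as a supremum, is
convex and the penalized loss concave. Finite penalties permit real arithmetic. -/
theorem le_densityTerm_mixWeights [IsProbabilityMeasure P] (hρ : IsCondConvexRisk P ℱ t ρ)
    (hN : IsWeight ℱ P N) (hN' : IsWeight ℱ P N')
    (hmass : massFrom ℱ t P N =ᵐ[P] 1) (hmass' : massFrom ℱ t P N' =ᵐ[P] 1)
    (hpen : ∀ᵐ ω ∂P, densityPenalty P ℱ t ρ N ω < ⊤)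
    (hpen' : ∀ᵐ ω ∂P, densityPenalty P ℱ t ρ N' ω < ⊤) (ha : 0 ≤ a) (hb : 0 ≤ b) (hab : a + b = 1)
    (hX : MemR P ℱ X) : ∀ᵐ ω ∂P,
      ((a * (lossRatio P ℱ t N X ω - (densityPenalty P ℱ t ρ N ω).toReal) +
        b * (lossRatio P ℱ t N' X ω - (densityPenalty P ℱ t ρ N' ω).toReal) : ℝ) : EReal) ≤
      densityTerm P ℱ t ρ (mixWeights a N b N') X ω := by
  have hm : ∀ K : H.Time → Ω → ℝ, Measurable[ℱ t] fun ω => (densityPenalty P ℱ t ρ K ω).toReal :=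
    fun K => measurable_ereal_toReal.comp (measurable_familyEssSup P (ℱ.le t) _)
  have hle : ∀ K : H.Time → Ω → ℝ, (∀ᵐ ω ∂P, densityPenalty P ℱ t ρ K ω < ⊤) →
      ∀ Y, MemAccept P ℱ t ρ Y →
        ∀ᵐ ω ∂P, lossRatio P ℱ t K Y ω ≤ (densityPenalty P ℱ t ρ K ω).toReal := by
    intro K hK Y hY
    have h0 := le_familyEssSup P (ℱ.le t) (S := {f | ∃ X, MemAccept P ℱ t ρ X ∧
      f = fun ω => (lossRatio P ℱ t K X ω : EReal)}) ⟨Y, hY, rfl⟩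
    filter_upwards [hK, h0, zero_le_densityPenalty (N := K) hρ] with ω h1 h2 h3
    have h4 : densityPenalty P ℱ t ρ K ω ≠ ⊥ := (lt_of_lt_of_le EReal.bot_lt_zero h3).ne'
    rw [← EReal.coe_le_coe_iff, EReal.coe_toReal h1.ne h4]
    exact h2
  have hbound : densityPenalty P ℱ t ρ (mixWeights a N b N') ≤ᵐ[P] fun ω =>
      ((a * (densityPenalty P ℱ t ρ N ω).toReal +
        b * (densityPenalty P ℱ t ρ N' ω).toReal : ℝ) : EReal) := by
    refine (familyEssSup_spec P (ℱ.le t) _).least _ (measurable_coe_real_ereal.comp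
      (((hm N).const_mul a).add ((hm N').const_mul b))) ?_
    rintro f ⟨Y, hY, rfl⟩
    filter_upwards [lossRatio_mixWeights hN hN' hmass hmass' hab hY.memRt.memR, hle N hpen Y hY,
      hle N' hpen' Y hY] with ω h1 h2 h3
    rw [h1]
    exact EReal.coe_le_coe_iff.2 (add_le_add (mul_le_mul_of_nonneg_left h2 ha)
      (mul_le_mul_of_nonneg_left h3 hb))
  filter_upwards [hbound, lossRatio_mixWeights hN hN' hmass hmass' hab hX] with ω h1 h2
  rw [densityTerm, h2]
  refine le_trans (le_of_eq ?_) (EReal.sub_le_sub le_rfl h1)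
  rw [← EReal.coe_sub]
  congr 1
  ring

theorem null_of_optProd_rect_singleton (hN : ∀ s, Measurable[ℱ s] (N s))
    (hpos : ∀ᵐ ω ∂P, 0 < N s ω) {A : Set Ω} (hA : MeasurableSet[ℱ s] A)
    (h : optProd ℱ P N (rect ℱ A {s}) = 0) : P A = 0 := by
  rw [optProd_rect_singleton hN hA, lintegral_eq_zero_iff
    ((hN s).mono (ℱ.le s) le_rfl).ennreal_ofReal] at h
  have h1 : ∀ᵐ ω ∂P, ω ∉ A := by
    filter_upwards [(ae_restrict_iff' (ℱ.le s _ hA)).1 h, hpos] with ω h2 h3 h4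
    exact absurd (ENNReal.ofReal_eq_zero.1 (h2 h4)) (not_le.2 h3)
  simpa [ae_iff] using h1

theorem optProd_rect_nonpos (hγ : ∀ s, Measurable[ℱ s] (γ s)) (s : H.Time) :
    optProd ℱ Q γ (rect ℱ {ω | γ s ω ≤ 0} {s}) = 0 := by
  have hA : MeasurableSet[ℱ s] {ω | γ s ω ≤ 0} := measurableSet_le (hγ s) measurable_const
  rw [optProd_rect_singleton hγ hA, setLIntegral_congr_fun (g := fun _ => 0) (ℱ.le s _ hA)
    fun ω hω => ENNReal.ofReal_eq_zero.2 hω]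
  simp

/-- Positive weights come from locally equivalent measures and positive random measures. -/
theorem exists_equiv_decomposition [IsProbabilityMeasure P] (hℱ : IsStandardFiltration ℱ)
    (hN : IsWeight ℱ P N) (hprob : IsProbabilityMeasure (optProd ℱ P N))
    (hpos : ∀ s, ∀ᵐ ω ∂P, 0 < N s ω) :
    ∃ Q γ, MemMlocE P ℱ Q ∧ MemGammaE P ℱ Q γ ∧ optProd ℱ Q γ = optProd ℱ P N := by
  obtain ⟨Q, γ, hQ, hγ, heq⟩ := exists_decomposition hℱ hN hprob
  refine ⟨Q, γ, ⟨hQ.prob, fun s hs A hA => ⟨hQ.locally_ac s hs A hA, fun h => ?_⟩⟩,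
    ⟨hγ, fun s => ?_⟩, heq⟩
  -- A `Q`-null event of `ℱ_s` carries no product mass at time `s`, and positivity of `N s` makes it
  -- `P`-null. The same argument applied to `{γ s ≤ 0}` gives positivity of `γ`.
  · refine null_of_optProd_rect_singleton hN.adapted (hpos s) hA ?_
    rw [← heq, optProd_rect_singleton hγ.adapted hA, Measure.restrict_eq_zero.2 h,
      lintegral_zero_measure]
  · have h1 := null_of_optProd_rect_singleton hN.adapted (hpos s)
      (measurableSet_le (hγ.adapted s) measurable_const)
      (heq ▸ optProd_rect_nonpos (Q := Q) hγ.adapted s)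
    filter_upwards [measure_eq_zero_iff_ae_notMem.1 h1] with ω h using not_le.1 h

theorem MemMlocE.memMloc (hQ : MemMlocE P ℱ Q) : MemMloc P ℱ Q :=
  ⟨hQ.prob, fun s hs A hA => (hQ.locally_equiv s hs A hA).1⟩

/-- Local equivalence takes positivity of `γ t` from `P` to `Q`; the common product measure makes `N
t` positive under `Q`, and equivalence brings this back to `P`. -/
theorem MemGammaE.massFrom_pos [IsProbabilityMeasure P] (hQ : MemMlocE P ℱ Q)
    (hγ : MemGammaE P ℱ Q γ) (hN : IsWeight ℱ P N) (heq : optProd ℱ Q γ = optProd ℱ P N)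
    (ht : t.1 ≠ ⊤) : ∀ᵐ ω ∂P, 0 < massFrom ℱ t P N ω := by
  refine hN.massFrom_pos ?_
  have hle : ∀ {K : H.Time → Ω → ℝ}, (∀ s, Measurable[ℱ s] (K s)) →
      MeasurableSet[ℱ t] {ω | K t ω ≤ 0} := fun hK => measurableSet_le (hK t) measurable_const
  have h1 : ∀ᵐ ω ∂Q, 0 < γ t ω := by
    have h2 : P {ω | γ t ω ≤ 0} = 0 :=
      measure_eq_zero_iff_ae_notMem.2 ((hγ.pos t).mono fun ω h => not_le.2 h)
    filter_upwards [measure_eq_zero_iff_ae_notMem.1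
      ((hQ.locally_equiv t ht _ (hle hγ.memGamma.adapted)).1 h2)] with ω h using not_le.1 h
  have h3 := null_of_optProd_rect_singleton hγ.memGamma.adapted h1 (hle hN.adapted)
    (heq ▸ optProd_rect_nonpos (Q := P) hN.adapted t)
  filter_upwards [measure_eq_zero_iff_ae_notMem.1
    ((hQ.locally_equiv t ht _ (hle hN.adapted)).2 h3)] with ω h using not_le.1 h

theorem normalizedTerm_eq_densityTerm [IsProbabilityMeasure P] [IsProbabilityMeasure Q]
    (hγ : MemGamma P ℱ Q γ) (hN : IsWeight ℱ P N) (heq : optProd ℱ Q γ = optProd ℱ P N)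
    (ht : t.1 ≠ ⊤) (hpos : ∀ᵐ ω ∂P, 0 < massFrom ℱ t P N ω) (hX : MemR P ℱ X) :
    (fun ω => (condLoss ℱ t Q (normalize t γ) X ω : EReal) - penalty P ℱ t ρ Q γ ω) =ᵐ[P]
      densityTerm P ℱ t ρ N X := by
  filter_upwards [condLoss_normalize_eq_lossRatio hγ hN heq ht hX,
    penalty_eq_densityPenalty (ρ := ρ) hγ hN heq ht, hpos] with ω h1 h2 h3
  rw [densityTerm, h1 h3, h2 h3]

theorem IsWeight.zero : IsWeight ℱ P (0 : H.Time → Ω → ℝ) := by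
  have hm : ∀ s, Measurable[ℱ s] ((0 : H.Time → Ω → ℝ) s) := fun s =>
    @measurable_const _ _ _ (ℱ s) 0
  refine ⟨hm, by simp, ⟨?_⟩⟩
  rw [optProd_apply hm MeasurableSet.univ]
  simp

/-- An equivalent measure with finite penalty provides positive weights of unit mass with finite
penalty. -/
theorem exists_positive_weight [IsProbabilityMeasure P] (hℱ : IsStandardFiltration ℱ)
    (hμ : IsReference P ℱ μ) (ht : t.1 ≠ ⊤) (hQ : MemMloc P ℱ Q) (hγ : MemGamma P ℱ Q γ)
    (hac : optProd ℱ P μ ≪ optProd ℱ Q γ) (hpen : ∀ᵐ ω ∂P, penalty P ℱ t ρ Q γ ω < ⊤) :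
    ∃ N, IsWeight ℱ P N ∧ massFrom ℱ t P N =ᵐ[P] 1 ∧ (∀ s, t ≤ s → ∀ᵐ ω ∂P, 0 < N s ω) ∧
      ∀ᵐ ω ∂P, densityPenalty P ℱ t ρ N ω < ⊤ := by
  have := hQ.prob
  obtain ⟨N, hN, heq, -⟩ := exists_weight_of_memGamma hℱ hμ hQ hγ
  -- A density is positive almost everywhere under its own measure, hence also under the reference
  -- measure, which is absolutely continuous with respect to it.
  have hNpos : ∀ s, ∀ᵐ ω ∂P, 0 < N s ω := by
    have hm : Measurable fun p : OptSpace ℱ => N p.time p.outcome :=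
      measurable_optSpace_iff.2 hN.adapted
    have h1 : ∀ᵐ p ∂optProd ℱ P N, 0 < N p.time p.outcome :=
      (ae_optProd_iff hN.adapted (measurableSet_lt measurable_const hm)).2 fun s =>
        Eventually.of_forall fun ω h => h
    rw [← heq] at h1
    exact fun s => hμ.ae_of_ae_optProd (hac.ae_le h1) s
  have hU := hN.massFrom_pos (hNpos t)
  have hc : Measurable[ℱ t] fun ω => (massFrom ℱ t P N ω)⁻¹ := (measurable_massFrom t P N).inv
  have hcpos : ∀ᵐ ω ∂P, 0 < (massFrom ℱ t P N ω)⁻¹ := hU.mono fun ω h => inv_pos.2 h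
  have hone : (fun ω => (massFrom ℱ t P N ω)⁻¹ * massFrom ℱ t P N ω) =ᵐ[P] 1 :=
    hU.mono fun ω h => inv_mul_cancel₀ h.ne'
  -- Discarding the weights before `t` and dividing by the remaining mass gives unit mass without
  -- changing the penalty.
  have hK : IsWeight ℱ P (pasteFrom t 0 (fun ω => (massFrom ℱ t P N ω)⁻¹) N) :=
    isWeight_pasteFrom IsWeight.zero hN hc (hcpos.mono fun ω h => h.le)
      ((integrable_const (1 : ℝ)).congr hone.symm)
  refine ⟨_, hK, (massFrom_pasteFrom hN hK hc).trans hone, fun s hs => ?_, ?_⟩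
  · filter_upwards [hcpos, hNpos s] with ω h1 h2
    simpa [pasteFrom, hs] using mul_pos h1 h2
  · filter_upwards [densityPenalty_pasteFrom (ρ := ρ) hN hK hc, hcpos, hpen, hU,
      penalty_eq_densityPenalty (ρ := ρ) hγ hN heq ht] with ω h1 h2 h3 h4 h5
    rw [h1 h2, ← h5 h4]
    exact h3

/-- If an equivalent measure has a finite penalty, continuity from above is equivalent to the robust
representation over equivalent measures. -/
theorem contFromAbove_iff_equivRep [IsProbabilityMeasure P] (hℱ : IsStandardFiltration ℱ)
    (hμ : IsReference P ℱ μ) (ht : t.1 ≠ ⊤) (hρ : IsCondConvexRisk P ℱ t ρ)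
    {Qs : Measure Ω} {γs : H.Time → Ω → ℝ} (hQs : MemMloc P ℱ Qs) (hγs : MemGamma P ℱ Qs γs)
    (hac : optProd ℱ P μ ≪ optProd ℱ Qs γs) (hpen : ∀ᵐ ω ∂P, penalty P ℱ t ρ Qs γs ω < ⊤) :
    ContFromAbove P ℱ t ρ ↔
      ∀ X, MemRt P ℱ t X → ∀ᵐ ω ∂P, (ρ X ω : EReal) = equivRep P ℱ t ρ X ω := by
  refine contFromAbove_iff_of_family hρ {N | IsWeight ℱ P N ∧ ∃ Q γ, MemMlocE P ℱ Q ∧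
    MemGammaE P ℱ Q γ ∧ optProd ℱ Q γ = optProd ℱ P N} _ (fun N hN => hN.1) ?_ ?_ ?_ ?_
  · rintro N ⟨hN, Q, γ, hQ, hγ, heq⟩
    exact hγ.massFrom_pos hQ hN heq ht
  · rintro X hX N ⟨hN, Q, γ, hQ, hγ, heq⟩
    have := hQ.prob
    exact (normalizedTerm_eq_densityTerm hγ.memGamma hN heq ht (hγ.massFrom_pos hQ hN heq ht)
      hX.memR).symm.le.trans (le_familyEssSup P (ℱ.le t) ⟨Q, γ, hQ, hγ, rfl⟩)
  · intro X hX h hh hS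
    refine (familyEssSup_spec P (ℱ.le t) _).least h hh ?_
    rintro f ⟨Q, γ, hQ, hγ, rfl⟩
    have := hQ.prob
    obtain ⟨N, hN, heq, -⟩ := exists_weight_of_memGamma hℱ hμ hQ.memMloc hγ.memGamma
    exact (normalizedTerm_eq_densityTerm hγ.memGamma hN heq ht (hγ.massFrom_pos hQ hN heq ht)
      hX.memR).le.trans (hS N ⟨hN, Q, γ, hQ, hγ, heq⟩)
  · intro hcont X hX h hS
    obtain ⟨N₂, hN₂, hmass₂, hpos₂, hpen₂⟩ := exists_positive_weight hℱ hμ ht hQs hγs hac hpen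
    refine le_of_forall_densityTerm_le hμ hρ hcont hX fun N₁ hN₁ => ?_
    have hpen₁ : ∀ᵐ ω ∂P, densityPenalty P ℱ t ρ N₁ ω < ⊤ := by
      have hm : Measurable fun ω => (densityPenalty P ℱ t ρ N₁ ω).toENNReal :=
        measurable_ereal_toENNReal.comp
          ((measurable_familyEssSup P (ℱ.le t) _).mono (ℱ.le t) le_rfl)
      filter_upwards [ae_lt_top hm hN₁.penalty] with ω h1
      refine lt_top_iff_ne_top.2 fun hc => ?_
      rw [hc] at h1
      simp at h1
    have hUm := measurable_massFrom (ℱ := ℱ) t P μ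
    have hUpos := hμ.massFrom_pos t
    -- Any share `b > 0` of the positive density `N₂` makes the mixture positive from `t` on.
    -- Pasting it after the reference weights, scaled to their remaining mass, gives a probability
    -- measure with positive weights at all times, which decomposes into an equivalent pair.
    have key : ∀ a b : ℝ, 0 ≤ a → 0 < b → a + b = 1 → ∀ᵐ ω ∂P,
        ((a * (lossRatio P ℱ t N₁ X ω - (densityPenalty P ℱ t ρ N₁ ω).toReal) +
          b * (lossRatio P ℱ t N₂ X ω - (densityPenalty P ℱ t ρ N₂ ω).toReal) : ℝ) : EReal) ≤
        h ω := by
      intro a b ha hb hab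
      have hM := isWeight_mixWeights hN₁.isWeight hN₂ ha hb.le
      have hMmass := massFrom_mixWeights hN₁.isWeight hN₂ hN₁.mass hmass₂ hab
      have hUM : (fun ω => massFrom ℱ t P μ ω * massFrom ℱ t P (mixWeights a N₁ b N₂) ω) =ᵐ[P]
          massFrom ℱ t P μ := by
        filter_upwards [hMmass] with ω h2
        rw [h2, Pi.one_apply, mul_one]
      have hK : IsWeight ℱ P (pasteFrom t μ (massFrom ℱ t P μ) (mixWeights a N₁ b N₂)) :=
        isWeight_pasteFrom hμ.isWeight hM hUm (hUpos.mono fun ω h => h.le)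
          (integrable_condExp.congr hUM.symm)
      have hprob : IsProbabilityMeasure
          (optProd ℱ P (pasteFrom t μ (massFrom ℱ t P μ) (mixWeights a N₁ b N₂))) := by
        have := hμ.isProbabilityMeasure
        refine ⟨?_⟩
        rw [(optProd_eq_on_optFiltration hK hμ.isWeight (fun s hs => by
            refine Eventually.of_forall fun ω => ?_
            simp [pasteFrom, not_le.2 hs])
          ((massFrom_pasteFrom hM hK hUm).trans hUM)).2]
        exact measure_univ
      have hKpos : ∀ s, ∀ᵐ ω ∂P,
          0 < pasteFrom t μ (massFrom ℱ t P μ) (mixWeights a N₁ b N₂) s ω := by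
        intro s
        by_cases hs : t ≤ s
        · filter_upwards [hUpos, hN₁.isWeight.nonneg, hpos₂ s hs] with ω h1 h2 h3
          simp only [pasteFrom, hs, if_true, mixWeights]
          exact mul_pos h1 (add_pos_of_nonneg_of_pos (mul_nonneg ha (h2 s)) (mul_pos hb h3))
        · filter_upwards [hμ.pos] with ω h1
          simpa [pasteFrom, hs] using h1 s
      obtain ⟨Q, γ, hQ, hγ, heq⟩ := exists_equiv_decomposition hℱ hK hprob hKpos
      filter_upwards [hS _ ⟨hK, Q, γ, hQ, hγ, heq⟩, hUpos,
        densityTerm_pasteFrom (ρ := ρ) hM hK hUm hX.memR,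
        le_densityTerm_mixWeights hρ hN₁.isWeight hN₂ hN₁.mass hmass₂ hpen₁ hpen₂ ha hb.le hab
          hX.memR] with ω h1 h2 h3 h4
      rw [h3 h2] at h1
      exact h4.trans h1
    have hseq : ∀ n : ℕ, (0 : ℝ) < 1 / ((n : ℝ) + 1) ∧ 1 / ((n : ℝ) + 1) ≤ 1 := fun n =>
      ⟨by positivity, by
        rw [div_le_one (by positivity)]
        exact le_add_of_nonneg_left n.cast_nonneg⟩
    -- Letting the share `1 / (n + 1)` of `N₂` tend to zero recovers the penalized loss of `N₁`;
    -- finiteness of the penalty of `N₂` makes its contribution disappear.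
    have key' := ae_all_iff.2 fun n : ℕ => key (1 - 1 / ((n : ℝ) + 1)) (1 / ((n : ℝ) + 1))
      (sub_nonneg.2 (hseq n).2) (hseq n).1 (sub_add_cancel _ _)
    filter_upwards [key', hpen₁, zero_le_densityPenalty (N := N₁) hρ] with ω h1 h2 h3
    have h4 : densityPenalty P ℱ t ρ N₁ ω ≠ ⊥ := (lt_of_lt_of_le EReal.bot_lt_zero h3).ne'
    have h5 : densityTerm P ℱ t ρ N₁ X ω =
        ((lossRatio P ℱ t N₁ X ω - (densityPenalty P ℱ t ρ N₁ ω).toReal : ℝ) : EReal) := by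
      rw [densityTerm, EReal.coe_sub, EReal.coe_toReal h2.ne h4]
    rw [h5]
    have h6 : Tendsto (fun n : ℕ => 1 / ((n : ℝ) + 1)) atTop (𝓝 0) :=
      tendsto_one_div_add_atTop_nhds_zero_nat
    have h7 := ((h6.const_sub 1).mul_const
      (lossRatio P ℱ t N₁ X ω - (densityPenalty P ℱ t ρ N₁ ω).toReal)).add
      (h6.mul_const (lossRatio P ℱ t N₂ X ω - (densityPenalty P ℱ t ρ N₂ ω).toReal))
    rw [sub_zero, one_mul, zero_mul, add_zero] at h7
    exact le_of_tendsto' ((continuous_coe_real_ereal.tendsto _).comp h7) h1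

end Equivalent

end RiskProc

/-! ### The theorem, assembled from its parts -/

theorem theorem3p5 {Ω : Type*} {mΩ : MeasurableSpace Ω} (P : Measure Ω) [IsProbabilityMeasure P]
    (H : RiskProc.Horizon) (ℱ : Filtration H.Time mΩ) (hℱ : RiskProc.IsStandardFiltration ℱ)
    (μ : H.Time → Ω → ℝ) (hμ : RiskProc.IsReference P ℱ μ)
    (t : H.Time) (ht : t.1 ≠ ⊤)
    (ρ : (H.Time → Ω → ℝ) → Ω → ℝ) (hρ : RiskProc.IsCondConvexRisk P ℱ t ρ) :
    -- the robust representation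
    (RiskProc.ContFromAbove P ℱ t ρ ↔
      ∀ X, RiskProc.MemRt P ℱ t X →
        ∀ᵐ ω ∂P, (ρ X ω : EReal) = RiskProc.gammaRep P ℱ t ρ X ω) ∧
    -- the form in terms of discounting factors: the series converge, the right-hand sides agree,
    -- and hence the representations correspond to each other
    (∀ X, RiskProc.MemXt P ℱ t X → ∀ Q, RiskProc.MemQloc P ℱ t Q →
      ∀ D, RiskProc.MemDiscT P ℱ t Q D →
        ∀ᵐ ω ∂Q, ∃ l : ℝ, Tendsto (fun n : ℕ => RiskProc.discSum t D X n ω) atTop (𝓝 l)) ∧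
    (∀ X, RiskProc.MemXt P ℱ t X →
      RiskProc.gammaRep P ℱ t ρ X =ᵐ[P] RiskProc.discRep P ℱ t ρ X) ∧
    (RiskProc.ContFromAbove P ℱ t ρ → ∀ X, RiskProc.MemXt P ℱ t X →
      ∀ᵐ ω ∂P, (ρ X ω : EReal) = RiskProc.discRep P ℱ t ρ X ω) ∧
    (⊤ ∉ H.times →
      (RiskProc.ContFromAbove P ℱ t ρ ↔ ∀ X, RiskProc.MemRt P ℱ t X →
        ∀ᵐ ω ∂P, (ρ X ω : EReal) = RiskProc.discRep P ℱ t ρ X ω)) ∧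
    -- the supremum over measures with finite expected penalty
    (RiskProc.ContFromAbove P ℱ t ρ ↔
      ∀ X, RiskProc.MemRt P ℱ t X →
        ∀ᵐ ω ∂P, (ρ X ω : EReal) = RiskProc.finitePenaltyRep P ℱ μ t ρ X ω) ∧
    -- the representations under all measures in `ℳ(P̄)`
    (RiskProc.ContFromAbove P ℱ t ρ ↔
      ∀ Qbar, RiskProc.MemMbar P ℱ μ Qbar →
        ∀ Q γ, RiskProc.IsDecomp P ℱ Qbar Q γ → ∀ X, RiskProc.MemRt P ℱ t X →
          ∀ᵐ ω ∂Q, 0 < RiskProc.discOf γ t ω →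
            (ρ X ω : EReal) = RiskProc.localRep P ℱ μ t ρ X Qbar Q γ ω) ∧
    -- the supremum over equivalent measures
    ((∃ (Pbar : Measure (RiskProc.OptSpace ℱ)) (Q : Measure Ω) (γ : H.Time → Ω → ℝ),
        IsProbabilityMeasure Pbar ∧
        Pbar ≪ RiskProc.optProd ℱ P μ ∧ RiskProc.optProd ℱ P μ ≪ Pbar ∧
        RiskProc.IsDecomp P ℱ Pbar Q γ ∧
        ∀ᵐ ω ∂P, RiskProc.penalty P ℱ t ρ Q γ ω < ⊤) →
      (RiskProc.ContFromAbove P ℱ t ρ ↔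
        ∀ X, RiskProc.MemRt P ℱ t X →
          ∀ᵐ ω ∂P, (ρ X ω : EReal) = RiskProc.equivRep P ℱ t ρ X ω)) := by
  have hXt : ⊤ ∉ H.times → ∀ X, RiskProc.MemRt P ℱ t X → RiskProc.MemXt P ℱ t X :=
    fun h X hX => ⟨hX, fun i hi => absurd (hi ▸ i.2) h⟩
  have hgamma := RiskProc.contFromAbove_iff_gammaRep hℱ hμ ht hρ
  have hdisc : ∀ X, RiskProc.MemXt P ℱ t X →
      RiskProc.gammaRep P ℱ t ρ X =ᵐ[P] RiskProc.discRep P ℱ t ρ X :=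
    fun X hX => RiskProc.gammaRep_eq_discRep hℱ ht hX
  have hcont : RiskProc.ContFromAbove P ℱ t ρ → ∀ X, RiskProc.MemXt P ℱ t X →
      ∀ᵐ ω ∂P, (ρ X ω : EReal) = RiskProc.discRep P ℱ t ρ X ω := fun hc X hX => by
    filter_upwards [hgamma.1 hc X hX.memRt, hdisc X hX] with ω h1 h2
    rw [h1, h2]
  refine ⟨hgamma, fun X hX Q hQ D hD => ?_, hdisc, hcont, fun htop =>
    ⟨fun hc X hX => hcont hc X (hXt htop X hX), fun h => hgamma.2 fun X hX => ?_⟩,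
    RiskProc.contFromAbove_iff_finitePenaltyRep hℱ hμ ht hρ,
    RiskProc.contFromAbove_iff_localRep hℱ hμ ht hρ, ?_⟩
  · filter_upwards [hD.memDisc.tendsto_discSum hℱ hQ.memMloc hX] with ω h using ⟨_, h⟩
  · filter_upwards [h X hX, hdisc X (hXt htop X hX)] with ω h1 h2
    rw [h1, h2]
  · rintro ⟨Pbar, Q, γ, -, -, hac, ⟨hQ, hγ, rfl⟩, hpen⟩
    exact RiskProc.contFromAbove_iff_equivRep hℱ hμ ht hρ hQ hγ hac hpen
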